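/- Let $b(x)=\lambda x$ (XXX case) or $b(x)=\lambda\sinh(\nu x)$ (XXZ case) with $\lambda,\nu\in\mathbb C^\times$; let $\eta,\xi_+,\xi_-\in\mathbb C$, $\tau\in\mathbb C^\times$, let $N,M\ge 0$ be integers and $V=(\mathbb C^2)^{\otimes N}$, where $\mathbb C^2$ has ordered basis $(e_+,e_-)$. Put $$R(x)=\frac1{b(x+\eta)}\begin{pmatrix} b(x+\eta)&0&0&0\\0&b(x)&b(\eta)&0\\0&b(\eta)&b(x)&0\\0&0&0&b(x+\eta)\end{pmatrix},\qquad K^{\xi}(x)=\begin{pmatrix}1&0\\0&\frac{b(\xi-x)}{b(\xi+x)}\end{pmatrix},$$ the first matrix being taken with respect to the basis $(e_+\otimes e_+,e_+\otimes e_-,e_-\otimes e_+,e_-\otimes e_-)$. Subscripts denote the tensor legs on which an operator acts, and $\mathbf t=(t_1,\dots,t_N)$. On $\mathbb C^2\otimes V$ (the auxiliary leg is labelled $0$) let $T(x;\mathbf t)=R_{01}(x-t_1)\cdots R_{0N}(x-t_N)$ and $\mathcal U^\xi(x;\mathbf t)=T(x;\mathbf t)^{-1}K^\xi_0(x)^{-1}T(-x;\mathbf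 t)$. Let $\mathcal B^\xi(x;\mathbf t)\in\mathrm{End}(V)$ be the upper right entry of $\mathcal U^\xi(x;\mathbf t)$, written as a $2\times2$ matrix with respect to the basis $(e_+,e_-)$ of the auxiliary space. Set $$\overline{\mathcal B}^{\xi}(x;\mathbf t)=\Bigl(\prod_{r=1}^N\frac{b(x-t_r-\frac\eta2)}{b(x-t_r+\frac\eta2)}\Bigr)\frac{b(\xi-x-\frac\eta2)\,b(2x)}{b(2x+\eta)}\,\mathcal B^\xi\bigl(x+\tfrac\eta2;\mathbf t\bigr),\qquad \Omega=e_+^{\otimes N},$$ where $\overline{\mathcal B}^\xi$ is regarded as a meromorphic function, i.e. removable singularities are removed. Let $g,h,F$ be meromorphic functions on $\mathbb C$ satisfying, as identities of meromorphic functions, $$g(x+\tau)=\frac{b(\xi_--x-\frac\eta2)\,b(\xi_+-x-\frac\tau2-\frac\eta2)}{b(\xi_-+x+\tau-\frac\eta2)\,b(\xi_++x+\frac\tau2-\frac\eta2)}\,g(x),$$ $$h(x+\tau)=\frac{b(x+\tau)\,b(x+\eta)}{b(x)\,b(x+\tau-\eta)}\,h(x),\qquad F(x+\tau)=\frac{b(x+\tau-\frac\eta2)}{b(x+\tau+\frac\eta2)}\,F(x).$$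 Let $\mathbf x_0\in\mathbb C^M$ be generic in the following sense: for all $\mathbf x\in\mathbf x_0+\tau\mathbb Z^M$, $g$ is holomorphic at every $x_i$, and for $i<j$, $h$ is holomorphic at $x_i+x_j$ and at $x_i-x_j$, and $b(x_i+x_j)\ne0\ne b(x_i-x_j)$. A sum $\sum_{\mathbf x}w(\mathbf x;\mathbf t)$ of $V$-valued functions that are meromorphic in $\mathbf t\in\mathbb C^N$ *converges mero-uniformly* if every $\mathbf t_0\in\mathbb C^N$ has an open neighbourhood $U$ with a holomorphic function $v$ on $U$, not identically zero near any point of $U$, such that all $v\,w(\mathbf x;\cdot)$ are holomorphic on $U$ and $\sum_{\mathbf x}v(\mathbf t)w(\mathbf x;\mathbf t)$ converges absolutely and uniformly on $U$. Its sum is then the unique meromorphic function $f$ on $\mathbb C^N$ with $v f=\sum_{\mathbf x}v\,w(\mathbf x;\cdot)$ on all such $U$. Suppose that the sum $$f_M(\mathbf t)=\sum_{\mathbf x\in\mathbf x_0+\tau\mathbb Z^M}\Bigl(\prod_{i=1}^M g(x_i)\Bigr)\Bigl(\prod_{1\le i<j\le M}h(x_i+x_j)h(x_i-x_j)\Bigr)\Bigl(\prod_{r=1}^N\prod_{i=1}^M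 F(t_r+x_i)F(t_r-x_i)\Bigr)\,\overline{\mathcal B}^{\xi_-}(x_1;\mathbf t)\cdots\overline{\mathcal B}^{\xi_-}(x_M;\mathbf t)\,\Omega$$ converges mero-uniformly in $\mathbf t\in\mathbb C^N$. Then $f_M$ is a meromorphic solution of the boundary quantum Knizhnik–Zamolodchikov equations $$f_M(\mathbf t+\tau\mathbf e_r)=A_r(\mathbf t;\xi_+,\xi_-;\tau)\,f_M(\mathbf t),\qquad r=1,\dots,N,$$ where $\mathbf e_r$ is the $r$-th standard basis vector and $$\begin{aligned}A_r(\mathbf t;\xi_+,\xi_-;\tau)={}&R_{r\,r+1}(t_r-t_{r+1}+\tau)\cdots R_{rN}(t_r-t_N+\tau)\,K^{\xi_+}_r(t_r+\tfrac\tau2)\\&\times R_{Nr}(t_N+t_r)\cdots R_{r+1\,r}(t_{r+1}+t_r)\,R_{r-1\,r}(t_{r-1}+t_r)\cdots R_{1r}(t_1+t_r)\\&\times K^{\xi_-}_r(t_r)\,R_{r1}(t_r-t_1)\cdots R_{r\,r-1}(t_r-t_{r-1}).\end{aligned}$$ -/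

import Mathlib

open Filter Topology Matrix

noncomputable section

namespace BQKZ

/-! ### Meromorphic functions of several complex variables and mero-uniform convergence

A meromorphic function on a complex vector space `E` is represented by an honest function `f`,
whose values on a thin set (a set that is locally contained in the zero set of a holomorphic
function which does not vanish identically near any point) are irrelevant. -/

section Meromorphic

variable {E V ι : Type*} [NormedAddCommGroup E] [NormedSpace ℂ E]
  [NormedAddCommGroup V] [NormedSpace ℂ V]

/-- `u` is holomorphic on a neighbourhood of `t` and not identically zero near `t`. -/
def IsNonzeroGerm (u : E → ℂ) (t : E) : Prop :=
  (∀ᶠ s in 𝓝 t, DifferentiableAt ℂ u s) ∧ ∃ᶠ s in 𝓝 t, u s ≠ 0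

/-- `f` and `g` agree on `U` outside a thin subset. For meromorphic functions on an open set `U`
this is equality as meromorphic functions. -/
def EqOffThin (U : Set E) (f g : E → V) : Prop :=
  ∀ t ∈ U, ∃ u : E → ℂ, IsNonzeroGerm u t ∧ ∀ᶠ s in 𝓝 t, u s ≠ 0 → f s = g s

/-- `f` is meromorphic on all of `E`: locally it is a quotient `φ / v` of holomorphic functions
with `v` not identically zero. -/
def IsMeromorphic (f : E → V) : Prop :=
  ∀ t : E, ∃ (v : E → ℂ) (φ : E → V), IsNonzeroGerm v t ∧
    (∀ᶠ s in 𝓝 t, DifferentiableAt ℂ φ s) ∧ ∀ᶠ s in 𝓝 t, v s ≠ 0 → v s • f s = φ s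

/-- `U` is open, `v` is holomorphic on `U` and not identically zero near any point of `U`, each
`v • w x` extends to the holomorphic function `φ x` on `U`, and `∑ x, φ x` converges absolutely
and uniformly on `U`. -/
structure IsMeroUniformChart (w : ι → E → V) (U : Set E) (v : E → ℂ) (φ : ι → E → V) :
    Prop where
  isOpen : IsOpen U
  holomorphic_mul : DifferentiableOn ℂ v U
  nonzero : ∀ s ∈ U, ∃ᶠ s' in 𝓝 s, v s' ≠ 0
  holomorphic : ∀ x, DifferentiableOn ℂ (φ x) U
  eq : ∀ x, EqOffThin U (fun s => v s • w x s) (φ x)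
  absolutely : ∀ s ∈ U, Summable fun x => ‖φ x s‖
  uniformly : SummableUniformlyOn φ U

/-- The sum `∑ x, w x` of meromorphic functions converges mero-uniformly. -/
def MeroUniformlySummable (w : ι → E → V) : Prop :=
  ∀ t₀ : E, ∃ (U : Set E) (v : E → ℂ) (φ : ι → E → V), t₀ ∈ U ∧ IsMeroUniformChart w U v φ

/-- The sum `∑ x, w x` converges mero-uniformly with sum `f`, i.e. locally
`v • f = ∑ x, v • w x`. This determines `f` as a meromorphic function. -/
def HasMeroSum (w : ι → E → V) (f : E → V) : Prop :=
  ∀ t₀ : E, ∃ (U : Set E) (v : E → ℂ) (φ : ι → E → V), t₀ ∈ U ∧ IsMeroUniformChart w U v φ ∧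
    EqOffThin U (fun s => v s • f s) (fun s => ∑' x, φ x s)

end Meromorphic

/-! ### R- and K-matrices

The index `0 : Fin 2` is the basis vector `e₊` of `ℂ²` and `1 : Fin 2` is `e₋`. The space
`(ℂ²)^{⊗ n}` is `(Fin n → Fin 2) → ℂ`, written in coordinates with respect to the basis
`e_{s 0} ⊗ ⋯ ⊗ e_{s (n - 1)}`, `s : Fin n → Fin 2`. Linear operators are matrices with respect to
these bases. -/

/-- The XXX case. -/
def IsXXX (b : ℂ → ℂ) : Prop := ∃ c : ℂ, c ≠ 0 ∧ ∀ x, b x = c * x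

/-- The XXZ case. -/
def IsXXZ (b : ℂ → ℂ) : Prop := ∃ c ν : ℂ, c ≠ 0 ∧ ν ≠ 0 ∧ ∀ x, b x = c * Complex.sinh (ν * x)

/-- The R-matrix `R(x; η)` on `ℂ² ⊗ ℂ²`. -/
def Rmat (b : ℂ → ℂ) (η x : ℂ) : Matrix (Fin 2 × Fin 2) (Fin 2 × Fin 2) ℂ :=
  (b (x + η))⁻¹ • Matrix.of fun p q =>
    if p = q then (if p.1 = p.2 then b (x + η) else b x)
    else if p = q.swap then b η else 0

/-- The diagonal K-matrix `K^ξ(x)` on `ℂ²`. -/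
def Kmat (b : ℂ → ℂ) (ξ x : ℂ) : Matrix (Fin 2) (Fin 2) ℂ :=
  Matrix.diagonal ![1, b (ξ - x) / b (ξ + x)]

/-- `A_i`: the operator `A` acting on the `i`-th tensor leg. -/
def leg1 {n : ℕ} (i : Fin n) (A : Matrix (Fin 2) (Fin 2) ℂ) :
    Matrix (Fin n → Fin 2) (Fin n → Fin 2) ℂ :=
  Matrix.of fun s s' => if ∀ k, k ≠ i → s k = s' k then A (s i) (s' i) else 0

/-- `A_{ij}` for `i ≠ j`: the operator `A` on `ℂ² ⊗ ℂ²` acting on the tensor legs `i` and `j`. -/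
def leg2 {n : ℕ} (i j : Fin n) (A : Matrix (Fin 2 × Fin 2) (Fin 2 × Fin 2) ℂ) :
    Matrix (Fin n → Fin 2) (Fin n → Fin 2) ℂ :=
  Matrix.of fun s s' =>
    if ∀ k, k ≠ i → k ≠ j → s k = s' k then A (s i, s j) (s' i, s' j) else 0

/-! ### The boundary monodromy operator and boundary Bethe vectors -/

/-- The monodromy operator `T(x; t) = R_{01}(x - t_1) ⋯ R_{0N}(x - t_N)` on `ℂ² ⊗ (ℂ²)^{⊗ N}`;
the auxiliary space is the leg `0 : Fin (N + 1)`. -/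
def monodromy (b : ℂ → ℂ) (η : ℂ) {N : ℕ} (x : ℂ) (t : Fin N → ℂ) :
    Matrix (Fin (N + 1) → Fin 2) (Fin (N + 1) → Fin 2) ℂ :=
  (List.ofFn fun r : Fin N => leg2 0 r.succ (Rmat b η (x - t r))).prod

/-- The boundary monodromy operator `U^ξ(x; t) = T(x; t)⁻¹ K^ξ_0(x)⁻¹ T(-x; t)`. -/
def boundaryMonodromy (b : ℂ → ℂ) (η ξ : ℂ) {N : ℕ} (x : ℂ) (t : Fin N → ℂ) :
    Matrix (Fin (N + 1) → Fin 2) (Fin (N + 1) → Fin 2) ℂ :=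
  (monodromy b η x t)⁻¹ * leg1 0 (Kmat b ξ x)⁻¹ * monodromy b η (-x) t

/-- The upper right entry `B^ξ(x; t)` of the boundary monodromy operator, written as a
`2 × 2`-matrix over `End((ℂ²)^{⊗ N})` with respect to the basis `(e₊, e₋)` of the auxiliary
space. -/
def boundaryB (b : ℂ → ℂ) (η ξ : ℂ) {N : ℕ} (x : ℂ) (t : Fin N → ℂ) :
    Matrix (Fin N → Fin 2) (Fin N → Fin 2) ℂ :=
  Matrix.of fun s s' =>
    boundaryMonodromy b η ξ x t (Fin.cons (α := fun _ => Fin 2) 0 s)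
      (Fin.cons (α := fun _ => Fin 2) 1 s')

/-- The formula for the renormalized operator `B̄^ξ(x; t)`, valid where no denominator vanishes. -/
def boundaryBbarFormula (b : ℂ → ℂ) (η ξ : ℂ) {N : ℕ} (x : ℂ) (t : Fin N → ℂ) :
    Matrix (Fin N → Fin 2) (Fin N → Fin 2) ℂ :=
  ((∏ r, b (x - t r - η / 2) / b (x - t r + η / 2)) *
      (b (ξ - x - η / 2) * b (2 * x) / b (2 * x + η))) •
    boundaryB b η ξ (x + η / 2) t

/-- The value at `x` of the meromorphic function `B̄^ξ(·; t)`: the limit of its defining formula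
at `x` (so that removable singularities of the formula do not matter). -/
def boundaryBbar (b : ℂ → ℂ) (η ξ : ℂ) {N : ℕ} (x : ℂ) (t : Fin N → ℂ) :
    Matrix (Fin N → Fin 2) (Fin N → Fin 2) ℂ :=
  limUnder (𝓝[≠] x) fun y => boundaryBbarFormula b η ξ y t

/-- The pseudo-vacuum vector `Ω = e₊ ⊗ ⋯ ⊗ e₊`. -/
def pseudoVacuum (N : ℕ) : (Fin N → Fin 2) → ℂ := Pi.single (fun _ => 0) 1

/-- The off-shell boundary Bethe vector `B̄^ξ(x_1; t) ⋯ B̄^ξ(x_M; t) Ω`. -/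
def boundaryBethe (b : ℂ → ℂ) (η ξ : ℂ) {N M : ℕ} (x : Fin M → ℂ) (t : Fin N → ℂ) :
    (Fin N → Fin 2) → ℂ :=
  (List.ofFn fun i : Fin M => boundaryBbar b η ξ (x i) t).prod *ᵥ pseudoVacuum N

/-! ### The boundary quantum KZ equations -/

/-- The transport operator `A_r(t; ξ₊, ξ₋; τ)`:
`R_{r,r+1}(t_r-t_{r+1}+τ) ⋯ R_{rN}(t_r-t_N+τ) K^{ξ₊}_r(t_r+τ/2)`
`R_{Nr}(t_N+t_r) ⋯ R_{r+1,r}(t_{r+1}+t_r) R_{r-1,r}(t_{r-1}+t_r) ⋯ R_{1r}(t_1+t_r)`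
`K^{ξ₋}_r(t_r) R_{r1}(t_r-t_1) ⋯ R_{r,r-1}(t_r-t_{r-1})`. -/
def transport (b : ℂ → ℂ) (η ξp ξm τ : ℂ) {N : ℕ} (r : Fin N) (t : Fin N → ℂ) :
    Matrix (Fin N → Fin 2) (Fin N → Fin 2) ℂ :=
  let above : List (Fin N) := (List.finRange N).filter fun s => r < s
  let below : List (Fin N) := (List.finRange N).filter fun s => s < r
  (above.map fun s => leg2 r s (Rmat b η (t r - t s + τ))).prod *
    leg1 r (Kmat b ξp (t r + τ / 2)) *
    (above.reverse.map fun s => leg2 s r (Rmat b η (t s + t r))).prod *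
    (below.reverse.map fun s => leg2 s r (Rmat b η (t s + t r))).prod *
    leg1 r (Kmat b ξm (t r)) *
    (below.map fun s => leg2 r s (Rmat b η (t r - t s))).prod

/-- `f` solves the boundary quantum KZ equations
`f(t + τ e_r) = A_r(t; ξ₊, ξ₋; τ) f(t)`, `r = 1, …, N`, as a meromorphic function of `t`. -/
def SolvesBoundaryQKZ (b : ℂ → ℂ) (η ξp ξm τ : ℂ) {N : ℕ}
    (f : (Fin N → ℂ) → (Fin N → Fin 2) → ℂ) : Prop :=
  ∀ r : Fin N, EqOffThin Set.univ (fun t => f (t + Pi.single r τ))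
    (fun t => transport b η ξp ξm τ r t *ᵥ f t)

/-! ### The bilateral sum -/

/-- The point `x₀ + τ n` of the lattice `x₀ + τ ℤ^M`. -/
def latticePoint (τ : ℂ) {M : ℕ} (x₀ : Fin M → ℂ) (n : Fin M → ℤ) : Fin M → ℂ :=
  fun i => x₀ i + τ * n i

/-- The weight
`∏_i g(x_i) ∏_{i<j} h(x_i + x_j) h(x_i - x_j) ∏_{r,i} F(t_r + x_i) F(t_r - x_i)`. -/
def weight (g h F : ℂ → ℂ) {N M : ℕ} (x : Fin M → ℂ) (t : Fin N → ℂ) : ℂ :=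
  (∏ i, g (x i)) *
    (∏ i, ∏ j ∈ Finset.Ioi i, h (x i + x j) * h (x i - x j)) *
    (∏ r, ∏ i, F (t r + x i) * F (t r - x i))

/-- The summand at `x₀ + τ n` of the bilateral sum `f_M`, as a function of `t`. -/
def summand (b : ℂ → ℂ) (η ξm τ : ℂ) (g h F : ℂ → ℂ) {N M : ℕ} (x₀ : Fin M → ℂ)
    (n : Fin M → ℤ) (t : Fin N → ℂ) : (Fin N → Fin 2) → ℂ :=
  weight g h F (latticePoint τ x₀ n) t • boundaryBethe b η ξm (latticePoint τ x₀ n) t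

/-- Genericity of the base point `x₀`: on the lattice `x₀ + τ ℤ^M` the functions `g(x_i)` and
`h(x_i ± x_j)`, `i < j`, have no poles, and `b(x_i ± x_j) ≠ 0` for `i < j`. -/
structure IsGeneric (b : ℂ → ℂ) (τ : ℂ) (g h : ℂ → ℂ) {M : ℕ} (x₀ : Fin M → ℂ) : Prop where
  analyticAt_g : ∀ i, ∀ k : ℤ, AnalyticAt ℂ g (x₀ i + τ * k)
  analyticAt_h_add : ∀ i j, i < j → ∀ k : ℤ, AnalyticAt ℂ h (x₀ i + x₀ j + τ * k)
  analyticAt_h_sub : ∀ i j, i < j → ∀ k : ℤ, AnalyticAt ℂ h (x₀ i - x₀ j + τ * k)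
  ne_zero_add : ∀ i j, i < j → ∀ k : ℤ, b (x₀ i + x₀ j + τ * k) ≠ 0
  ne_zero_sub : ∀ i j, i < j → ∀ k : ℤ, b (x₀ i - x₀ j + τ * k) ≠ 0

end BQKZ

end

/-!
The boundary qKZ equations hold because, for generic inhomogeneities `t`, the difference of the two
sides is a sum over the lattice `x₀ + τ ℤ^M` that telescopes.

**Algebra of one summand.** The reflection equation for the double row monodromy matrix yields the
exchange relations of its blocks, and crossing symmetry writes the boundary Bethe vectors through
creation operators that are entire in the spectral parameter. With site `r` made outermost, a Bethe
vector becomes a wanted vector, in which site `r` is in the state `e₊`, minus unwanted terms that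
form a sum of simple fractions in `Z = t_r + η/2` with poles at `∓ x_i` (`boundaryBethe_eq_siteVec`,
`siteVec_eq`). The operator `A_r` takes this vector to one of the same shape with another argument
(`transport_mulVec_boundaryBethe`). Hence `A_r(t) · summand(t) - summand(t + τ e_r)` is a fixed
matrix applied to `cauchySum (Z + τ) - κ • cauchySum Z'`, where `Z' = - t_r + η/2`
(`IsRegularPoint.transport_sub`).

**Telescoping.** By the functional equations of `g` and `h`, the residue at `u = x_i` of one summand,
weighted with `(b (Z + τ + u))⁻¹ - κ (b (Z' + u))⁻¹`, is opposite to the residue at `u = - x_i - τ` of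
the summand with `x_i` replaced by `x_i + τ` (`weight_residueTerm_shift`, `PairedResidues`). So the
difference above is the divergence of a flow along the edges of the lattice.

**Why the telescoping is legitimate.** The flow itself need not be summable: only the sums of simple
fractions at the arguments `Z + k τ` are known to converge, from the convergence at the points
`t + k τ e_r`. Interpolation recovers the flow from these up to discriminant factors in the `x_i`
(`PairedResidues.flow_bound`), and there are three cases.

* If `b` grows along the lattice, because it is linear or because `re (ν τ) ≠ 0`, then the flow has at
  most power growth in `b` relative to a summable sequence. A product of quotients of values of `b`
  that satisfies a compatible shift relation damps it by a power with exponent proportional to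
  `re s`. For large `re s` the damped sum telescopes to `0`, and the result extends to `s = 0` by
  analytic continuation (`PairedResidues.tsum_eq_zero_of_isExpanding`).
* If `re (ν τ) = 0` and no nonzero multiple of `τ` is a zero of `b`, then `b` is bounded along the
  lattice, but the discriminants may come arbitrarily close to `0`. The edges at whose ends they are
  small form finite clusters. Summing over unions of clusters, only the other edges contribute, and
  on these the flow is summable (`PairedResidues.tsum_eq_zero_of_re_eq_zero`).
* If some nonzero multiple of `τ` is a zero of `b`, then `b` has a period `ω ∈ τ ℕ`, and translating
  a lattice coordinate by `ω` multiplies the summand by an `ω`-periodic factor. Absolute convergence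
  then makes every summand vanish (`summand_eq_zero_of_period`), unless `M = 0`, where the flow is
  empty.

**From generic points to meromorphic functions.** The conditions on `t` used above hold on a residual
set (`eventually_isRegularPoint`), and so does pointwise summability at all `t + k τ e_r`. Two
meromorphic functions that agree on a residual set agree outside a thin set
(`IsMeromorphic.eqOffThin`).
-/

noncomputable section

namespace BQKZ

/-! ### The function `b` -/

section bFunction

variable {b : ℂ → ℂ}

theorem b_neg (hb : IsXXX b ∨ IsXXZ b) (x : ℂ) : b (-x) = -b x := by
  rcases hb with ⟨c, -, h⟩ | ⟨c, ν, -, -, h⟩ <;> simp [h]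

theorem b_zero (hb : IsXXX b ∨ IsXXZ b) : b 0 = 0 := by
  rcases hb with ⟨c, -, h⟩ | ⟨c, ν, -, -, h⟩ <;> simp [h]

theorem b_differentiable (hb : IsXXX b ∨ IsXXZ b) : Differentiable ℂ b := by
  rcases hb with ⟨c, -, h⟩ | ⟨c, ν, -, -, h⟩
  · rw [funext h]; fun_prop
  · rw [funext h]; fun_prop

theorem b_continuous (hb : IsXXX b ∨ IsXXZ b) : Continuous b := (b_differentiable hb).continuous

end bFunction

/-! ### Operators on tensor legs -/

section Legs

/-- The operator `A` on `(ℂ²)^{⊗ m}` acting on the tensor legs `e 0, …, e (m - 1)` of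
`(ℂ²)^{⊗ n}`. -/
def onLegs {m n : ℕ} (e : Fin m → Fin n) (A : Matrix (Fin m → Fin 2) (Fin m → Fin 2) ℂ) :
    Matrix (Fin n → Fin 2) (Fin n → Fin 2) ℂ :=
  Matrix.of fun s s' => if ∀ k, k ∉ Set.range e → s k = s' k then A (s ∘ e) (s' ∘ e) else 0

variable {m n : ℕ}

theorem onLegs_apply (e : Fin m → Fin n) (A : Matrix (Fin m → Fin 2) (Fin m → Fin 2) ℂ)
    (s s' : Fin n → Fin 2) : onLegs e A s s' =
      if ∀ k, k ∉ Set.range e → s k = s' k then A (s ∘ e) (s' ∘ e) else 0 := rfl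

theorem onLegs_mul {e : Fin m → Fin n} (he : Function.Injective e)
    (A B : Matrix (Fin m → Fin 2) (Fin m → Fin 2) ℂ) :
    onLegs e (A * B) = onLegs e A * onLegs e B := by
  ext s s'
  have key : ∀ v : Fin m → Fin 2, Function.extend e v s ∘ e = v := fun v => by
    funext i; simp [he.extend_apply]
  rw [onLegs_apply, Matrix.mul_apply, Matrix.mul_apply]
  rw [← Fintype.sum_of_injective (fun v : Fin m → Fin 2 => Function.extend e v s)
    (fun v w h => by rw [← key v, ← key w]; exact congrArg (· ∘ e) h)
    (fun v => if ∀ k, k ∉ Set.range e → s k = s' k then A (s ∘ e) v * B v (s' ∘ e) else 0)]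
  · split_ifs <;> simp
  · intro u hu
    rw [onLegs_apply, if_neg, zero_mul]
    intro h
    refine hu ⟨u ∘ e, ?_⟩
    funext k
    by_cases hk : k ∈ Set.range e
    · obtain ⟨i, rfl⟩ := hk; simp [he.extend_apply]
    · simp only [Set.mem_range] at hk
      exact (Function.extend_apply' _ _ _ hk).trans (h k hk)
  · intro v
    have h1 : ∀ k, k ∉ Set.range e → s k = Function.extend e v s k := fun k hk => by
      rw [Function.extend_apply' _ _ _ hk]
    have h2 : (∀ k, k ∉ Set.range e → Function.extend e v s k = s' k) ↔
        ∀ k, k ∉ Set.range e → s k = s' k :=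
      forall₂_congr fun k hk => by rw [← h1 k hk]
    rw [onLegs_apply, onLegs_apply, if_pos h1, key]
    simp only [h2]
    split_ifs <;> simp

theorem onLegs_one (e : Fin m → Fin n) : onLegs e 1 = 1 := by
  ext s s'
  rw [onLegs_apply]
  by_cases h : s = s'
  · subst h; simp
  · rw [Matrix.one_apply_ne h]
    split_ifs with h1
    · refine Matrix.one_apply_ne fun h2 => h (funext fun k => ?_)
      by_cases hk : k ∈ Set.range e
      · obtain ⟨i, rfl⟩ := hk; exact congrFun h2 i
      · exact h1 k hk
    · rfl

theorem onLegs_add (e : Fin m → Fin n) (A B : Matrix (Fin m → Fin 2) (Fin m → Fin 2) ℂ) :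
    onLegs e (A + B) = onLegs e A + onLegs e B := by
  ext s s'; simp only [onLegs_apply, Matrix.add_apply]; split_ifs <;> simp

theorem onLegs_smul (e : Fin m → Fin n) (c : ℂ) (A : Matrix (Fin m → Fin 2) (Fin m → Fin 2) ℂ) :
    onLegs e (c • A) = c • onLegs e A := by
  ext s s'; simp only [onLegs_apply, Matrix.smul_apply]; split_ifs <;> simp

/-- Operators acting on disjoint sets of legs commute. -/
theorem onLegs_commute {l : ℕ} {e : Fin m → Fin n} {f : Fin l → Fin n}
    (hef : ∀ i j, e i ≠ f j) (A : Matrix (Fin m → Fin 2) (Fin m → Fin 2) ℂ)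
    (B : Matrix (Fin l → Fin 2) (Fin l → Fin 2) ℂ) :
    Commute (onLegs e A) (onLegs f B) := by
  classical
  -- Both products have the same entries: only one intermediate state contributes.
  have key : ∀ {m l : ℕ} {e : Fin m → Fin n} {f : Fin l → Fin n} (_ : ∀ i j, e i ≠ f j)
      (A : Matrix (Fin m → Fin 2) (Fin m → Fin 2) ℂ)
      (B : Matrix (Fin l → Fin 2) (Fin l → Fin 2) ℂ) (s s' : Fin n → Fin 2),
      (onLegs e A * onLegs f B) s s' =
        if ∀ k, k ∉ Set.range e → k ∉ Set.range f → s k = s' k then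
          A (s ∘ e) (s' ∘ e) * B (s ∘ f) (s' ∘ f) else 0 := by
    intro m l e f hef A B s s'
    rw [Matrix.mul_apply, Finset.sum_eq_single (fun k => if k ∈ Set.range e then s' k else s k)]
    · have h1 : (fun k => if k ∈ Set.range e then s' k else s k) ∘ e = s' ∘ e := by
        funext i; simp
      have h2 : (fun k => if k ∈ Set.range e then s' k else s k) ∘ f = s ∘ f := by
        funext i; simp [hef]
      rw [onLegs_apply, onLegs_apply, h1, h2, if_pos (fun k hk => by simp only [if_neg hk])]
      have h3 : (∀ k, k ∉ Set.range f → (if k ∈ Set.range e then s' k else s k) = s' k) ↔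
          ∀ k, k ∉ Set.range e → k ∉ Set.range f → s k = s' k := by
        refine ⟨fun h k h4 h5 => by simpa only [if_neg h4] using h k h5, fun h k h5 => ?_⟩
        split_ifs with h4
        · rfl
        · exact h k h4 h5
      simp only [h3]; split_ifs <;> simp
    · intro u _ hu
      rw [onLegs_apply, onLegs_apply]
      split_ifs with h1 h2
      · refine absurd (funext fun k => ?_) hu
        split_ifs with h3
        · refine h2 k ?_
          rintro ⟨j, rfl⟩
          obtain ⟨i, hi⟩ := h3
          exact hef i j hi
        · exact (h1 k h3).symm
      all_goals simp
    · simp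
  ext s s'
  rw [key hef, key fun i j => (hef j i).symm]
  have : (∀ k, k ∉ Set.range e → k ∉ Set.range f → s k = s' k) ↔
      ∀ k, k ∉ Set.range f → k ∉ Set.range e → s k = s' k := forall_congr' fun k => forall_comm
  simp only [this, mul_comm]

theorem onLegs_comp {l : ℕ} {e : Fin m → Fin n} (he : Function.Injective e) (f : Fin l → Fin m)
    (A : Matrix (Fin l → Fin 2) (Fin l → Fin 2) ℂ) :
    onLegs e (onLegs f A) = onLegs (e ∘ f) A := by
  ext s s'
  simp only [onLegs_apply, ← ite_and]
  have : ((∀ k, k ∉ Set.range e → s k = s' k) ∧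
      ∀ k, k ∉ Set.range f → (s ∘ e) k = (s' ∘ e) k) ↔
      ∀ k, k ∉ Set.range (e ∘ f) → s k = s' k := by
    constructor
    · rintro ⟨h1, h2⟩ k hk
      by_cases h : k ∈ Set.range e
      · obtain ⟨i, rfl⟩ := h
        refine h2 i ?_
        rintro ⟨j, rfl⟩
        exact hk ⟨j, rfl⟩
      · exact h1 k h
    · intro h
      refine ⟨fun k hk => h k ?_, fun k hk => h (e k) ?_⟩
      · rintro ⟨j, rfl⟩; exact hk ⟨f j, rfl⟩
      · rintro ⟨j, hj⟩; exact hk ⟨j, he hj⟩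
  simp only [this]; rfl

theorem leg1_eq_onLegs (i : Fin n) (A : Matrix (Fin 2) (Fin 2) ℂ) :
    leg1 i A = onLegs ![i] (A.submatrix (fun v => v 0) fun v => v 0) := by
  ext s s'
  simp [leg1, onLegs_apply]

theorem leg2_eq_onLegs (i j : Fin n) (A : Matrix (Fin 2 × Fin 2) (Fin 2 × Fin 2) ℂ) :
    leg2 i j A = onLegs ![i, j] (A.submatrix (fun v => (v 0, v 1)) fun v => (v 0, v 1)) := by
  ext s s'
  have h : (∀ k, k ∉ Set.range ![i, j] → s k = s' k) ↔ ∀ k, k ≠ i → k ≠ j → s k = s' k := by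
    simp [or_comm, not_or]
  simp only [leg2, onLegs_apply, Matrix.of_apply, h]
  simp

theorem leg1_mul (i : Fin n) (A B : Matrix (Fin 2) (Fin 2) ℂ) :
    leg1 i (A * B) = leg1 i A * leg1 i B := by
  simp only [leg1_eq_onLegs]
  rw [← onLegs_mul]
  · congr 1
  · intro x y _; exact Subsingleton.elim (α := Fin 1) x y

theorem leg1_one (i : Fin n) : leg1 i 1 = 1 := by
  rw [leg1_eq_onLegs, ← onLegs_one ![i]]
  congr 1
  exact Matrix.submatrix_one_equiv (Equiv.funUnique (Fin 1) (Fin 2))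

theorem leg1_add (i : Fin n) (A B : Matrix (Fin 2) (Fin 2) ℂ) :
    leg1 i (A + B) = leg1 i A + leg1 i B := by
  simp only [leg1_eq_onLegs, ← onLegs_add]; rfl

theorem leg1_smul (i : Fin n) (c : ℂ) (A : Matrix (Fin 2) (Fin 2) ℂ) :
    leg1 i (c • A) = c • leg1 i A := by
  simp only [leg1_eq_onLegs, ← onLegs_smul]; rfl

theorem leg2_mul {i j : Fin n} (hij : i ≠ j) (A B : Matrix (Fin 2 × Fin 2) (Fin 2 × Fin 2) ℂ) :
    leg2 i j (A * B) = leg2 i j A * leg2 i j B := by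
  simp only [leg2_eq_onLegs]
  rw [← onLegs_mul]
  · exact congrArg _ (Matrix.submatrix_mul_equiv A B _ (finTwoArrowEquiv (Fin 2)) _).symm
  · intro x y; fin_cases x <;> fin_cases y <;> simp [hij, hij.symm]

theorem leg2_one (i j : Fin n) : leg2 i j 1 = 1 := by
  rw [leg2_eq_onLegs, ← onLegs_one ![i, j]]
  congr 1
  exact Matrix.submatrix_one_equiv (finTwoArrowEquiv (Fin 2))

theorem leg2_smul (i j : Fin n) (c : ℂ) (A : Matrix (Fin 2 × Fin 2) (Fin 2 × Fin 2) ℂ) :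
    leg2 i j (c • A) = c • leg2 i j A := by
  simp only [leg2_eq_onLegs, ← onLegs_smul]; rfl

theorem leg1_commute_leg1 {i j : Fin n} (hij : i ≠ j) (A B : Matrix (Fin 2) (Fin 2) ℂ) :
    Commute (leg1 i A) (leg1 j B) := by
  simp only [leg1_eq_onLegs]
  exact onLegs_commute (by simp [hij]) _ _

theorem leg1_commute_leg2 {i j k : Fin n} (hij : i ≠ j) (hik : i ≠ k)
    (A : Matrix (Fin 2) (Fin 2) ℂ) (B : Matrix (Fin 2 × Fin 2) (Fin 2 × Fin 2) ℂ) :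
    Commute (leg1 i A) (leg2 j k B) := by
  simp only [leg1_eq_onLegs, leg2_eq_onLegs]
  exact onLegs_commute (by simp [Fin.forall_fin_two, hij, hik]) _ _

theorem leg2_commute_leg2 {i j k l : Fin n} (hik : i ≠ k) (hil : i ≠ l) (hjk : j ≠ k) (hjl : j ≠ l)
    (A B : Matrix (Fin 2 × Fin 2) (Fin 2 × Fin 2) ℂ) :
    Commute (leg2 i j A) (leg2 k l B) := by
  simp only [leg2_eq_onLegs]
  exact onLegs_commute (by simp [Fin.forall_fin_two, hik, hil, hjk, hjl]) _ _

theorem onLegs_leg2 {e : Fin m → Fin n} (he : Function.Injective e) (i j : Fin m)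
    (A : Matrix (Fin 2 × Fin 2) (Fin 2 × Fin 2) ℂ) :
    onLegs e (leg2 i j A) = leg2 (e i) (e j) A := by
  simp only [leg2_eq_onLegs, onLegs_comp he]
  congr 1; funext x; fin_cases x <;> rfl

end Legs

/-! ### Six-vertex matrices -/

section SixVertex

variable {n : ℕ}

/-- The six-vertex matrix with weights `a`, `b`, `c`. -/
def sixVertex (a b c : ℂ) : Matrix (Fin 2 × Fin 2) (Fin 2 × Fin 2) ℂ :=
  Matrix.of fun p q => if p = q then (if p.1 = p.2 then a else b) else if p = q.swap then c else 0

theorem sixVertex_comm (i j : Fin n) (a b c : ℂ) :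
    leg2 i j (sixVertex a b c) = leg2 j i (sixVertex a b c) := by
  ext s s'
  have h1 : (∀ k, k ≠ i → k ≠ j → s k = s' k) ↔ ∀ k, k ≠ j → k ≠ i → s k = s' k :=
    forall_congr' fun k => forall_comm
  simp only [leg2, sixVertex, Matrix.of_apply, h1]
  generalize s i = a1; generalize s j = a2; generalize s' i = a3; generalize s' j = a4
  fin_cases a1 <;> fin_cases a2 <;> fin_cases a3 <;> fin_cases a4 <;> simp

theorem sum_three_legs (f : (Fin 3 → Fin 2) → ℂ) :
    ∑ s, f s = ∑ x, ∑ y, ∑ z, f ![x, y, z] := by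
  have h : (Finset.univ : Finset (Fin 3 → Fin 2)) = {![0, 0, 0], ![0, 0, 1], ![0, 1, 0],
    ![0, 1, 1], ![1, 0, 0], ![1, 0, 1], ![1, 1, 0], ![1, 1, 1]} := by decide
  rw [h]
  repeat rw [Finset.sum_insert (by decide)]
  simp only [Finset.sum_singleton, Fin.sum_univ_two]; ring

/-- The Yang–Baxter equation on three legs, from the relations between the weights. -/
theorem yangBaxter_three {a₁ b₁ a₂ b₂ a₃ b₃ c : ℂ} (h₁ : a₁ * a₃ = b₁ * b₃ + a₂ * c)
    (h₂ : a₁ * b₂ = b₁ * a₂ + c * b₃) (h₃ : b₂ * a₃ = a₂ * b₃ + b₁ * c) :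
    leg2 (0 : Fin 3) 1 (sixVertex a₁ b₁ c) * leg2 0 2 (sixVertex a₂ b₂ c) *
        leg2 1 2 (sixVertex a₃ b₃ c) =
      leg2 1 2 (sixVertex a₃ b₃ c) * leg2 0 2 (sixVertex a₂ b₂ c) *
        leg2 (0 : Fin 3) 1 (sixVertex a₁ b₁ c) := by
  have hs : ∀ s : Fin 3 → Fin 2, s = ![s 0, s 1, s 2] := fun s => by
    funext k; fin_cases k <;> rfl
  have h01 : ∀ (A : Matrix (Fin 2 × Fin 2) (Fin 2 × Fin 2) ℂ) (x y z x' y' z' : Fin 2),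
      leg2 (0 : Fin 3) 1 A ![x, y, z] ![x', y', z'] =
        if z = z' then A (x, y) (x', y') else 0 := fun A x y z x' y' z' => by
    simp only [leg2, Fin.forall_fin_succ, Matrix.of_apply]
    simp
  have h02 : ∀ (A : Matrix (Fin 2 × Fin 2) (Fin 2 × Fin 2) ℂ) (x y z x' y' z' : Fin 2),
      leg2 (0 : Fin 3) 2 A ![x, y, z] ![x', y', z'] =
        if y = y' then A (x, z) (x', z') else 0 := fun A x y z x' y' z' => by
    simp only [leg2, Fin.forall_fin_succ, Matrix.of_apply]
    simp
  have h12 : ∀ (A : Matrix (Fin 2 × Fin 2) (Fin 2 × Fin 2) ℂ) (x y z x' y' z' : Fin 2),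
      leg2 (1 : Fin 3) 2 A ![x, y, z] ![x', y', z'] =
        if x = x' then A (y, z) (y', z') else 0 := fun A x y z x' y' z' => by
    simp only [leg2, Fin.forall_fin_succ, Matrix.of_apply]
    simp
  ext s s'
  rw [hs s, hs s']
  generalize s 0 = x1; generalize s 1 = x2; generalize s 2 = x3
  generalize s' 0 = y1; generalize s' 1 = y2; generalize s' 2 = y3
  simp only [Matrix.mul_apply, sum_three_legs, h01, h02, h12, Fin.sum_univ_two]
  fin_cases x1 <;> fin_cases x2 <;> fin_cases x3 <;> fin_cases y1 <;> fin_cases y2 <;>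
    fin_cases y3 <;> simp [sixVertex] <;> grind

end SixVertex

/-! ### The reflection equation -/

section Reflection

variable {b : ℂ → ℂ} {n : ℕ}

/-- The R-matrix without its denominator. -/
def Rhat (b : ℂ → ℂ) (η u : ℂ) : Matrix (Fin 2 × Fin 2) (Fin 2 × Fin 2) ℂ :=
  sixVertex (b (u + η)) (b u) (b η)

/-- The inverse K-matrix `K^ξ(x)⁻¹` without its denominator. -/
def Khat (b : ℂ → ℂ) (ξ x : ℂ) : Matrix (Fin 2) (Fin 2) ℂ :=
  Matrix.diagonal ![b (ξ - x), b (ξ + x)]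

theorem Rmat_eq (b : ℂ → ℂ) (η u : ℂ) : Rmat b η u = (b (u + η))⁻¹ • Rhat b η u := rfl

theorem Rhat_comm (η u : ℂ) (i j : Fin n) : leg2 i j (Rhat b η u) = leg2 j i (Rhat b η u) :=
  sixVertex_comm ..

theorem yangBaxter (hb : IsXXX b ∨ IsXXZ b) (η : ℂ) {i j k : Fin n} (hij : i ≠ j) (hik : i ≠ k)
    (hjk : j ≠ k) {u v w : ℂ} (huv : w = u + v) :
    leg2 i j (Rhat b η u) * leg2 i k (Rhat b η w) * leg2 j k (Rhat b η v) =
      leg2 j k (Rhat b η v) * leg2 i k (Rhat b η w) * leg2 i j (Rhat b η u) := by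
  subst huv
  have he : Function.Injective ![i, j, k] := by
    intro x y; fin_cases x <;> fin_cases y <;> simp [hij, hik, hjk, hij.symm, hik.symm, hjk.symm]
  have h := congrArg (onLegs ![i, j, k]) (yangBaxter_three (a₁ := b (u + η)) (b₁ := b u)
    (a₂ := b (u + v + η)) (b₂ := b (u + v)) (a₃ := b (v + η)) (b₃ := b v) (c := b η) ?_ ?_ ?_)
  · simp only [onLegs_mul he, onLegs_leg2 he] at h
    exact h
  all_goals
    rcases hb with ⟨c, -, h⟩ | ⟨c, ν, -, -, h⟩
    · simp only [h]; ring
    · simp only [h, Complex.sinh, mul_add, neg_add, Complex.exp_add, Complex.exp_neg]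
      field_simp
      ring

theorem leg1_eq_leg2_left {i j : Fin n} (hij : i ≠ j) (A : Matrix (Fin 2) (Fin 2) ℂ) :
    leg1 i A = leg2 i j (Matrix.of fun p q => if p.2 = q.2 then A p.1 q.1 else 0) := by
  ext s s'
  have : (∀ k, k ≠ i → s k = s' k) ↔ (∀ k, k ≠ i → k ≠ j → s k = s' k) ∧ s j = s' j := by
    refine ⟨fun h => ⟨fun k h1 _ => h k h1, h j hij.symm⟩, fun h k hk => ?_⟩
    by_cases hkj : k = j
    · rw [hkj, h.2]
    · exact h.1 k hk hkj
  simp only [leg1, leg2, Matrix.of_apply, this, ite_and]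

theorem leg1_eq_leg2_right {i j : Fin n} (hij : i ≠ j) (A : Matrix (Fin 2) (Fin 2) ℂ) :
    leg1 j A = leg2 i j (Matrix.of fun p q => if p.1 = q.1 then A p.2 q.2 else 0) := by
  ext s s'
  have : (∀ k, k ≠ j → s k = s' k) ↔ (∀ k, k ≠ i → k ≠ j → s k = s' k) ∧ s i = s' i := by
    refine ⟨fun h => ⟨fun k _ h1 => h k h1, h i hij⟩, fun h k hk => ?_⟩
    by_cases hkj : k = i
    · rw [hkj, h.2]
    · exact h.1 k hkj hk
  simp only [leg1, leg2, Matrix.of_apply, this, ite_and]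

/-- The reflection equation for the diagonal K-matrix. -/
theorem reflection_Khat (hb : IsXXX b ∨ IsXXZ b) (η ξ : ℂ) {i j : Fin n} (hij : i ≠ j) (x y : ℂ) :
    leg2 i j (Rhat b η (y - x)) * leg1 i (Khat b ξ x) * leg2 i j (Rhat b η (-x - y)) *
        leg1 j (Khat b ξ y) =
      leg1 j (Khat b ξ y) * leg2 i j (Rhat b η (-x - y)) * leg1 i (Khat b ξ x) *
        leg2 i j (Rhat b η (y - x)) := by
  rw [leg1_eq_leg2_left hij, leg1_eq_leg2_right hij]
  simp only [← leg2_mul hij]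
  congr 1
  have h1 : b (y - x) * b (ξ + x) * b (ξ + y) * b η + b η * b (ξ - x) * b (-x - y) * b (ξ + y) =
      b (ξ - y) * b (-x - y) * b (ξ + x) * b η + b (ξ - y) * b η * b (ξ - x) * b (y - x) := by
    rcases hb with ⟨c, -, h⟩ | ⟨c, ν, -, -, h⟩
    · simp only [h]; ring
    · simp only [h, Complex.sinh, mul_add, mul_sub, neg_add, neg_sub, Complex.exp_add,
        Complex.exp_sub, Complex.exp_neg, mul_neg]
      field_simp
      ring
  ext ⟨p1, p2⟩ ⟨q1, q2⟩
  simp only [Matrix.mul_apply, Fintype.sum_prod_type, Fin.sum_univ_two, Rhat, sixVertex, Khat,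
    Matrix.of_apply]
  fin_cases p1 <;> fin_cases p2 <;> fin_cases q1 <;> fin_cases q2 <;> simp <;> grind

/-- A double row operator: the product
`R_{a s₁}(t₁ - x) ⋯ R_{a sₖ}(tₖ - x) K_a(x)⁻¹ R_{a sₖ}(-x - tₖ) ⋯ R_{a s₁}(-x - t₁)` without its
denominators, for a list of sites `(s₁, t₁), …, (sₖ, tₖ)`, each consisting of a tensor leg and an
inhomogeneity. The head of the list is the outermost site. -/
def doubleRow (b : ℂ → ℂ) (η ξ : ℂ) (a : Fin n) :
    List (Fin n × ℂ) → ℂ → Matrix (Fin n → Fin 2) (Fin n → Fin 2) ℂ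
  | [], x => leg1 a (Khat b ξ x)
  | (s, t) :: L, x =>
    leg2 a s (Rhat b η (t - x)) * doubleRow b η ξ a L x * leg2 a s (Rhat b η (-x - t))

theorem doubleRow_nil (η ξ : ℂ) (a : Fin n) (x : ℂ) :
    doubleRow b η ξ a [] x = leg1 a (Khat b ξ x) := rfl

theorem doubleRow_cons (η ξ : ℂ) (a s : Fin n) (t : ℂ) (L : List (Fin n × ℂ)) (x : ℂ) :
    doubleRow b η ξ a ((s, t) :: L) x =
      leg2 a s (Rhat b η (t - x)) * doubleRow b η ξ a L x * leg2 a s (Rhat b η (-x - t)) := rfl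

theorem commute_doubleRow (η ξ : ℂ) {a : Fin n} {L : List (Fin n × ℂ)}
    {M : Matrix (Fin n → Fin 2) (Fin n → Fin 2) ℂ} (h1 : ∀ A, Commute M (leg1 a A))
    (h2 : ∀ s ∈ L, ∀ A, Commute M (leg2 a s.1 A)) (x : ℂ) : Commute M (doubleRow b η ξ a L x) := by
  induction L with
  | nil => exact h1 _
  | cons s L ih =>
    have h := h2 s (by simp)
    exact ((h _).mul_right (ih fun s hs => h2 s (by simp [hs]))).mul_right (h _)

theorem leg2_commute_doubleRow (η ξ : ℂ) {a c d : Fin n} {L : List (Fin n × ℂ)} (hc : c ≠ a)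
    (hd : d ≠ a) (hcL : ∀ s ∈ L, s.1 ≠ c) (hdL : ∀ s ∈ L, s.1 ≠ d)
    (A : Matrix (Fin 2 × Fin 2) (Fin 2 × Fin 2) ℂ) (x : ℂ) :
    Commute (leg2 c d A) (doubleRow b η ξ a L x) :=
  commute_doubleRow η ξ (fun _ => (leg1_commute_leg2 hc.symm hd.symm _ _).symm)
    (fun s hs _ => leg2_commute_leg2 hc (hcL s hs).symm hd (hdL s hs).symm _ _) x

/-- The algebra behind the induction step of the reflection equation: `U`, `V` are the double row
operators with auxiliary legs `a`, `b` for the inner sites, `P`, `P'` (resp. `Q`, `Q'`) are the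
R-matrices between `a` (resp. `b`) and the new site, and `R`, `S` those between `a` and `b`. -/
theorem reflection_step {G : Type*} [Semigroup G] {U V P P' Q Q' R S : G}
    (hUQ : U * Q = Q * U) (hUQ' : U * Q' = Q' * U) (hVP : V * P = P * V) (hVP' : V * P' = P' * V)
    (h1 : P' * S * Q = Q * S * P') (h2 : R * P * Q = Q * P * R) (h3 : R * P' * Q' = Q' * P' * R)
    (h4 : P * S * Q' = Q' * S * P) (ih : R * U * S * V = V * S * U * R) :
    R * (P * U * P') * S * (Q * V * Q') = Q * V * Q' * S * (P * U * P') * R := by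
  calc R * (P * U * P') * S * (Q * V * Q')
      = R * P * U * (P' * S * Q) * V * Q' := by simp only [mul_assoc]
    _ = R * P * (U * Q) * S * (P' * V) * Q' := by rw [h1]; simp only [mul_assoc]
    _ = (R * P * Q) * U * S * V * P' * Q' := by rw [hUQ, ← hVP']; simp only [mul_assoc]
    _ = Q * P * (R * U * S * V) * P' * Q' := by rw [h2]; simp only [mul_assoc]
    _ = Q * P * V * S * U * (R * P' * Q') := by rw [ih]; simp only [mul_assoc]
    _ = Q * (P * V) * S * (U * Q') * P' * R := by rw [h3]; simp only [mul_assoc]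
    _ = Q * V * (P * S * Q') * U * P' * R := by rw [← hVP, hUQ']; simp only [mul_assoc]
    _ = Q * V * Q' * S * (P * U * P') * R := by rw [h4]; simp only [mul_assoc]

/-- The reflection equation for double row operators with auxiliary legs `i` and `j`. -/
theorem reflection_doubleRow (hb : IsXXX b ∨ IsXXZ b) (η ξ : ℂ) {i j : Fin n} (hij : i ≠ j)
    {L : List (Fin n × ℂ)} (hL : (L.map Prod.fst).Nodup) (hi : ∀ s ∈ L, s.1 ≠ i)
    (hj : ∀ s ∈ L, s.1 ≠ j) (x y : ℂ) :
    leg2 i j (Rhat b η (y - x)) * doubleRow b η ξ i L x * leg2 i j (Rhat b η (-x - y)) *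
        doubleRow b η ξ j L y =
      doubleRow b η ξ j L y * leg2 i j (Rhat b η (-x - y)) * doubleRow b η ξ i L x *
        leg2 i j (Rhat b η (y - x)) := by
  induction L with
  | nil => exact reflection_Khat hb η ξ hij x y
  | cons s L ih =>
    obtain ⟨s, t⟩ := s
    simp only [List.map_cons, List.nodup_cons, List.mem_map, not_exists, not_and] at hL
    have hsi : s ≠ i := hi (s, t) (by simp)
    have hsj : s ≠ j := hj (s, t) (by simp)
    have hsL : ∀ r ∈ L, r.1 ≠ s := fun r hr => hL.1 r hr
    have hi' : ∀ r ∈ L, r.1 ≠ i := fun r hr => hi r (by simp [hr])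
    have hj' : ∀ r ∈ L, r.1 ≠ j := fun r hr => hj r (by simp [hr])
    refine reflection_step ?_ ?_ ?_ ?_ ?_ ?_ ?_ ?_ (ih hL.2 hi' hj')
    · exact (leg2_commute_doubleRow η ξ hij.symm hsi hj' hsL _ _).symm
    · exact (leg2_commute_doubleRow η ξ hij.symm hsi hj' hsL _ _).symm
    · exact (leg2_commute_doubleRow η ξ hij hsj hi' hsL _ _).symm
    · exact (leg2_commute_doubleRow η ξ hij hsj hi' hsL _ _).symm
    · rw [Rhat_comm η _ j s]
      exact yangBaxter hb η hsi.symm hij hsj (by ring)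
    · exact yangBaxter hb η hij hsi.symm hsj.symm (by ring)
    · exact yangBaxter hb η hij hsi.symm hsj.symm (by ring)
    · rw [Rhat_comm η _ j s]
      exact yangBaxter hb η hsi.symm hij hsj (by ring)

theorem move_step {G : Type*} [Semigroup G] {A A' B B' U V Y R : G} (hA : A * Y = Y * A)
    (hA' : A' * Y = Y * A') (hV : R * V = V * R) (ih : U * Y = Y * (B * V * B'))
    (h1 : B' * A' * R = R * A' * B') (h2 : A * B * R = R * B * A) :
    A * U * A' * (Y * R) = Y * R * (B * (A * V * A') * B') := by
  calc A * U * A' * (Y * R) = A * U * (A' * Y) * R := by simp only [mul_assoc]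
    _ = A * (U * Y) * A' * R := by rw [hA']; simp only [mul_assoc]
    _ = (A * Y) * B * V * (B' * A' * R) := by rw [ih]; simp only [mul_assoc]
    _ = Y * A * B * (V * R) * A' * B' := by rw [hA, h1]; simp only [mul_assoc]
    _ = Y * (A * B * R) * V * A' * B' := by rw [← hV]; simp only [mul_assoc]
    _ = Y * R * (B * (A * V * A') * B') := by rw [h2]; simp only [mul_assoc]

/-- Moving a site past the sites `P` to the outermost position intertwines double row operators. -/
theorem doubleRow_move (hb : IsXXX b ∨ IsXXZ b) (η ξ : ℂ) {a r : Fin n} (har : a ≠ r) (z : ℂ)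
    {P Q : List (Fin n × ℂ)} (hP : ∀ s ∈ P, s.1 ≠ a ∧ s.1 ≠ r) (hPn : (P.map Prod.fst).Nodup)
    (hQ : ∀ s ∈ Q, s.1 ≠ a ∧ s.1 ≠ r) (hPQ : ∀ s ∈ P, ∀ s' ∈ Q, s.1 ≠ s'.1) (x : ℂ) :
    doubleRow b η ξ a (P ++ (r, z) :: Q) x *
        (P.reverse.map fun s => leg2 r s.1 (Rhat b η (z - s.2))).prod =
      (P.reverse.map fun s => leg2 r s.1 (Rhat b η (z - s.2))).prod *
        doubleRow b η ξ a ((r, z) :: (P ++ Q)) x := by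
  induction P with
  | nil => simp
  | cons s P ih =>
    obtain ⟨s, t⟩ := s
    simp only [List.map_cons, List.nodup_cons, List.mem_map, not_exists, not_and] at hPn
    have hsa : s ≠ a := (hP (s, t) (by simp)).1
    have hsr : s ≠ r := (hP (s, t) (by simp)).2
    have ih := ih (fun s hs => hP s (by simp [hs])) hPn.2
      (fun s hs => hPQ s (by simp [hs]))
    simp only [List.reverse_cons, List.map_append, List.map_cons, List.map_nil, List.prod_append,
      List.prod_cons, List.prod_nil, mul_one, List.cons_append]
    rw [doubleRow_cons, doubleRow_cons, doubleRow_cons]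
    rw [doubleRow_cons] at ih
    set Y := (P.reverse.map fun s => leg2 r s.1 (Rhat b η (z - s.2))).prod with hY
    set U := doubleRow b η ξ a (P ++ (r, z) :: Q) x
    set V := doubleRow b η ξ a (P ++ Q) x with hV
    have hYc : ∀ A, Commute (leg2 a s A) Y := fun A => by
      refine Commute.list_prod_right _ _ fun M hM => ?_
      simp only [List.mem_map, List.mem_reverse] at hM
      obtain ⟨q, hq, rfl⟩ := hM
      exact leg2_commute_leg2 har (hP q (by simp [hq])).1.symm hsr
        (fun h => hPn.1 q hq h.symm) _ _
    have hVc : Commute (leg2 r s (Rhat b η (z - t))) V := by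
      refine leg2_commute_doubleRow η ξ har.symm hsa ?_ ?_ _ _
      · intro q hq
        rcases List.mem_append.1 hq with hq | hq
        · exact (hP q (by simp [hq])).2
        · exact (hQ q hq).2
      · intro q hq
        rcases List.mem_append.1 hq with hq | hq
        · exact hPn.1 q hq
        · exact (hPQ (s, t) (by simp) q hq).symm
    refine move_step (hYc _) (hYc _) hVc ih ?_ ?_
    · exact yangBaxter hb η har hsa.symm hsr.symm (by ring)
    · rw [Rhat_comm η _ r s]
      exact yangBaxter hb η hsa.symm har hsr (by ring)

end Reflection

/-! ### Blocks with respect to the auxiliary leg -/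

section Blocks

variable {b : ℂ → ℂ} {N : ℕ}

/-- The matrix unit `E_{kl}` acting on the leg `r`. -/
def legUnit (r : Fin N) (k l : Fin 2) : Matrix (Fin N → Fin 2) (Fin N → Fin 2) ℂ :=
  leg1 r (Matrix.single k l 1)

theorem legUnit_mul (r : Fin N) (k l m n : Fin 2) :
    legUnit r k l * legUnit r m n = if l = m then legUnit r k n else 0 := by
  rw [legUnit, legUnit, ← leg1_mul]
  split_ifs with h
  · subst h; rw [Matrix.single_mul_single_same, mul_one]; rfl
  · rw [Matrix.single_mul_single_of_ne _ _ _ _ h]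
    ext s s'; simp [leg1]

theorem leg1_eq_sum (r : Fin N) (A : Matrix (Fin 2) (Fin 2) ℂ) :
    leg1 r A = A 0 0 • legUnit r 0 0 + A 0 1 • legUnit r 0 1 + A 1 0 • legUnit r 1 0 +
      A 1 1 • legUnit r 1 1 := by
  simp only [legUnit, ← leg1_smul, ← leg1_add]
  congr 1
  ext i j; fin_cases i <;> fin_cases j <;> simp

theorem legUnit_add (r : Fin N) : legUnit r 0 0 + legUnit r 1 1 = 1 := by
  rw [← leg1_one r, leg1_eq_sum]; simp

/-- The blocks of an operator on `(ℂ²)^{⊗ (N + 1)}` with respect to the auxiliary leg `0`. -/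
def auxBlocks (M : Matrix (Fin (N + 1) → Fin 2) (Fin (N + 1) → Fin 2) ℂ) :
    Matrix (Fin 2) (Fin 2) (Matrix (Fin N → Fin 2) (Fin N → Fin 2) ℂ) :=
  Matrix.of fun k l => Matrix.of fun s s' =>
    M (Fin.cons (α := fun _ => Fin 2) k s) (Fin.cons (α := fun _ => Fin 2) l s')

theorem auxBlocks_mul (M M' : Matrix (Fin (N + 1) → Fin 2) (Fin (N + 1) → Fin 2) ℂ) :
    auxBlocks (M * M') = auxBlocks M * auxBlocks M' := by
  ext k l s s'
  rw [Matrix.mul_apply, Matrix.sum_apply]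
  simp only [auxBlocks, Matrix.mul_apply, Matrix.of_apply]
  rw [← Fintype.sum_prod_type', ← (Fin.consEquiv fun _ : Fin (N + 1) => Fin 2).sum_comp]
  rfl

theorem auxBlocks_one : auxBlocks (1 : Matrix (Fin (N + 1) → Fin 2) (Fin (N + 1) → Fin 2) ℂ) =
    1 := by
  ext k l s s'
  simp only [auxBlocks, Matrix.of_apply, Matrix.one_apply, Fin.cons_inj]
  by_cases h : k = l <;> simp [h, Matrix.one_apply]

theorem auxBlocks_leg1_zero (K : Matrix (Fin 2) (Fin 2) ℂ) :
    auxBlocks (leg1 (0 : Fin (N + 1)) K) = Matrix.of fun k l => K k l • 1 := by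
  ext k l s s'
  have : (∀ i : Fin (N + 1), i ≠ 0 → (Fin.cons k s : Fin (N + 1) → Fin 2) i =
      (Fin.cons l s' : Fin (N + 1) → Fin 2) i) ↔ s = s' := by
    simp [Fin.forall_fin_succ, funext_iff]
  simp only [auxBlocks, leg1, Matrix.of_apply, this, Fin.cons_zero, Matrix.smul_apply,
    Matrix.one_apply, smul_eq_mul, mul_ite, mul_one, mul_zero]

theorem auxBlocks_leg2_succ (i j : Fin N) (A : Matrix (Fin 2 × Fin 2) (Fin 2 × Fin 2) ℂ) :
    auxBlocks (leg2 i.succ j.succ A) = Matrix.of fun k l => if k = l then leg2 i j A else 0 := by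
  ext k l s s'
  have : (∀ m : Fin (N + 1), m ≠ i.succ → m ≠ j.succ → (Fin.cons k s : Fin (N + 1) → Fin 2) m =
      (Fin.cons l s' : Fin (N + 1) → Fin 2) m) ↔
      k = l ∧ ∀ m, m ≠ i → m ≠ j → s m = s' m := by
    rw [Fin.forall_fin_succ]
    simp [(Fin.succ_ne_zero _).symm]
  simp only [auxBlocks, leg2, Matrix.of_apply, this, Fin.cons_succ]
  by_cases h : k = l <;> simp [h]

theorem auxBlocks_leg1_succ (i : Fin N) (A : Matrix (Fin 2) (Fin 2) ℂ) :
    auxBlocks (leg1 i.succ A) = Matrix.of fun k l => if k = l then leg1 i A else 0 := by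
  ext k l s s'
  have : (∀ m : Fin (N + 1), m ≠ i.succ → (Fin.cons k s : Fin (N + 1) → Fin 2) m =
      (Fin.cons l s' : Fin (N + 1) → Fin 2) m) ↔ k = l ∧ ∀ m, m ≠ i → s m = s' m := by
    rw [Fin.forall_fin_succ]
    simp [(Fin.succ_ne_zero _).symm]
  simp only [auxBlocks, leg1, Matrix.of_apply, this, Fin.cons_succ]
  by_cases h : k = l <;> simp [h]

/-- The blocks of the six-vertex matrix acting on the auxiliary leg and on the leg `r`. -/
def sixVertexBlocks (r : Fin N) (a b c : ℂ) :
    Matrix (Fin 2) (Fin 2) (Matrix (Fin N → Fin 2) (Fin N → Fin 2) ℂ) :=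
  !![a • legUnit r 0 0 + b • legUnit r 1 1, c • legUnit r 1 0;
     c • legUnit r 0 1, b • legUnit r 0 0 + a • legUnit r 1 1]

theorem sixVertexBlocks_zero_zero (r : Fin N) (a b c : ℂ) :
    sixVertexBlocks r a b c 0 0 = a • legUnit r 0 0 + b • legUnit r 1 1 := rfl

theorem sixVertexBlocks_zero_one (r : Fin N) (a b c : ℂ) :
    sixVertexBlocks r a b c 0 1 = c • legUnit r 1 0 := rfl

theorem sixVertexBlocks_one_zero (r : Fin N) (a b c : ℂ) :
    sixVertexBlocks r a b c 1 0 = c • legUnit r 0 1 := rfl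

theorem sixVertexBlocks_one_one (r : Fin N) (a b c : ℂ) :
    sixVertexBlocks r a b c 1 1 = b • legUnit r 0 0 + a • legUnit r 1 1 := rfl

theorem auxBlocks_sixVertex (r : Fin N) (a b c : ℂ) :
    auxBlocks (leg2 0 r.succ (sixVertex a b c)) = sixVertexBlocks r a b c := by
  have hl : ∀ A : Matrix (Fin 2 × Fin 2) (Fin 2 × Fin 2) ℂ, auxBlocks (leg2 0 r.succ A) =
      Matrix.of fun k l => leg1 r (Matrix.of fun x y => A (k, x) (l, y)) := by
    intro A
    ext k l s s'
    have : (∀ m : Fin (N + 1), m ≠ 0 → m ≠ r.succ → (Fin.cons k s : Fin (N + 1) → Fin 2) m =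
        (Fin.cons l s' : Fin (N + 1) → Fin 2) m) ↔ ∀ m, m ≠ r → s m = s' m := by
      rw [Fin.forall_fin_succ]; simp
    simp only [auxBlocks, leg1, leg2, Matrix.of_apply, this, Fin.cons_succ, Fin.cons_zero]
  rw [hl]
  refine Matrix.ext fun k l => ?_
  rw [Matrix.of_apply, leg1_eq_sum]
  fin_cases k <;> fin_cases l <;> simp [sixVertexBlocks, sixVertex]

/-- The blocks `A, B, C, D` of the double row operator at `x + η / 2` with sites `L`. -/
def rowBlocks (b : ℂ → ℂ) (η ξ : ℂ) (L : List (Fin N × ℂ)) (x : ℂ) :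
    Matrix (Fin 2) (Fin 2) (Matrix (Fin N → Fin 2) (Fin N → Fin 2) ℂ) :=
  auxBlocks (doubleRow b η ξ 0 (L.map (Prod.map Fin.succ id)) (x + η / 2))

theorem rowBlocks_nil (η ξ x : ℂ) : rowBlocks (N := N) b η ξ [] x =
    !![b (ξ - x - η / 2) • 1, 0; 0, b (ξ + x + η / 2) • 1] := by
  rw [rowBlocks, List.map_nil, doubleRow_nil, auxBlocks_leg1_zero]
  refine Matrix.ext fun k l => ?_
  fin_cases k <;> fin_cases l <;> simp [Khat, sub_sub, add_assoc]

theorem rowBlocks_cons (η ξ x : ℂ) (r : Fin N) (z : ℂ) (L : List (Fin N × ℂ)) :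
    rowBlocks b η ξ ((r, z) :: L) x =
      sixVertexBlocks r (b (z - x + η / 2)) (b (z - x - η / 2)) (b η) * rowBlocks b η ξ L x *
        sixVertexBlocks r (b (-x - z + η / 2)) (b (-x - z - η / 2)) (b η) := by
  rw [rowBlocks, List.map_cons]
  simp only [Prod.map_apply, id]
  rw [doubleRow_cons, auxBlocks_mul, auxBlocks_mul, Rhat, Rhat, auxBlocks_sixVertex,
    auxBlocks_sixVertex, rowBlocks]
  have h1 : z - (x + η / 2) + η = z - x + η / 2 := by ring
  have h2 : z - (x + η / 2) = z - x - η / 2 := by ring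
  have h3 : -(x + η / 2) - z + η = -x - z + η / 2 := by ring
  have h4 : -(x + η / 2) - z = -x - z - η / 2 := by ring
  rw [h1, h2, h3, h4]

/-- The blocks commute with the operators acting on legs that are not among the sites. -/
theorem legUnit_commute_rowBlocks (η ξ x : ℂ) {r : Fin N} {L : List (Fin N × ℂ)}
    (hr : ∀ s ∈ L, s.1 ≠ r) (k l m n : Fin 2) :
    Commute (legUnit r k l) (rowBlocks b η ξ L x m n) := by
  have h : Commute (leg1 r.succ (Matrix.single k l 1))
      (doubleRow b η ξ 0 (L.map (Prod.map Fin.succ id)) (x + η / 2)) := by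
    refine commute_doubleRow η ξ (fun A => leg1_commute_leg1 (Fin.succ_ne_zero _) _ _) ?_ _
    intro s hs A
    obtain ⟨s', hs', rfl⟩ := List.mem_map.1 hs
    refine leg1_commute_leg2 (Fin.succ_ne_zero _) ?_ _ _
    simpa using (hr s' hs').symm
  have h2 := congrFun (congrFun (congrArg auxBlocks h.eq) m) n
  rw [auxBlocks_mul, auxBlocks_mul, auxBlocks_leg1_succ] at h2
  have h3 : (Matrix.of fun k' l' : Fin 2 => if k' = l' then leg1 r (Matrix.single k l 1) else 0) =
      Matrix.diagonal fun _ => leg1 r (Matrix.single k l 1) := by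
    ext i j : 2; simp [Matrix.diagonal_apply]
  rw [h3, Matrix.diagonal_mul, Matrix.mul_diagonal] at h2
  exact h2

end Blocks

/-! ### Exchange relations of the blocks -/

section Exchange

variable {b : ℂ → ℂ} {N : ℕ}

theorem leg2_add {n : ℕ} (i j : Fin n) (A B : Matrix (Fin 2 × Fin 2) (Fin 2 × Fin 2) ℂ) :
    leg2 i j (A + B) = leg2 i j A + leg2 i j B := by
  ext s s'; simp only [leg2, Matrix.of_apply, Matrix.add_apply]; split_ifs <;> simp

theorem leg2_sixVertex_eq {r s : Fin N} (hrs : r ≠ s) (a b c : ℂ) :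
    leg2 r s (sixVertex a b c) = ∑ k, ∑ l, legUnit r k l * sixVertexBlocks s a b c k l := by
  simp only [Fin.sum_univ_two, sixVertexBlocks, Matrix.of_apply, Matrix.cons_val_zero,
    Matrix.cons_val_one, legUnit, ← leg1_smul, ← leg1_add]
  simp only [leg1_eq_leg2_left hrs, leg1_eq_leg2_right hrs, ← leg2_mul hrs, ← leg2_add]
  congr 1
  ext ⟨p1, p2⟩ ⟨q1, q2⟩
  simp only [Matrix.add_apply, Matrix.mul_apply, Fintype.sum_prod_type, Fin.sum_univ_two,
    sixVertex, Matrix.of_apply]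
  fin_cases p1 <;> fin_cases p2 <;> fin_cases q1 <;> fin_cases q2 <;> simp

/-- A double row operator whose auxiliary leg `r` is one of the `N` legs is assembled from the
blocks. -/
theorem doubleRow_eq_sum (η ξ : ℂ) {r : Fin N} {L : List (Fin N × ℂ)} (hr : ∀ s ∈ L, s.1 ≠ r)
    (x : ℂ) : doubleRow b η ξ r L (x + η / 2) =
      ∑ k, ∑ l, legUnit r k l * rowBlocks b η ξ L x k l := by
  induction L with
  | nil =>
    rw [doubleRow_nil, leg1_eq_sum, rowBlocks_nil]
    simp [Fin.sum_univ_two, Khat, sub_sub, add_assoc]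
  | cons s L ih =>
    obtain ⟨s, t⟩ := s
    have hsr : r ≠ s := (hr (s, t) (by simp)).symm
    have hr' : ∀ s ∈ L, s.1 ≠ r := fun q hq => hr q (by simp [hq])
    rw [doubleRow_cons, ih hr', rowBlocks_cons, Rhat, Rhat, leg2_sixVertex_eq hsr,
      leg2_sixVertex_eq hsr]
    have h1 : t - (x + η / 2) + η = t - x + η / 2 := by ring
    have h2 : t - (x + η / 2) = t - x - η / 2 := by ring
    have h3 : -(x + η / 2) - t + η = -x - t + η / 2 := by ring
    have h4 : -(x + η / 2) - t = -x - t - η / 2 := by ring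
    rw [h1, h2, h3, h4]
    have hS : ∀ (a b c : ℂ) (k l m n : Fin 2), sixVertexBlocks s a b c m n * legUnit r k l =
        legUnit r k l * sixVertexBlocks s a b c m n := by
      intro a b c k l m n
      have : ∀ k' l', legUnit s k' l' * legUnit r k l = legUnit r k l * legUnit s k' l' :=
        fun k' l' => leg1_commute_leg1 hsr.symm _ _
      fin_cases m <;> fin_cases n <;> simp [sixVertexBlocks, add_mul, mul_add, this]
    have hU : ∀ (k l m n : Fin 2), rowBlocks b η ξ L x m n * legUnit r k l =
        legUnit r k l * rowBlocks b η ξ L x m n :=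
      fun k l m n => (legUnit_commute_rowBlocks η ξ x hr' k l m n).eq.symm
    have hS' : ∀ (a b c : ℂ) (k l m n : Fin 2) X, sixVertexBlocks s a b c m n *
        (legUnit r k l * X) = legUnit r k l * (sixVertexBlocks s a b c m n * X) := by
      intro a b c k l m n X; rw [← mul_assoc, hS, mul_assoc]
    have hU' : ∀ (k l m n : Fin 2) X, rowBlocks b η ξ L x m n * (legUnit r k l * X) =
        legUnit r k l * (rowBlocks b η ξ L x m n * X) := by
      intro k l m n X; rw [← mul_assoc, hU, mul_assoc]
    have hE : ∀ (k l m n : Fin 2) X, legUnit r k l * (legUnit r m n * X) =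
        if l = m then legUnit r k n * X else 0 := by
      intro k l m n X; rw [← mul_assoc, legUnit_mul]; split_ifs <;> simp
    simp only [Fin.sum_univ_two, Matrix.mul_apply, add_mul, mul_add, mul_assoc, hS', hU', hE,
      one_ne_zero, zero_ne_one, if_true, if_false, add_zero, zero_add]
    abel

theorem auxBlocks_doubleRow_succ (η ξ : ℂ) (r : Fin N) (L : List (Fin N × ℂ)) (x : ℂ) :
    auxBlocks (doubleRow b η ξ r.succ (L.map (Prod.map Fin.succ id)) x) =
      Matrix.diagonal fun _ => doubleRow b η ξ r L x := by
  have h : ∀ M : Matrix (Fin N → Fin 2) (Fin N → Fin 2) ℂ,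
      (Matrix.of fun k l : Fin 2 => if k = l then M else 0) = Matrix.diagonal fun _ => M := by
    intro M; ext i j : 2; simp [Matrix.diagonal_apply]
  induction L with
  | nil => rw [List.map_nil, doubleRow_nil, auxBlocks_leg1_succ, h]; rfl
  | cons s L ih =>
    rw [List.map_cons]
    simp only [Prod.map_apply', id]
    rw [doubleRow_cons, auxBlocks_mul, auxBlocks_mul, ih, auxBlocks_leg2_succ, auxBlocks_leg2_succ,
      h, h, Matrix.diagonal_mul_diagonal, Matrix.diagonal_mul_diagonal]
    rfl

/-- The reflection equation in terms of the blocks with respect to the auxiliary leg. -/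
theorem reflection_rowBlocks (hb : IsXXX b ∨ IsXXZ b) (η ξ : ℂ) {r : Fin N}
    {L : List (Fin N × ℂ)} (hL : (L.map Prod.fst).Nodup) (hr : ∀ s ∈ L, s.1 ≠ r) (x y : ℂ) :
    sixVertexBlocks r (b (y - x + η)) (b (y - x)) (b η) * rowBlocks b η ξ L x *
        sixVertexBlocks r (b (-x - y)) (b (-x - y - η)) (b η) *
        Matrix.diagonal (fun _ => doubleRow b η ξ r L (y + η / 2)) =
      Matrix.diagonal (fun _ => doubleRow b η ξ r L (y + η / 2)) *
        sixVertexBlocks r (b (-x - y)) (b (-x - y - η)) (b η) * rowBlocks b η ξ L x *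
        sixVertexBlocks r (b (y - x + η)) (b (y - x)) (b η) := by
  have h := reflection_doubleRow hb η ξ (i := (0 : Fin (N + 1))) (j := r.succ)
    (L := L.map (Prod.map Fin.succ id)) (Fin.succ_ne_zero r).symm ?_ ?_ ?_ (x + η / 2) (y + η / 2)
  · have h := congrArg auxBlocks h
    have h2 : y + η / 2 - (x + η / 2) = y - x := by ring
    have h3 : -(x + η / 2) - (y + η / 2) + η = -x - y := by ring
    have h4 : -(x + η / 2) - (y + η / 2) = -x - y - η := by ring
    simp only [auxBlocks_mul, auxBlocks_doubleRow_succ, Rhat, auxBlocks_sixVertex] at h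
    rw [h2, h3, h4] at h
    exact h
  · rw [List.map_map]
    have : (Prod.fst ∘ Prod.map Fin.succ id : Fin N × ℂ → Fin (N + 1)) = Fin.succ ∘ Prod.fst := rfl
    rw [this, ← List.map_map]
    exact hL.map (Fin.succ_injective N)
  · intro s hs
    obtain ⟨q, -, rfl⟩ := List.mem_map.1 hs
    exact Fin.succ_ne_zero _
  · intro s hs
    obtain ⟨q, hq, rfl⟩ := List.mem_map.1 hs
    simpa using hr q hq

theorem eq_zero_of_legUnit_mul {r : Fin N} {X : Matrix (Fin N → Fin 2) (Fin N → Fin 2) ℂ}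
    (hX : ∀ k l, Commute (legUnit r k l) X) (h : legUnit r 0 1 * X = 0) : X = 0 := by
  have h1 : legUnit r 1 1 * X = 0 := by
    have : legUnit r 1 1 = legUnit r 1 0 * legUnit r 0 1 := by simp [legUnit_mul]
    rw [this, mul_assoc, h, mul_zero]
  have h0 : legUnit r 0 0 * X = 0 := by
    have : legUnit r 0 0 = legUnit r 0 1 * legUnit r 1 0 := by simp [legUnit_mul]
    rw [this, mul_assoc, (hX 1 0).eq, ← mul_assoc, h, zero_mul]
  rw [← one_mul X, ← legUnit_add r, add_mul, h0, h1, add_zero]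

/-- The consequences of the reflection equation for the blocks `A`, `B`, `D`, before the
denominators are cleared. -/
theorem exchange_of_reflection {r : Fin N} {a₁ b₁ a₂ b₂ c : ℂ}
    {U V : Matrix (Fin 2) (Fin 2) (Matrix (Fin N → Fin 2) (Fin N → Fin 2) ℂ)}
    (hU : ∀ k l m n, Commute (legUnit r k l) (U m n))
    (hV : ∀ k l m n, Commute (legUnit r k l) (V m n))
    (h : sixVertexBlocks r a₁ b₁ c * U * sixVertexBlocks r a₂ b₂ c *
        Matrix.diagonal (fun _ => ∑ k, ∑ l, legUnit r k l * V k l) =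
      Matrix.diagonal (fun _ => ∑ k, ∑ l, legUnit r k l * V k l) *
        sixVertexBlocks r a₂ b₂ c * U * sixVertexBlocks r a₁ b₁ c) :
    (a₁ * b₂) • (U 0 1 * V 0 1) = (a₁ * b₂) • (V 0 1 * U 0 1) ∧
    a₁ • (a₂ • (U 0 0 * V 0 1) + c • (U 0 1 * V 1 1)) =
      (b₁ * b₂) • (V 0 1 * U 0 0) + c • (a₂ • (V 0 0 * U 0 1) + c • (V 0 1 * U 1 1)) := by
  have hU1 : ∀ k l m n, U m n * legUnit r k l = legUnit r k l * U m n :=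
    fun k l m n => (hU k l m n).eq.symm
  have hV1 : ∀ k l m n, V m n * legUnit r k l = legUnit r k l * V m n :=
    fun k l m n => (hV k l m n).eq.symm
  have hU2 : ∀ k l m n X, U m n * (legUnit r k l * X) = legUnit r k l * (U m n * X) := by
    intro k l m n X; rw [← mul_assoc, hU1, mul_assoc]
  have hV2 : ∀ k l m n X, V m n * (legUnit r k l * X) = legUnit r k l * (V m n * X) := by
    intro k l m n X; rw [← mul_assoc, hV1, mul_assoc]
  have hE : ∀ (k l m n : Fin 2) X, legUnit r k l * (legUnit r m n * X) =
      if l = m then legUnit r k n * X else 0 := by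
    intro k l m n X; rw [← mul_assoc, legUnit_mul]; split_ifs <;> simp
  constructor
  · have h01 := congrArg (fun X => legUnit r 0 0 * X 0 1 * legUnit r 1 1) h
    simp only [Matrix.mul_apply, Fin.sum_univ_two, sixVertexBlocks_zero_zero,
      sixVertexBlocks_zero_one, sixVertexBlocks_one_zero, sixVertexBlocks_one_one,
      Matrix.diagonal_apply, if_true, if_false, add_mul, mul_add, mul_assoc, hU2, hV2, hE, hU1, hV1,
      smul_smul, smul_mul_assoc, mul_smul_comm, one_ne_zero, zero_ne_one, smul_zero,
      zero_mul, mul_zero, add_zero, zero_add] at h01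
    rw [← sub_eq_zero]
    refine eq_zero_of_legUnit_mul (r := r) (fun k l => ?_) ?_
    · exact (((hU _ _ _ _).mul_right (hV _ _ _ _)).smul_right _).sub_right
        (((hV _ _ _ _).mul_right (hU _ _ _ _)).smul_right _)
    · simp only [mul_sub, mul_smul_comm]
      linear_combination (norm := module) h01
  · have h00 := congrArg (fun X => legUnit r 0 0 * X 0 0 * legUnit r 1 1) h
    simp only [Matrix.mul_apply, Fin.sum_univ_two, sixVertexBlocks_zero_zero,
      sixVertexBlocks_zero_one, sixVertexBlocks_one_zero, sixVertexBlocks_one_one,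
      Matrix.diagonal_apply, if_true, if_false, add_mul, mul_add, mul_assoc, hU2, hV2, hE, hU1, hV1,
      smul_smul, smul_mul_assoc, mul_smul_comm, one_ne_zero, zero_ne_one, smul_zero,
      zero_mul, mul_zero, add_zero, zero_add] at h00
    rw [← sub_eq_zero]
    refine eq_zero_of_legUnit_mul (r := r) (fun k l => ?_) ?_
    · have hUV : ∀ i j m n, Commute (legUnit r k l) (U i j * V m n) :=
        fun i j m n => (hU _ _ _ _).mul_right (hV _ _ _ _)
      have hVU : ∀ i j m n, Commute (legUnit r k l) (V i j * U m n) :=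
        fun i j m n => (hV _ _ _ _).mul_right (hU _ _ _ _)
      exact ((((hUV _ _ _ _).smul_right _).add_right ((hUV _ _ _ _).smul_right _)).smul_right
        _).sub_right (((hVU _ _ _ _).smul_right _).add_right ((((hVU _ _ _ _).smul_right
          _).add_right ((hVU _ _ _ _).smul_right _)).smul_right _))
    · simp only [mul_sub, mul_add, mul_smul_comm, smul_add, smul_smul]
      linear_combination (norm := module) h00

end Exchange

/-! ### Generic arguments -/

section Generic

variable {b : ℂ → ℂ}

theorem b_not_identically_zero (hb : IsXXX b ∨ IsXXZ b) : ∃ x, b x ≠ 0 := by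
  rcases hb with ⟨c, hc, h⟩ | ⟨c, ν, hc, hν, h⟩
  · exact ⟨1, by simpa [h] using hc⟩
  · refine ⟨(Real.pi / 2 * Complex.I) / ν, ?_⟩
    rw [h, mul_div_cancel₀ _ hν, Complex.sinh_mul_I]
    simpa using hc

/-- The zeros of `b` are isolated. -/
theorem eventually_b_ne_zero (hb : IsXXX b ∨ IsXXZ b) (α c x₀ : ℂ) (hα : α ≠ 0) :
    ∀ᶠ x in 𝓝[≠] x₀, b (α * x + c) ≠ 0 := by
  have hd : Differentiable ℂ fun x => b (α * x + c) :=
    (b_differentiable hb).comp (by fun_prop)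
  rcases (hd.analyticAt x₀).eventually_eq_zero_or_eventually_ne_zero with h | h
  · exfalso
    obtain ⟨x, hx⟩ := b_not_identically_zero hb
    have := AnalyticOnNhd.eq_of_eventuallyEq (f := fun x => b (α * x + c)) (g := fun _ => 0)
      (fun z _ => hd.analyticAt z) (fun z _ => analyticAt_const) h
    refine hx ?_
    have h2 := congrFun this ((x - c) / α)
    simpa [mul_div_cancel₀ _ hα] using h2
  · exact h

theorem eq_of_eventually_eq_punctured {X : Type*} [TopologicalSpace X] [T2Space X] {f g : ℂ → X}
    {x₀ : ℂ} (hf : ContinuousAt f x₀) (hg : ContinuousAt g x₀) (h : ∀ᶠ x in 𝓝[≠] x₀, f x = g x) :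
    f x₀ = g x₀ :=
  tendsto_nhds_unique (hf.tendsto.mono_left nhdsWithin_le_nhds)
    ((hg.tendsto.mono_left nhdsWithin_le_nhds).congr' (h.mono fun _ hx => hx.symm))

end Generic

/-! ### Crossing symmetry and the creation operators -/

section Creation

variable {b : ℂ → ℂ} {N : ℕ}

/-- The blocks of a double row operator in terms of those with the outermost site removed. -/
theorem rowBlocks_cons_apply (η ξ x : ℂ) {r : Fin N} (z : ℂ) {L : List (Fin N × ℂ)}
    (hr : ∀ s ∈ L, s.1 ≠ r) {au bu aw bw : ℂ} (hau : au = b (z - x + η / 2))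
    (hbu : bu = b (z - x - η / 2)) (haw : aw = b (-x - z + η / 2))
    (hbw : bw = b (-x - z - η / 2)) :
    let U := rowBlocks b η ξ L x
    let V := rowBlocks b η ξ ((r, z) :: L) x
    let E := legUnit r
    V 0 0 = (au * aw) • (E 0 0 * U 0 0) + (bu * bw) • (E 1 1 * U 0 0) +
      (au * b η) • (E 0 1 * U 0 1) + (b η * aw) • (E 1 0 * U 1 0) +
        (b η * b η) • (E 1 1 * U 1 1) ∧
    V 0 1 = (b η * bu) • (E 1 0 * U 0 0) + (au * bw) • (E 0 0 * U 0 1) +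
      (bu * aw) • (E 1 1 * U 0 1) + (b η * bw) • (E 1 0 * U 1 1) ∧
    V 1 0 = (b η * bw) • (E 0 1 * U 0 0) + (bu * aw) • (E 0 0 * U 1 0) +
      (au * bw) • (E 1 1 * U 1 0) + (bu * b η) • (E 0 1 * U 1 1) ∧
    V 1 1 = (b η * b η) • (E 0 0 * U 0 0) + (b η * aw) • (E 0 1 * U 0 1) +
      (au * b η) • (E 1 0 * U 1 0) + (bu * bw) • (E 0 0 * U 1 1) +
        (au * aw) • (E 1 1 * U 1 1) := by
  intro U V E
  have hU1 : ∀ k l m n, U m n * E k l = E k l * U m n :=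
    fun k l m n => (legUnit_commute_rowBlocks η ξ x hr k l m n).eq.symm
  have hE : ∀ (k l m n : Fin 2) X, E k l * (E m n * X) =
      if l = m then E k n * X else 0 := by
    intro k l m n X; rw [← mul_assoc, legUnit_mul]; split_ifs <;> simp [E]
  have hV : V = sixVertexBlocks r au bu (b η) * U * sixVertexBlocks r aw bw (b η) := by
    rw [hau, hbu, haw, hbw]; exact rowBlocks_cons η ξ x r z L
  rw [hV]
  refine ⟨?_, ?_, ?_, ?_⟩ <;>
  · simp only [Matrix.mul_apply, Fin.sum_univ_two, sixVertexBlocks_zero_zero,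
      sixVertexBlocks_zero_one, sixVertexBlocks_one_zero, sixVertexBlocks_one_one,
      add_mul, mul_add, mul_assoc, smul_mul_assoc, mul_smul_comm]
    simp only [show legUnit r = E from rfl, hU1, hE, if_true, if_false, one_ne_zero,
      zero_ne_one, smul_zero, add_zero, zero_add]
    module

/-- Crossing symmetry: the blocks at `-x` in terms of those at `x`. -/
theorem rowBlocks_neg (hb : IsXXX b ∨ IsXXZ b) (η ξ x : ℂ) {L : List (Fin N × ℂ)}
    (hL : (L.map Prod.fst).Nodup) :
    b (2 * x + η) • rowBlocks b η ξ L (-x) 0 0 =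
      b (2 * x) • rowBlocks b η ξ L x 1 1 + b η • rowBlocks b η ξ L x 0 0 ∧
    b (2 * x + η) • rowBlocks b η ξ L (-x) 0 1 = b (η - 2 * x) • rowBlocks b η ξ L x 0 1 ∧
    b (2 * x + η) • rowBlocks b η ξ L (-x) 1 0 = b (η - 2 * x) • rowBlocks b η ξ L x 1 0 ∧
    b (2 * x + η) • rowBlocks b η ξ L (-x) 1 1 =
      b (2 * x) • rowBlocks b η ξ L x 0 0 + b η • rowBlocks b η ξ L x 1 1 := by
  induction L with
  | nil =>
    have h1 : b (2 * x + η) * b (ξ - -x - η / 2) =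
        b (2 * x) * b (ξ + x + η / 2) + b η * b (ξ - x - η / 2) := by
      rcases hb with ⟨c, -, h⟩ | ⟨c, ν, -, -, h⟩
      · simp only [h]; ring
      · obtain ⟨η', rfl⟩ : ∃ η', η = 2 * η' := ⟨η / 2, by ring⟩
        simp only [mul_div_cancel_left₀ _ (two_ne_zero' ℂ)]
        simp only [h, Complex.sinh, two_mul, mul_add, mul_sub, neg_add, neg_sub, Complex.exp_add,
          Complex.exp_sub, Complex.exp_neg, mul_neg]
        field_simp
        ring
    have h2 : b (2 * x + η) * b (ξ + -x + η / 2) =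
        b (2 * x) * b (ξ - x - η / 2) + b η * b (ξ + x + η / 2) := by
      rcases hb with ⟨c, -, h⟩ | ⟨c, ν, -, -, h⟩
      · simp only [h]; ring
      · obtain ⟨η', rfl⟩ : ∃ η', η = 2 * η' := ⟨η / 2, by ring⟩
        simp only [mul_div_cancel_left₀ _ (two_ne_zero' ℂ)]
        simp only [h, Complex.sinh, two_mul, mul_add, mul_sub, neg_add, neg_sub, Complex.exp_add,
          Complex.exp_sub, Complex.exp_neg, mul_neg]
        field_simp
        ring
    simp only [rowBlocks_nil, Matrix.of_apply, Matrix.cons_val_zero, Matrix.cons_val_one,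
      smul_smul, h1, h2, smul_zero, true_and]
    exact ⟨add_smul _ _ _, add_smul _ _ _⟩
  | cons s L ih =>
    obtain ⟨r, z⟩ := s
    simp only [List.map_cons, List.nodup_cons, List.mem_map, not_exists, not_and] at hL
    have hr : ∀ s ∈ L, s.1 ≠ r := fun s hs => hL.1 s hs
    obtain ⟨iA, iB, iC, iD⟩ := ih hL.2
    generalize hau : b (z - x + η / 2) = au
    generalize hbu : b (z - x - η / 2) = bu
    generalize haw : b (-x - z + η / 2) = aw
    generalize hbw : b (-x - z - η / 2) = bw
    have hau' : -bw = b (z - -x + η / 2) := by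
      rw [← hbw, ← b_neg hb]; congr 1; ring
    have hbu' : -aw = b (z - -x - η / 2) := by
      rw [← haw, ← b_neg hb]; congr 1; ring
    have haw' : -bu = b (- -x - z + η / 2) := by
      rw [← hbu, ← b_neg hb]; congr 1; ring
    have hbw' : -au = b (- -x - z - η / 2) := by
      rw [← hau, ← b_neg hb]; congr 1; ring
    obtain ⟨pA, pB, pC, pD⟩ := rowBlocks_cons_apply (b := b) η ξ x z hr hau.symm hbu.symm haw.symm
      hbw.symm
    obtain ⟨qA, qB, qC, qD⟩ := rowBlocks_cons_apply (b := b) η ξ (-x) z hr hau' hbu' haw' hbw'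
    have hT : bu * bw = b (2 * x) * b η + au * aw ∧
        -(bw * b (η - 2 * x)) = b (2 * x) * aw + b η * au ∧
        -(bu * b (η - 2 * x)) = b (2 * x) * au + b η * aw := by
      rw [← hau, ← hbu, ← haw, ← hbw]
      rcases hb with ⟨c, -, h⟩ | ⟨c, ν, -, -, h⟩
      · simp only [h]; refine ⟨?_, ?_, ?_⟩ <;> ring
      · obtain ⟨η', rfl⟩ : ∃ η', η = 2 * η' := ⟨η / 2, by ring⟩
        simp only [mul_div_cancel_left₀ _ (two_ne_zero' ℂ)]
        simp only [h, Complex.sinh, two_mul, mul_add, mul_sub, neg_add, neg_sub, Complex.exp_add,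
          Complex.exp_sub, Complex.exp_neg, mul_neg]
        refine ⟨?_, ?_, ?_⟩ <;> (field_simp; ring)
    obtain ⟨hT1, hT2, hT3⟩ := hT
    have mE : ∀ (k l : Fin 2) {X Y : Matrix (Fin N → Fin 2) (Fin N → Fin 2) ℂ}, X = Y →
        legUnit r k l * X = legUnit r k l * Y := fun k l X Y h => by rw [h]
    have eA := fun k l => mE k l iA
    have eB := fun k l => mE k l iB
    have eC := fun k l => mE k l iC
    have eD := fun k l => mE k l iD
    simp only [mul_add, mul_smul_comm] at eA eB eC eD
    refine ⟨?_, ?_, ?_, ?_⟩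
    · rw [qA, pA, pD]
      linear_combination (norm := module) (bu * bw) • eA 0 0 + (au * aw) • eA 1 1 -
        (bw * b η) • eB 0 1 - (b η * bu) • eC 1 0 + (b η * b η) • eD 1 1 +
        (b η * hT1) • (legUnit r 0 0 * rowBlocks b η ξ L x 0 0) -
        (b η * hT1) • (legUnit r 1 1 * rowBlocks b η ξ L x 0 0) +
        (b η * hT2) • (legUnit r 0 1 * rowBlocks b η ξ L x 0 1) +
        (b η * hT3) • (legUnit r 1 0 * rowBlocks b η ξ L x 1 0)
    · rw [qB, pB]
      linear_combination (norm := module) (-(b η * aw)) • eA 1 0 + (bw * au) • eB 0 0 +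
        (aw * bu) • eB 1 1 - (b η * au) • eD 1 0 +
        (b η * hT3) • (legUnit r 1 0 * rowBlocks b η ξ L x 0 0) +
        (b η * hT2) • (legUnit r 1 0 * rowBlocks b η ξ L x 1 1)
    · rw [qC, pC]
      linear_combination (norm := module) (-(b η * au)) • eA 0 1 + (aw * bu) • eC 0 0 +
        (bw * au) • eC 1 1 - (b η * aw) • eD 0 1 +
        (b η * hT2) • (legUnit r 0 1 * rowBlocks b η ξ L x 0 0) +
        (b η * hT3) • (legUnit r 0 1 * rowBlocks b η ξ L x 1 1)
    · rw [qD, pA, pD]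
      linear_combination (norm := module) (b η * b η) • eA 0 0 - (b η * bu) • eB 0 1 -
        (bw * b η) • eC 1 0 + (aw * au) • eD 0 0 + (bw * bu) • eD 1 1 -
        (b η * hT1) • (legUnit r 0 0 * rowBlocks b η ξ L x 1 1) +
        (b η * hT1) • (legUnit r 1 1 * rowBlocks b η ξ L x 1 1) +
        (b η * hT3) • (legUnit r 0 1 * rowBlocks b η ξ L x 0 1) +
        (b η * hT2) • (legUnit r 1 0 * rowBlocks b η ξ L x 1 0)

theorem continuous_rowBlocks (hb : IsXXX b ∨ IsXXZ b) (η ξ : ℂ) (L : List (Fin N × ℂ))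
    (k l : Fin 2) : Continuous fun x => rowBlocks b η ξ L x k l := by
  have hc := b_continuous hb
  induction L generalizing k l with
  | nil =>
    simp only [rowBlocks_nil]
    fin_cases k <;> fin_cases l <;> simp <;> fun_prop
  | cons s L ih =>
    obtain ⟨r, z⟩ := s
    simp only [rowBlocks_cons, Matrix.mul_apply]
    have h6 : ∀ (u v : ℂ → ℂ), Continuous u → Continuous v → ∀ k l : Fin 2,
        Continuous fun x => sixVertexBlocks r (u x) (v x) (b η) k l := by
      intro u v hu hv k l
      fin_cases k <;> fin_cases l <;> simp [sixVertexBlocks] <;> fun_prop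
    refine continuous_finsetSum _ fun i _ => ?_
    refine Continuous.matrix_mul (continuous_finsetSum _ fun j _ => ?_) ?_
    · exact (h6 _ _ (by fun_prop) (by fun_prop) _ _).matrix_mul (ih _ _)
    · exact h6 _ _ (by fun_prop) (by fun_prop) _ _

/-- The block `B` of the double row operator with the factor `b (2x + η) / b (2x)` removed. It is
entire in the spectral parameter. -/
def creation (b : ℂ → ℂ) (η ξ : ℂ) :
    List (Fin N × ℂ) → ℂ → Matrix (Fin N → Fin 2) (Fin N → Fin 2) ℂ
  | [], _ => 0
  | (r, z) :: L, x =>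
    ((b (z - x + η / 2) * b (-x - z - η / 2)) • legUnit r 0 0 +
      (b (z - x - η / 2) * b (-x - z + η / 2)) • legUnit r 1 1) * creation b η ξ L x +
    b η • (legUnit r 1 0 * (b (z - x + η / 2) • rowBlocks b η ξ L x 0 0 +
      b (-x - z - η / 2) • rowBlocks b η ξ L (-x) 0 0))

theorem creation_cons (η ξ x z : ℂ) (r : Fin N) (L : List (Fin N × ℂ)) :
    creation b η ξ ((r, z) :: L) x =
      ((b (z - x + η / 2) * b (-x - z - η / 2)) • legUnit r 0 0 +
        (b (z - x - η / 2) * b (-x - z + η / 2)) • legUnit r 1 1) * creation b η ξ L x +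
      b η • (legUnit r 1 0 * (b (z - x + η / 2) • rowBlocks b η ξ L x 0 0 +
        b (-x - z - η / 2) • rowBlocks b η ξ L (-x) 0 0)) := rfl

theorem smul_creation (hb : IsXXX b ∨ IsXXZ b) (η ξ x : ℂ) {L : List (Fin N × ℂ)}
    (hL : (L.map Prod.fst).Nodup) :
    b (2 * x + η) • creation b η ξ L x = b (2 * x) • rowBlocks b η ξ L x 0 1 := by
  induction L with
  | nil => simp [creation, rowBlocks_nil]
  | cons s L ih =>
    obtain ⟨r, z⟩ := s
    simp only [List.map_cons, List.nodup_cons, List.mem_map, not_exists, not_and] at hL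
    have hr : ∀ s ∈ L, s.1 ≠ r := fun s hs => hL.1 s hs
    have i0 := ih hL.2
    have i1 := (rowBlocks_neg hb η ξ x hL.2).1
    rw [creation_cons, (rowBlocks_cons_apply (b := b) η ξ x z hr rfl rfl rfl rfl).2.1]
    have hT : b (2 * x) * b (z - x - η / 2) = b (2 * x + η) * b (z - x + η / 2) +
        b η * b (-x - z - η / 2) := by
      rcases hb with ⟨c, -, h⟩ | ⟨c, ν, -, -, h⟩
      · simp only [h]; ring
      · obtain ⟨η', rfl⟩ : ∃ η', η = 2 * η' := ⟨η / 2, by ring⟩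
        simp only [mul_div_cancel_left₀ _ (two_ne_zero' ℂ)]
        simp only [h, Complex.sinh, two_mul, mul_add, mul_sub, neg_add, neg_sub, Complex.exp_add,
          Complex.exp_sub, Complex.exp_neg, mul_neg]
        field_simp
        ring
    have e0 := fun k l => congrArg (legUnit r k l * ·) i0
    have e1 := fun k l => congrArg (legUnit r k l * ·) i1
    simp only [mul_add, mul_smul_comm] at e0 e1
    simp only [add_mul, mul_add, smul_mul_assoc, mul_smul_comm]
    linear_combination (norm := module)
      (b (z - x + η / 2) * b (-x - z - η / 2)) • e0 0 0 +
      (b (z - x - η / 2) * b (-x - z + η / 2)) • e0 1 1 +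
      (b η * b (-x - z - η / 2)) • e1 1 0 - (b η * hT) • (legUnit r 1 0 * rowBlocks b η ξ L x 0 0)

theorem creation_neg (hb : IsXXX b ∨ IsXXZ b) (η ξ x : ℂ) (L : List (Fin N × ℂ)) :
    creation b η ξ L (-x) = -creation b η ξ L x := by
  induction L with
  | nil => simp [creation]
  | cons s L ih =>
    obtain ⟨r, z⟩ := s
    rw [creation_cons, creation_cons, ih, neg_neg]
    have h1 : b (z - -x + η / 2) = -b (-x - z - η / 2) := by rw [← b_neg hb]; congr 1; ring
    have h2 : b (x - z - η / 2) = -b (z - x + η / 2) := by rw [← b_neg hb]; congr 1; ring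
    have h3 : b (z - -x - η / 2) = -b (-x - z + η / 2) := by rw [← b_neg hb]; congr 1; ring
    have h4 : b (x - z + η / 2) = -b (z - x - η / 2) := by rw [← b_neg hb]; congr 1; ring
    rw [h1, h2, h3, h4]
    simp only [add_mul, mul_add, smul_mul_assoc, mul_smul_comm, mul_neg]
    module

theorem continuous_creation (hb : IsXXX b ∨ IsXXZ b) (η ξ : ℂ) (L : List (Fin N × ℂ)) :
    Continuous fun x => creation b η ξ L x := by
  have hc := b_continuous hb
  induction L with
  | nil => exact continuous_const
  | cons s L ih =>
    obtain ⟨r, z⟩ := s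
    simp only [creation_cons]
    have h0 := continuous_rowBlocks hb η ξ L 0 0
    have h1 : Continuous fun x => rowBlocks b η ξ L (-x) 0 0 := h0.comp continuous_neg
    have h2 : Continuous fun x => (b (z - x + η / 2) * b (-x - z - η / 2)) • legUnit r 0 0 +
        (b (z - x - η / 2) * b (-x - z + η / 2)) • legUnit r 1 1 := by fun_prop
    have h3 : Continuous fun x => b (z - x + η / 2) • rowBlocks b η ξ L x 0 0 +
        b (-x - z - η / 2) • rowBlocks b η ξ L (-x) 0 0 := by fun_prop
    have h4 : Continuous fun _ : ℂ => legUnit r 1 0 := continuous_const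
    have h5 := h4.matrix_mul h3
    have h6 := h2.matrix_mul ih
    fun_prop

theorem legUnit_commute_creation (η ξ x : ℂ) {r : Fin N} {L : List (Fin N × ℂ)}
    (hr : ∀ s ∈ L, s.1 ≠ r) (k l : Fin 2) :
    Commute (legUnit r k l) (creation b η ξ L x) := by
  induction L with
  | nil => exact Commute.zero_right _
  | cons s L ih =>
    obtain ⟨s, z⟩ := s
    have hsr : r ≠ s := (hr (s, z) (by simp)).symm
    have hr' : ∀ s ∈ L, s.1 ≠ r := fun q hq => hr q (by simp [hq])
    have hE : ∀ m n, Commute (legUnit r k l) (legUnit s m n) :=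
      fun m n => leg1_commute_leg1 hsr _ _
    have hU : ∀ x, Commute (legUnit r k l) (rowBlocks b η ξ L x 0 0) :=
      fun x => legUnit_commute_rowBlocks η ξ x hr' k l 0 0
    exact ((((hE _ _).smul_right _).add_right ((hE _ _).smul_right _)).mul_right (ih hr')).add_right
      (((hE _ _).mul_right (((hU _).smul_right _).add_right ((hU _).smul_right _))).smul_right _)

theorem eventually_b_two_mul_ne_zero (hb : IsXXX b ∨ IsXXZ b) (c x₀ : ℂ) :
    ∀ᶠ x in 𝓝[≠] x₀, b (2 * x + c) ≠ 0 :=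
  eventually_b_ne_zero hb 2 c x₀ two_ne_zero

/-- An operator that intertwines the blocks `B` intertwines the creation operators. -/
theorem creation_intertwine (hb : IsXXX b ∨ IsXXZ b) (η ξ : ℂ) {L L' : List (Fin N × ℂ)}
    (hL : (L.map Prod.fst).Nodup) (hL' : (L'.map Prod.fst).Nodup)
    {Y : Matrix (Fin N → Fin 2) (Fin N → Fin 2) ℂ}
    (h : ∀ x, rowBlocks b η ξ L x 0 1 * Y = Y * rowBlocks b η ξ L' x 0 1) (x : ℂ) :
    creation b η ξ L x * Y = Y * creation b η ξ L' x := by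
  refine eq_of_eventually_eq_punctured (f := fun x => creation b η ξ L x * Y)
    (g := fun x => Y * creation b η ξ L' x)
    ((continuous_creation hb η ξ L).matrix_mul continuous_const).continuousAt
    (continuous_const.matrix_mul (continuous_creation hb η ξ L')).continuousAt ?_
  filter_upwards [eventually_b_two_mul_ne_zero hb η x] with y hy
  refine smul_right_injective _ hy ?_
  simp only
  rw [← smul_mul_assoc, smul_creation hb η ξ y hL, ← mul_smul_comm, smul_creation hb η ξ y hL',
    smul_mul_assoc, h, mul_smul_comm]

theorem creation_move (hb : IsXXX b ∨ IsXXZ b) (η ξ : ℂ) {r : Fin N} (z : ℂ)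
    {P Q : List (Fin N × ℂ)} (hPQ : ((P ++ (r, z) :: Q).map Prod.fst).Nodup) (x : ℂ) :
    creation b η ξ (P ++ (r, z) :: Q) x *
        (P.reverse.map fun s => leg2 r s.1 (Rhat b η (z - s.2))).prod =
      (P.reverse.map fun s => leg2 r s.1 (Rhat b η (z - s.2))).prod *
        creation b η ξ ((r, z) :: (P ++ Q)) x := by
  have hperm : (P ++ (r, z) :: Q).Perm ((r, z) :: (P ++ Q)) := List.perm_middle
  have hn := ((hperm.map Prod.fst).nodup_iff).1 hPQ
  refine creation_intertwine hb η ξ hPQ hn (fun x => ?_) x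
  have hn' := hn
  rw [List.map_cons, List.nodup_cons, List.map_append, List.nodup_append, List.mem_append,
    not_or] at hn'
  obtain ⟨⟨h1, h2⟩, h3, -, h5⟩ := hn'
  have h := doubleRow_move hb η ξ (a := 0) (r := r.succ) (Fin.succ_ne_zero r).symm z
    (P := P.map (Prod.map Fin.succ id)) (Q := Q.map (Prod.map Fin.succ id)) ?_ ?_ ?_ ?_ (x + η / 2)
  · have h := congrArg (fun X => auxBlocks X 0 1) h
    have hY : auxBlocks (((P.map (Prod.map Fin.succ id)).reverse.map fun s =>
        leg2 r.succ s.1 (Rhat b η (z - s.2))).prod) =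
        Matrix.diagonal fun _ => (P.reverse.map fun s => leg2 r s.1 (Rhat b η (z - s.2))).prod := by
      rw [← List.map_reverse, List.map_map]
      generalize P.reverse = P'
      induction P' with
      | nil => simp [auxBlocks_one]
      | cons s P' ih =>
        rw [List.map_cons, List.prod_cons, auxBlocks_mul, ih, List.map_cons, List.prod_cons]
        simp only [Function.comp_apply, Prod.map_fst, Prod.map_snd, id]
        rw [auxBlocks_leg2_succ]
        ext i j : 2
        fin_cases i <;> fin_cases j <;> simp [Matrix.mul_apply]
    simp only [auxBlocks_mul, hY] at h
    rw [Matrix.mul_diagonal, Matrix.diagonal_mul] at h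
    simpa [rowBlocks, Prod.map] using h
  · intro s hs
    obtain ⟨q, hq, rfl⟩ := List.mem_map.1 hs
    exact ⟨Fin.succ_ne_zero _, fun h => h1 (List.mem_map.2 ⟨q, hq, Fin.succ_injective _ h⟩)⟩
  · rw [List.map_map, show (Prod.fst ∘ Prod.map Fin.succ id : Fin N × ℂ → Fin (N + 1)) =
      Fin.succ ∘ Prod.fst from rfl, ← List.map_map]
    exact h3.map (Fin.succ_injective N)
  · intro s hs
    obtain ⟨q, hq, rfl⟩ := List.mem_map.1 hs
    exact ⟨Fin.succ_ne_zero _, fun h => h2 (List.mem_map.2 ⟨q, hq, Fin.succ_injective _ h⟩)⟩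
  · intro s hs s' hs' h
    obtain ⟨q, hq, rfl⟩ := List.mem_map.1 hs
    obtain ⟨q', hq', rfl⟩ := List.mem_map.1 hs'
    exact h5 q.1 (List.mem_map_of_mem hq) q'.1 (List.mem_map_of_mem hq') (Fin.succ_injective _ h)

/-- Reflecting the inhomogeneity of the outermost site. -/
theorem creation_reflect (hb : IsXXX b ∨ IsXXZ b) (η ξ z : ℂ) {r : Fin N}
    {L : List (Fin N × ℂ)} (hL : (L.map Prod.fst).Nodup) (hr : ∀ s ∈ L, s.1 ≠ r) (x : ℂ) :
    creation b η ξ ((r, -z) :: L) x * doubleRow b η ξ r L (-z) =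
      doubleRow b η ξ r L (-z) * creation b η ξ ((r, z) :: L) x := by
  have hn : ∀ z, (((r, z) :: L).map Prod.fst).Nodup := by
    intro z
    simp only [List.map_cons, List.nodup_cons, hL, and_true, List.mem_map, not_exists, not_and]
    exact fun s hs => hr s hs
  refine creation_intertwine hb η ξ (hn _) (hn _) (fun x => ?_) x
  have h := reflection_rowBlocks hb η ξ hL hr x (-z - η / 2)
  have h1 : -z - η / 2 + η / 2 = -z := by ring
  have h2 : sixVertexBlocks r (b (-z - η / 2 - x + η)) (b (-z - η / 2 - x)) (b η) =
      sixVertexBlocks r (b (-z - x + η / 2)) (b (-z - x - η / 2)) (b η) := by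
    congr 2 <;> ring
  have h3 : sixVertexBlocks r (b (-z - η / 2 - x + η)) (b (-z - η / 2 - x)) (b η) =
      sixVertexBlocks r (b (-x - z + η / 2)) (b (-x - z - η / 2)) (b η) := by
    congr 2 <;> ring
  have h4 : sixVertexBlocks r (b (-x - (-z - η / 2))) (b (-x - (-z - η / 2) - η)) (b η) =
      sixVertexBlocks r (b (-x - -z + η / 2)) (b (-x - -z - η / 2)) (b η) := by
    congr 2 <;> ring
  have h5 : sixVertexBlocks r (b (-x - (-z - η / 2))) (b (-x - (-z - η / 2) - η)) (b η) =
      sixVertexBlocks r (b (z - x + η / 2)) (b (z - x - η / 2)) (b η) := by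
    congr 2 <;> ring
  have h6 : rowBlocks b η ξ ((r, -z) :: L) x * Matrix.diagonal (fun _ => doubleRow b η ξ r L (-z)) =
      Matrix.diagonal (fun _ => doubleRow b η ξ r L (-z)) * rowBlocks b η ξ ((r, z) :: L) x := by
    rw [rowBlocks_cons, rowBlocks_cons, ← h2, ← h3, ← h4, ← h5]
    rw [h1] at h
    rw [h]
    simp only [Matrix.mul_assoc]
  have h7 := congrFun (congrFun h6 0) 1
  rwa [Matrix.mul_diagonal, Matrix.diagonal_mul] at h7

theorem exchange_rowBlocks (hb : IsXXX b ∨ IsXXZ b) (η ξ : ℂ) {r : Fin N}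
    {L : List (Fin N × ℂ)} (hL : (L.map Prod.fst).Nodup) (hr : ∀ s ∈ L, s.1 ≠ r) (x y : ℂ) :
    (b (y - x + η) * b (-x - y - η)) • (rowBlocks b η ξ L x 0 1 * rowBlocks b η ξ L y 0 1) =
      (b (y - x + η) * b (-x - y - η)) • (rowBlocks b η ξ L y 0 1 * rowBlocks b η ξ L x 0 1) ∧
    b (y - x + η) • (b (-x - y) • (rowBlocks b η ξ L x 0 0 * rowBlocks b η ξ L y 0 1) +
        b η • (rowBlocks b η ξ L x 0 1 * rowBlocks b η ξ L y 1 1)) =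
      (b (y - x) * b (-x - y - η)) • (rowBlocks b η ξ L y 0 1 * rowBlocks b η ξ L x 0 0) +
        b η • (b (-x - y) • (rowBlocks b η ξ L y 0 0 * rowBlocks b η ξ L x 0 1) +
          b η • (rowBlocks b η ξ L y 0 1 * rowBlocks b η ξ L x 1 1)) := by
  have h := reflection_rowBlocks hb η ξ hL hr x y
  rw [doubleRow_eq_sum η ξ hr] at h
  exact exchange_of_reflection (fun k l m n => legUnit_commute_rowBlocks η ξ x hr k l m n)
    (fun k l m n => legUnit_commute_rowBlocks η ξ y hr k l m n) h

/-- The creation operators commute. The leg `r` serves as a second auxiliary space. -/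
theorem creation_comm (hb : IsXXX b ∨ IsXXZ b) (η ξ : ℂ) {r : Fin N}
    {L : List (Fin N × ℂ)} (hL : (L.map Prod.fst).Nodup) (hr : ∀ s ∈ L, s.1 ≠ r) (x y : ℂ) :
    creation b η ξ L x * creation b η ξ L y = creation b η ξ L y * creation b η ξ L x := by
  have hc := continuous_creation hb η ξ L
  refine eq_of_eventually_eq_punctured (f := fun x => creation b η ξ L x * creation b η ξ L y)
    (g := fun x => creation b η ξ L y * creation b η ξ L x)
    (hc.matrix_mul continuous_const).continuousAt (continuous_const.matrix_mul hc).continuousAt ?_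
  filter_upwards [eventually_b_two_mul_ne_zero hb η x] with x hx
  refine eq_of_eventually_eq_punctured (f := fun y => creation b η ξ L x * creation b η ξ L y)
    (g := fun y => creation b η ξ L y * creation b η ξ L x)
    (continuous_const.matrix_mul hc).continuousAt (hc.matrix_mul continuous_const).continuousAt ?_
  filter_upwards [eventually_b_two_mul_ne_zero hb η y,
    eventually_b_ne_zero hb 1 (-x + η) y one_ne_zero,
    eventually_b_ne_zero hb (-1) (-x - η) y (neg_ne_zero.2 one_ne_zero)] with y hy h1 h2
  have h3 := (exchange_rowBlocks hb η ξ hL hr x y).1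
  rw [show 1 * y + (-x + η) = y - x + η by ring] at h1
  rw [show -1 * y + (-x - η) = -x - y - η by ring] at h2
  have h4 := smul_right_injective _ (mul_ne_zero h1 h2) h3
  have h5 := congrArg₂ (· * ·) (smul_creation hb η ξ x hL) (smul_creation hb η ξ y hL)
  have h6 := congrArg₂ (· * ·) (smul_creation hb η ξ y hL) (smul_creation hb η ξ x hL)
  simp only [smul_mul_smul_comm] at h5 h6
  refine smul_right_injective _ (mul_ne_zero hx hy) ?_
  linear_combination (norm := module) h5 - h6 + (b (2 * x) * b (2 * y)) • h4

/-- The exchange relation of the blocks `A` with the creation operators, with cleared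
denominators. -/
theorem rowBlocks_mul_creation (hb : IsXXX b ∨ IsXXZ b) (η ξ : ℂ) {r : Fin N}
    {L : List (Fin N × ℂ)} (hL : (L.map Prod.fst).Nodup) (hr : ∀ s ∈ L, s.1 ≠ r) (x y : ℂ) :
    (b (y - x) * b (x + y) * b (2 * x)) • (rowBlocks b η ξ L x 0 0 * creation b η ξ L y) =
      (-(b (x + y + η) * b (x - y + η) * b (2 * x))) •
          (creation b η ξ L y * rowBlocks b η ξ L x 0 0) +
        (b η * b (2 * x + η)) • (creation b η ξ L x *
          (b (y - x) • rowBlocks b η ξ L (-y) 0 0 + b (x + y) • rowBlocks b η ξ L y 0 0)) := by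
  have hcb := b_continuous hb
  have hc := continuous_creation hb η ξ L
  have hA := continuous_rowBlocks hb η ξ L 0 0
  have hA' : Continuous fun y => rowBlocks b η ξ L (-y) 0 0 := hA.comp continuous_neg
  have hA'' : Continuous fun y => b (y - x) • rowBlocks b η ξ L (-y) 0 0 +
      b (x + y) • rowBlocks b η ξ L y 0 0 := by fun_prop
  have c1 : Continuous fun y => rowBlocks b η ξ L x 0 0 * creation b η ξ L y :=
    continuous_const.matrix_mul hc
  have c2 : Continuous fun y => creation b η ξ L y * rowBlocks b η ξ L x 0 0 :=
    hc.matrix_mul continuous_const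
  have c3 : Continuous fun y => creation b η ξ L x * (b (y - x) • rowBlocks b η ξ L (-y) 0 0 +
      b (x + y) • rowBlocks b η ξ L y 0 0) := continuous_const.matrix_mul hA''
  refine eq_of_eventually_eq_punctured (x₀ := y)
    (f := fun y => (b (y - x) * b (x + y) * b (2 * x)) •
      (rowBlocks b η ξ L x 0 0 * creation b η ξ L y))
    (g := fun y => (-(b (x + y + η) * b (x - y + η) * b (2 * x))) •
          (creation b η ξ L y * rowBlocks b η ξ L x 0 0) +
        (b η * b (2 * x + η)) • (creation b η ξ L x *
          (b (y - x) • rowBlocks b η ξ L (-y) 0 0 + b (x + y) • rowBlocks b η ξ L y 0 0)))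
    (Continuous.continuousAt (by fun_prop)) (Continuous.continuousAt (by fun_prop)) ?_
  filter_upwards [eventually_b_two_mul_ne_zero hb η y,
    eventually_b_ne_zero hb 1 (-x) y one_ne_zero] with y hy h1
  rw [show 1 * y + -x = y - x by ring] at h1
  have e1 := (exchange_rowBlocks hb η ξ hL hr x y).2
  have e2 := (exchange_rowBlocks hb η ξ hL hr y x).2
  have k1 := congrArg (rowBlocks b η ξ L x 0 0 * ·) (smul_creation hb η ξ y hL)
  have k2 := congrArg (· * rowBlocks b η ξ L x 0 0) (smul_creation hb η ξ y hL)
  have k3 := fun X => congrArg (· * X) (smul_creation hb η ξ x hL)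
  have k4 := congrArg (rowBlocks b η ξ L x 0 1 * ·) (rowBlocks_neg hb η ξ y hL).1
  simp only [mul_add, mul_smul_comm, smul_mul_assoc] at k1 k2 k3 k4
  have t1 : b (y - x + η) * b (x - y + η) - b η * b η = -(b (y - x) * b (y - x)) := by
    rcases hb with ⟨c, -, h⟩ | ⟨c, ν, -, -, h⟩
    · simp only [h]; ring
    · simp only [h, Complex.sinh, mul_add, mul_sub, neg_add, neg_sub, Complex.exp_add,
        Complex.exp_sub, Complex.exp_neg]
      field_simp
      ring
  have t2 : b (2 * y) * b (x + y + η) = b (y - x) * b η + b (x + y) * b (2 * y + η) := by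
    rcases hb with ⟨c, -, h⟩ | ⟨c, ν, -, -, h⟩
    · simp only [h]; ring
    · simp only [h, Complex.sinh, two_mul, mul_add, mul_sub, neg_add, neg_sub, Complex.exp_add,
        Complex.exp_sub, Complex.exp_neg]
      field_simp
      ring
  have t3 : b (-x - y) = -b (x + y) := by rw [← b_neg hb]; congr 1; ring
  have t4 : b (-x - y - η) = -b (x + y + η) := by rw [← b_neg hb]; congr 1; ring
  have t5 : b (-y - x) = -b (x + y) := by rw [← b_neg hb]; congr 1; ring
  have t6 : b (-y - x - η) = -b (x + y + η) := by rw [← b_neg hb]; congr 1; ring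
  have t7 : b (x - y) = -b (y - x) := by rw [← b_neg hb]; congr 1; ring
  rw [t3, t4] at e1
  rw [t5, t6, t7] at e2
  refine smul_right_injective _ (mul_ne_zero h1 hy) ?_
  simp only [mul_add, mul_smul_comm]
  linear_combination (norm := module)
    (b (y - x) * b (y - x) * b (x + y) * b (2 * x)) • k1 +
    (b (x + y + η) * b (x - y + η) * b (2 * x) * b (y - x)) • k2 -
    (b η * b (y - x) * b (2 * y + η) * b (y - x)) • k3 (rowBlocks b η ξ L (-y) 0 0) -
    (b η * b (y - x) * b (2 * y + η) * b (x + y)) • k3 (rowBlocks b η ξ L y 0 0) -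
    (b η * b (y - x) * b (y - x) * b (2 * x)) • k4 +
    (b (2 * x) * b (2 * y) * b (x - y + η)) • e1 + (b (2 * x) * b (2 * y) * b η) • e2 +
    (b (2 * x) * b (2 * y) * b (x + y) * t1) •
      (rowBlocks b η ξ L x 0 0 * rowBlocks b η ξ L y 0 1) -
    (b (2 * x) * b (2 * y) * b η * t1) • (rowBlocks b η ξ L x 0 1 * rowBlocks b η ξ L y 1 1) +
    (b η * b (y - x) * b (2 * x) * t2) • (rowBlocks b η ξ L x 0 1 * rowBlocks b η ξ L y 0 0)

end Creation

/-! ### Off-shell Bethe vectors and unwanted terms -/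

section Bethe

variable {b : ℂ → ℂ} {ι : Type*} [Fintype ι] [DecidableEq ι]

/-- The factor picked up by the block `A` with spectral parameter `x` when it is moved through a
creation operator with spectral parameter `y`. -/
def scatter (b : ℂ → ℂ) (η x y : ℂ) : ℂ :=
  b (x + y + η) * b (x - y + η) / (b (x + y) * b (x - y))

/-- The Bethe vector obtained from `Ω` by applying the creation operators `C x`, `x ∈ xs`. -/
def bethe (C : ℂ → Matrix ι ι ℂ) (Ω : ι → ℂ) (xs : List ℂ) : ι → ℂ := (xs.map C).prod *ᵥ Ω

/-- The linear combination of the Bethe vectors with one of the spectral parameters removed, which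
collects the unwanted terms; the removed parameters `± x` are weighted with `φ (± x)`. -/
def residueSum (b : ℂ → ℂ) (η : ℂ) (α : ℂ → ℂ) (C : ℂ → Matrix ι ι ℂ) (Ω : ι → ℂ) :
    (ℂ → ℂ) → List ℂ → ι → ℂ
  | _, [] => 0
  | φ, x :: xs =>
    (φ x * α x * (xs.map (scatter b η x)).prod -
        φ (-x) * α (-x) * (xs.map (scatter b η (-x))).prod) • bethe C Ω xs +
      C x *ᵥ residueSum b η α C Ω (fun u => φ u * scatter b η u x) xs

/-- The Bethe roots `x`, `y` do not interfere. -/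
def Separated (b : ℂ → ℂ) (x y : ℂ) : Prop := b (x + y) ≠ 0 ∧ b (x - y) ≠ 0

theorem separated_neg_left (hb : IsXXX b ∨ IsXXZ b) {x y : ℂ} (h : Separated b x y) :
    Separated b (-x) y := by
  refine ⟨?_, ?_⟩
  · rw [show -x + y = -(x - y) by ring, b_neg hb]; exact neg_ne_zero.2 h.2
  · rw [show -x - y = -(x + y) by ring, b_neg hb]; exact neg_ne_zero.2 h.1

theorem separated_symm (hb : IsXXX b ∨ IsXXZ b) {x y : ℂ} (h : Separated b x y) :
    Separated b y x := by
  refine ⟨?_, ?_⟩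
  · rw [add_comm]; exact h.1
  · rw [show y - x = -(x - y) by ring, b_neg hb]; exact neg_ne_zero.2 h.2

theorem bethe_cons (C : ℂ → Matrix ι ι ℂ) (Ω : ι → ℂ) (x : ℂ) (xs : List ℂ) :
    bethe C Ω (x :: xs) = C x *ᵥ bethe C Ω xs := by
  simp [bethe, Matrix.mulVec_mulVec]

theorem residueSum_lin (η : ℂ) (α : ℂ → ℂ) (C : ℂ → Matrix ι ι ℂ) (Ω : ι → ℂ) (xs : List ℂ)
    {φ φ₁ φ₂ φ₃ : ℂ → ℂ} {c₁ c₂ c₃ : ℂ}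
    (h : ∀ u, u ∈ xs ∨ -u ∈ xs → φ u = c₁ * φ₁ u + c₂ * φ₂ u + c₃ * φ₃ u) :
    residueSum b η α C Ω φ xs = c₁ • residueSum b η α C Ω φ₁ xs +
      c₂ • residueSum b η α C Ω φ₂ xs + c₃ • residueSum b η α C Ω φ₃ xs := by
  induction xs generalizing φ φ₁ φ₂ φ₃ with
  | nil => simp [residueSum]
  | cons x xs ih =>
    simp only [residueSum]
    rw [ih (φ₁ := fun u => φ₁ u * scatter b η u x) (φ₂ := fun u => φ₂ u * scatter b η u x)
      (φ₃ := fun u => φ₃ u * scatter b η u x), h x (by simp), h (-x) (by simp)]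
    · simp only [Matrix.mulVec_add, Matrix.mulVec_smul]
      module
    · intro u hu
      rw [h u (by rcases hu with hu | hu <;> simp [hu])]
      ring

/-- The partial fraction identity behind the recursion for the unwanted terms. -/
theorem scatter_partial_fractions (hb : IsXXX b ∨ IsXXZ b) (η : ℂ) {Z x y : ℂ}
    (hx : b (2 * x) ≠ 0) (hZy : b (Z + y) ≠ 0) (hZx : Separated b Z x) (hyx : Separated b y x) :
    (b (Z + y))⁻¹ * scatter b η y x = scatter b η (-Z) x * (b (Z + y))⁻¹ +
      (b η * b (2 * x + η) / (b (2 * x) * b (Z + x))) * (b (-x + y))⁻¹ +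
      (-(b η * b (η - 2 * x) / (b (2 * x) * b (Z - x)))) * (b (x + y))⁻¹ := by
  obtain ⟨h1, h2⟩ := hZx
  obtain ⟨h3, h4⟩ := hyx
  have key : b (Z + x) * b (Z - x) * b (y + x + η) * b (y - x + η) * b (2 * x) =
      b η * b (Z + y) * (b (2 * x + η) * b (Z - x) * b (y + x) -
        b (η - 2 * x) * b (Z + x) * b (y - x)) +
      b (Z + x - η) * b (Z - x - η) * b (y + x) * b (y - x) * b (2 * x) := by
    rcases hb with ⟨c, -, h⟩ | ⟨c, ν, -, -, h⟩
    · simp only [h]; ring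
    · simp only [h, Complex.sinh, two_mul, mul_add, mul_sub, neg_add, neg_sub, Complex.exp_add,
        Complex.exp_sub, Complex.exp_neg]
      field_simp
      ring
  have e1 : b (-Z + x + η) = -b (Z - x - η) := by rw [← b_neg hb]; congr 1; ring
  have e2 : b (-Z - x + η) = -b (Z + x - η) := by rw [← b_neg hb]; congr 1; ring
  have e3 : b (-Z + x) = -b (Z - x) := by rw [← b_neg hb]; congr 1; ring
  have e4 : b (-Z - x) = -b (Z + x) := by rw [← b_neg hb]; congr 1; ring
  have e5 : b (-x + y) = b (y - x) := by congr 1; ring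
  have e6 : b (x + y) = b (y + x) := by congr 1; ring
  rw [scatter, scatter, e1, e2, e3, e4, e5, e6]
  generalize b (2 * x) = β, b (2 * x + η) = γ, b (η - 2 * x) = δ at *
  field_simp
  linear_combination key

variable {η : ℂ} {α : ℂ → ℂ} {A C : ℂ → Matrix ι ι ℂ} {Ω : ι → ℂ}

/-- The recursion for the unwanted terms, given the action of `A` on the remaining Bethe vector. -/
theorem residueSum_cons (hb : IsXXX b ∨ IsXXZ b) (hCn : ∀ x, C (-x) = -C x) {xs : List ℂ}
    {Z x : ℂ} (hx : b (2 * x) ≠ 0) (hZx : Separated b Z x)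
    (hxs : ∀ y ∈ xs, Separated b x y ∧ Separated b Z y)
    (hA : ∀ x', (x' = x ∨ x' = -x) → A x' *ᵥ bethe C Ω xs =
      (α x' * (xs.map (scatter b η x')).prod) • bethe C Ω xs +
        (b η * b (2 * x' + η) / b (2 * x')) •
          C x' *ᵥ residueSum b η α C Ω (fun u => (b (-x' + u))⁻¹) xs) :
    residueSum b η α C Ω (fun u => (b (Z + u))⁻¹) (x :: xs) =
      scatter b η (-Z) x • C x *ᵥ residueSum b η α C Ω (fun u => (b (Z + u))⁻¹) xs +
        (b (Z + x))⁻¹ • A x *ᵥ bethe C Ω xs - (b (Z - x))⁻¹ • A (-x) *ᵥ bethe C Ω xs := by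
  have hlin := residueSum_lin (b := b) η α C Ω xs (φ := fun u => (b (Z + u))⁻¹ * scatter b η u x)
    (φ₁ := fun u => (b (Z + u))⁻¹) (φ₂ := fun u => (b (-x + u))⁻¹) (φ₃ := fun u => (b (x + u))⁻¹)
    (c₁ := scatter b η (-Z) x) (c₂ := b η * b (2 * x + η) / (b (2 * x) * b (Z + x)))
    (c₃ := -(b η * b (η - 2 * x) / (b (2 * x) * b (Z - x)))) (by
      rintro u (hu | hu)
      · exact scatter_partial_fractions hb η hx (hxs u hu).2.1 hZx (separated_symm hb (hxs u hu).1)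
      · refine scatter_partial_fractions hb η hx ?_ hZx ?_
        · have := (hxs _ hu).2.2; rwa [sub_neg_eq_add] at this
        · have := separated_neg_left hb (separated_symm hb (hxs _ hu).1); rwa [neg_neg] at this)
  simp only [residueSum]
  rw [hlin, hA x (Or.inl rfl), hA (-x) (Or.inr rfl), hCn x]
  have e1 : b (2 * -x) = -b (2 * x) := by rw [← b_neg hb]; congr 1; ring
  have e2 : 2 * -x + η = η - 2 * x := by ring
  obtain ⟨h1, h2⟩ := hZx
  rw [e1, e2, neg_neg, ← sub_eq_add_neg Z x]
  simp only [Matrix.mulVec_add, Matrix.mulVec_smul, Matrix.neg_mulVec, div_eq_mul_inv, mul_inv,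
    inv_neg]
  module

/-- The action of the block `A` on an off-shell Bethe vector. -/
theorem mulVec_bethe (hb : IsXXX b ∨ IsXXZ b) (hΩ : ∀ x, A x *ᵥ Ω = α x • Ω)
    (hCC : ∀ x y, C x * C y = C y * C x) (hCn : ∀ x, C (-x) = -C x)
    (hAC : ∀ x y, (b (y - x) * b (x + y) * b (2 * x)) • (A x * C y) =
      (-(b (x + y + η) * b (x - y + η) * b (2 * x))) • (C y * A x) +
        (b η * b (2 * x + η)) • (C x * (b (y - x) • A (-y) + b (x + y) • A y))) {xs : List ℂ}
    (hxs : xs.Pairwise (Separated b)) (hxs2 : ∀ y ∈ xs, b (2 * y) ≠ 0) {x : ℂ}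
    (hx : b (2 * x) ≠ 0) (hx' : ∀ y ∈ xs, Separated b x y) :
    A x *ᵥ bethe C Ω xs = (α x * (xs.map (scatter b η x)).prod) • bethe C Ω xs +
        (b η * b (2 * x + η) / b (2 * x)) •
          C x *ᵥ residueSum b η α C Ω (fun u => (b (-x + u))⁻¹) xs := by
  induction xs generalizing x with
  | nil => simp [bethe, residueSum, hΩ]
  | cons y xs ih =>
    have hy2 : b (2 * y) ≠ 0 := hxs2 y (by simp)
    obtain ⟨hy, hxs⟩ := List.pairwise_cons.1 hxs
    have ih' := fun {x} => ih hxs (fun y hy => hxs2 y (by simp [hy])) (x := x)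
    have hxy := hx' y (by simp)
    have hxxs : ∀ y ∈ xs, Separated b x y := fun y hy => hx' y (by simp [hy])
    rw [residueSum_cons (A := A) hb hCn hy2 (separated_neg_left hb hxy)
      (fun u hu => ⟨hy u hu, separated_neg_left hb (hxxs u hu)⟩), bethe_cons]
    · have h1 := congrArg (· *ᵥ bethe C Ω xs) (hAC x y)
      have h2 := ih' hx hxxs
      have h3 := congrArg (· *ᵥ residueSum b η α C Ω (fun u => (b (-x + u))⁻¹) xs) (hCC x y)
      simp only [Matrix.add_mulVec, Matrix.smul_mulVec, ← Matrix.mulVec_mulVec, Matrix.mulVec_add,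
        Matrix.mulVec_smul] at h1 h3
      rw [h2] at h1
      have e1 : b (y - x) = -b (x - y) := by rw [← b_neg hb]; congr 1; ring
      have e2 : b (-x + y) = -b (x - y) := by rw [← b_neg hb]; congr 1; ring
      have e3 : b (-x - y) = -b (x + y) := by rw [← b_neg hb]; congr 1; ring
      rw [e1] at h1
      rw [neg_neg, e2, e3]
      simp only [Matrix.mulVec_sub, Matrix.mulVec_add, Matrix.mulVec_smul, List.map_cons,
        List.prod_cons] at h1 ⊢
      rw [← h3] at h1
      obtain ⟨h4, h5⟩ := hxy
      refine smul_right_injective _ (mul_ne_zero (mul_ne_zero (neg_ne_zero.2 h5) h4) hx) ?_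
      simp only
      rw [h1, scatter]
      simp only [smul_add, smul_sub, smul_smul, div_eq_mul_inv, mul_inv, inv_neg]
      match_scalars <;> field_simp
    · rintro x' (rfl | rfl)
      · exact ih' hy2 hy
      · refine ih' ?_ fun u hu => separated_neg_left hb (hy u hu)
        rw [mul_neg, b_neg hb]
        exact neg_ne_zero.2 hy2

/-- The off-shell Bethe vectors of a chain with one more site, of which `E₀₀`, `E₁₁` are the
projections and `E₁₀` is the lowering operator. -/
theorem bethe_add_site (hb : IsXXX b ∨ IsXXZ b) (hΩ : ∀ x, A x *ᵥ Ω = α x • Ω)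
    (hCC : ∀ x y, C x * C y = C y * C x) (hCn : ∀ x, C (-x) = -C x)
    (hAC : ∀ x y, (b (y - x) * b (x + y) * b (2 * x)) • (A x * C y) =
      (-(b (x + y + η) * b (x - y + η) * b (2 * x))) • (C y * A x) +
        (b η * b (2 * x + η)) • (C x * (b (y - x) • A (-y) + b (x + y) • A y)))
    {E₀₀ E₁₀ E₁₁ : Matrix ι ι ℂ} {C' : ℂ → Matrix ι ι ℂ} {Z : ℂ}
    (h00 : E₀₀ *ᵥ Ω = Ω) (h11 : E₁₁ *ᵥ Ω = 0) (h0010 : E₀₀ * E₁₀ = 0) (h1110 : E₁₁ * E₁₀ = E₁₀)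
    (h1010 : E₁₀ * E₁₀ = 0) (hC0 : ∀ x, E₀₀ * C x = C x * E₀₀) (hC1 : ∀ x, E₁₁ * C x = C x * E₁₁)
    (hC10 : ∀ x, E₁₀ * C x = C x * E₁₀) (hA10 : ∀ x, E₁₀ * A x = A x * E₁₀)
    (hC' : ∀ x, C' x = ((b (Z - x) * -b (Z + x)) • E₀₀ +
      (b (Z - x - η) * -b (Z + x - η)) • E₁₁) * C x +
        b η • (E₁₀ * (b (Z - x) • A x + (-b (Z + x)) • A (-x)))) {xs : List ℂ}
    (hxs : xs.Pairwise (Separated b)) (hxs2 : ∀ y ∈ xs, b (2 * y) ≠ 0)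
    (hZ : ∀ y ∈ xs, Separated b Z y) :
    bethe C' Ω xs = (xs.map fun x => -(b (Z + x) * b (Z - x))).prod • (bethe C Ω xs -
      b η • E₁₀ *ᵥ residueSum b η α C Ω (fun u => (b (Z + u))⁻¹) xs) := by
  induction xs with
  | nil => simp [bethe, residueSum]
  | cons x xs ih =>
    have hx2 : b (2 * x) ≠ 0 := hxs2 x (by simp)
    obtain ⟨hx, hxs'⟩ := List.pairwise_cons.1 hxs
    have hxs2' : ∀ y ∈ xs, b (2 * y) ≠ 0 := fun y hy => hxs2 y (by simp [hy])
    have hZx := hZ x (by simp)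
    have hZ' : ∀ y ∈ xs, Separated b Z y := fun y hy => hZ y (by simp [hy])
    rw [bethe_cons, ih hxs' hxs2' hZ', residueSum_cons (A := A) hb hCn hx2 hZx
      (fun u hu => ⟨hx u hu, hZ' u hu⟩), bethe_cons]
    · have hP : ∀ (E : Matrix ι ι ℂ), (∀ x, E * C x = C x * E) → ∀ xs, E *ᵥ bethe C Ω xs =
          (xs.map C).prod *ᵥ (E *ᵥ Ω) := by
        intro E hE xs
        have : Commute E (xs.map C).prod := by
          refine Commute.list_prod_right _ _ fun M hM => ?_
          obtain ⟨x, -, rfl⟩ := List.mem_map.1 hM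
          exact hE x
        rw [bethe, Matrix.mulVec_mulVec, this.eq, Matrix.mulVec_mulVec]
      have e0 : E₀₀ *ᵥ bethe C Ω xs = bethe C Ω xs := by rw [hP _ hC0, h00, bethe]
      have e1 : E₁₁ *ᵥ bethe C Ω xs = 0 := by rw [hP _ hC1, h11, Matrix.mulVec_zero]
      have v : ∀ (M P Q : Matrix ι ι ℂ) w, M * P = Q → M *ᵥ (P *ᵥ w) = Q *ᵥ w :=
        fun M P Q w h => by rw [Matrix.mulVec_mulVec, h]
      have f0 : ∀ w, E₀₀ *ᵥ (C x *ᵥ w) = C x *ᵥ (E₀₀ *ᵥ w) := fun w => by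
        rw [Matrix.mulVec_mulVec, hC0, Matrix.mulVec_mulVec]
      have f1 : ∀ w, E₁₁ *ᵥ (C x *ᵥ w) = C x *ᵥ (E₁₁ *ᵥ w) := fun w => by
        rw [Matrix.mulVec_mulVec, hC1, Matrix.mulVec_mulVec]
      have f10 : ∀ w, E₁₀ *ᵥ (C x *ᵥ w) = C x *ᵥ (E₁₀ *ᵥ w) := fun w => by
        rw [Matrix.mulVec_mulVec, hC10, Matrix.mulVec_mulVec]
      have g10 : ∀ x w, A x *ᵥ (E₁₀ *ᵥ w) = E₁₀ *ᵥ (A x *ᵥ w) := fun x w => by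
        rw [Matrix.mulVec_mulVec, ← hA10, Matrix.mulVec_mulVec]
      have k1 : ∀ w, E₀₀ *ᵥ (E₁₀ *ᵥ w) = 0 := fun w => by rw [v _ _ _ _ h0010, Matrix.zero_mulVec]
      have k2 : ∀ w, E₁₁ *ᵥ (E₁₀ *ᵥ w) = E₁₀ *ᵥ w := fun w => v _ _ _ _ h1110
      have k3 : ∀ w, E₁₀ *ᵥ (E₁₀ *ᵥ w) = 0 := fun w => by rw [v _ _ _ _ h1010, Matrix.zero_mulVec]
      obtain ⟨h1, h2⟩ := hZx
      have s1 : b (-Z + x + η) = -b (Z - x - η) := by rw [← b_neg hb]; congr 1; ring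
      have s2 : b (-Z - x + η) = -b (Z + x - η) := by rw [← b_neg hb]; congr 1; ring
      have s3 : b (-Z + x) = -b (Z - x) := by rw [← b_neg hb]; congr 1; ring
      have s4 : b (-Z - x) = -b (Z + x) := by rw [← b_neg hb]; congr 1; ring
      rw [hC', scatter, s1, s2, s3, s4]
      simp only [Matrix.add_mulVec, Matrix.smul_mulVec, ← Matrix.mulVec_mulVec, Matrix.mulVec_add,
        Matrix.mulVec_sub, Matrix.mulVec_smul, f0, f1, f10, g10, k1, k2, k3, e0, e1,
        Matrix.mulVec_zero, smul_zero, List.map_cons, List.prod_cons]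
      match_scalars <;> field_simp
    · rintro x' (rfl | rfl)
      · exact mulVec_bethe hb hΩ hCC hCn hAC hxs' hxs2' hx2 hx
      · refine mulVec_bethe hb hΩ hCC hCn hAC hxs' hxs2' ?_
          fun u hu => separated_neg_left hb (hx u hu)
        rw [mul_neg, b_neg hb]
        exact neg_ne_zero.2 hx2

end Bethe

section BetheContinuity

variable {b : ℂ → ℂ} {ι : Type*} [Fintype ι] [DecidableEq ι] {η : ℂ} {α : ℂ → ℂ}
  {A C : ℂ → Matrix ι ι ℂ} {Ω : ι → ℂ}

theorem continuous_bethe_shift (hC : Continuous C) (xs : List ℂ) :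
    Continuous fun ε => bethe C Ω (xs.map (· + ε)) := by
  induction xs with
  | nil => exact (continuous_const : Continuous fun _ : ℂ => bethe C Ω [])
  | cons x xs ih =>
    simp only [List.map_cons, bethe_cons]
    have h1 : Continuous fun ε => C (x + ε) := hC.comp (by fun_prop)
    exact h1.matrix_mulVec ih

theorem continuousAt_scatter (hb : Continuous b) {u v : ℂ → ℂ} (hu : Continuous u)
    (hv : Continuous v) {x₀ : ℂ} (h : Separated b (u x₀) (v x₀)) :
    ContinuousAt (fun x => scatter b η (u x) (v x)) x₀ := by
  unfold scatter
  refine ContinuousAt.div (Continuous.continuousAt (by fun_prop))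
    (Continuous.continuousAt (by fun_prop)) (mul_ne_zero h.1 h.2)

theorem continuousAt_prod_scatter (hb : Continuous b) {u : ℂ → ℂ} (hu : Continuous u)
    {xs : List ℂ} (h : ∀ y ∈ xs, Separated b (u 0) y) :
    ContinuousAt (fun ε => ((xs.map (· + ε)).map (scatter b η (u ε))).prod) 0 := by
  induction xs with
  | nil => exact continuousAt_const
  | cons x xs ih =>
    simp only [List.map_cons, List.prod_cons]
    refine (continuousAt_scatter hb hu (by fun_prop) ?_).mul (ih fun y hy => h y (by simp [hy]))
    simpa using h x (by simp)

theorem continuousAt_residueSum (hb : IsXXX b ∨ IsXXZ b) (hα : Continuous α) (hC : Continuous C)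
    {φ : ℂ → ℂ → ℂ} {xs : List ℂ} (hxs : xs.Pairwise (Separated b))
    (hφ : ∀ x ∈ xs, ContinuousAt (fun ε => φ ε (x + ε)) 0 ∧
      ContinuousAt (fun ε => φ ε (-(x + ε))) 0) :
    ContinuousAt (fun ε => residueSum b η α C Ω (φ ε) (xs.map (· + ε))) 0 := by
  have hbc := b_continuous hb
  induction xs generalizing φ with
  | nil => exact continuousAt_const
  | cons x xs ih =>
    obtain ⟨hx, hxs⟩ := List.pairwise_cons.1 hxs
    simp only [List.map_cons, residueSum]
    have h1 := hφ x (by simp)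
    have h2 := ih hxs (φ := fun ε u => φ ε u * scatter b η u (x + ε)) fun y hy => by
      have hyx : Separated b y x := separated_symm hb (hx y hy)
      have h3 := hφ y (by simp [hy])
      refine ⟨h3.1.mul (continuousAt_scatter hbc (by fun_prop) (by fun_prop) (by simpa using hyx)),
        h3.2.mul (continuousAt_scatter hbc (by fun_prop) (by fun_prop) ?_)⟩
      simpa using separated_neg_left hb hyx
    have h4 : ContinuousAt (fun ε => C (x + ε)) 0 := (hC.comp (by fun_prop)).continuousAt
    have h5 : ContinuousAt (fun ε => C (x + ε) *ᵥ residueSum b η α C Ω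
        (fun u => φ ε u * scatter b η u (x + ε)) (xs.map (· + ε))) 0 := by
      have hm : Continuous fun p : Matrix ι ι ℂ × (ι → ℂ) => p.1 *ᵥ p.2 :=
        continuous_fst.matrix_mulVec continuous_snd
      exact hm.continuousAt.comp (h4.prodMk h2)
    have h6 := (continuous_bethe_shift (Ω := Ω) hC xs).continuousAt (x := 0)
    have h7 := continuousAt_prod_scatter (η := η) hbc (u := fun ε => x + ε) (by fun_prop)
      (xs := xs) (by simpa using hx)
    have h8 := continuousAt_prod_scatter (η := η) hbc (u := fun ε => -(x + ε)) (by fun_prop)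
      (xs := xs) (fun y hy => by simpa using separated_neg_left hb (hx y hy))
    have h9 : ContinuousAt (fun ε => α (x + ε)) 0 := (hα.comp (by fun_prop)).continuousAt
    have h10 : ContinuousAt (fun ε => α (-(x + ε))) 0 := (hα.comp (by fun_prop)).continuousAt
    exact ((((h1.1.mul h9).mul h7).sub ((h1.2.mul h10).mul h8)).smul h6).add h5

theorem bethe_add_site_of_separated (hb : IsXXX b ∨ IsXXZ b) (hα : Continuous α)
    (hC : Continuous C) {C' : ℂ → Matrix ι ι ℂ} (hCc' : Continuous C') {E : Matrix ι ι ℂ} {Z : ℂ}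
    (h : ∀ xs : List ℂ, xs.Pairwise (Separated b) → (∀ y ∈ xs, b (2 * y) ≠ 0) →
      (∀ y ∈ xs, Separated b Z y) →
      bethe C' Ω xs = (xs.map fun x => -(b (Z + x) * b (Z - x))).prod • (bethe C Ω xs -
        b η • E *ᵥ residueSum b η α C Ω (fun u => (b (Z + u))⁻¹) xs))
    {xs : List ℂ} (hxs : xs.Pairwise (Separated b)) (hZ : ∀ y ∈ xs, Separated b Z y) :
    bethe C' Ω xs = (xs.map fun x => -(b (Z + x) * b (Z - x))).prod • (bethe C Ω xs -
      b η • E *ᵥ residueSum b η α C Ω (fun u => (b (Z + u))⁻¹) xs) := by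
  have hbc := b_continuous hb
  have h0 : ∀ {f : ℂ → ℂ}, Continuous f → f 0 ≠ 0 → ∀ᶠ ε in 𝓝[≠] 0, f ε ≠ 0 := fun hf h0 =>
    (hf.continuousAt.eventually_ne h0).filter_mono nhdsWithin_le_nhds
  have e2 : ∀ᶠ ε in 𝓝[≠] 0, ∀ y ∈ xs, b (2 * (y + ε)) ≠ 0 := by
    refine (Filter.eventually_all_finite xs.finite_toSet).2 fun y hy => ?_
    filter_upwards [eventually_b_ne_zero hb 2 (2 * y) 0 two_ne_zero] with ε hε
    rwa [mul_add, add_comm]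
  have e3 : ∀ᶠ ε in 𝓝[≠] 0, ∀ y ∈ xs, Separated b Z (y + ε) := by
    refine (Filter.eventually_all_finite xs.finite_toSet).2 fun y hy => ?_
    filter_upwards [h0 (f := fun ε => b (Z + (y + ε))) (by fun_prop) (by simpa using (hZ y hy).1),
      h0 (f := fun ε => b (Z - (y + ε))) (by fun_prop) (by simpa using (hZ y hy).2)] with ε h1 h2
    exact ⟨h1, h2⟩
  have e1 : ∀ᶠ ε in 𝓝[≠] (0 : ℂ), (xs.map (· + ε)).Pairwise (Separated b) := by
    clear hZ e2 e3
    induction xs with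
    | nil => exact Eventually.of_forall fun _ => List.Pairwise.nil
    | cons x xs ih =>
      obtain ⟨hx, hxs⟩ := List.pairwise_cons.1 hxs
      have e4 : ∀ᶠ ε in 𝓝[≠] 0, ∀ y ∈ xs, Separated b (x + ε) (y + ε) := by
        refine (Filter.eventually_all_finite xs.finite_toSet).2 fun y hy => ?_
        filter_upwards [h0 (f := fun ε => b (x + ε + (y + ε))) (by fun_prop)
          (by simpa using (hx y hy).1), h0 (f := fun ε => b (x + ε - (y + ε))) (by fun_prop)
          (by simpa using (hx y hy).2)] with ε h1 h2
        exact ⟨h1, h2⟩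
      filter_upwards [ih hxs, e4] with ε h1 h2
      rw [List.map_cons, List.pairwise_cons]
      exact ⟨by simpa using h2, h1⟩
  have hprod : Continuous fun ε => ((xs.map (· + ε)).map fun x => -(b (Z + x) * b (Z - x))).prod := by
    clear hxs hZ e1 e2 e3
    induction xs with
    | nil => exact continuous_const
    | cons x xs ih =>
      simp only [List.map_cons, List.prod_cons]
      fun_prop
  have hres := continuousAt_residueSum (η := η) (Ω := Ω) hb hα hC (φ := fun _ u => (b (Z + u))⁻¹)
    hxs fun y hy => ⟨ContinuousAt.inv₀ (Continuous.continuousAt (by fun_prop))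
      (by simpa using (hZ y hy).1), ContinuousAt.inv₀ (Continuous.continuousAt (by fun_prop))
      (by simpa [← sub_eq_add_neg] using (hZ y hy).2)⟩
  have hres' : ContinuousAt (fun ε => E *ᵥ residueSum b η α C Ω (fun u => (b (Z + u))⁻¹)
      (xs.map (· + ε))) 0 := by
    have hm : Continuous fun p : ι → ℂ => E *ᵥ p := continuous_const.matrix_mulVec continuous_id
    exact hm.continuousAt.comp hres
  have key := eq_of_eventually_eq_punctured (x₀ := 0) (f := fun ε => bethe C' Ω (xs.map (· + ε)))
    (g := fun ε => ((xs.map (· + ε)).map fun x => -(b (Z + x) * b (Z - x))).prod •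
      (bethe C Ω (xs.map (· + ε)) -
        b η • E *ᵥ residueSum b η α C Ω (fun u => (b (Z + u))⁻¹) (xs.map (· + ε))))
    (continuous_bethe_shift hCc' xs).continuousAt
    (hprod.continuousAt.smul ((continuous_bethe_shift hC xs).continuousAt.sub
      (hres'.const_smul (b η)))) (by
    filter_upwards [e1, e2, e3] with ε h1 h2 h3
    refine h _ h1 ?_ ?_
    · simpa using h2
    · simpa using h3)
  simpa using key

/-- The unwanted terms, indexed by the removed spectral parameter. -/
theorem residueSum_ofFn (η : ℂ) (α : ℂ → ℂ) (C : ℂ → Matrix ι ι ℂ) (Ω : ι → ℂ) {M : ℕ}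
    (φ : ℂ → ℂ) (x : Fin M → ℂ) :
    residueSum b η α C Ω φ (List.ofFn x) = ∑ i,
      (φ (x i) * α (x i) * (∏ k, if k = i then 1 else scatter b η (x i) (x k)) -
        φ (-x i) * α (-x i) * (∏ k, if k = i then 1 else scatter b η (-x i) (x k))) •
      ((List.ofFn fun k => if k = i then 1 else C (x k)).prod *ᵥ Ω) := by
  induction M generalizing φ with
  | zero => simp [residueSum]
  | succ M ih =>
    rw [List.ofFn_succ, residueSum, ih, Fin.sum_univ_succ]
    congr 1
    · simp only [List.map_ofFn, List.prod_ofFn, Fin.prod_univ_succ, List.ofFn_succ, if_true, one_mul,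
        Fin.succ_ne_zero, if_false, List.prod_cons, bethe]
      rfl
    · rw [Matrix.mulVec_sum]
      refine Finset.sum_congr rfl fun i _ => ?_
      rw [Matrix.mulVec_smul, Matrix.mulVec_mulVec]
      have h0 : (0 : Fin (M + 1)) ≠ i.succ := (Fin.succ_ne_zero i).symm
      simp only [Fin.prod_univ_succ, List.ofFn_succ, List.prod_cons, if_neg h0, Fin.succ_inj]
      congr 1
      ring

end BetheContinuity

section Vacuum

variable {b : ℂ → ℂ} {N : ℕ}

theorem leg1_mulVec_pseudoVacuum (r : Fin N) (A : Matrix (Fin 2) (Fin 2) ℂ) (h : A 1 0 = 0) :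
    leg1 r A *ᵥ pseudoVacuum N = A 0 0 • pseudoVacuum N := by
  ext s
  rw [pseudoVacuum, Matrix.mulVec_single_one, Matrix.col_apply, leg1, Matrix.of_apply,
    Pi.smul_apply]
  by_cases hs : s = fun _ => 0
  · subst hs; simp
  · rw [Pi.single_eq_of_ne hs, smul_zero]
    split_ifs with h'
    · have : s r ≠ 0 := fun h0 => hs (by
        ext k
        by_cases hk : k = r
        · rw [hk, h0]
        · rw [h' k hk])
      rw [show s r = 1 by omega, h]
    · rfl

theorem legUnit_mulVec_pseudoVacuum (r : Fin N) :
    legUnit r 0 0 *ᵥ pseudoVacuum N = pseudoVacuum N ∧ legUnit r 1 1 *ᵥ pseudoVacuum N = 0 ∧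
      legUnit r 0 1 *ᵥ pseudoVacuum N = 0 := by
  refine ⟨?_, ?_, ?_⟩ <;> rw [legUnit, leg1_mulVec_pseudoVacuum] <;> simp

/-- The eigenvalue of the block `A` on the pseudo-vacuum vector. -/
def vacuumEigenvalue (b : ℂ → ℂ) (η ξ : ℂ) (L : List (Fin N × ℂ)) (x : ℂ) : ℂ :=
  b (ξ - x - η / 2) * (L.map fun s => b (s.2 - x + η / 2) * b (-x - s.2 + η / 2)).prod

theorem rowBlocks_mulVec_pseudoVacuum (η ξ x : ℂ) {L : List (Fin N × ℂ)}
    (hL : (L.map Prod.fst).Nodup) :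
    rowBlocks b η ξ L x 0 0 *ᵥ pseudoVacuum N = vacuumEigenvalue b η ξ L x • pseudoVacuum N ∧
      rowBlocks b η ξ L x 1 0 *ᵥ pseudoVacuum N = 0 := by
  induction L with
  | nil => simp [rowBlocks_nil, vacuumEigenvalue, Matrix.smul_mulVec]
  | cons s L ih =>
    obtain ⟨r, z⟩ := s
    simp only [List.map_cons, List.nodup_cons, List.mem_map, not_exists, not_and] at hL
    have hr : ∀ s ∈ L, s.1 ≠ r := fun s hs => hL.1 s hs
    obtain ⟨iA, iC⟩ := ih hL.2
    obtain ⟨v0, v1, v2⟩ := legUnit_mulVec_pseudoVacuum r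
    obtain ⟨pA, -, pC, -⟩ := rowBlocks_cons_apply (b := b) η ξ x z hr rfl rfl rfl rfl
    have hc : ∀ k l m n w, legUnit r k l *ᵥ (rowBlocks b η ξ L x m n *ᵥ w) =
        rowBlocks b η ξ L x m n *ᵥ (legUnit r k l *ᵥ w) := fun k l m n w => by
      rw [Matrix.mulVec_mulVec, (legUnit_commute_rowBlocks η ξ x hr k l m n).eq,
        Matrix.mulVec_mulVec]
    constructor
    · rw [pA]
      simp only [Matrix.add_mulVec, Matrix.smul_mulVec, ← Matrix.mulVec_mulVec]
      rw [hc 1 1, hc 0 1, iC, hc 0 0, v0, v1, v2, iA, vacuumEigenvalue, vacuumEigenvalue, hc 1 1, v1]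
      simp only [Matrix.mulVec_zero, smul_zero, add_zero, List.map_cons, List.prod_cons, smul_smul]
      congr 1
      ring
    · rw [pC]
      simp only [Matrix.add_mulVec, Matrix.smul_mulVec, ← Matrix.mulVec_mulVec]
      rw [hc 0 1, hc 0 1, iC, v2]
      simp

theorem continuous_vacuumEigenvalue (hb : IsXXX b ∨ IsXXZ b) (η ξ : ℂ) (L : List (Fin N × ℂ)) :
    Continuous (vacuumEigenvalue b η ξ L) := by
  have hbc := b_continuous hb
  unfold vacuumEigenvalue
  refine Continuous.mul (by fun_prop) ?_
  induction L with
  | nil => exact continuous_const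
  | cons s L ih =>
    simp only [List.map_cons, List.prod_cons]
    fun_prop

/-- The dependence of the off-shell Bethe vectors on the inhomogeneity `z` of the outermost site. -/
theorem bethe_creation_cons (hb : IsXXX b ∨ IsXXZ b) (η ξ z : ℂ) {r : Fin N}
    {L : List (Fin N × ℂ)} (hL : (L.map Prod.fst).Nodup) (hr : ∀ s ∈ L, s.1 ≠ r) {xs : List ℂ}
    (hxs : xs.Pairwise (Separated b)) (hZ : ∀ y ∈ xs, Separated b (z + η / 2) y) :
    bethe (creation b η ξ ((r, z) :: L)) (pseudoVacuum N) xs =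
      (xs.map fun x => -(b (z + η / 2 + x) * b (z + η / 2 - x))).prod •
        (bethe (creation b η ξ L) (pseudoVacuum N) xs -
          b η • legUnit r 1 0 *ᵥ residueSum b η (vacuumEigenvalue b η ξ L) (creation b η ξ L)
            (pseudoVacuum N) (fun u => (b (z + η / 2 + u))⁻¹) xs) := by
  refine bethe_add_site_of_separated hb (continuous_vacuumEigenvalue hb η ξ L)
    (continuous_creation hb η ξ L) (continuous_creation hb η ξ _) (fun xs h1 h2 h3 => ?_) hxs hZ
  obtain ⟨v0, v1, -⟩ := legUnit_mulVec_pseudoVacuum r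
  refine bethe_add_site (A := fun x => rowBlocks b η ξ L x 0 0) (E₀₀ := legUnit r 0 0)
    (E₁₁ := legUnit r 1 1) hb (fun x => (rowBlocks_mulVec_pseudoVacuum η ξ x hL).1)
    (creation_comm hb η ξ hL hr) (fun x => creation_neg hb η ξ x L)
    (rowBlocks_mul_creation hb η ξ hL hr) v0 v1 ?_ ?_ ?_
    (fun x => legUnit_commute_creation η ξ x hr 0 0) (fun x => legUnit_commute_creation η ξ x hr 1 1)
    (fun x => legUnit_commute_creation η ξ x hr 1 0)
    (fun x => legUnit_commute_rowBlocks η ξ x hr 1 0 0 0) (fun x => ?_) h1 h2 h3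
  · simp [legUnit_mul]
  · simp [legUnit_mul]
  · simp [legUnit_mul]
  · have e1 : b (-x - z - η / 2) = -b (z + η / 2 + x) := by rw [← b_neg hb]; congr 1; ring
    have e2 : b (-x - z + η / 2) = -b (z + η / 2 + x - η) := by rw [← b_neg hb]; congr 1; ring
    have e3 : z - x + η / 2 = z + η / 2 - x := by ring
    have e4 : z - x - η / 2 = z + η / 2 - x - η := by ring
    rw [creation_cons, e1, e2, e3, e4]

end Vacuum

/-! ### The boundary Bethe vectors in terms of the creation operators -/

section Identification

variable {b : ℂ → ℂ} {N : ℕ}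

theorem Rhat_mul_Rhat_neg (hb : IsXXX b ∨ IsXXZ b) (η u : ℂ) :
    Rhat b η u * Rhat b η (-u) = (b (u + η) * b (-u + η)) • 1 := by
  have key : b u * b (-u) + b η * b η = b (u + η) * b (-u + η) := by
    rcases hb with ⟨c, -, h⟩ | ⟨c, ν, -, -, h⟩
    · simp only [h]; ring
    · simp only [h, Complex.sinh, mul_add, neg_add, Complex.exp_add, Complex.exp_neg, mul_neg]
      field_simp
      ring
  have key2 : b u * b η + b η * b (-u) = 0 := by rw [b_neg hb]; ring
  ext ⟨p1, p2⟩ ⟨q1, q2⟩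
  simp only [Matrix.mul_apply, Fintype.sum_prod_type, Fin.sum_univ_two, Rhat, sixVertex,
    Matrix.of_apply, Matrix.smul_apply, Matrix.one_apply]
  fin_cases p1 <;> fin_cases p2 <;> fin_cases q1 <;> fin_cases q2 <;>
    simp <;> first | linear_combination key | linear_combination key2

/-- The sites with their inhomogeneities, outermost first. -/
def sites (t : Fin N → ℂ) : List (Fin N × ℂ) :=
  (List.finRange N).reverse.map fun s => (s, t s)

theorem doubleRow_eq_prod (η ξ : ℂ) (a : Fin N) (L : List (Fin N × ℂ)) (x : ℂ) :
    doubleRow b η ξ a L x = (L.map fun s => leg2 a s.1 (Rhat b η (s.2 - x))).prod *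
      leg1 a (Khat b ξ x) * (L.reverse.map fun s => leg2 a s.1 (Rhat b η (-x - s.2))).prod := by
  induction L with
  | nil => simp [doubleRow_nil]
  | cons s L ih =>
    rw [doubleRow_cons, ih]
    simp [mul_assoc]

theorem prod_map_smul {ι A : Type*} [Monoid A] [MulAction ℂ A] [IsScalarTower ℂ A A]
    [SMulCommClass ℂ A A] (L : List ι) (c : ι → ℂ) (f : ι → A) :
    (L.map fun s => c s • f s).prod = (L.map c).prod • (L.map f).prod := by
  induction L with
  | nil => simp
  | cons s L ih => simp only [List.map_cons, List.prod_cons, ih, smul_mul_smul_comm]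

theorem prod_finRange {G : Type*} [CommMonoid G] (f : Fin N → G) :
    ((List.finRange N).map f).prod = ∏ r, f r := by
  rw [← List.ofFn_eq_map, List.prod_ofFn]

theorem prod_finRange_reverse {G : Type*} [CommMonoid G] (f : Fin N → G) :
    ((List.finRange N).reverse.map f).prod = ∏ r, f r := by
  rw [← prod_finRange f]
  exact ((List.reverse_perm _).map f).prod_eq

theorem monodromy_eq (η x : ℂ) (t : Fin N → ℂ) :
    monodromy b η x t = (∏ r, b (x - t r + η))⁻¹ •
      ((List.finRange N).map fun r => leg2 0 r.succ (Rhat b η (x - t r))).prod := by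
  rw [monodromy, List.ofFn_eq_map]
  simp only [Rmat_eq, leg2_smul]
  rw [prod_map_smul, prod_finRange, Finset.prod_inv_distrib]

theorem monodromy_inv (hb : IsXXX b ∨ IsXXZ b) (η x : ℂ) (t : Fin N → ℂ)
    (h1 : ∀ r, b (x - t r + η) ≠ 0) (h2 : ∀ r, b (t r - x + η) ≠ 0) :
    (monodromy b η x t)⁻¹ = (∏ r, b (t r - x + η))⁻¹ •
      ((List.finRange N).reverse.map fun r => leg2 0 r.succ (Rhat b η (t r - x))).prod := by
  refine Matrix.inv_eq_left_inv ?_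
  rw [monodromy_eq, smul_mul_smul_comm]
  have key : ∀ l : List (Fin N), (l.reverse.map fun r => leg2 0 r.succ (Rhat b η (t r - x))).prod *
      (l.map fun r => leg2 0 r.succ (Rhat b η (x - t r))).prod =
      ((l.map fun r => b (t r - x + η)).prod * (l.map fun r => b (x - t r + η)).prod) • 1 := by
    intro l
    induction l with
    | nil => simp
    | cons r l ih =>
      have h := Rhat_mul_Rhat_neg hb η (t r - x)
      rw [neg_sub] at h
      rw [List.reverse_cons, List.map_append, List.prod_append, List.map_cons, List.prod_cons,
        List.map_cons, List.prod_cons, List.map_nil, List.prod_nil, mul_one, mul_assoc,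
        ← mul_assoc (leg2 _ _ _) (leg2 _ _ _), ← leg2_mul (Fin.succ_ne_zero r).symm, h, leg2_smul, leg2_one, smul_mul_assoc, one_mul,
        mul_smul_comm, ih, smul_smul]
      simp only [List.map_cons, List.prod_cons]
      congr 1
      ring
  rw [key, prod_finRange, prod_finRange, smul_smul]
  have e1 : (∏ r, b (t r - x + η)) ≠ 0 := Finset.prod_ne_zero_iff.2 fun r _ => h2 r
  have e2 : (∏ r, b (x - t r + η)) ≠ 0 := Finset.prod_ne_zero_iff.2 fun r _ => h1 r
  rw [show (∏ r, b (t r - x + η))⁻¹ * (∏ r, b (x - t r + η))⁻¹ *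
    ((∏ r, b (t r - x + η)) * ∏ r, b (x - t r + η)) = 1 by field_simp, one_smul]

theorem Kmat_inv (ξ x : ℂ) (h1 : b (ξ - x) ≠ 0) (h2 : b (ξ + x) ≠ 0) :
    (Kmat b ξ x)⁻¹ = (b (ξ - x))⁻¹ • Khat b ξ x := by
  refine Matrix.inv_eq_left_inv ?_
  rw [Kmat, Khat, smul_mul_assoc, Matrix.diagonal_mul_diagonal]
  ext i j
  fin_cases i <;> fin_cases j <;> simp <;> field_simp

theorem Kmat_eq (ξ x : ℂ) (h : b (ξ + x) ≠ 0) :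
    Kmat b ξ x = (b (ξ + x))⁻¹ • Khat b ξ (-x) := by
  rw [Kmat, Khat]
  ext i j
  fin_cases i <;> fin_cases j <;> simp [sub_eq_add_neg] <;> field_simp

/-- The denominator of the renormalized creation operator. -/
def poleFactor (b : ℂ → ℂ) (η : ℂ) (L : List (Fin N × ℂ)) (x : ℂ) : ℂ :=
  (L.map fun s => b (s.2 - x - η / 2) * b (-x - s.2 + η / 2)).prod

theorem boundaryB_eq (hb : IsXXX b ∨ IsXXZ b) (η ξ x : ℂ) (t : Fin N → ℂ)
    (h1 : ∀ r, b (x + η / 2 - t r + η) ≠ 0) (h2 : ∀ r, b (t r - x + η / 2) ≠ 0)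
    (h3 : b (ξ - x - η / 2) ≠ 0) (h4 : b (ξ + x + η / 2) ≠ 0) :
    boundaryB b η ξ (x + η / 2) t = ((∏ r, b (t r - x + η / 2)) * b (ξ - x - η / 2) *
      (∏ r, b (-x - t r + η / 2)))⁻¹ • rowBlocks b η ξ (sites t) x 0 1 := by
  have e : ∀ r, t r - (x + η / 2) + η = t r - x + η / 2 := fun r => by ring
  have e' : ∀ r, -(x + η / 2) - t r + η = -x - t r + η / 2 := fun r => by ring
  have e3 : ξ - (x + η / 2) = ξ - x - η / 2 := by ring
  have e4 : ξ + (x + η / 2) = ξ + x + η / 2 := by ring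
  have hM : boundaryMonodromy b η ξ (x + η / 2) t = ((∏ r, b (t r - x + η / 2)) *
      b (ξ - x - η / 2) * (∏ r, b (-x - t r + η / 2)))⁻¹ •
      doubleRow b η ξ 0 ((sites t).map (Prod.map Fin.succ id)) (x + η / 2) := by
    rw [boundaryMonodromy, monodromy_inv hb η (x + η / 2) t h1 (fun r => by rw [e]; exact h2 r),
      Kmat_inv ξ (x + η / 2) (by rwa [e3]) (by rwa [e4]), monodromy_eq, leg1_smul,
      smul_mul_smul_comm, smul_mul_smul_comm, doubleRow_eq_prod]
    simp only [e, e', e3]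
    congr 1
    · rw [mul_inv, mul_inv]
    · rw [sites]
      simp only [← List.map_reverse, List.reverse_reverse, List.map_map]
      rfl
  ext s s'
  rw [boundaryB, Matrix.of_apply, hM]
  rfl

theorem boundaryBbarFormula_eq (hb : IsXXX b ∨ IsXXZ b) (η ξ x : ℂ) (t : Fin N → ℂ)
    (h1 : ∀ r, b (x + η / 2 - t r + η) ≠ 0) (h2 : ∀ r, b (t r - x + η / 2) ≠ 0)
    (h3 : b (ξ - x - η / 2) ≠ 0) (h4 : b (ξ + x + η / 2) ≠ 0) (h5 : b (2 * x + η) ≠ 0) :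
    boundaryBbarFormula b η ξ x t =
      (poleFactor b η (sites t) x)⁻¹ • creation b η ξ (sites t) x := by
  have hn : ((sites t).map Prod.fst).Nodup := by
    rw [sites, List.map_map]
    simpa [Function.comp_def] using (List.nodup_finRange N)
  have hc := smul_creation hb η ξ x hn
  rw [boundaryBbarFormula, boundaryB_eq hb η ξ x t h1 h2 h3 h4, smul_smul]
  have e1 : ∀ r, b (x - t r - η / 2) = -b (t r - x + η / 2) := fun r => by
    rw [← b_neg hb]; congr 1; ring
  have e2 : ∀ r, b (x - t r + η / 2) = -b (t r - x - η / 2) := fun r => by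
    rw [← b_neg hb]; congr 1; ring
  have hp : poleFactor b η (sites t) x =
      (∏ r, b (t r - x - η / 2)) * ∏ r, b (-x - t r + η / 2) := by
    rw [poleFactor, sites, List.map_map, ← Finset.prod_mul_distrib]
    exact prod_finRange_reverse fun r => b (t r - x - η / 2) * b (-x - t r + η / 2)
  have e3 : (∏ r, b (t r - x + η / 2)) ≠ 0 := Finset.prod_ne_zero_iff.2 fun r _ => h2 r
  simp only [e1, e2, neg_div_neg_eq, Finset.prod_div_distrib]
  rw [hp]
  have hc' : creation b η ξ (sites t) x =
      (b (2 * x) / b (2 * x + η)) • rowBlocks b η ξ (sites t) x 0 1 := by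
    rw [div_eq_inv_mul, mul_smul, ← hc, smul_smul, inv_mul_cancel₀ h5, one_smul]
  rw [hc', smul_smul]
  congr 1
  generalize (∏ r, b (t r - x + η / 2)) = p at *
  generalize (∏ r, b (t r - x - η / 2)) = q, (∏ r, b (-x - t r + η / 2)) = q',
    b (2 * x) = β, b (2 * x + η) = γ, b (ξ - x - η / 2) = δ at *
  field_simp

theorem boundaryBbar_eq (hb : IsXXX b ∨ IsXXZ b) (η ξ x : ℂ) (t : Fin N → ℂ)
    (h : poleFactor b η (sites t) x ≠ 0) :
    boundaryBbar b η ξ x t = (poleFactor b η (sites t) x)⁻¹ • creation b η ξ (sites t) x := by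
  have hbc := b_continuous hb
  have hcp : Continuous (poleFactor b η (sites t)) := by
    unfold poleFactor
    induction sites t with
    | nil => exact continuous_const
    | cons s L ih =>
      simp only [List.map_cons, List.prod_cons]
      fun_prop
  refine Tendsto.limUnder_eq ?_
  have hcont : ContinuousAt (fun y => (poleFactor b η (sites t) y)⁻¹ •
      creation b η ξ (sites t) y) x :=
    (hcp.continuousAt.inv₀ h).smul (continuous_creation hb η ξ _).continuousAt
  refine (hcont.tendsto.mono_left nhdsWithin_le_nhds).congr' ?_
  have g1 : ∀ᶠ y in 𝓝[≠] x, ∀ r, b (y + η / 2 - t r + η) ≠ 0 := eventually_all.2 fun r => by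
    filter_upwards [eventually_b_ne_zero hb 1 (η / 2 - t r + η) x one_ne_zero] with y hy
    rwa [show y + η / 2 - t r + η = 1 * y + (η / 2 - t r + η) by ring]
  have g2 : ∀ᶠ y in 𝓝[≠] x, ∀ r, b (t r - y + η / 2) ≠ 0 := eventually_all.2 fun r => by
    filter_upwards [eventually_b_ne_zero hb (-1) (t r + η / 2) x (by simp)] with y hy
    rwa [show t r - y + η / 2 = -1 * y + (t r + η / 2) by ring]
  filter_upwards [g1, g2, eventually_b_ne_zero hb (-1) (ξ - η / 2) x (by simp),
    eventually_b_ne_zero hb 1 (ξ + η / 2) x one_ne_zero, eventually_b_two_mul_ne_zero hb η x]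
    with y h1 h2 h3 h4 h5
  refine (boundaryBbarFormula_eq hb η ξ y t h1 h2 ?_ ?_ h5).symm
  · rwa [show ξ - y - η / 2 = -1 * y + (ξ - η / 2) by ring]
  · rwa [show ξ + y + η / 2 = 1 * y + (ξ + η / 2) by ring]

theorem boundaryBethe_eq (hb : IsXXX b ∨ IsXXZ b) (η ξ : ℂ) {M : ℕ} (x : Fin M → ℂ)
    (t : Fin N → ℂ) (h : ∀ i, poleFactor b η (sites t) (x i) ≠ 0) :
    boundaryBethe b η ξ x t = (∏ i, poleFactor b η (sites t) (x i))⁻¹ •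
      bethe (creation b η ξ (sites t)) (pseudoVacuum N) (List.ofFn x) := by
  rw [boundaryBethe, bethe]
  simp only [boundaryBbar_eq hb η ξ _ t (h _)]
  rw [List.ofFn_eq_map, prod_map_smul, prod_finRange, Finset.prod_inv_distrib, Matrix.smul_mulVec,
    List.ofFn_eq_map, List.map_map]
  rfl

theorem finRange_split (r : Fin N) :
    List.finRange N = ((List.finRange N).filter fun s => s < r) ++
      r :: ((List.finRange N).filter fun s => r < s) := by
  have key : ∀ l : List (Fin N), l.Pairwise (· < ·) → r ∈ l →
      l = (l.filter fun s => s < r) ++ r :: (l.filter fun s => r < s) := by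
    intro l hl hr
    induction l with
    | nil => simp at hr
    | cons a l ih =>
      obtain ⟨ha, hl⟩ := List.pairwise_cons.1 hl
      rcases List.mem_cons.1 hr with rfl | hr
      · have h1 : (l.filter fun s => decide (s < r)) = [] :=
          List.filter_eq_nil_iff.2 fun s hs => by simpa using (ha s hs).le
        have h2 : (l.filter fun s => decide (r < s)) = l :=
          List.filter_eq_self.2 fun s hs => by simpa using ha s hs
        simp [h1, h2]
      · have h1 := ha r hr
        rw [List.filter_cons_of_pos (by simpa using h1),
          List.filter_cons_of_neg (by simpa using h1.le), List.cons_append, ← ih hl hr]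
  exact key _ (List.pairwise_lt_finRange N) (List.mem_finRange r)

end Identification

/-! ### The action of the transport operators on boundary Bethe vectors -/

section Transport

variable {b : ℂ → ℂ} {N : ℕ}

/-- The sites other than `r`, outermost first. -/
def otherSites (t : Fin N → ℂ) (r : Fin N) : List (Fin N × ℂ) :=
  (((List.finRange N).filter fun s => r < s).reverse.map fun s => (s, t s)) ++
    (((List.finRange N).filter fun s => s < r).reverse.map fun s => (s, t s))

theorem sites_eq (t : Fin N → ℂ) (r : Fin N) : sites t =
    (((List.finRange N).filter fun s => r < s).reverse.map fun s => (s, t s)) ++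
      (r, t r) :: (((List.finRange N).filter fun s => s < r).reverse.map fun s => (s, t s)) := by
  conv_lhs => rw [sites, finRange_split r]
  simp

theorem sites_perm (t : Fin N → ℂ) (r : Fin N) :
    (sites t).Perm ((r, t r) :: otherSites t r) := by
  rw [sites_eq t r, otherSites]
  exact List.perm_middle

theorem nodup_sites (t : Fin N → ℂ) : ((sites t).map Prod.fst).Nodup := by
  rw [sites, List.map_map]
  simpa [Function.comp_def] using (List.nodup_finRange N)

theorem nodup_otherSites (t : Fin N → ℂ) (r : Fin N) :
    ((otherSites t r).map Prod.fst).Nodup ∧ ∀ s ∈ otherSites t r, s.1 ≠ r := by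
  have h := (((sites_perm t r).map Prod.fst).nodup_iff).1 (nodup_sites t)
  simp only [List.map_cons, List.nodup_cons, List.mem_map, not_exists, not_and] at h
  exact ⟨h.2, fun s hs => h.1 s hs⟩

theorem mem_otherSites {t : Fin N → ℂ} {r : Fin N} {s : Fin N × ℂ} (h : s ∈ otherSites t r) :
    s.1 ≠ r ∧ s.2 = t s.1 := by
  refine ⟨(nodup_otherSites t r).2 s h, ?_⟩
  simp only [otherSites, List.mem_append, List.mem_map] at h
  rcases h with ⟨q, -, rfl⟩ | ⟨q, -, rfl⟩ <;> rfl

/-- The product `R_{r,r+1}(z - t_{r+1}) ⋯ R_{rN}(z - t_N)` that moves the leg `r` outermost. -/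
def moveOut (b : ℂ → ℂ) (η : ℂ) (r : Fin N) (t : Fin N → ℂ) (z : ℂ) :
    Matrix (Fin N → Fin 2) (Fin N → Fin 2) ℂ :=
  (((List.finRange N).filter fun s => r < s).map fun s => leg2 r s (Rmat b η (z - t s))).prod

theorem leg2_Rmat_mulVec_pseudoVacuum (η : ℂ) {r s : Fin N} {u : ℂ} (h : b (u + η) ≠ 0) :
    leg2 r s (Rmat b η u) *ᵥ pseudoVacuum N = pseudoVacuum N := by
  ext p
  rw [pseudoVacuum, Matrix.mulVec_single_one, Matrix.col_apply, leg2, Matrix.of_apply]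
  by_cases hp : p = fun _ => 0
  · subst hp
    simp [Rmat, h]
  · rw [Pi.single_eq_of_ne hp]
    split_ifs with h'
    · have : ¬(p r = 0 ∧ p s = 0) := fun h0 => hp (by
        ext k
        by_cases hk : k = r
        · rw [hk, h0.1]
        · by_cases hk' : k = s
          · rw [hk', h0.2]
          · rw [h' k hk hk'])
      have h1 : (p r, p s) ≠ (0, 0) := fun h0 => this (by simpa using h0)
      simp [Rmat, h1, Prod.swap]
    · rfl

theorem list_prod_mulVec {ι : Type*} {Ω : (Fin N → Fin 2) → ℂ}
    {f : ι → Matrix (Fin N → Fin 2) (Fin N → Fin 2) ℂ} {l : List ι}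
    (h : ∀ s ∈ l, f s *ᵥ Ω = Ω) : (l.map f).prod *ᵥ Ω = Ω := by
  induction l with
  | nil => simp
  | cons s l ih =>
    rw [List.map_cons, List.prod_cons, ← Matrix.mulVec_mulVec, ih fun q hq => h q (by simp [hq]),
      h s (by simp)]

theorem moveOut_mulVec_pseudoVacuum (η : ℂ) {r : Fin N} {t : Fin N → ℂ} {z : ℂ}
    (h : ∀ s, s ≠ r → b (z - t s + η) ≠ 0) :
    moveOut b η r t z *ᵥ pseudoVacuum N = pseudoVacuum N := by
  refine list_prod_mulVec fun s hs => leg2_Rmat_mulVec_pseudoVacuum η (h s ?_)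
  have := (List.mem_filter.1 hs).2
  exact (of_decide_eq_true this).ne'

theorem bethe_intertwine {ι : Type*} [Fintype ι] [DecidableEq ι] {C C' : ℂ → Matrix ι ι ℂ}
    {D : Matrix ι ι ℂ} {Ω : ι → ℂ} (h : ∀ x, C x * D = D * C' x) (hΩ : D *ᵥ Ω = Ω) (xs : List ℂ) :
    D *ᵥ bethe C' Ω xs = bethe C Ω xs := by
  induction xs with
  | nil => simp [bethe, hΩ]
  | cons x xs ih => rw [bethe_cons, bethe_cons, Matrix.mulVec_mulVec, ← h, ← Matrix.mulVec_mulVec, ih]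

theorem moveOut_mulVec_bethe (hb : IsXXX b ∨ IsXXZ b) (η ξ : ℂ) {r : Fin N} {t : Fin N → ℂ}
    (h : ∀ s, s ≠ r → b (t r - t s + η) ≠ 0) (xs : List ℂ) :
    moveOut b η r t (t r) *ᵥ
        bethe (creation b η ξ ((r, t r) :: otherSites t r)) (pseudoVacuum N) xs =
      bethe (creation b η ξ (sites t)) (pseudoVacuum N) xs := by
  refine bethe_intertwine (fun x => ?_) (moveOut_mulVec_pseudoVacuum η h) xs
  have hm := creation_move hb η ξ (r := r) (t r)
    (P := ((List.finRange N).filter fun s => r < s).reverse.map fun s => (s, t s))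
    (Q := ((List.finRange N).filter fun s => s < r).reverse.map fun s => (s, t s))
    (by rw [← sites_eq]; exact nodup_sites t) x
  rw [← sites_eq, ← List.map_reverse, List.reverse_reverse, List.map_map] at hm
  simp only [moveOut, Rmat_eq, leg2_smul]
  rw [prod_map_smul, mul_smul_comm, smul_mul_assoc]
  exact congrArg _ hm

/-- The Bethe vector for the sites other than `r`, corrected by the unwanted terms. Up to a scalar
this is the Bethe vector for all sites with the site `r` outermost and carrying the inhomogeneity
`Z - η / 2`. -/
def siteVec (b : ℂ → ℂ) (η ξ : ℂ) {M : ℕ} (r : Fin N) (x : Fin M → ℂ) (t : Fin N → ℂ) (Z : ℂ) :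
    (Fin N → Fin 2) → ℂ :=
  (∏ i, poleFactor b η (otherSites t r) (x i))⁻¹ •
    (bethe (creation b η ξ (otherSites t r)) (pseudoVacuum N) (List.ofFn x) -
      b η • legUnit r 1 0 *ᵥ residueSum b η (vacuumEigenvalue b η ξ (otherSites t r))
        (creation b η ξ (otherSites t r)) (pseudoVacuum N) (fun u => (b (Z + u))⁻¹) (List.ofFn x))

/-- The change of the Bethe vector's scalar prefactor under a shift of an inhomogeneity. -/
def shiftFactor (b : ℂ → ℂ) (η z x : ℂ) : ℂ :=
  b (z + η / 2 + x) * b (z + η / 2 - x) / (b (z - η / 2 + x) * b (z - η / 2 - x))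

theorem poleFactor_sites (hb : IsXXX b ∨ IsXXZ b) (η x : ℂ) (t : Fin N → ℂ) (r : Fin N) :
    poleFactor b η (sites t) x =
      -(b (t r - η / 2 + x) * b (t r - η / 2 - x)) * poleFactor b η (otherSites t r) x := by
  rw [poleFactor, ((sites_perm t r).map _).prod_eq, List.map_cons, List.prod_cons, poleFactor]
  have e1 : b (-x - t r + η / 2) = -b (t r - η / 2 + x) := by rw [← b_neg hb]; congr 1; ring
  have e2 : t r - x - η / 2 = t r - η / 2 - x := by ring
  rw [e1, e2]
  ring

variable {M : ℕ}

theorem boundaryBethe_eq_siteVec (hb : IsXXX b ∨ IsXXZ b) (η ξ : ℂ) {r : Fin N} {t : Fin N → ℂ}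
    {x : Fin M → ℂ} (hx : ∀ i j, i < j → Separated b (x i) (x j))
    (hp : ∀ i, poleFactor b η (sites t) (x i) ≠ 0)
    (hY : ∀ s, s ≠ r → b (t r - t s + η) ≠ 0) (hZ : ∀ i, Separated b (t r + η / 2) (x i)) :
    boundaryBethe b η ξ x t =
      (∏ i, shiftFactor b η (t r) (x i)) • moveOut b η r t (t r) *ᵥ
        siteVec b η ξ r x t (t r + η / 2) := by
  rw [boundaryBethe_eq hb η ξ x t hp, ← moveOut_mulVec_bethe hb η ξ hY,
    bethe_creation_cons hb η ξ (t r) (nodup_otherSites t r).1 (nodup_otherSites t r).2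
      (List.pairwise_ofFn.2 hx) (by simpa [List.mem_ofFn] using hZ), siteVec]
  simp only [Matrix.mulVec_smul, smul_smul]
  congr 1
  rw [List.map_ofFn, List.prod_ofFn, ← Finset.prod_inv_distrib, ← Finset.prod_inv_distrib,
    ← Finset.prod_mul_distrib, ← Finset.prod_mul_distrib]
  refine Finset.prod_congr rfl fun i _ => ?_
  have h := hp i
  rw [poleFactor_sites hb η (x i) t r] at h ⊢
  rw [shiftFactor]
  generalize poleFactor b η (otherSites t r) (x i) = P at *
  have h1 : b (t r - η / 2 + x i) ≠ 0 := fun h0 => h (by rw [h0]; ring)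
  have h2 : b (t r - η / 2 - x i) ≠ 0 := fun h0 => h (by rw [h0]; ring)
  have h3 : P ≠ 0 := fun h0 => h (by rw [h0]; ring)
  simp only [Function.comp_apply]
  generalize b (t r - η / 2 + x i) = u1, b (t r - η / 2 - x i) = u2, b (t r + η / 2 + x i) = u3,
    b (t r + η / 2 - x i) = u4 at *
  field_simp

theorem transport_mul_moveOut (η ξp ξm τ : ℂ) {r : Fin N} {t : Fin N → ℂ}
    (hK : b (ξm + t r) ≠ 0) :
    ∃ c : ℂ, transport b η ξp ξm τ r t * moveOut b η r t (t r) =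
      moveOut b η r t (t r + τ) * leg1 r (Kmat b ξp (t r + τ / 2)) *
        (c • doubleRow b η ξm r (otherSites t r) (-t r)) ∧
    ((∀ s, s ≠ r → b (t s + t r + η) ≠ 0) → (∀ s, s ≠ r → b (t r - t s + η) ≠ 0) →
      (c • doubleRow b η ξm r (otherSites t r) (-t r)) *ᵥ pseudoVacuum N = pseudoVacuum N) := by
  set above : List (Fin N) := (List.finRange N).filter fun s => r < s with habove
  set below : List (Fin N) := (List.finRange N).filter fun s => s < r with hbelow
  set A := ((above.reverse ++ below.reverse).map fun s => leg2 r s (Rmat b η (t s + t r))).prod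
  set B := ((below ++ above).map fun s => leg2 r s (Rmat b η (t r - t s))).prod
  have hne : ∀ s ∈ above.reverse ++ below.reverse, s ≠ r := by
    intro s hs
    simp only [List.mem_append, List.mem_reverse, habove, hbelow, List.mem_filter] at hs
    rcases hs with ⟨-, h⟩ | ⟨-, h⟩
    · exact (of_decide_eq_true h).ne'
    · exact (of_decide_eq_true h).ne
  have hne' : ∀ s ∈ below ++ above, s ≠ r := by
    intro s hs
    refine hne s ?_
    simp only [List.mem_append, List.mem_reverse] at hs ⊢
    exact hs.symm
  obtain ⟨c, hc⟩ : ∃ c : ℂ, A * leg1 r (Kmat b ξm (t r)) * B =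
      c • doubleRow b η ξm r (otherSites t r) (-t r) := by
    refine ⟨((above.reverse ++ below.reverse).map fun s => (b (t s + t r + η))⁻¹).prod *
      (b (ξm + t r))⁻¹ * ((below ++ above).map fun s => (b (t r - t s + η))⁻¹).prod, ?_⟩
    simp only [A, B, Rmat_eq, leg2_smul, Kmat_eq ξm (t r) hK, leg1_smul]
    rw [prod_map_smul, prod_map_smul, smul_mul_smul_comm, smul_mul_smul_comm, doubleRow_eq_prod,
      otherSites]
    simp only [← habove, ← hbelow, ← List.map_append, List.map_map, ← List.map_reverse,
      List.reverse_append, List.reverse_reverse, Function.comp_def, sub_neg_eq_add, neg_neg]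
  refine ⟨c, ?_, fun h1 h2 => ?_⟩
  · rw [← hc]
    have hR : ∀ s, leg2 s r (Rmat b η (t s + t r)) = leg2 r s (Rmat b η (t s + t r)) := fun s => by
      rw [Rmat_eq, leg2_smul, leg2_smul, Rhat_comm]
    have hS : ∀ s, t r - t s + τ = t r + τ - t s := fun s => by ring
    simp only [transport, moveOut, ← habove, ← hbelow, hR, hS, A, B, List.map_append,
      List.prod_append, mul_assoc]
  · rw [← hc, ← Matrix.mulVec_mulVec, ← Matrix.mulVec_mulVec,
      list_prod_mulVec fun s hs => leg2_Rmat_mulVec_pseudoVacuum η (h2 s (hne' s hs)),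
      leg1_mulVec_pseudoVacuum _ _ (by simp [Kmat]),
      show Kmat b ξm (t r) 0 0 = 1 by simp [Kmat], one_smul,
      list_prod_mulVec fun s hs => leg2_Rmat_mulVec_pseudoVacuum η (h1 s (hne s hs))]

theorem transport_mulVec_boundaryBethe (hb : IsXXX b ∨ IsXXZ b) (η ξp ξm τ : ℂ) {r : Fin N}
    {t : Fin N → ℂ} {x : Fin M → ℂ} (hx : ∀ i j, i < j → Separated b (x i) (x j))
    (hp : ∀ i, poleFactor b η (sites t) (x i) ≠ 0)
    (hY : ∀ s, s ≠ r → b (t r - t s + η) ≠ 0) (hY' : ∀ s, s ≠ r → b (t s + t r + η) ≠ 0)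
    (hK : b (ξm + t r) ≠ 0) (hZ : ∀ i, Separated b (-t r + η / 2) (x i)) :
    transport b η ξp ξm τ r t *ᵥ boundaryBethe b η ξm x t =
      moveOut b η r t (t r + τ) *ᵥ leg1 r (Kmat b ξp (t r + τ / 2)) *ᵥ
        siteVec b η ξm r x t (-t r + η / 2) := by
  obtain ⟨c, hc, hcΩ⟩ := transport_mul_moveOut (b := b) η ξp ξm τ (r := r) (t := t) hK
  have hr := creation_reflect hb η ξm (t r) (nodup_otherSites t r).1 (nodup_otherSites t r).2
  have hi := bethe_intertwine (C := creation b η ξm ((r, -t r) :: otherSites t r))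
    (C' := creation b η ξm ((r, t r) :: otherSites t r)) (fun x => by
      rw [mul_smul_comm, hr, smul_mul_assoc]) (hcΩ hY' hY) (List.ofFn x)
  rw [boundaryBethe_eq hb η ξm x t hp, ← moveOut_mulVec_bethe hb η ξm hY, Matrix.mulVec_smul,
    Matrix.mulVec_mulVec, hc, ← Matrix.mulVec_mulVec, hi,
    bethe_creation_cons hb η ξm (-t r) (nodup_otherSites t r).1 (nodup_otherSites t r).2
      (List.pairwise_ofFn.2 hx) (by simpa [List.mem_ofFn] using hZ), siteVec,
    ← Matrix.mulVec_mulVec]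
  simp only [Matrix.mulVec_smul, smul_smul]
  congr 1
  rw [List.map_ofFn, List.prod_ofFn, ← Finset.prod_inv_distrib, ← Finset.prod_inv_distrib,
    ← Finset.prod_mul_distrib]
  refine Finset.prod_congr rfl fun i _ => ?_
  have h := hp i
  rw [poleFactor_sites hb η (x i) t r] at h ⊢
  simp only [Function.comp_apply]
  have e1 : b (-t r + η / 2 + x i) = -b (t r - η / 2 - x i) := by rw [← b_neg hb]; congr 1; ring
  have e2 : b (-t r + η / 2 - x i) = -b (t r - η / 2 + x i) := by rw [← b_neg hb]; congr 1; ring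
  rw [e1, e2]
  generalize poleFactor b η (otherSites t r) (x i) = P at *
  have h1 : b (t r - η / 2 + x i) ≠ 0 := fun h0 => h (by rw [h0]; ring)
  have h2 : b (t r - η / 2 - x i) ≠ 0 := fun h0 => h (by rw [h0]; ring)
  have h3 : P ≠ 0 := fun h0 => h (by rw [h0]; ring)
  generalize b (t r - η / 2 + x i) = u1, b (t r - η / 2 - x i) = u2 at *
  field_simp

end Transport

/-! ### Residues of the summands and their behaviour under lattice shifts -/

section Shift

variable {b : ℂ → ℂ} {N M : ℕ}

/-- The coefficient of `(b (Z + u))⁻¹` in the unwanted terms, where `u` is one of `± x i`. -/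
def residueTerm (b : ℂ → ℂ) (η ξ : ℂ) (r : Fin N) (t : Fin N → ℂ) (x : Fin M → ℂ) (i : Fin M)
    (u : ℂ) : (Fin N → Fin 2) → ℂ :=
  ((∏ k, poleFactor b η (otherSites t r) (x k))⁻¹ *
    (b η * (vacuumEigenvalue b η ξ (otherSites t r) u *
      ∏ k, if k = i then 1 else scatter b η u (x k)))) •
    legUnit r 1 0 *ᵥ ((List.ofFn fun k => if k = i then 1 else
      creation b η ξ (otherSites t r) (x k)).prod *ᵥ pseudoVacuum N)

theorem siteVec_eq (η ξ : ℂ) (r : Fin N) (x : Fin M → ℂ) (t : Fin N → ℂ) (Z : ℂ) :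
    siteVec b η ξ r x t Z = (∏ i, poleFactor b η (otherSites t r) (x i))⁻¹ •
        bethe (creation b η ξ (otherSites t r)) (pseudoVacuum N) (List.ofFn x) -
      ∑ i, ((b (Z + x i))⁻¹ • residueTerm b η ξ r t x i (x i) -
        (b (Z - x i))⁻¹ • residueTerm b η ξ r t x i (-x i)) := by
  rw [siteVec, smul_sub, residueSum_ofFn, Matrix.mulVec_sum, Finset.smul_sum, Finset.smul_sum]
  congr 1
  refine Finset.sum_congr rfl fun i _ => ?_
  rw [residueTerm, residueTerm, Matrix.mulVec_smul, ← sub_eq_add_neg Z]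
  module

theorem prod_Ioi_eq {G : Type*} [CommMonoid G] (H : Fin M → Fin M → G) (i : Fin M) :
    ∏ a, ∏ c ∈ Finset.Ioi a, H a c =
      (∏ k, if k = i then 1 else if i < k then H i k else H k i) *
        ∏ a, ∏ c ∈ Finset.Ioi a, if a = i ∨ c = i then 1 else H a c := by
  have h1 : ∀ H : Fin M → Fin M → G, ∏ a, ∏ c ∈ Finset.Ioi a, H a c =
      ∏ a, ∏ c, if a < c then H a c else 1 := fun H => by
    refine Finset.prod_congr rfl fun a _ => ?_
    rw [← Finset.prod_filter]
    congr 1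
    ext c
    simp
  have h2 : ∀ a c, (if a < c then H a c else 1) =
      ((if a = i then (if i < c then H i c else 1) else 1) *
        (if c = i then (if a < i then H a i else 1) else 1)) *
          (if a < c then (if a = i ∨ c = i then 1 else H a c) else 1) := by
    intro a c
    by_cases ha : a = i
    · subst ha
      by_cases hc : c = a
      · subst hc; simp
      · simp [hc]
    · by_cases hc : c = i
      · subst hc; simp [ha]
      · simp [ha, hc]
  rw [h1, h1, Finset.prod_congr rfl fun a _ => Finset.prod_congr rfl fun c _ => h2 a c]
  simp only [Finset.prod_mul_distrib]
  congr 1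
  rw [Finset.prod_comm (f := fun a c => if c = i then (if a < i then H a i else 1) else 1)]
  have h3 : ∀ f : Fin M → Fin M → G, (∏ a, ∏ c, if a = i then f a c else 1) = ∏ c, f i c := by
    intro f
    rw [Finset.prod_eq_single i]
    · simp
    · intro a _ ha; simp [ha]
    · simp
  rw [h3 (fun _ c => if i < c then H i c else 1), h3 (fun _ c => if c < i then H c i else 1),
    ← Finset.prod_mul_distrib]
  refine Finset.prod_congr rfl fun k _ => ?_
  rcases lt_trichotomy k i with h | rfl | h
  · simp [h.ne, h.not_gt, h]
  · simp
  · simp [h.ne', h.not_gt, h]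

theorem prod_sites {G : Type*} [CommMonoid G] (f : ℂ → G) (t : Fin N → ℂ) (r : Fin N) :
    ∏ s, f (t s) = f (t r) * ((otherSites t r).map fun s => f s.2).prod := by
  have h := ((sites_perm t r).map fun s => f s.2).prod_eq
  rw [List.map_cons, List.prod_cons] at h
  rw [← h, sites, List.map_map]
  exact (prod_finRange_reverse fun s => f (t s)).symm

/-- The part of the weight that involves the lattice coordinate `x i`. -/
theorem weight_eq (g h F : ℂ → ℂ) (x : Fin M → ℂ) (t : Fin N → ℂ) (r : Fin N) (i : Fin M) :
    ∃ w : ℂ, ∀ y, weight g h F (Function.update x i y) t = g y *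
      (∏ k, if k = i then 1 else if i < k then h (y + x k) * h (y - x k) else
        h (x k + y) * h (x k - y)) *
      (F (t r + y) * F (t r - y) *
        ((otherSites t r).map fun s => F (s.2 + y) * F (s.2 - y)).prod) * w := by
  refine ⟨(∏ k, if k = i then 1 else g (x k)) *
    (∏ a, ∏ c ∈ Finset.Ioi a, if a = i ∨ c = i then 1 else h (x a + x c) * h (x a - x c)) *
    ∏ s, ∏ k, if k = i then 1 else F (t s + x k) * F (t s - x k), fun y => ?_⟩
  have e : ∀ k, Function.update x i y k = if k = i then y else x k := fun k => by
    by_cases hk : k = i <;> simp [hk]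
  have h1 : ∀ f : ℂ → ℂ, (∏ k, f (Function.update x i y k)) =
      f y * ∏ k, if k = i then 1 else f (x k) := fun f => by
    have : ∀ k, f (Function.update x i y k) =
        (if k = i then f y else 1) * (if k = i then 1 else f (x k)) := fun k => by
      by_cases hk : k = i
      · subst hk; simp
      · simp [hk]
    simp only [this, Finset.prod_mul_distrib, Finset.prod_ite_eq', Finset.mem_univ, if_true]
  rw [weight, h1 g, prod_Ioi_eq _ i]
  have h2 : ∀ s, (∏ k, F (t s + Function.update x i y k) * F (t s - Function.update x i y k)) =
      F (t s + y) * F (t s - y) * ∏ k, if k = i then 1 else F (t s + x k) * F (t s - x k) :=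
    fun s => h1 fun u => F (t s + u) * F (t s - u)
  simp only [h2, Finset.prod_mul_distrib (f := fun s => F (t s + y) * F (t s - y))]
  rw [prod_sites (fun z => F (z + y) * F (z - y)) t r]
  have h3 : (∏ k, if k = i then 1 else if i < k then
      h (Function.update x i y i + Function.update x i y k) *
        h (Function.update x i y i - Function.update x i y k) else
      h (Function.update x i y k + Function.update x i y i) *
        h (Function.update x i y k - Function.update x i y i)) =
      ∏ k, if k = i then 1 else if i < k then h (y + x k) * h (y - x k) else
        h (x k + y) * h (x k - y) := by
    refine Finset.prod_congr rfl fun k _ => ?_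
    by_cases hk : k = i <;> simp [hk]
  have h4 : (∏ a, ∏ c ∈ Finset.Ioi a, if a = i ∨ c = i then 1 else
      h (Function.update x i y a + Function.update x i y c) *
        h (Function.update x i y a - Function.update x i y c)) =
      ∏ a, ∏ c ∈ Finset.Ioi a, if a = i ∨ c = i then 1 else h (x a + x c) * h (x a - x c) := by
    refine Finset.prod_congr rfl fun a _ => Finset.prod_congr rfl fun c _ => ?_
    by_cases ha : a = i <;> by_cases hc : c = i <;> simp [ha, hc]
  rw [h3, h4]
  ring

/-- The functional equations of `F` turn the vacuum eigenvalue at the reflected shifted point into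
the one at the original point. -/
theorem prod_F_shift (hb : IsXXX b ∨ IsXXZ b) (η τ : ℂ) (F : ℂ → ℂ) {x : ℂ}
    {L : List (Fin N × ℂ)}
    (h1 : ∀ s ∈ L, b (s.2 + x + τ + η / 2) ≠ 0 ∧ b (s.2 - x - η / 2) ≠ 0 ∧
      F (s.2 + x + τ) * b (s.2 + x + τ + η / 2) = b (s.2 + x + τ - η / 2) * F (s.2 + x) ∧
      F (s.2 - x) * b (s.2 - x + η / 2) = b (s.2 - x - η / 2) * F (s.2 - x - τ))
    (hp : poleFactor b η L x ≠ 0) (hp' : poleFactor b η L (x + τ) ≠ 0) :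
    (L.map fun s => F (s.2 + (x + τ)) * F (s.2 - (x + τ))).prod *
        (poleFactor b η L (x + τ))⁻¹ *
        (L.map fun s => b (s.2 - (-(x + τ)) + η / 2) * b (-(-(x + τ)) - s.2 + η / 2)).prod =
      (L.map fun s => F (s.2 + x) * F (s.2 - x)).prod * (poleFactor b η L x)⁻¹ *
        (L.map fun s => b (s.2 - x + η / 2) * b (-x - s.2 + η / 2)).prod := by
  induction L with
  | nil => simp [poleFactor]
  | cons s L ih =>
    simp only [poleFactor, List.map_cons, List.prod_cons] at hp hp' ih ⊢
    obtain ⟨q1, q2⟩ := mul_ne_zero_iff.1 hp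
    obtain ⟨q1', q2'⟩ := mul_ne_zero_iff.1 hp'
    have ih' := ih (fun s hs => h1 s (by simp [hs])) q2 q2'
    obtain ⟨d1, d2, f1, f2⟩ := h1 s (by simp)
    have e1 : b (s.2 - (x + τ) - η / 2) = -b (x + τ - s.2 + η / 2) := by
      rw [← b_neg hb]; congr 1; ring
    have e2 : b (-(x + τ) - s.2 + η / 2) = -b (s.2 + x + τ - η / 2) := by
      rw [← b_neg hb]; congr 1; ring
    have e3 : b (s.2 - -(x + τ) + η / 2) = b (s.2 + x + τ + η / 2) := by congr 1; ring
    have e4 : b (- -(x + τ) - s.2 + η / 2) = b (x + τ - s.2 + η / 2) := by congr 1; ring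
    have e5 : F (s.2 + (x + τ)) = F (s.2 + x + τ) := by congr 1; ring
    have e6 : F (s.2 - (x + τ)) = F (s.2 - x - τ) := by congr 1; ring
    rw [e1, e2] at q1'
    obtain ⟨u1, u2⟩ := mul_ne_zero_iff.1 q1
    obtain ⟨u3, u4⟩ := mul_ne_zero_iff.1 q1'
    have u3' : b (x + τ - s.2 + η / 2) ≠ 0 := neg_ne_zero.1 u3
    have u4' : b (s.2 + x + τ - η / 2) ≠ 0 := neg_ne_zero.1 u4
    rw [e1, e2, e3, e4, e5, e6]
    have key : F (s.2 + x + τ) * F (s.2 - x - τ) *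
        (-b (x + τ - s.2 + η / 2) * -b (s.2 + x + τ - η / 2))⁻¹ *
        (b (s.2 + x + τ + η / 2) * b (x + τ - s.2 + η / 2)) = F (s.2 + x) * F (s.2 - x) *
        (b (s.2 - x - η / 2) * b (-x - s.2 + η / 2))⁻¹ *
        (b (s.2 - x + η / 2) * b (-x - s.2 + η / 2)) := by
      generalize F (s.2 + x + τ) = Fa, F (s.2 - x - τ) = Fb, F (s.2 + x) = Fc, F (s.2 - x) = Fd,
        b (s.2 + x + τ + η / 2) = b1, b (s.2 + x + τ - η / 2) = b2, b (s.2 - x + η / 2) = b3,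
        b (s.2 - x - η / 2) = b4, b (x + τ - s.2 + η / 2) = b5, b (-x - s.2 + η / 2) = b6 at *
      field_simp
      linear_combination Fb * b4 * f1 - Fc * b2 * f2
    rw [mul_inv, mul_inv]
    linear_combination key * (L.map fun s => F (s.2 + (x + τ)) * F (s.2 - (x + τ))).prod *
      (List.map (fun s => b (s.2 - (x + τ) - η / 2) * b (-(x + τ) - s.2 + η / 2)) L).prod⁻¹ *
      (L.map fun s => b (s.2 - (-(x + τ)) + η / 2) * b (-(-(x + τ)) - s.2 + η / 2)).prod +
      (F (s.2 + x) * F (s.2 - x) *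
        (b (s.2 - x - η / 2) * b (-x - s.2 + η / 2))⁻¹ *
        (b (s.2 - x + η / 2) * b (-x - s.2 + η / 2))) * ih'

/-- The functional equation of `h`. -/
theorem h_shift (hb : IsXXX b ∨ IsXXZ b) (η τ : ℂ) (h : ℂ → ℂ) {x y : ℂ}
    (hxy : Separated b x y) (hxy' : Separated b (x + τ) y)
    (h1 : h (x + y + τ) * (b (x + y) * b (x + y + τ - η)) =
      b (x + y + τ) * b (x + y + η) * h (x + y))
    (h2 : h (x - y + τ) * (b (x - y) * b (x - y + τ - η)) =
      b (x - y + τ) * b (x - y + η) * h (x - y)) :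
    h (x + τ + y) * h (x + τ - y) * scatter b η (-(x + τ)) y =
      h (x + y) * h (x - y) * scatter b η x y := by
  obtain ⟨u1, u2⟩ := hxy
  obtain ⟨u3, u4⟩ := hxy'
  have e1 : b (-(x + τ) + y + η) = -b (x - y + τ - η) := by rw [← b_neg hb]; congr 1; ring
  have e2 : b (-(x + τ) - y + η) = -b (x + y + τ - η) := by rw [← b_neg hb]; congr 1; ring
  have e3 : b (-(x + τ) + y) = -b (x - y + τ) := by rw [← b_neg hb]; congr 1; ring
  have e4 : b (-(x + τ) - y) = -b (x + y + τ) := by rw [← b_neg hb]; congr 1; ring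
  have e5 : x + τ + y = x + y + τ := by ring
  have e6 : x + τ - y = x - y + τ := by ring
  rw [scatter, scatter, e1, e2, e3, e4]
  rw [e5] at u3 ⊢
  rw [e6] at u4 ⊢
  generalize b (x + y) = b1, b (x + y + τ) = b2, b (x + y + η) = b3, b (x + y + τ - η) = b4,
    h (x + y + τ) = h5, h (x + y) = h6, b (x - y) = c1, b (x - y + τ) = c2, b (x - y + η) = c3,
    b (x - y + τ - η) = c4, h (x - y + τ) = h7, h (x - y) = h8 at *
  field_simp
  linear_combination h7 * c1 * c4 * h1 + b2 * b3 * h6 * h2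

/-- The equation of `h` for the reversed difference. -/
theorem h_shift_neg (hb : IsXXX b ∨ IsXXZ b) (η τ : ℂ) (h : ℂ → ℂ) {x y : ℂ}
    (hxy : Separated b x y) (hxy' : Separated b (x + τ) y)
    (h1 : h (x + y + τ) * (b (x + y) * b (x + y + τ - η)) =
      b (x + y + τ) * b (x + y + η) * h (x + y))
    (h2 : h (y - x) * (b (y - x - τ) * b (y - x - η)) =
      b (y - x) * b (y - x - τ + η) * h (y - x - τ)) :
    h (y + (x + τ)) * h (y - (x + τ)) * scatter b η (-(x + τ)) y =
      h (y + x) * h (y - x) * scatter b η x y := by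
  obtain ⟨u1, u2⟩ := hxy
  obtain ⟨u3, u4⟩ := hxy'
  have e1 : b (-(x + τ) + y + η) = b (y - x - τ + η) := by congr 1; ring
  have e2 : b (-(x + τ) - y + η) = -b (x + y + τ - η) := by rw [← b_neg hb]; congr 1; ring
  have e3 : b (-(x + τ) + y) = b (y - x - τ) := by congr 1; ring
  have e4 : b (-(x + τ) - y) = -b (x + y + τ) := by rw [← b_neg hb]; congr 1; ring
  have e5 : x + τ + y = x + y + τ := by ring
  have e6 : b (x + τ - y) = -b (y - x - τ) := by rw [← b_neg hb]; congr 1; ring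
  have e7 : y + (x + τ) = x + y + τ := by ring
  have e8 : y - (x + τ) = y - x - τ := by ring
  have e9 : b (x - y + η) = -b (y - x - η) := by rw [← b_neg hb]; congr 1; ring
  have e10 : b (x - y) = -b (y - x) := by rw [← b_neg hb]; congr 1; ring
  rw [scatter, scatter, e1, e2, e3, e4, e7, e8, e9, e10, add_comm y x]
  rw [e5] at u3
  rw [e6, neg_ne_zero] at u4
  rw [e10, neg_ne_zero] at u2
  generalize b (x + y) = b1, b (x + y + τ) = b2, b (x + y + η) = b3, b (x + y + τ - η) = b4,
    h (x + y + τ) = h5, h (x + y) = h6, b (y - x) = c1, b (y - x - τ) = c2, b (y - x - η) = c3,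
    b (y - x - τ + η) = c4, h (y - x - τ) = h7, h (y - x) = h8 at *
  field_simp
  linear_combination h7 * c1 * c4 * h1 - b2 * b3 * h6 * h2

/-- The partial fraction `W` built from the reflected and the shifted inhomogeneity. -/
def kernelW (b : ℂ → ℂ) (η ξp τ z u : ℂ) : ℂ :=
  (b (z + τ + η / 2 + u))⁻¹ -
    b (ξp - z - τ / 2) / b (ξp + z + τ / 2) * (b (-z + η / 2 + u))⁻¹

theorem kernelW_eq (hb : IsXXX b ∨ IsXXZ b) {η ξp τ z u : ℂ} (h1 : b (z + τ + η / 2 + u) ≠ 0)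
    (h2 : b (-z + η / 2 + u) ≠ 0) (h3 : b (ξp + z + τ / 2) ≠ 0) :
    kernelW b η ξp τ z u = -(b (2 * z + τ) * b (ξp - τ / 2 - η / 2 - u)) /
      (b (ξp + z + τ / 2) * b (z + τ + η / 2 + u) * b (-z + η / 2 + u)) := by
  have key : b (-z + η / 2 + u) * b (ξp + z + τ / 2) - b (ξp - z - τ / 2) *
      b (z + τ + η / 2 + u) = -(b (2 * z + τ) * b (ξp - τ / 2 - η / 2 - u)) := by
    rcases hb with ⟨c, -, h⟩ | ⟨c, ν, -, -, h⟩
    · simp only [h]; ring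
    · obtain ⟨η', rfl⟩ : ∃ η', η = 2 * η' := ⟨η / 2, by ring⟩
      obtain ⟨τ', rfl⟩ : ∃ τ', τ = 2 * τ' := ⟨τ / 2, by ring⟩
      simp only [mul_div_cancel_left₀ _ (two_ne_zero' ℂ)]
      simp only [h, Complex.sinh, two_mul, mul_add, mul_sub, neg_add, neg_sub, Complex.exp_add,
        Complex.exp_sub, Complex.exp_neg, mul_neg]
      field_simp
      ring
  rw [kernelW, ← key]
  generalize b (-z + η / 2 + u) = b1, b (z + τ + η / 2 + u) = b2, b (ξp + z + τ / 2) = b3 at *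
  field_simp

theorem shift_algebra {g g' A A' B B' H H' S S' P P' p p' a a' f f' W W' v w R c : ℂ}
    (hg : g' * (B' * A') = B * A * g) (hh : H' * S' = H * S) (hP : P' * p' * a' = P * p * a)
    (hW' : f' * W' = v * A') (hW : f * W = v * A) :
    g' * H' * (f' * P') * w * W' * (p' * R * (c * (B' * a' * S'))) =
      g * H * (f * P) * w * W * (p * R * (c * (B * a * S))) := by
  linear_combination g' * H' * P' * w * p' * R * c * B' * a' * S' * hW' +
    v * H' * P' * w * p' * R * c * a' * S' * hg + w * R * c * v * B * A * g * P' * p' * a' * hh +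
    w * R * c * v * B * A * g * H * S * hP - g * H * P * w * p * R * c * B * a * S * hW

/-- The shift of one lattice coordinate matches the residue at `u = - x i` of the shifted summand
with the residue at `u = x i` of the original one. -/
theorem weight_residueTerm_shift (hb : IsXXX b ∨ IsXXZ b) {η ξp ξm τ : ℂ} {g h F : ℂ → ℂ}
    {r : Fin N} {t : Fin N → ℂ} {x : Fin M → ℂ} {i : Fin M}
    (hg : g (x i + τ) * (b (ξm + x i + τ - η / 2) * b (ξp + x i + τ / 2 - η / 2)) =
      b (ξm - x i - η / 2) * b (ξp - x i - τ / 2 - η / 2) * g (x i))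
    (hh : ∀ k, i < k ∨ k < i → Separated b (x i) (x k) ∧ Separated b (x i + τ) (x k) ∧
      h (x i + x k + τ) * (b (x i + x k) * b (x i + x k + τ - η)) =
        b (x i + x k + τ) * b (x i + x k + η) * h (x i + x k))
    (hh1 : ∀ k, i < k → h (x i - x k + τ) * (b (x i - x k) * b (x i - x k + τ - η)) =
        b (x i - x k + τ) * b (x i - x k + η) * h (x i - x k))
    (hh2 : ∀ k, k < i → h (x k - x i) * (b (x k - x i - τ) * b (x k - x i - η)) =
      b (x k - x i) * b (x k - x i - τ + η) * h (x k - x i - τ))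
    (hF : ∀ s, b (t s + x i + τ + η / 2) ≠ 0 ∧ b (t s - x i - η / 2) ≠ 0 ∧
      F (t s + x i + τ) * b (t s + x i + τ + η / 2) = b (t s + x i + τ - η / 2) * F (t s + x i) ∧
      F (t s - x i) * b (t s - x i + η / 2) = b (t s - x i - η / 2) * F (t s - x i - τ))
    (hp : poleFactor b η (sites t) (x i) ≠ 0) (hp' : poleFactor b η (sites t) (x i + τ) ≠ 0)
    (hξ : b (ξp + t r + τ / 2) ≠ 0) (hz : b (t r - x i + η / 2) ≠ 0) :
    (weight g h F (Function.update x i (x i + τ)) t *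
        kernelW b η ξp τ (t r) (-(x i + τ))) •
        residueTerm b η ξm r t (Function.update x i (x i + τ)) i (-(x i + τ)) =
      (weight g h F x t * kernelW b η ξp τ (t r) (x i)) •
        residueTerm b η ξm r t x i (x i) := by
  obtain ⟨w, hw⟩ := weight_eq g h F x t r i
  have hw0 := hw (x i)
  rw [Function.update_eq_self] at hw0
  rw [hw, hw0, residueTerm, residueTerm]
  have e : ∀ y k, Function.update x i y k = if k = i then y else x k := fun y k => by
    by_cases hk : k = i <;> simp [hk]
  have hprod : ∀ y (f : ℂ → ℂ), (∏ k, f (Function.update x i y k)) =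
      f y * ∏ k, if k = i then 1 else f (x k) := fun y f => by
    have : ∀ k, f (Function.update x i y k) =
        (if k = i then f y else 1) * (if k = i then 1 else f (x k)) := fun k => by
      by_cases hk : k = i
      · subst hk; simp
      · simp [hk]
    simp only [this, Finset.prod_mul_distrib, Finset.prod_ite_eq', Finset.mem_univ, if_true]
  have hC : (fun k => if k = i then (1 : Matrix (Fin N → Fin 2) (Fin N → Fin 2) ℂ) else
      creation b η ξm (otherSites t r) (Function.update x i (x i + τ) k)) =
      fun k => if k = i then 1 else creation b η ξm (otherSites t r) (x k) := by
    ext1 k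
    by_cases hk : k = i <;> simp [hk]
  have hS : ∀ u, (∏ k, if k = i then 1 else
      scatter b η u (Function.update x i (x i + τ) k)) =
      ∏ k, if k = i then 1 else scatter b η u (x k) := fun u => by
    refine Finset.prod_congr rfl fun k _ => ?_
    by_cases hk : k = i <;> simp [hk]
  have hP := hprod (x i + τ) (poleFactor b η (otherSites t r))
  have hP0 := hprod (x i) (poleFactor b η (otherSites t r))
  rw [Function.update_eq_self] at hP0
  rw [hC, hS, hP, hP0, smul_smul, smul_smul]
  congr 1
  have hL : ∀ s ∈ otherSites t r, s.2 = t s.1 := fun s hs => (mem_otherSites hs).2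
  rw [poleFactor_sites hb η _ t r] at hp hp'
  obtain ⟨p1, p2⟩ := mul_ne_zero_iff.1 hp
  obtain ⟨p1', p2'⟩ := mul_ne_zero_iff.1 hp'
  have kF := prod_F_shift hb η τ F (x := x i) (L := otherSites t r)
    (fun s hs => by rw [hL s hs]; exact hF s.1) p2 p2'
  have kh : (∏ k, if k = i then 1 else if i < k then h (x i + τ + x k) * h (x i + τ - x k) else
      h (x k + (x i + τ)) * h (x k - (x i + τ))) *
      (∏ k, if k = i then 1 else scatter b η (-(x i + τ)) (x k)) =
      (∏ k, if k = i then 1 else if i < k then h (x i + x k) * h (x i - x k) else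
        h (x k + x i) * h (x k - x i)) * (∏ k, if k = i then 1 else scatter b η (x i) (x k)) := by
    rw [← Finset.prod_mul_distrib, ← Finset.prod_mul_distrib]
    refine Finset.prod_congr rfl fun k _ => ?_
    rcases lt_trichotomy k i with hk | rfl | hk
    · obtain ⟨a1, a2, a3⟩ := hh k (Or.inr hk)
      rw [if_neg hk.ne, if_neg hk.ne, if_neg hk.not_gt, if_neg hk.ne, if_neg hk.ne,
        if_neg hk.not_gt]
      exact h_shift_neg hb η τ h a1 a2 a3 (hh2 k hk)
    · simp
    · obtain ⟨a1, a2, a3⟩ := hh k (Or.inl hk)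
      rw [if_neg hk.ne', if_neg hk.ne', if_pos hk, if_neg hk.ne', if_neg hk.ne', if_pos hk]
      exact h_shift hb η τ h a1 a2 a3 (hh1 k hk)
  obtain ⟨d1, d2, f1, f2⟩ := hF r
  have q : b (t r - η / 2 + (x i + τ)) ≠ 0 ∧ b (t r - η / 2 - (x i + τ)) ≠ 0 :=
    mul_ne_zero_iff.1 (neg_ne_zero.1 p1')
  have q0 : b (t r - η / 2 + x i) ≠ 0 ∧ b (t r - η / 2 - x i) ≠ 0 :=
    mul_ne_zero_iff.1 (neg_ne_zero.1 p1)
  have c1 : b (t r + τ + η / 2 + -(x i + τ)) = b (t r - x i + η / 2) := by congr 1; ring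
  have c2 : b (-t r + η / 2 + -(x i + τ)) = -b (t r + x i + τ - η / 2) := by
    rw [← b_neg hb]; congr 1; ring
  have c3 : b (t r + τ + η / 2 + x i) = b (t r + x i + τ + η / 2) := by congr 1; ring
  have c4 : b (-t r + η / 2 + x i) = -b (t r - x i - η / 2) := by rw [← b_neg hb]; congr 1; ring
  have c5 : b (t r - η / 2 + (x i + τ)) = b (t r + x i + τ - η / 2) := by congr 1; ring
  have c6 : b (ξp - τ / 2 - η / 2 - -(x i + τ)) = b (ξp + x i + τ / 2 - η / 2) := by
    congr 1; ring
  have c7 : b (ξp - τ / 2 - η / 2 - x i) = b (ξp - x i - τ / 2 - η / 2) := by congr 1; ring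
  have c8 : b (ξm - -(x i + τ) - η / 2) = b (ξm + x i + τ - η / 2) := by congr 1; ring
  rw [c5] at q
  obtain ⟨w', hw1, hw2⟩ : ∃ w', F (t r + (x i + τ)) * F (t r - (x i + τ)) *
      kernelW b η ξp τ (t r) (-(x i + τ)) = w' * b (ξp + x i + τ / 2 - η / 2) ∧
      F (t r + x i) * F (t r - x i) * kernelW b η ξp τ (t r) (x i) =
        w' * b (ξp - x i - τ / 2 - η / 2) := by
    refine ⟨b (2 * t r + τ) * (F (t r + x i) * F (t r - x i)) / (b (ξp + t r + τ / 2) *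
      b (t r + x i + τ + η / 2) * b (t r - x i - η / 2)), ?_, ?_⟩
    · rw [kernelW_eq hb (by rwa [c1]) (by rw [c2]; exact neg_ne_zero.2 q.1) hξ, c1, c2, c6,
        ← add_assoc, ← sub_sub]
      obtain ⟨q1, q2⟩ := q
      clear hw hw0 hC hS hP hP0 kF kh hF hprod
      generalize F (t r + x i + τ) = Fa, F (t r - x i - τ) = Fb, F (t r + x i) = Fc,
        F (t r - x i) = Fd, b (t r + x i + τ + η / 2) = b1, b (t r + x i + τ - η / 2) = b2,
        b (t r - x i + η / 2) = b3, b (t r - x i - η / 2) = b4, b (2 * t r + τ) = b5,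
        b (ξp + t r + τ / 2) = b6, b (ξp + x i + τ / 2 - η / 2) = b7 at *
      field_simp
      linear_combination Fb * b4 * b5 * b7 * f1 - Fc * b2 * b5 * b7 * f2
    · rw [kernelW_eq hb (by rwa [c3]) (by rw [c4]; exact neg_ne_zero.2 d2) hξ, c3, c4, c7]
      clear hw hw0 hC hS hP hP0 kF kh hF hprod
      generalize F (t r + x i) = Fc, F (t r - x i) = Fd, b (t r + x i + τ + η / 2) = b1,
        b (t r - x i - η / 2) = b4, b (2 * t r + τ) = b5, b (ξp + t r + τ / 2) = b6 at *
      field_simp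
  rw [vacuumEigenvalue, vacuumEigenvalue, c8, mul_inv, mul_inv]
  exact shift_algebra hg kh kF hw1 hw2

end Shift

/-! ### Recovering residues from values of a sum of simple fractions -/

section Elimination

variable {b : ℂ → ℂ} {V : Type*} [NormedAddCommGroup V] [NormedSpace ℂ V]

/-- A product-to-sum identity for `b`. -/
theorem b_mul_sub_mul (hb : IsXXX b ∨ IsXXZ b) {p q r s : ℂ} (h : p + q = r + s) :
    b p * b q - b r * b s = b (p - s) * b (r - p) := by
  obtain rfl : q = r + s - p := by linear_combination h
  rcases hb with ⟨c, -, h⟩ | ⟨c, ν, -, -, h⟩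
  · simp only [h]; ring
  · simp only [h, Complex.sinh, mul_add, mul_sub, neg_sub, Complex.exp_add,
      Complex.exp_sub, Complex.exp_neg]
    field_simp
    ring

/-- Successive elimination of the poles `-y`, `y ∈ ys`, from the values `Y k` at `Z + k τ` of a sum
of simple fractions. -/
def eliminate (b : ℂ → ℂ) (τ Z : ℂ) (Y : ℕ → V) : List ℂ → ℕ → V
  | [], k => Y k
  | y :: ys, k => b (Z + (k + ys.length + 1 : ℕ) * τ + y) • eliminate b τ Z Y ys (k + 1) -
      b (Z + k * τ + y) • eliminate b τ Z Y ys k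

theorem eliminate_sum {ι : Type*} (τ Z : ℂ) (s : Finset ι) (Y : ι → ℕ → V) (ys : List ℂ) (k : ℕ) :
    eliminate b τ Z (fun k => ∑ a ∈ s, Y a k) ys k = ∑ a ∈ s, eliminate b τ Z (Y a) ys k := by
  induction ys generalizing k with
  | nil => rfl
  | cons y ys ih => simp only [eliminate, ih, Finset.smul_sum, Finset.sum_sub_distrib]

theorem eliminate_single (hb : IsXXX b ∨ IsXXZ b) (τ Z a : ℂ) (X : V)
    (h : ∀ k : ℕ, b (Z + k * τ + a) ≠ 0) (ys : List ℂ) (k : ℕ) :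
    eliminate b τ Z (fun k => (b (Z + k * τ + a))⁻¹ • X) ys k =
      ((ys.map fun y => b (a - y)).prod * (∏ j ∈ Finset.range ys.length, b ((j + 1 : ℕ) * τ)) *
        ∏ j ∈ Finset.range (ys.length + 1), (b (Z + (k + j : ℕ) * τ + a))⁻¹) • X := by
  induction ys generalizing k with
  | nil => simp [eliminate]
  | cons y ys ih =>
    rw [eliminate, ih, ih, List.map_cons, List.prod_cons, List.length_cons,
      Finset.prod_range_succ (fun j => b ((j + 1 : ℕ) * τ)), smul_smul, smul_smul, ← sub_smul]
    congr 1
    set m := ys.length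
    have e1 : ∏ j ∈ Finset.range (m + 1 + 1), (b (Z + (k + j : ℕ) * τ + a))⁻¹ =
        (b (Z + k * τ + a))⁻¹ * (∏ j ∈ Finset.range m, (b (Z + (k + (j + 1) : ℕ) * τ + a))⁻¹) *
          (b (Z + (k + m + 1 : ℕ) * τ + a))⁻¹ := by
      rw [Finset.prod_range_succ, Finset.prod_range_succ', mul_comm (∏ _ ∈ _, _)]
      rfl
    have e2 : ∏ j ∈ Finset.range (m + 1), (b (Z + (k + 1 + j : ℕ) * τ + a))⁻¹ =
        (∏ j ∈ Finset.range m, (b (Z + (k + (j + 1) : ℕ) * τ + a))⁻¹) *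
          (b (Z + (k + m + 1 : ℕ) * τ + a))⁻¹ := by
      rw [Finset.prod_range_succ]
      have : ∀ j, k + 1 + j = k + (j + 1) := fun j => by ring
      simp only [this]
      rfl
    have e3 : ∏ j ∈ Finset.range (m + 1), (b (Z + (k + j : ℕ) * τ + a))⁻¹ =
        (b (Z + k * τ + a))⁻¹ * ∏ j ∈ Finset.range m, (b (Z + (k + (j + 1) : ℕ) * τ + a))⁻¹ := by
      rw [Finset.prod_range_succ', mul_comm]
      rfl
    rw [e1, e2, e3]
    have h1 := h k
    have h2 := h (k + m + 1)
    have key := b_mul_sub_mul hb (p := Z + (k + m + 1 : ℕ) * τ + y) (q := Z + k * τ + a)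
      (r := Z + k * τ + y) (s := Z + (k + m + 1 : ℕ) * τ + a) (by ring)
    have e4 : b (Z + (k + m + 1 : ℕ) * τ + y - (Z + (k + m + 1 : ℕ) * τ + a)) = -b (a - y) := by
      rw [← b_neg hb]; congr 1; ring
    have e5 : b (Z + k * τ + y - (Z + (k + m + 1 : ℕ) * τ + y)) = -b ((m + 1 : ℕ) * τ) := by
      rw [← b_neg hb]; congr 1; push_cast; ring
    rw [e4, e5] at key
    generalize b (Z + (k + m + 1 : ℕ) * τ + a) = b1, b (Z + k * τ + a) = b2,
      b (Z + (k + m + 1 : ℕ) * τ + y) = b3, b (Z + k * τ + y) = b4,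
      (List.map (fun y => b (a - y)) ys).prod = p1,
      ∏ j ∈ Finset.range m, (b (Z + (k + (j + 1) : ℕ) * τ + a))⁻¹ = p2,
      ∏ j ∈ Finset.range m, b ((j + 1 : ℕ) * τ) = p3 at *
    field_simp
    linear_combination p1 * p2 * p3 * key

theorem norm_eliminate_le (τ Z : ℂ) (Y : ℕ → V) {B : ℝ} {n : ℕ} {ys : List ℂ}
    (hB : ∀ j ≤ n, ∀ y ∈ ys, ‖b (Z + j * τ + y)‖ ≤ B) {k : ℕ} (hk : k + ys.length ≤ n) :
    ‖eliminate b τ Z Y ys k‖ ≤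
      (2 * B) ^ ys.length * ∑ j ∈ Finset.range (ys.length + 1), ‖Y (k + j)‖ := by
  induction ys generalizing k with
  | nil => simp [eliminate]
  | cons y ys ih =>
    rw [List.length_cons] at hk ⊢
    have hB' : ∀ j ≤ n, ∀ y ∈ ys, ‖b (Z + j * τ + y)‖ ≤ B :=
      fun j hj q hq => hB j hj q (by simp [hq])
    have h1 := ih hB' (k := k + 1) (by omega)
    have h2 := ih hB' (k := k) (by omega)
    have hB0 : 0 ≤ B := (norm_nonneg _).trans (hB 0 (by omega) y (by simp))
    set m := ys.length
    have s1 : ∑ j ∈ Finset.range (m + 1), ‖Y (k + 1 + j)‖ ≤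
        ∑ j ∈ Finset.range (m + 1 + 1), ‖Y (k + j)‖ := by
      rw [Finset.sum_range_succ' _ (m + 1)]
      have : ∀ j, k + 1 + j = k + (j + 1) := fun j => by ring
      simp only [this]
      linarith [norm_nonneg (Y (k + 0))]
    have s2 : ∑ j ∈ Finset.range (m + 1), ‖Y (k + j)‖ ≤
        ∑ j ∈ Finset.range (m + 1 + 1), ‖Y (k + j)‖ := by
      rw [Finset.sum_range_succ _ (m + 1)]
      linarith [norm_nonneg (Y (k + (m + 1)))]
    set S := ∑ j ∈ Finset.range (m + 1 + 1), ‖Y (k + j)‖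
    have hpow : 0 ≤ (2 * B) ^ m := by positivity
    have t1 : ‖b (Z + (k + m + 1 : ℕ) * τ + y) • eliminate b τ Z Y ys (k + 1)‖ ≤
        B * ((2 * B) ^ m * S) := by
      rw [norm_smul]
      exact mul_le_mul (hB _ (by omega) y (by simp))
        (h1.trans (mul_le_mul_of_nonneg_left s1 hpow)) (norm_nonneg _) hB0
    have t2 : ‖b (Z + k * τ + y) • eliminate b τ Z Y ys k‖ ≤ B * ((2 * B) ^ m * S) := by
      rw [norm_smul]
      exact mul_le_mul (hB _ (by omega) y (by simp))
        (h2.trans (mul_le_mul_of_nonneg_left s2 hpow)) (norm_nonneg _) hB0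
    calc ‖eliminate b τ Z Y (y :: ys) k‖ ≤ B * ((2 * B) ^ m * S) + B * ((2 * B) ^ m * S) :=
          (norm_sub_le _ _).trans (add_le_add t1 t2)
      _ = (2 * B) ^ (m + 1) * S := by ring

/-- Each residue of a sum of simple fractions is controlled by finitely many values of the sum. -/
theorem norm_residue_le (hb : IsXXX b ∨ IsXXZ b) {ι : Type*} [Fintype ι] [DecidableEq ι]
    (τ Z : ℂ) (y : ι → ℂ) (X : ι → V) {B : ℝ}
    (hB : ∀ j < Fintype.card ι, ∀ a, ‖b (Z + j * τ + y a)‖ ≤ B)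
    (hne : ∀ (j : ℕ) a, b (Z + j * τ + y a) ≠ 0) (a₀ : ι) :
    ‖X a₀‖ * (∏ a ∈ Finset.univ.erase a₀, ‖b (y a₀ - y a)‖) *
        ∏ j ∈ Finset.range (Fintype.card ι - 1), ‖b ((j + 1 : ℕ) * τ)‖ ≤
      B ^ Fintype.card ι * (2 * B) ^ (Fintype.card ι - 1) *
        ∑ j ∈ Finset.range (Fintype.card ι), ‖∑ a, (b (Z + j * τ + y a))⁻¹ • X a‖ := by
  have hcard : 0 < Fintype.card ι := Fintype.card_pos_iff.2 ⟨a₀⟩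
  set ys : List ℂ := (Finset.univ.erase a₀).toList.map y with hys
  have hlen : ys.length = Fintype.card ι - 1 := by
    rw [hys, List.length_map, Finset.length_toList, Finset.card_erase_of_mem (Finset.mem_univ _),
      Finset.card_univ]
  have hlen' : ys.length + 1 = Fintype.card ι := by omega
  have hprod : ∀ f : ℂ → ℂ, (ys.map f).prod = ∏ a ∈ Finset.univ.erase a₀, f (y a) := fun f => by
    rw [hys, List.map_map, ← Finset.prod_map_toList]
    rfl
  have h1 := norm_eliminate_le (b := b) τ Z (fun k => ∑ a, (b (Z + k * τ + y a))⁻¹ • X a) (B := B)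
    (n := Fintype.card ι - 1) (ys := ys) (fun j hj q hq => by
      obtain ⟨a, -, rfl⟩ := List.mem_map.1 hq
      exact hB j (by omega) a) (k := 0) (by omega)
  rw [eliminate_sum, Finset.sum_eq_single a₀] at h1
  · rw [eliminate_single hb τ Z (y a₀) (X a₀) (fun k => hne k a₀), norm_smul, norm_mul, norm_mul,
      hprod, norm_prod, norm_prod, norm_prod, hlen', hlen] at h1
    simp only [zero_add, norm_inv, Finset.prod_inv_distrib] at h1
    have h2 : ∏ j ∈ Finset.range (Fintype.card ι), ‖b (Z + j * τ + y a₀)‖ ≤ B ^ Fintype.card ι := by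
      refine (Finset.prod_le_prod (fun _ _ => norm_nonneg _) (g := fun _ => B)
        fun j hj => hB j (Finset.mem_range.1 hj) a₀).trans ?_
      simp
    have h3 : 0 < ∏ j ∈ Finset.range (Fintype.card ι), ‖b (Z + j * τ + y a₀)‖ :=
      Finset.prod_pos fun j _ => norm_pos_iff.2 (hne j a₀)
    set P := ∏ j ∈ Finset.range (Fintype.card ι), ‖b (Z + j * τ + y a₀)‖
    set R := (2 * B) ^ (Fintype.card ι - 1) *
      ∑ j ∈ Finset.range (Fintype.card ι), ‖∑ a, (b (Z + j * τ + y a))⁻¹ • X a‖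
    have h4 : 0 ≤ R := (by positivity : (0 : ℝ) ≤ _).trans h1
    calc ‖X a₀‖ * (∏ a ∈ Finset.univ.erase a₀, ‖b (y a₀ - y a)‖) *
          ∏ j ∈ Finset.range (Fintype.card ι - 1), ‖b ((j + 1 : ℕ) * τ)‖
        = P * (((∏ a ∈ Finset.univ.erase a₀, ‖b (y a₀ - y a)‖) *
          ∏ j ∈ Finset.range (Fintype.card ι - 1), ‖b ((j + 1 : ℕ) * τ)‖) * P⁻¹ * ‖X a₀‖) := by
          generalize (∏ a ∈ Finset.univ.erase a₀, ‖b (y a₀ - y a)‖) = p,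
            (∏ j ∈ Finset.range (Fintype.card ι - 1), ‖b ((j + 1 : ℕ) * τ)‖) = q
          field_simp
      _ ≤ P * R := mul_le_mul_of_nonneg_left h1 h3.le
      _ ≤ B ^ Fintype.card ι * R := mul_le_mul_of_nonneg_right h2 h4
      _ = _ := by simp only [R, mul_assoc]
  · intro a _ ha
    rw [eliminate_single hb τ Z (y a) (X a) (fun k => hne k a), hprod,
      Finset.prod_eq_zero (Finset.mem_erase.2 ⟨ha, Finset.mem_univ a⟩) (by rw [sub_self, b_zero hb]),
      zero_mul, zero_mul, zero_smul]
  · intro h; exact absurd (Finset.mem_univ _) h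

end Elimination

/-! ### Telescoping sums over a lattice -/

section Telescoping

variable {b : ℂ → ℂ} {V : Type*} [NormedAddCommGroup V] [NormedSpace ℂ V] {M : ℕ}

/-- The sum of simple fractions in `Z` with poles at `∓ x i` and residues `Xp i n`, `Xm i n` at the
lattice point `x` with index `n`. -/
def cauchySum (b : ℂ → ℂ) (τ : ℂ) (x₀ : Fin M → ℂ) (Xp Xm : Fin M → (Fin M → ℤ) → V) (Z : ℂ)
    (n : Fin M → ℤ) : V :=
  ∑ i, ((b (Z + latticePoint τ x₀ n i))⁻¹ • Xp i n + (b (Z - latticePoint τ x₀ n i))⁻¹ • Xm i n)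

/-- Residues on the lattice `x₀ + τ ℤ^M` that cancel in pairs: the residue at `x i`, weighted with
`(b (Z + τ + u))⁻¹ - κ (b (Z' + u))⁻¹`, `u = x i`, is opposite to the residue at `- x i` of the next
lattice point in the direction `i`. -/
structure PairedResidues (b : ℂ → ℂ) (τ : ℂ) (x₀ : Fin M → ℂ) (Xp Xm : Fin M → (Fin M → ℤ) → V)
    (Z Z' κ : ℂ) : Prop where
  root : ∀ k : ℤ, k ≠ 0 → b (k * τ) ≠ 0
  sep_add : ∀ i j, i ≠ j → ∀ k : ℤ, b (x₀ i + x₀ j + τ * k) ≠ 0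
  sep_sub : ∀ i j, i ≠ j → ∀ k : ℤ, b (x₀ i - x₀ j + τ * k) ≠ 0
  lower : ∀ k : ℤ, ∃ c > 0, ∀ i, ∀ m : ℤ, c ≤ ‖b (Z + k * τ + (x₀ i + τ * m))‖ ∧
    c ≤ ‖b (Z + k * τ - (x₀ i + τ * m))‖
  lower' : ∃ c > 0, ∀ i, ∀ m : ℤ, c ≤ ‖b (Z' + (x₀ i + τ * m))‖ ∧
    c ≤ ‖b (Z' - (x₀ i + τ * m))‖
  summable : ∀ k : ℤ, Summable fun n => ‖cauchySum b τ x₀ Xp Xm (Z + k * τ) n‖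
  summable' : Summable fun n => ‖κ • cauchySum b τ x₀ Xp Xm Z' n‖
  ne : ∀ k : ℤ, b (Z + k * τ - Z') ≠ 0
  paired : ∀ i n,
    ((b (Z + τ + latticePoint τ x₀ n i))⁻¹ - κ * (b (Z' + latticePoint τ x₀ n i))⁻¹) • Xp i n +
    ((b (Z + τ + -(latticePoint τ x₀ n i + τ)))⁻¹ -
      κ * (b (Z' + -(latticePoint τ x₀ n i + τ)))⁻¹) • Xm i (n + Pi.single i 1) = 0

/-- The flow through the edge of the lattice that enters `n` in the direction `i`. -/
def flow (b : ℂ → ℂ) (τ : ℂ) (x₀ : Fin M → ℂ) (Xm : Fin M → (Fin M → ℤ) → V)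
    (Z Z' κ : ℂ) (i : Fin M) (n : Fin M → ℤ) : V :=
  ((b (Z + τ + -latticePoint τ x₀ n i))⁻¹ - κ * (b (Z' + -latticePoint τ x₀ n i))⁻¹) • Xm i n

/-- The discriminant factor of the coordinate `i`. -/
def discr (b : ℂ → ℂ) (τ : ℂ) (x₀ : Fin M → ℂ) (i : Fin M) (n : Fin M → ℤ) : ℝ :=
  ‖b (2 * latticePoint τ x₀ n i)‖ * ∏ k ∈ Finset.univ.erase i,
    (‖b (latticePoint τ x₀ n i + latticePoint τ x₀ n k)‖ *
      ‖b (latticePoint τ x₀ n i - latticePoint τ x₀ n k)‖)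

variable {τ : ℂ} {x₀ : Fin M → ℂ} {Xp Xm : Fin M → (Fin M → ℤ) → V} {Z Z' κ : ℂ}

theorem latticePoint_add_single (n : Fin M → ℤ) (i : Fin M) :
    latticePoint τ x₀ (n + Pi.single i 1) i = latticePoint τ x₀ n i + τ := by
  simp [latticePoint]; ring

theorem latticePoint_add_single_eq_update (n : Fin M → ℤ) (i : Fin M) :
    latticePoint τ x₀ (n + Pi.single i 1) =
      Function.update (latticePoint τ x₀ n) i (latticePoint τ x₀ n i + τ) := by
  ext k
  by_cases hk : k = i
  · subst hk; rw [latticePoint_add_single, Function.update_self]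
  · simp [latticePoint, hk]

/-- The difference of the two sums of simple fractions is the divergence of the flow. -/
theorem PairedResidues.sum_flow (hP : PairedResidues b τ x₀ Xp Xm Z Z' κ) (n : Fin M → ℤ) :
    cauchySum b τ x₀ Xp Xm (Z + τ) n - κ • cauchySum b τ x₀ Xp Xm Z' n =
      ∑ i, (flow b τ x₀ Xm Z Z' κ i n - flow b τ x₀ Xm Z Z' κ i (n + Pi.single i 1)) := by
  rw [cauchySum, cauchySum, Finset.smul_sum, ← Finset.sum_sub_distrib]
  refine Finset.sum_congr rfl fun i _ => ?_
  have h := hP.paired i n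
  rw [flow, flow, latticePoint_add_single, sub_eq_add_neg (Z + τ), sub_eq_add_neg Z']
  linear_combination (norm := module) h

theorem PairedResidues.flow_add_single (hP : PairedResidues b τ x₀ Xp Xm Z Z' κ) (i : Fin M)
    (n : Fin M → ℤ) : flow b τ x₀ Xm Z Z' κ i (n + Pi.single i 1) =
      -(((b (Z + τ + latticePoint τ x₀ n i))⁻¹ - κ * (b (Z' + latticePoint τ x₀ n i))⁻¹) •
        Xp i n) := by
  rw [flow, latticePoint_add_single, eq_neg_iff_add_eq_zero, add_comm]
  exact hP.paired i n

theorem norm_b_neg (hb : IsXXX b ∨ IsXXZ b) (x : ℂ) : ‖b (-x)‖ = ‖b x‖ := by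
  rw [b_neg hb, norm_neg]

/-- The flow through an edge, multiplied with the discriminant factor of either end, is controlled
by finitely many sums of simple fractions. -/
theorem PairedResidues.flow_bound (hb : IsXXX b ∨ IsXXZ b)
    (hP : PairedResidues b τ x₀ Xp Xm Z Z' κ) :
    ∃ K : ℝ, 0 ≤ K ∧ ∀ (n : Fin M → ℤ) (i : Fin M) (B : ℝ), 0 ≤ B →
      (∀ j < 2 * M, ∀ k, ‖b (Z + j * τ + latticePoint τ x₀ n k)‖ ≤ B ∧
        ‖b (Z + j * τ - latticePoint τ x₀ n k)‖ ≤ B) →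
      ‖flow b τ x₀ Xm Z Z' κ i n‖ * discr b τ x₀ i n ≤ K * B ^ (4 * M - 1) *
        ∑ j ∈ Finset.range (2 * M), ‖cauchySum b τ x₀ Xp Xm (Z + j * τ) n‖ ∧
      ‖flow b τ x₀ Xm Z Z' κ i (n + Pi.single i 1)‖ * discr b τ x₀ i n ≤ K * B ^ (4 * M - 1) *
        ∑ j ∈ Finset.range (2 * M), ‖cauchySum b τ x₀ Xp Xm (Z + j * τ) n‖ := by
  obtain ⟨c, hc, hlow⟩ := hP.lower 1
  obtain ⟨c', hc', hlow'⟩ := hP.lower'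
  simp only [Int.cast_one, one_mul] at hlow
  set Cw : ℝ := c⁻¹ + ‖κ‖ * c'⁻¹
  have hCw : 0 ≤ Cw := by positivity
  set Q : ℝ := ∏ j ∈ Finset.range (2 * M - 1), ‖b ((j + 1 : ℕ) * τ)‖ with hQdef
  have hQ : 0 < Q := Finset.prod_pos fun j _ => norm_pos_iff.2 (by
    have := hP.root (j + 1 : ℕ) (by positivity)
    simpa using this)
  refine ⟨Cw * 2 ^ (2 * M - 1) * Q⁻¹, by positivity, fun n i B hB0 hB => ?_⟩
  have hM : 0 < M := i.pos
  set x := latticePoint τ x₀ n with hx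
  let y : Fin M ⊕ Fin M → ℂ := Sum.elim x fun k => -x k
  let X : Fin M ⊕ Fin M → V := Sum.elim (fun k => Xp k n) fun k => Xm k n
  have hcard : Fintype.card (Fin M ⊕ Fin M) = 2 * M := by simp; ring
  have hsum : ∀ Z, (∑ a, (b (Z + y a))⁻¹ • X a) = cauchySum b τ x₀ Xp Xm Z n := fun Z => by
    rw [Fintype.sum_sum_type, cauchySum, Finset.sum_add_distrib]
    rfl
  have hres := norm_residue_le hb τ Z y X (B := B) (by
    rw [hcard]
    rintro j hj (k | k)
    · exact (hB j hj k).1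
    · exact (hB j hj k).2) (by
    rintro j (k | k)
    · obtain ⟨c, hc, h⟩ := hP.lower j
      have := (h k (n k)).1
      rw [Int.cast_natCast] at this
      exact norm_pos_iff.1 (hc.trans_le this)
    · obtain ⟨c, hc, h⟩ := hP.lower j
      have := (h k (n k)).2
      rw [Int.cast_natCast] at this
      exact norm_pos_iff.1 (hc.trans_le this))
  simp only [hcard, hsum] at hres
  rw [← hQdef] at hres
  set S := ∑ j ∈ Finset.range (2 * M), ‖cauchySum b τ x₀ Xp Xm (Z + j * τ) n‖
  have hS : 0 ≤ S := Finset.sum_nonneg fun _ _ => norm_nonneg _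
  have hpow : B ^ (2 * M) * (2 * B) ^ (2 * M - 1) = 2 ^ (2 * M - 1) * B ^ (4 * M - 1) := by
    rw [mul_pow, mul_left_comm, ← pow_add]
    congr 2
    omega
  have hd : ∀ f : Fin M ⊕ Fin M → ℝ, (∏ a ∈ Finset.univ.erase (Sum.inr i), f a) =
      f (Sum.inl i) * ∏ k ∈ Finset.univ.erase i, (f (Sum.inl k) * f (Sum.inr k)) := fun f => by
    have h1 : (Finset.univ.erase (Sum.inr i) : Finset (Fin M ⊕ Fin M)) =
        Finset.univ.disjSum (Finset.univ.erase i) := by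
      ext a; rcases a with a | a <;> simp
    rw [h1, Finset.prod_disjSum, ← Finset.mul_prod_erase _ _ (Finset.mem_univ i), mul_assoc,
      ← Finset.prod_mul_distrib]
  have hd' : ∀ f : Fin M ⊕ Fin M → ℝ, (∏ a ∈ Finset.univ.erase (Sum.inl i), f a) =
      f (Sum.inr i) * ∏ k ∈ Finset.univ.erase i, (f (Sum.inl k) * f (Sum.inr k)) := fun f => by
    have h1 : (Finset.univ.erase (Sum.inl i) : Finset (Fin M ⊕ Fin M)) =
        (Finset.univ.erase i).disjSum Finset.univ := by
      ext a; rcases a with a | a <;> simp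
    rw [h1, Finset.prod_disjSum, ← Finset.mul_prod_erase Finset.univ _ (Finset.mem_univ i),
      mul_left_comm, ← Finset.prod_mul_distrib]
  have hm := hres (Sum.inr i)
  have hp := hres (Sum.inl i)
  rw [hd] at hm
  rw [hd'] at hp
  have dm : ‖b (y (Sum.inr i) - y (Sum.inl i))‖ * ∏ k ∈ Finset.univ.erase i,
      (‖b (y (Sum.inr i) - y (Sum.inl k))‖ * ‖b (y (Sum.inr i) - y (Sum.inr k))‖) =
      discr b τ x₀ i n := by
    rw [discr]
    congr 1
    · rw [← norm_b_neg hb]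
      congr 2
      simp only [y, Sum.elim_inl, Sum.elim_inr, ← hx]; ring
    · refine Finset.prod_congr rfl fun k _ => ?_
      rw [← norm_b_neg hb, ← norm_b_neg hb (y _ - y (Sum.inr k))]
      congr 3 <;> simp only [y, Sum.elim_inl, Sum.elim_inr, ← hx] <;> ring
  have dp : ‖b (y (Sum.inl i) - y (Sum.inr i))‖ * ∏ k ∈ Finset.univ.erase i,
      (‖b (y (Sum.inl i) - y (Sum.inl k))‖ * ‖b (y (Sum.inl i) - y (Sum.inr k))‖) =
      discr b τ x₀ i n := by
    rw [discr]
    congr 1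
    · congr 2
      simp only [y, Sum.elim_inl, Sum.elim_inr, ← hx]; ring
    · refine Finset.prod_congr rfl fun k _ => ?_
      rw [mul_comm]
      congr 3 
      simp only [y, Sum.elim_inl, Sum.elim_inr, ← hx]; ring
  rw [dm, hpow] at hm
  rw [dp, hpow] at hp
  have hW : ∀ u, c ≤ ‖b (Z + τ + u)‖ → c' ≤ ‖b (Z' + u)‖ →
      ‖(b (Z + τ + u))⁻¹ - κ * (b (Z' + u))⁻¹‖ ≤ Cw := fun u h1 h2 => by
    refine (norm_sub_le _ _).trans (add_le_add ?_ ?_)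
    · rw [norm_inv]; exact inv_anti₀ hc h1
    · rw [norm_mul, norm_inv]
      exact mul_le_mul_of_nonneg_left (inv_anti₀ hc' h2) (norm_nonneg _)
  have hdis : 0 ≤ discr b τ x₀ i n := by
    unfold discr; positivity
  have fin : ∀ (w : ℂ) (v : V), ‖w‖ ≤ Cw →
      ‖v‖ * discr b τ x₀ i n * Q ≤ 2 ^ (2 * M - 1) * B ^ (4 * M - 1) * S →
      ‖w • v‖ * discr b τ x₀ i n ≤ Cw * 2 ^ (2 * M - 1) * Q⁻¹ * B ^ (4 * M - 1) * S := by
    intro w v h1 h2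
    have h3 : ‖v‖ * discr b τ x₀ i n ≤ 2 ^ (2 * M - 1) * B ^ (4 * M - 1) * S * Q⁻¹ := by
      rw [← div_eq_mul_inv, le_div_iff₀ hQ]; exact h2
    rw [norm_smul, mul_assoc]
    calc ‖w‖ * (‖v‖ * discr b τ x₀ i n) ≤ Cw * (2 ^ (2 * M - 1) * B ^ (4 * M - 1) * S * Q⁻¹) :=
          mul_le_mul h1 h3 (by positivity) hCw
      _ = _ := by ring
  constructor
  · refine fin _ _ (hW _ ?_ ?_) hm
    · rw [← sub_eq_add_neg]; exact (hlow i (n i)).2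
    · rw [← sub_eq_add_neg]; exact (hlow' i (n i)).2
  · rw [hP.flow_add_single, norm_neg]
    exact fin _ _ (hW _ (hlow i (n i)).1 (hlow' i (n i)).1) hp

end Telescoping

/-! ### Damping factors -/

section Damping

/-- The quotient `r (x) / r (-x - τ)` for `r (u) = b (u + Z - s ω) / b (u + Z)`. -/
def shiftRatio (b : ℂ → ℂ) (τ ω Z s x : ℂ) : ℂ :=
  b (x + Z - s * ω) * b (x + τ - Z) / (b (x + Z) * b (x + τ - Z + s * ω))

/-- The size of `b` at the point with index `m` of a string `x + τ ℤ`, up to constants. -/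
def growth (d : ℕ → ℝ) (m : ℤ) : ℝ := Real.exp (∑ l ∈ Finset.range m.natAbs, d l)

/-- `b` tends to infinity in the directions `±τ`. The sequence `d` is the logarithmic derivative of
the growth of `b`, and the values of `shiftRatio` along a string are those of `exp (-2 s d)`
up to a summable error. -/
structure IsExpanding (b : ℂ → ℂ) (τ μ ω : ℂ) (d : ℕ → ℝ) : Prop where
  nonneg : ∀ l, 0 ≤ d l
  bounded : ∃ D, ∀ l, d l ≤ D
  re_mul_pos : 0 < (μ * τ).re
  re_mul_nonneg : ∀ s : ℂ, 0 ≤ s.re → 0 ≤ (μ * (s * ω)).re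
  lower : ∃ c > 0, ∀ y, c * |(μ * y).re| ≤ ‖b y‖
  upper : ∀ y, ∃ C, 0 ≤ C ∧ ∀ m : ℤ, ‖b (y + τ * m)‖ ≤ C * growth d m
  ratio : ∀ x Z : ℂ, ∀ᶠ k : ℤ in atBot, (∀ m : ℤ, b (Z + k * τ + (x + τ * m)) ≠ 0) →
    ∀ R : ℝ, ∃ ε : ℕ → ℝ, Summable ε ∧ ∀ s : ℂ, 0 ≤ s.re → ‖s‖ ≤ R → ∀ l : ℕ,
      ‖shiftRatio b τ ω (Z + k * τ) s (x + τ * l) - Complex.exp (-(2 * s * d l))‖ ≤ ε l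

theorem exists_pos_le {f : ℕ → ℝ} (hf : ∀ l, 0 < f l) {c : ℝ} (hc : 0 < c)
    (h : ∀ᶠ l in atTop, c ≤ f l) : ∃ c' > 0, ∀ l, c' ≤ f l := by
  obtain ⟨n, hn⟩ := eventually_atTop.1 h
  induction n generalizing c with
  | zero => exact ⟨c, hc, fun l => hn l (Nat.zero_le l)⟩
  | succ n ih =>
    refine ih (lt_min hc (hf n)) (eventually_atTop.2 ⟨n, fun l hl => ?_⟩) fun l hl => ?_
    all_goals
      rcases hl.eq_or_lt with rfl | hl
      · exact min_le_right _ _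
      · exact (min_le_left _ _).trans (hn l hl)

theorem abs_re_le_norm_sinh (w : ℂ) : |w.re| ≤ ‖Complex.sinh w‖ := by
  have h1 : |Real.exp w.re - Real.exp (-w.re)| ≤ ‖Complex.exp w - Complex.exp (-w)‖ := by
    have := abs_norm_sub_norm_le (Complex.exp w) (Complex.exp (-w))
    rwa [Complex.norm_exp, Complex.norm_exp, Complex.neg_re] at this
  have h2 : ‖Complex.sinh w‖ = ‖Complex.exp w - Complex.exp (-w)‖ / 2 := by
    rw [Complex.sinh, norm_div]; norm_num
  have h3 : |Real.exp w.re - Real.exp (-w.re)| = 2 * |Real.sinh w.re| := by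
    rw [Real.sinh_eq, abs_div, abs_two]; ring
  have h4 : |w.re| ≤ |Real.sinh w.re| := by
    rw [Real.abs_sinh]
    exact Real.self_le_sinh_iff.2 (abs_nonneg _)
  linarith

theorem norm_sinh_le (w : ℂ) : ‖Complex.sinh w‖ ≤ Real.exp |w.re| := by
  have h2 : ‖Complex.sinh w‖ = ‖Complex.exp w - Complex.exp (-w)‖ / 2 := by
    rw [Complex.sinh, norm_div]; norm_num
  have h1 := norm_sub_le (Complex.exp w) (Complex.exp (-w))
  rw [Complex.norm_exp, Complex.norm_exp, Complex.neg_re] at h1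
  have h3 := Real.exp_le_exp.2 (le_abs_self w.re)
  have h4 := Real.exp_le_exp.2 (neg_le_abs w.re)
  linarith

theorem isExpanding_rational {b : ℂ → ℂ} {τ c : ℂ} (hτ : τ ≠ 0) (hc : c ≠ 0) (hb : ∀ x, b x = c * x) :
    IsExpanding b τ τ⁻¹ τ fun l => 1 / (l + 1) where
  nonneg l := by positivity
  bounded := ⟨1, fun l => by
    rw [div_le_one (by positivity)]
    linarith [(Nat.cast_nonneg l : (0 : ℝ) ≤ l)]⟩
  re_mul_pos := by rw [inv_mul_cancel₀ hτ]; simp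
  re_mul_nonneg s hs := by
    rwa [mul_left_comm, inv_mul_cancel₀ hτ, mul_one]
  lower := by
    refine ⟨‖c‖ * ‖τ‖, by positivity, fun y => ?_⟩
    rw [hb, norm_mul, mul_assoc]
    refine mul_le_mul_of_nonneg_left ?_ (norm_nonneg _)
    refine (mul_le_mul_of_nonneg_left (Complex.abs_re_le_norm _) (norm_nonneg _)).trans ?_
    rw [norm_mul, norm_inv, mul_inv_cancel_left₀ (norm_ne_zero_iff.2 hτ)]
  upper y := by
    refine ⟨‖c‖ * (‖y‖ + ‖τ‖), by positivity, fun m => ?_⟩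
    have hg : ∀ n : ℕ, (n : ℝ) + 1 ≤ Real.exp (∑ l ∈ Finset.range n, 1 / ((l : ℝ) + 1)) := by
      intro n
      induction n with
      | zero => simp
      | succ n ih =>
        rw [Finset.sum_range_succ, Real.exp_add]
        have h1 := Real.add_one_le_exp (1 / ((n : ℝ) + 1))
        calc ((n + 1 : ℕ) : ℝ) + 1 = (n + 1) * (1 / ((n : ℝ) + 1) + 1) := by
              push_cast; field_simp; ring
          _ ≤ _ := mul_le_mul ih h1 (by positivity) (Real.exp_pos _).le
    have h1 := hg m.natAbs
    rw [hb, norm_mul, mul_assoc]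
    refine mul_le_mul_of_nonneg_left ?_ (norm_nonneg _)
    have h2 : ‖y + τ * m‖ ≤ ‖y‖ + ‖τ‖ * m.natAbs := by
      refine (norm_add_le _ _).trans ?_
      rw [norm_mul, Complex.norm_intCast, Nat.cast_natAbs, Int.cast_abs]
    have h3 : (0 : ℝ) ≤ m.natAbs := Nat.cast_nonneg _
    calc _ ≤ _ := h2
      _ ≤ (‖y‖ + ‖τ‖) * (m.natAbs + 1) := by nlinarith [norm_nonneg y, norm_nonneg τ]
      _ ≤ _ := mul_le_mul_of_nonneg_left h1 (by positivity)
  ratio x Z := by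
    have hk : ∀ᶠ k : ℤ in atBot, (k : ℝ) ≤ ((x + τ - Z) / τ).re - 1 :=
      tendsto_intCast_atBot_iff.2 tendsto_id |>.eventually (eventually_le_atBot _)
    filter_upwards [hk] with k hk hne R
    set Zk : ℂ := Z + k * τ with hZk
    set a : ℂ := (x + Zk) / τ with ha
    set a' : ℂ := (x + τ - Zk) / τ with ha'
    have ea : ∀ l : ℕ, x + τ * l + Zk = τ * (l + a) := fun l => by rw [ha]; field_simp; ring
    have ea' : ∀ l : ℕ, x + τ * l + τ - Zk = τ * (l + a') := fun l => by
      rw [ha']; field_simp; ring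
    have hre : 1 ≤ a'.re := by
      have : a' = (x + τ - Z) / τ - k := by rw [ha', hZk]; field_simp; ring
      rw [this, Complex.sub_re, Complex.intCast_re]; linarith
    have hla : ∀ l : ℕ, (l : ℂ) + a ≠ 0 := fun l h => by
      refine hne l ?_
      rw [hb, add_comm Zk, Int.cast_natCast, ea, h, mul_zero, mul_zero]
    obtain ⟨κ, hκ, hκ'⟩ : ∃ κ > 0, ∀ l : ℕ, κ ≤ ‖(l : ℂ) + a‖ / (l + 1) := by
      refine exists_pos_le (c := 1 / 2) (fun l => ?_) (by norm_num) ?_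
      · have := norm_pos_iff.2 (hla l)
        positivity
      · filter_upwards [eventually_ge_atTop (⌈2 * ‖a‖ + 1⌉₊)] with l hl
        have h1 : 2 * ‖a‖ + 1 ≤ l := Nat.ceil_le.1 hl
        have h2 : (l : ℝ) - ‖a‖ ≤ ‖(l : ℂ) + a‖ := by
          have := norm_sub_norm_le (l : ℂ) (-a)
          rwa [sub_neg_eq_add, norm_neg, Complex.norm_natCast] at this
        rw [le_div_iff₀ (by positivity)]
        linarith
    set R' := max R 0
    set C : ℝ := ‖a‖ + ‖a'‖ + 2 * R' + 2 + 2 * (‖a‖ * (‖a'‖ + R')) + (‖a‖ + ‖a'‖)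
    have hR' : 0 ≤ R' := le_max_right _ _
    have hC : 0 ≤ C := by positivity
    refine ⟨fun l => (R' * C / κ + 4 * R' ^ 2 * Real.exp (2 * R')) * (1 / (l + 1) ^ 2), ?_,
      fun s hs hsR l => ?_⟩
    · refine Summable.mul_left _ ?_
      have := (summable_nat_add_iff 1).2 (Real.summable_one_div_nat_pow.2 (one_lt_two))
      simpa using this
    · have hsR' : ‖s‖ ≤ R' := hsR.trans (le_max_left _ _)
      have hL : (0 : ℝ) < (l : ℝ) + 1 := by positivity
      have hLc : (l : ℂ) + 1 ≠ 0 := Nat.cast_add_one_ne_zero l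
      have n1 : (l : ℝ) + 1 ≤ ‖(l : ℂ) + a' + s‖ := by
        refine le_trans ?_ (Complex.re_le_norm _)
        simp only [Complex.add_re, Complex.natCast_re]; linarith
      have n1' : (l : ℂ) + a' + s ≠ 0 := norm_pos_iff.1 (hL.trans_le n1)
      have n2 : κ * ((l : ℝ) + 1) ≤ ‖(l : ℂ) + a‖ := (le_div_iff₀ hL).1 (hκ' l)
      have e1 : shiftRatio b τ τ Zk s (x + τ * l) =
          ((l + a - s) * (l + a')) / ((l + a) * (l + a' + s)) := by
        rw [shiftRatio, hb, hb, hb, hb, ea', ea]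
        have := hla l
        field_simp
      have e2 : ((l + a - s) * (l + a')) / ((l + a) * (l + a' + s)) - (1 + -(2 * s * (1 / (l + 1)))) =
          s * (l * (a + a' + 2 * s - 2) + (2 * (a * (a' + s)) - (a + a'))) /
            ((l + 1) * (l + a) * (l + a' + s)) := by
        have := hla l
        field_simp
        ring
      have b1 : ‖((l + a - s) * (l + a')) / ((l + a) * (l + a' + s)) -
          (1 + -(2 * s * (1 / (l + 1))))‖ ≤ R' * C / κ * (1 / (l + 1) ^ 2) := by
        rw [e2, norm_div, norm_mul, norm_mul, norm_mul]
        have t1 : ‖(l : ℂ) * (a + a' + 2 * s - 2) + (2 * (a * (a' + s)) - (a + a'))‖ ≤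
            C * (l + 1) := by
          have u1 : ‖a + a' + 2 * s - 2‖ ≤ ‖a‖ + ‖a'‖ + 2 * R' + 2 := by
            refine (norm_sub_le _ _).trans (add_le_add ((norm_add_le _ _).trans (add_le_add
              (norm_add_le _ _) ?_)) (by simp))
            rw [norm_mul, Complex.norm_ofNat]; linarith
          have u2 : ‖2 * (a * (a' + s)) - (a + a')‖ ≤
              2 * (‖a‖ * (‖a'‖ + R')) + (‖a‖ + ‖a'‖) := by
            refine (norm_sub_le _ _).trans (add_le_add ?_ (norm_add_le _ _))
            rw [norm_mul, norm_mul, Complex.norm_ofNat]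
            gcongr
            exact (norm_add_le _ _).trans (by linarith)
          refine (norm_add_le _ _).trans ?_
          rw [norm_mul, Complex.norm_natCast]
          have : 0 ≤ 2 * (‖a‖ * (‖a'‖ + R')) + (‖a‖ + ‖a'‖) := by positivity
          have h3 : 0 ≤ ‖a‖ + ‖a'‖ + 2 * R' + 2 := by positivity
          have h4 : (0 : ℝ) ≤ l := Nat.cast_nonneg l
          calc _ ≤ l * (‖a‖ + ‖a'‖ + 2 * R' + 2) + (2 * (‖a‖ * (‖a'‖ + R')) + (‖a‖ + ‖a'‖)) :=
                add_le_add (mul_le_mul_of_nonneg_left u1 h4) u2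
            _ ≤ C * (l + 1) := by simp only [C]; nlinarith
        have t2 : ‖(l : ℂ) + 1‖ = l + 1 := by
          have := Complex.norm_natCast (l + 1); push_cast at this; exact this
        rw [t2]
        calc _ ≤ R' * (C * (l + 1)) / ((l + 1) * (κ * (l + 1)) * (l + 1)) := by gcongr
          _ = _ := by field_simp
      have b2 : ‖(1 + -(2 * s * (1 / (l + 1)))) - Complex.exp (-(2 * s * (1 / (l + 1))))‖ ≤
          4 * R' ^ 2 * Real.exp (2 * R') * (1 / (l + 1) ^ 2) := by
        set z : ℂ := -(2 * s * (1 / (l + 1)))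
        have h1 := Complex.norm_exp_sub_sum_le_norm_mul_exp z 2
        simp only [Finset.sum_range_succ, Finset.sum_range_zero, pow_zero, pow_one,
          Nat.factorial, Nat.cast_one, div_one, zero_add, mul_one] at h1
        rw [norm_sub_rev]
        refine h1.trans ?_
        have h2 : ‖z‖ ≤ 2 * R' * (1 / (l + 1)) := by
          have : ‖(l : ℂ) + 1‖ = l + 1 := by
            have := Complex.norm_natCast (l + 1); push_cast at this; exact this
          simp only [z]
          rw [norm_neg, norm_mul, norm_mul, norm_div, this, Complex.norm_ofNat, norm_one]
          gcongr
        have h3 : 2 * R' * (1 / ((l : ℝ) + 1)) ≤ 2 * R' := by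
          refine mul_le_of_le_one_right (by positivity) ?_
          rw [div_le_one hL]; linarith [(Nat.cast_nonneg l : (0 : ℝ) ≤ l)]
        calc ‖z‖ ^ 2 * Real.exp ‖z‖ ≤ (2 * R' * (1 / (l + 1))) ^ 2 * Real.exp (2 * R') := by
              gcongr
              exact h2.trans h3
          _ = _ := by field_simp; ring
      rw [e1]
      calc _ ≤ _ := norm_sub_le_norm_sub_add_norm_sub _ (1 + -(2 * s * (1 / (l + 1)))) _
        _ ≤ _ := add_le_add b1 (by push_cast; exact b2)
        _ = _ := by ring

theorem isExpanding_hyperbolic {b : ℂ → ℂ} {τ c ν : ℂ} (hc : c ≠ 0) (hν : ν ≠ 0)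
    (hb : ∀ x, b x = c * Complex.sinh (ν * x)) (hσ : 0 < (ν * τ).re) :
    IsExpanding b τ ν ((ν * τ).re / ν) fun _ => (ν * τ).re where
  nonneg _ := hσ.le
  bounded := ⟨_, fun _ => le_rfl⟩
  re_mul_pos := hσ
  re_mul_nonneg s hs := by
    have : ν * (s * ((ν * τ).re / ν)) = s * ((ν * τ).re : ℂ) := by field_simp
    rw [this, Complex.re_mul_ofReal]
    positivity
  lower := by
    refine ⟨‖c‖, by positivity, fun y => ?_⟩
    rw [hb, norm_mul]
    exact mul_le_mul_of_nonneg_left (abs_re_le_norm_sinh _) (norm_nonneg _)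
  upper y := by
    refine ⟨‖c‖ * Real.exp |(ν * y).re|, by positivity, fun m => ?_⟩
    rw [hb, norm_mul, mul_assoc, growth, ← Real.exp_add]
    refine mul_le_mul_of_nonneg_left ((norm_sinh_le _).trans (Real.exp_le_exp.2 ?_)) (norm_nonneg _)
    have : (ν * (y + τ * m)).re = (ν * y).re + m * (ν * τ).re := by
      rw [mul_add, Complex.add_re, ← mul_assoc, mul_comm (ν * τ), ← Complex.ofReal_intCast,
        Complex.re_ofReal_mul]
    rw [this, Finset.sum_const, Finset.card_range, nsmul_eq_mul]
    refine (abs_add_le _ _).trans ?_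
    rw [abs_mul, abs_of_pos hσ, Nat.cast_natAbs, Int.cast_abs]
  ratio x Z := by
    set σ := (ν * τ).re with hσdef
    have hk : ∀ᶠ k : ℤ in atBot, (k : ℝ) * σ ≤ (ν * (x + τ - Z)).re - 1 :=
      ((tendsto_intCast_atBot_iff.2 tendsto_id).atBot_mul_const hσ).eventually (eventually_le_atBot _)
    filter_upwards [hk] with k hk hne R
    set Zk : ℂ := Z + k * τ with hZk
    set R' := max R 0
    have hR' : 0 ≤ R' := le_max_right _ _
    set q : ℝ := Real.exp (-(2 * σ)) with hq
    have hq1 : q < 1 := Real.exp_lt_one_iff.2 (by linarith)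
    let p : ℕ → ℂ := fun l => Complex.exp (-(2 * (ν * (x + τ * l + Zk))))
    let p' : ℕ → ℂ := fun l => Complex.exp (-(2 * (ν * (x + τ * l + τ - Zk))))
    set P := Real.exp (-(2 * (ν * (x + Zk)).re))
    set P' := Real.exp (-(2 * (ν * (x + τ - Zk)).re))
    have hql : ∀ l : ℕ, Real.exp (-(2 * (l * σ))) = q ^ l := fun l => by
      rw [hq, ← Real.exp_nat_mul]; congr 1; ring
    have np : ∀ l, ‖p l‖ = P * q ^ l := fun l => by
      simp only [p, P]
      rw [Complex.norm_exp, ← hql, ← Real.exp_add]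
      congr 1
      have : -(2 * (ν * (x + τ * l + Zk))) =
        ((-2 : ℝ) : ℂ) * (ν * (x + Zk)) + ((-2 * l : ℝ) : ℂ) * (ν * τ) := by push_cast; ring
      rw [this, Complex.add_re, Complex.re_ofReal_mul, Complex.re_ofReal_mul]
      ring
    have np' : ∀ l, ‖p' l‖ = P' * q ^ l := fun l => by
      simp only [p', P']
      rw [Complex.norm_exp, ← hql, ← Real.exp_add]
      congr 1
      have : -(2 * (ν * (x + τ * l + τ - Zk))) =
        ((-2 : ℝ) : ℂ) * (ν * (x + τ - Zk)) + ((-2 * l : ℝ) : ℂ) * (ν * τ) := by push_cast; ring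
      rw [this, Complex.add_re, Complex.re_ofReal_mul, Complex.re_ofReal_mul]
      ring
    have hP' : P' ≤ 1 / 2 := by
      have h1 : 1 ≤ (ν * (x + τ - Zk)).re := by
        have : ν * (x + τ - Zk) = ν * (x + τ - Z) - ((k : ℝ) : ℂ) * (ν * τ) := by
          rw [hZk]; push_cast; ring
        rw [this, Complex.sub_re, Complex.re_ofReal_mul]; linarith
      have h2 : P' ≤ Real.exp (-2) := Real.exp_le_exp.2 (by linarith)
      have h3 : Real.exp (-2) ≤ 1 / 2 := by
        rw [Real.exp_neg, ← one_div]
        exact one_div_le_one_div_of_le two_pos (by linarith [Real.add_one_le_exp (2 : ℝ)])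
      exact h2.trans h3
    have hqpow : ∀ l : ℕ, q ^ l ≤ 1 := fun l => pow_le_one₀ (Real.exp_pos _).le hq1.le
    have hq0 : ∀ l : ℕ, 0 ≤ q ^ l := fun l => pow_nonneg (Real.exp_pos _).le l
    have sinh_eq : ∀ w : ℂ, Complex.sinh w =
        Complex.exp w * (1 - Complex.exp (-(2 * w))) / 2 := fun w => by
      rw [Complex.sinh, mul_sub, ← Complex.exp_add]; ring_nf
    have hp1 : ∀ l, 1 - p l ≠ 0 := fun l h => by
      refine hne l ?_
      rw [hb, add_comm Zk, Int.cast_natCast, sinh_eq]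
      simp only [p] at h
      rw [h]; simp
    obtain ⟨κ, hκ, hκ'⟩ : ∃ κ > 0, ∀ l : ℕ, κ ≤ ‖1 - p l‖ := by
      refine exists_pos_le (c := 1 / 2) (fun l => norm_pos_iff.2 (hp1 l)) (by norm_num) ?_
      have : Tendsto (fun l => P * q ^ l) atTop (𝓝 (P * 0)) :=
        (tendsto_pow_atTop_nhds_zero_of_lt_one (Real.exp_pos _).le hq1).const_mul P
      rw [mul_zero] at this
      filter_upwards [this.eventually_le_const (by norm_num : (0 : ℝ) < 1 / 2)] with l hl
      have h1 := norm_sub_norm_le (1 : ℂ) (p l)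
      rw [norm_one, np] at h1
      linarith
    set G := Real.exp (2 * R' * σ)
    refine ⟨fun l => (P * G + P' + P * P' * G + P + P' + P * P') / (κ * (1 / 2)) * q ^ l,
      (summable_geometric_of_lt_one (Real.exp_pos _).le hq1).mul_left _, fun s hs hsR l => ?_⟩
    have hsR' : ‖s‖ ≤ R' := hsR.trans (le_max_left _ _)
    set S := Complex.exp (2 * s * σ) with hS
    set S' := Complex.exp (-(2 * s * σ)) with hS'
    have hSS : S * S' = 1 := by rw [hS, hS', ← Complex.exp_add, add_neg_cancel, Complex.exp_zero]
    have nS : ‖S‖ ≤ G := by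
      rw [hS, Complex.norm_exp]
      refine Real.exp_le_exp.2 ?_
      rw [Complex.re_mul_ofReal]
      refine mul_le_mul_of_nonneg_right ?_ hσ.le
      refine (Complex.re_le_norm _).trans ?_
      rw [norm_mul, Complex.norm_ofNat]; linarith
    have nS' : ‖S'‖ ≤ 1 := by
      rw [hS', Complex.norm_exp, Complex.neg_re, Complex.re_mul_ofReal]
      refine Real.exp_le_one_iff.2 ?_
      have : (2 * s).re = 2 * s.re := by simp
      rw [this]
      nlinarith
    have nden : 1 / 2 ≤ ‖1 - p' l * S'‖ := by
      have h1 := norm_sub_norm_le (1 : ℂ) (p' l * S')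
      rw [norm_one, norm_mul, np'] at h1
      have h2 : P' * q ^ l * ‖S'‖ ≤ 1 / 2 := by
        calc P' * q ^ l * ‖S'‖ ≤ (1 / 2) * 1 * 1 := by
              gcongr
              exact hqpow l
          _ = _ := by norm_num
      linarith
    have hden : 1 - p' l * S' ≠ 0 := norm_pos_iff.1 (by linarith)
    have e1 : shiftRatio b τ (σ / ν) Zk s (x + τ * l) =
        S' * ((1 - p l * S) * (1 - p' l)) / ((1 - p l) * (1 - p' l * S')) := by
      rw [shiftRatio, hb, hb, hb, hb, sinh_eq, sinh_eq, sinh_eq, sinh_eq]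
      have f1 : Complex.exp (-(2 * (ν * (x + τ * l + Zk - s * (σ / ν))))) = p l * S := by
        simp only [p, S]; rw [← Complex.exp_add]; congr 1; field_simp; ring
      have f2 : Complex.exp (-(2 * (ν * (x + τ * l + τ - Zk + s * (σ / ν))))) = p' l * S' := by
        simp only [p', S']; rw [← Complex.exp_add]; congr 1; field_simp; ring
      have f3 : Complex.exp (ν * (x + τ * l + Zk - s * (σ / ν))) *
          Complex.exp (ν * (x + τ * l + τ - Zk)) = S' * (Complex.exp (ν * (x + τ * l + Zk)) *
          Complex.exp (ν * (x + τ * l + τ - Zk + s * (σ / ν)))) := by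
        simp only [S']
        rw [← Complex.exp_add, ← Complex.exp_add, ← Complex.exp_add]; congr 1; field_simp; ring
      have f4 := Complex.exp_ne_zero (ν * (x + τ * l + Zk))
      have f5 := Complex.exp_ne_zero (ν * (x + τ * l + τ - Zk + s * (σ / ν)))
      rw [f1, f2]
      have g1 : Complex.exp (-(2 * (ν * (x + τ * l + Zk)))) = p l := rfl
      have g2 : Complex.exp (-(2 * (ν * (x + τ * l + τ - Zk)))) = p' l := rfl
      rw [g1, g2]
      have g3 := hp1 l
      generalize Complex.exp (ν * (x + τ * l + Zk)) = A1,
        Complex.exp (ν * (x + τ * l + τ - Zk + s * (σ / ν))) = A2,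
        Complex.exp (ν * (x + τ * l + Zk - s * (σ / ν))) = A3,
        Complex.exp (ν * (x + τ * l + τ - Zk)) = A4, p l = p, p' l = p' at *
      clear_value S S'
      field_simp
      linear_combination ((1 - p * S) * (1 - p')) * f3
    have e2 : S' * ((1 - p l * S) * (1 - p' l)) / ((1 - p l) * (1 - p' l * S')) - S' =
        S' * (-(p l * S) - p' l + p l * p' l * S + p l + p' l * S' - p l * p' l * S') /
          ((1 - p l) * (1 - p' l * S')) := by
      have g3 := hp1 l
      generalize p l = p₁, p' l = p₂ at *
      clear_value S S'
      rw [eq_div_iff (mul_ne_zero g3 hden), sub_mul, div_mul_cancel₀ _ (mul_ne_zero g3 hden)]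
      ring
    change ‖_ - S'‖ ≤ _
    rw [e1, e2, norm_div, norm_mul, norm_mul]
    have num : ‖-(p l * S) - p' l + p l * p' l * S + p l + p' l * S' - p l * p' l * S'‖ ≤
        (P * G + P' + P * P' * G + P + P' + P * P') * q ^ l := by
      have m1 : ‖p l * S‖ ≤ P * G * q ^ l := by
        rw [norm_mul, np]
        calc P * q ^ l * ‖S‖ ≤ P * q ^ l * G := by gcongr
          _ = _ := by ring
      have m2 : ‖p' l‖ ≤ P' * q ^ l := (np' l).le
      have m3 : ‖p l * p' l * S‖ ≤ P * P' * G * q ^ l := by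
        rw [norm_mul, norm_mul, np, np']
        calc P * q ^ l * (P' * q ^ l) * ‖S‖ ≤ P * q ^ l * (P' * 1) * G := by
              gcongr; exact hqpow l
          _ = _ := by ring
      have m4 : ‖p l‖ ≤ P * q ^ l := (np l).le
      have m5 : ‖p' l * S'‖ ≤ P' * q ^ l := by
        rw [norm_mul, np']
        exact mul_le_of_le_one_right (by positivity) nS'
      have m6 : ‖p l * p' l * S'‖ ≤ P * P' * q ^ l := by
        rw [norm_mul, norm_mul, np, np']
        calc P * q ^ l * (P' * q ^ l) * ‖S'‖ ≤ P * q ^ l * (P' * 1) * 1 := by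
              gcongr; exact hqpow l
          _ = _ := by ring
      calc _ ≤ ‖p l * S‖ + ‖p' l‖ + ‖p l * p' l * S‖ + ‖p l‖ + ‖p' l * S'‖ + ‖p l * p' l * S'‖ := by
            refine (norm_sub_le _ _).trans (add_le_add_left ?_ _)
            refine (norm_add_le _ _).trans (add_le_add_left ?_ _)
            refine (norm_add_le _ _).trans (add_le_add_left ?_ _)
            refine (norm_add_le _ _).trans (add_le_add_left ?_ _)
            refine (norm_sub_le _ _).trans ?_
            rw [norm_neg]
        _ ≤ _ := by linarith
    calc _ ≤ 1 * ((P * G + P' + P * P' * G + P + P' + P * P') * q ^ l) / (κ * (1 / 2)) := by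
          gcongr
          exact hκ' l
      _ = _ := by ring

end Damping

section Damping

variable {b : ℂ → ℂ} {τ μ ω : ℂ} {d : ℕ → ℝ}

theorem IsExpanding.tendsto (hE : IsExpanding b τ μ ω d) (y : ℂ) :
    Tendsto (fun m : ℤ => ‖b (y + τ * m)‖) cofinite atTop := by
  obtain ⟨c, hc, h⟩ := hE.lower
  set σ := (μ * τ).re
  have hσ : 0 < σ := hE.re_mul_pos
  have h1 : ∀ m : ℤ, c * (σ * |(m : ℝ)| - |(μ * y).re|) ≤ ‖b (y + τ * m)‖ := fun m => by
    refine le_trans (mul_le_mul_of_nonneg_left ?_ hc.le) (h _)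
    have : (μ * (y + τ * m)).re = (μ * y).re + m * σ := by
      rw [mul_add, Complex.add_re, ← mul_assoc, mul_comm (μ * τ), ← Complex.ofReal_intCast,
        Complex.re_ofReal_mul]
    rw [this]
    have h2 := abs_sub_abs_le_abs_sub (m * σ) (-(μ * y).re)
    rw [abs_neg, abs_mul, abs_of_pos hσ, sub_neg_eq_add, add_comm (m * σ)] at h2
    linarith
  refine tendsto_atTop_mono h1 (Tendsto.const_mul_atTop hc (tendsto_atTop_add_const_right _ _
    (Tendsto.const_mul_atTop hσ ?_)))
  have : Tendsto (fun m : ℤ => ‖m‖) cofinite atTop := by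
    rw [← cocompact_eq_cofinite]
    exact tendsto_norm_cocompact_atTop
  simpa only [Int.norm_eq_abs] using this

theorem IsExpanding.exists_lower (hE : IsExpanding b τ μ ω d) {y : ℂ}
    (h : ∀ m : ℤ, b (y + τ * m) ≠ 0) : ∃ c > 0, ∀ m : ℤ, c ≤ ‖b (y + τ * m)‖ := by
  obtain ⟨m, hm⟩ := (hE.tendsto y).exists_forall_le
  exact ⟨_, norm_pos_iff.2 (h m), hm⟩

theorem growth_neg (m : ℤ) : growth d (-m) = growth d m := by
  rw [growth, growth, Int.natAbs_neg]

theorem norm_prod_le_exp {ρ : ℕ → ℂ} {ε : ℕ → ℝ} {s : ℂ} {D R : ℝ} (hd : ∀ l, 0 ≤ d l)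
    (hD : ∀ l, d l ≤ D) (hR : ‖s‖ ≤ R) (hε : Summable ε)
    (h : ∀ l, ‖ρ l - Complex.exp (-(2 * s * d l))‖ ≤ ε l) (n : ℕ) :
    ‖∏ l ∈ Finset.range n, ρ l‖ ≤ Real.exp (Real.exp (2 * R * D) * ∑' l, ε l) *
      Real.exp (-(2 * s.re * ∑ l ∈ Finset.range n, d l)) := by
  have hε0 : ∀ l, 0 ≤ ε l := fun l => (norm_nonneg _).trans (h l)
  have hR0 : 0 ≤ R := (norm_nonneg s).trans hR
  have h1 : ∀ l, ‖ρ l‖ ≤ Real.exp (Real.exp (2 * R * D) * ε l - 2 * s.re * d l) := fun l => by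
    have e1 : ‖Complex.exp (-(2 * s * d l))‖ = Real.exp (-(2 * s.re * d l)) := by
      rw [Complex.norm_exp, Complex.neg_re, Complex.re_mul_ofReal]
      simp
    have e2 : ‖ρ l‖ ≤ Real.exp (-(2 * s.re * d l)) + ε l := by
      have := norm_add_le (ρ l - Complex.exp (-(2 * s * d l))) (Complex.exp (-(2 * s * d l)))
      rw [sub_add_cancel, e1] at this
      linarith [h l]
    have e3 : 1 ≤ Real.exp (-(2 * s.re * d l)) * Real.exp (2 * R * D) := by
      rw [← Real.exp_add]
      refine Real.one_le_exp ?_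
      have := mul_le_mul ((Complex.re_le_norm s).trans hR) (hD l) (hd l) hR0
      linarith
    calc ‖ρ l‖ ≤ Real.exp (-(2 * s.re * d l)) * (Real.exp (2 * R * D) * ε l + 1) := by
          nlinarith [hε0 l]
      _ ≤ Real.exp (-(2 * s.re * d l)) * Real.exp (Real.exp (2 * R * D) * ε l) :=
          mul_le_mul_of_nonneg_left (Real.add_one_le_exp _) (Real.exp_pos _).le
      _ = _ := by rw [← Real.exp_add]; congr 1; ring
  calc ‖∏ l ∈ Finset.range n, ρ l‖ = ∏ l ∈ Finset.range n, ‖ρ l‖ := norm_prod _ _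
    _ ≤ ∏ l ∈ Finset.range n, Real.exp (Real.exp (2 * R * D) * ε l - 2 * s.re * d l) :=
        Finset.prod_le_prod (fun _ _ => norm_nonneg _) fun l _ => h1 l
    _ = Real.exp (Real.exp (2 * R * D) * ∑ l ∈ Finset.range n, ε l +
          -(2 * s.re * ∑ l ∈ Finset.range n, d l)) := by
        rw [← Real.exp_sum, Finset.sum_sub_distrib, ← Finset.mul_sum, ← Finset.mul_sum]
        rfl
    _ ≤ _ := by
        rw [Real.exp_add]
        gcongr
        exact hε.sum_le_tsum _ fun l _ => hε0 l

/-- A solution `φ` of `φ (m + 1) r (-x - τ) = φ m r (x)` along the string `x + τ ℤ`, where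
`r (u) = b (u + Z - s ω) / b (u + Z)`. -/
def damping (b : ℂ → ℂ) (τ ω Z x s : ℂ) (m : ℤ) : ℂ :=
  if 0 ≤ m then ∏ l ∈ Finset.range m.natAbs, shiftRatio b τ ω Z s (x + τ * l)
  else ∏ l ∈ Finset.range m.natAbs, shiftRatio b τ ω Z s (-x + τ * l)

/-- The factor `r (u) = b (u + Z - s ω) / b (u + Z)` that deforms a simple fraction. -/
def deformer (b : ℂ → ℂ) (ω Z s u : ℂ) : ℂ := b (u + Z - s * ω) / b (u + Z)

theorem shiftRatio_mul_deformer (hb : IsXXX b ∨ IsXXZ b) {Z s x : ℂ}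
    (h1 : b (x + τ - Z) ≠ 0) (h2 : b (x + τ - Z + s * ω) ≠ 0) :
    shiftRatio b τ ω Z s x * deformer b ω Z s (-x - τ) = deformer b ω Z s x := by
  have e1 : b (-x - τ + Z - s * ω) = -b (x + τ - Z + s * ω) := by
    rw [← b_neg hb]; congr 1; ring
  have e2 : b (-x - τ + Z) = -b (x + τ - Z) := by rw [← b_neg hb]; congr 1; ring
  rw [shiftRatio, deformer, deformer, e1, e2]
  generalize b (x + τ - Z + s * ω) = A, b (x + τ - Z) = B, b (x + Z) = C, b (x + Z - s * ω) = D at *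
  field_simp

theorem damping_succ (hb : IsXXX b ∨ IsXXZ b) {Z s x : ℂ}
    (h1 : ∀ m : ℤ, b (Z - (x + τ * m)) ≠ 0) (h1' : ∀ m : ℤ, b (Z - (-x + τ * m)) ≠ 0)
    (h2 : ∀ l : ℕ, b (x + τ * l + τ - Z + s * ω) ≠ 0)
    (h2' : ∀ l : ℕ, b (-x + τ * l + τ - Z + s * ω) ≠ 0) (m : ℤ) :
    damping b τ ω Z x s (m + 1) * deformer b ω Z s (-(x + τ * m) - τ) =
      damping b τ ω Z x s m * deformer b ω Z s (x + τ * m) := by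
  have aux : ∀ y : ℂ, (∀ m : ℤ, b (Z - (y + τ * m)) ≠ 0) → ∀ l : ℕ, b (y + τ * l + τ - Z) ≠ 0 := by
    intro y hy l
    rw [← neg_sub, b_neg hb, neg_ne_zero]
    have := hy (l + 1)
    push_cast at this
    rwa [mul_add, mul_one, ← add_assoc] at this
  have key := fun l : ℕ => shiftRatio_mul_deformer hb (aux x h1 l) (h2 l)
  have key' := fun l : ℕ => shiftRatio_mul_deformer hb (aux (-x) h1' l) (h2' l)
  rcases le_or_gt 0 m with hm | hm
  · obtain ⟨l, rfl⟩ := Int.eq_ofNat_of_zero_le hm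
    have e : ((l : ℤ) + 1).natAbs = l + 1 := by omega
    rw [damping, damping, if_pos hm, if_pos (by omega), e, Finset.prod_range_succ, mul_assoc,
      Int.natAbs_natCast, Int.cast_natCast, key]
  · obtain ⟨l, rfl⟩ : ∃ l : ℕ, m = -((l : ℤ) + 1) := ⟨(-m - 1).toNat, by omega⟩
    have e : (-((l : ℤ) + 1)).natAbs = l + 1 := by omega
    have e' : (-((l : ℤ) + 1) + 1).natAbs = l := by omega
    have e3 : damping b τ ω Z x s (-((l : ℤ) + 1) + 1) =
        ∏ l ∈ Finset.range l, shiftRatio b τ ω Z s (-x + τ * l) := by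
      rw [damping, e']
      rcases Nat.eq_zero_or_pos l with rfl | hl
      · simp
      · rw [if_neg (by omega)]
    have e4 : -(x + τ * ((-((l : ℤ) + 1) : ℤ) : ℂ)) - τ = -x + τ * l := by push_cast; ring
    have e5 : x + τ * ((-((l : ℤ) + 1) : ℤ) : ℂ) = -(-x + τ * l) - τ := by push_cast; ring
    rw [e3, e4, e5, damping, if_neg (by omega), e, Finset.prod_range_succ, mul_assoc, key']

theorem IsExpanding.norm_damping_le (hE : IsExpanding b τ μ ω d) {Z x : ℂ} {R : ℝ} {ε ε' : ℕ → ℝ}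
    (hε : Summable ε) (hε' : Summable ε')
    (h : ∀ s : ℂ, 0 ≤ s.re → ‖s‖ ≤ R → ∀ l : ℕ,
      ‖shiftRatio b τ ω Z s (x + τ * l) - Complex.exp (-(2 * s * d l))‖ ≤ ε l)
    (h' : ∀ s : ℂ, 0 ≤ s.re → ‖s‖ ≤ R → ∀ l : ℕ,
      ‖shiftRatio b τ ω Z s (-x + τ * l) - Complex.exp (-(2 * s * d l))‖ ≤ ε' l) :
    ∃ C, 0 ≤ C ∧ ∀ s : ℂ, 0 ≤ s.re → ‖s‖ ≤ R → ∀ m,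
      ‖damping b τ ω Z x s m‖ ≤ C * Real.exp (-(2 * s.re * ∑ l ∈ Finset.range m.natAbs, d l)) := by
  obtain ⟨D, hD⟩ := hE.bounded
  refine ⟨max (Real.exp (Real.exp (2 * R * D) * ∑' l, ε l))
    (Real.exp (Real.exp (2 * R * D) * ∑' l, ε' l)), by positivity, fun s hs hR m => ?_⟩
  rw [damping]
  split_ifs
  · refine (norm_prod_le_exp hE.nonneg hD hR hε (h s hs hR) _).trans ?_
    gcongr
    exact le_max_left _ _
  · refine (norm_prod_le_exp hE.nonneg hD hR hε' (h' s hs hR) _).trans ?_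
    gcongr
    exact le_max_right _ _

theorem differentiableAt_damping (hb : IsXXX b ∨ IsXXZ b) {Z s x : ℂ}
    (h0 : ∀ m : ℤ, b (Z + (x + τ * m)) ≠ 0) (h0' : ∀ m : ℤ, b (Z + (-x + τ * m)) ≠ 0)
    (h2 : ∀ l : ℕ, b (x + τ * l + τ - Z + s * ω) ≠ 0)
    (h2' : ∀ l : ℕ, b (-x + τ * l + τ - Z + s * ω) ≠ 0) (m : ℤ) :
    DifferentiableAt ℂ (fun s => damping b τ ω Z x s m) s := by
  have hd := b_differentiable hb
  have key : ∀ y : ℂ, b (y + Z) ≠ 0 → b (y + τ - Z + s * ω) ≠ 0 →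
      DifferentiableAt ℂ (fun s => shiftRatio b τ ω Z s y) s := fun y hy hy' => by
    unfold shiftRatio
    refine DifferentiableAt.div ?_ ?_ (mul_ne_zero hy hy')
    · exact ((hd.differentiableAt).comp (f := fun s => y + Z - s * ω) s (by fun_prop)).mul_const _
    · exact ((hd.differentiableAt).comp (f := fun s => y + τ - Z + s * ω) s (by fun_prop)).const_mul _
  unfold damping
  split_ifs
  · refine DifferentiableAt.fun_finsetProd fun l _ => key _ ?_ (h2 l)
    rw [add_comm]; exact_mod_cast h0 l
  · refine DifferentiableAt.fun_finsetProd fun l _ => key _ ?_ (h2' l)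
    rw [add_comm]; exact_mod_cast h0' l

theorem damping_zero {Z x : ℂ} (hb : IsXXX b ∨ IsXXZ b)
    (h0 : ∀ m : ℤ, b (Z + (x + τ * m)) ≠ 0) (h0' : ∀ m : ℤ, b (Z + (-x + τ * m)) ≠ 0)
    (h1 : ∀ m : ℤ, b (Z - (x + τ * m)) ≠ 0) (h1' : ∀ m : ℤ, b (Z - (-x + τ * m)) ≠ 0) (m : ℤ) :
    damping b τ ω Z x 0 m = 1 := by
  have key : ∀ y : ℂ, (∀ m : ℤ, b (Z + (y + τ * m)) ≠ 0) → (∀ m : ℤ, b (Z - (y + τ * m)) ≠ 0) →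
      ∀ l : ℕ, shiftRatio b τ ω Z 0 (y + τ * l) = 1 := fun y hy hy' l => by
    rw [shiftRatio, zero_mul, sub_zero, add_zero, div_self]
    refine mul_ne_zero ?_ ?_
    · rw [add_comm]; exact_mod_cast hy l
    · rw [← neg_sub, b_neg hb, neg_ne_zero]
      have := hy' (l + 1)
      push_cast at this
      rwa [mul_add, mul_one, ← add_assoc] at this
  unfold damping
  split_ifs
  · exact Finset.prod_eq_one fun l _ => key x h0 h1 l
  · exact Finset.prod_eq_one fun l _ => key (-x) h0' h1' l

theorem deformer_mul_inv (hb : IsXXX b ∨ IsXXZ b) {Z A s u : ℂ} (h1 : b (A + u) ≠ 0)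
    (h2 : b (Z + u) ≠ 0) (h3 : b (Z - A) ≠ 0) :
    deformer b ω Z s u * (b (A + u))⁻¹ = b (Z - A - s * ω) / b (Z - A) * (b (A + u))⁻¹ +
      b (s * ω) / b (Z - A) * (b (Z + u))⁻¹ := by
  have key : b (u + Z - s * ω) * b (Z - A) = b (Z - A - s * ω) * b (Z + u) + b (s * ω) * b (A + u) := by
    rcases hb with ⟨c, -, h⟩ | ⟨c, ν, -, -, h⟩
    · simp only [h]; ring
    · simp only [h, Complex.sinh, mul_add, mul_sub, neg_add, neg_sub, Complex.exp_add,
        Complex.exp_sub, Complex.exp_neg]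
      field_simp
      ring
  rw [deformer, add_comm u Z]
  rw [add_comm u Z] at key
  generalize b (A + u) = p, b (Z + u) = q, b (Z - A) = r, b (Z + u - s * ω) = x1,
    b (Z - A - s * ω) = x2, b (s * ω) = x3 at *
  field_simp
  linear_combination key

end Damping

section Expanding

variable {b : ℂ → ℂ} {τ μ ω : ℂ} {d : ℕ → ℝ}
  {V : Type*} [NormedAddCommGroup V] [NormedSpace ℂ V] {M : ℕ}
  {x₀ : Fin M → ℂ} {Xp Xm : Fin M → (Fin M → ℤ) → V} {Z Z' κ : ℂ}

theorem exists_uniform_bound {ι α : Type*} [Finite ι] {f g : ι → α → ℝ} (hg : ∀ i a, 0 ≤ g i a)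
    (h : ∀ i, ∃ C, 0 ≤ C ∧ ∀ a, f i a ≤ C * g i a) : ∃ C, 0 ≤ C ∧ ∀ i a, f i a ≤ C * g i a := by
  have := Fintype.ofFinite ι
  choose C hC h using h
  exact ⟨∑ i, C i, Finset.sum_nonneg fun i _ => hC i, fun i a => (h i a).trans
    (mul_le_mul_of_nonneg_right (Finset.single_le_sum (fun i _ => hC i) (Finset.mem_univ i))
      (hg i a))⟩

theorem exists_uniform_lower {ι α : Type*} [Finite ι] {f : ι → α → ℝ}
    (h : ∀ i, ∃ c > 0, ∀ a, c ≤ f i a) : ∃ c > 0, ∀ i a, c ≤ f i a := by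
  have := Fintype.ofFinite ι
  choose c hc h using h
  rcases isEmpty_or_nonempty ι with hι | hι
  · exact ⟨1, one_pos, fun i => hι.elim i⟩
  · refine ⟨Finset.univ.inf' Finset.univ_nonempty c, ?_, fun i a =>
      (Finset.inf'_le _ (Finset.mem_univ i)).trans (h i a)⟩
    exact (Finset.lt_inf'_iff _).2 fun i _ => hc i

/-- The logarithm of the growth at a lattice point. -/
def logGrowth (d : ℕ → ℝ) (n : Fin M → ℤ) : ℝ := ∑ i, ∑ l ∈ Finset.range (n i).natAbs, d l

theorem IsExpanding.logGrowth_nonneg (hE : IsExpanding b τ μ ω d) (n : Fin M → ℤ) :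
    0 ≤ logGrowth d n :=
  Finset.sum_nonneg fun _ _ => Finset.sum_nonneg fun l _ => hE.nonneg l

theorem IsExpanding.growth_le (hE : IsExpanding b τ μ ω d) (n : Fin M → ℤ) (i : Fin M) :
    growth d (n i) ≤ Real.exp (logGrowth d n) :=
  Real.exp_le_exp.2 (Finset.single_le_sum (f := fun i => ∑ l ∈ Finset.range (n i).natAbs, d l)
    (fun _ _ => Finset.sum_nonneg fun l _ => hE.nonneg l) (Finset.mem_univ i))

theorem IsExpanding.logGrowth_sub_single_le (hE : IsExpanding b τ μ ω d) {D : ℝ}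
    (hD : ∀ l, d l ≤ D) (n : Fin M → ℤ) (i : Fin M) :
    logGrowth d (n - Pi.single i 1) ≤ logGrowth d n + D := by
  rw [logGrowth, logGrowth, ← Finset.add_sum_erase _ _ (Finset.mem_univ i),
    ← Finset.add_sum_erase (a := i) _ _ (Finset.mem_univ i)]
  have h1 : ∑ k ∈ Finset.univ.erase i, ∑ l ∈ Finset.range ((n - Pi.single i 1 : Fin M → ℤ) k).natAbs, d l =
      ∑ k ∈ Finset.univ.erase i, ∑ l ∈ Finset.range (n k).natAbs, d l :=
    Finset.sum_congr rfl fun k hk => by simp [Finset.ne_of_mem_erase hk]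
  have h2 : ∑ l ∈ Finset.range ((n - Pi.single i 1 : Fin M → ℤ) i).natAbs, d l ≤
      ∑ l ∈ Finset.range (n i).natAbs, d l + D := by
    have e : ((n - Pi.single i 1 : Fin M → ℤ) i).natAbs ≤ (n i).natAbs + 1 := by
      simp only [Pi.sub_apply, Pi.single_eq_same]; omega
    calc _ ≤ ∑ l ∈ Finset.range ((n i).natAbs + 1), d l :=
          Finset.sum_le_sum_of_subset_of_nonneg (Finset.range_subset_range.2 e)
            fun l _ _ => hE.nonneg l
      _ ≤ _ := by rw [Finset.sum_range_succ]; linarith [hD (n i).natAbs]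
  rw [h1]; linarith

/-- Consecutive discriminant factors are not both small. -/
theorem PairedResidues.exists_discr_lower (hb : IsXXX b ∨ IsXXZ b) (hE : IsExpanding b τ μ ω d)
    (hP : PairedResidues b τ x₀ Xp Xm Z Z' κ) :
    ∃ δ > 0, ∀ i n, δ ≤ discr b τ x₀ i n ∨ δ ≤ discr b τ x₀ i (n - Pi.single i 1) := by
  obtain ⟨c₁, hc₁, h₁⟩ : ∃ c > 0, ∀ (p : {p : Fin M × Fin M // p.1 ≠ p.2}) (m : ℤ),
      c ≤ ‖b (x₀ p.1.1 + x₀ p.1.2 + τ * m)‖ :=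
    exists_uniform_lower fun p => hE.exists_lower (hP.sep_add p.1.1 p.1.2 p.2)
  obtain ⟨c₂, hc₂, h₂⟩ : ∃ c > 0, ∀ (p : {p : Fin M × Fin M // p.1 ≠ p.2}) (m : ℤ),
      c ≤ ‖b (x₀ p.1.1 - x₀ p.1.2 + τ * m)‖ :=
    exists_uniform_lower fun p => hE.exists_lower (hP.sep_sub p.1.1 p.1.2 p.2)
  obtain ⟨c₃, hc₃, h₃⟩ : ∃ c > 0, ∀ (i : Fin M) (m : ℤ),
      c ≤ max ‖b (2 * x₀ i + τ * (2 * m : ℤ))‖ ‖b (2 * x₀ i + τ * (2 * (m - 1) : ℤ))‖ := by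
    refine exists_uniform_lower fun i => ?_
    have ht : Tendsto (fun m : ℤ => ‖b (2 * x₀ i + τ * (2 * m : ℤ))‖) cofinite atTop :=
      (hE.tendsto _).comp (Function.Injective.tendsto_cofinite
        fun p q (h : 2 * p = 2 * q) => by omega)
    have ht' := tendsto_atTop_mono (fun m : ℤ => le_max_left ‖b (2 * x₀ i + τ * (2 * m : ℤ))‖
      ‖b (2 * x₀ i + τ * (2 * (m - 1) : ℤ))‖) ht
    obtain ⟨m, hm⟩ := ht'.exists_forall_le
    refine ⟨_, ?_, hm⟩
    rw [gt_iff_lt, lt_max_iff, norm_pos_iff, norm_pos_iff]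
    by_contra! hcon
    refine hP.root 2 (by norm_num) ?_
    have e : ((2 : ℤ) : ℂ) * τ = (2 * x₀ i + τ * (2 * m : ℤ)) - (2 * x₀ i + τ * (2 * (m - 1) : ℤ)) := by
      push_cast; ring
    rw [e]
    generalize 2 * x₀ i + τ * (2 * m : ℤ) = p, 2 * x₀ i + τ * (2 * (m - 1) : ℤ) = q at hcon
    rcases hb with ⟨c, hc, h⟩ | ⟨c, ν, hc, -, h⟩
    · have := hcon.1; have := hcon.2
      simp only [h] at *
      linear_combination hcon.1 - hcon.2
    · simp only [h, mul_eq_zero, hc, false_or] at hcon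
      rw [h, mul_sub, Complex.sinh_sub, hcon.1, hcon.2]; ring
  refine ⟨c₃ * ∏ _k ∈ Finset.range (M - 1), (c₁ * c₂), by positivity, fun i n => ?_⟩
  have hcard : ∀ i : Fin M, (Finset.univ.erase i).card = M - 1 := fun i => by
    rw [Finset.card_erase_of_mem (Finset.mem_univ _), Finset.card_univ, Fintype.card_fin]
  have hprod : ∀ n : Fin M → ℤ, ∏ _k ∈ Finset.range (M - 1), (c₁ * c₂) ≤
      ∏ k ∈ Finset.univ.erase i, (‖b (latticePoint τ x₀ n i + latticePoint τ x₀ n k)‖ *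
      ‖b (latticePoint τ x₀ n i - latticePoint τ x₀ n k)‖) := fun n => by
    rw [Finset.prod_const, Finset.card_range, ← hcard i, ← Finset.prod_const]
    refine Finset.prod_le_prod (fun _ _ => by positivity) fun k hk => ?_
    have hne : i ≠ k := (Finset.ne_of_mem_erase hk).symm
    have e1 : latticePoint τ x₀ n i + latticePoint τ x₀ n k =
        x₀ i + x₀ k + τ * (n i + n k : ℤ) := by simp only [latticePoint]; push_cast; ring
    have e2 : latticePoint τ x₀ n i - latticePoint τ x₀ n k =
        x₀ i - x₀ k + τ * (n i - n k : ℤ) := by simp only [latticePoint]; push_cast; ring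
    rw [e1, e2]
    exact mul_le_mul (h₁ ⟨(i, k), hne⟩ _) (h₂ ⟨(i, k), hne⟩ _) hc₂.le (norm_nonneg _)
  have fin : ∀ n : Fin M → ℤ, c₃ ≤ ‖b (2 * x₀ i + τ * (2 * n i : ℤ))‖ →
      c₃ * ∏ _k ∈ Finset.range (M - 1), (c₁ * c₂) ≤ discr b τ x₀ i n := fun n hn => by
    rw [discr]
    have e : 2 * latticePoint τ x₀ n i = 2 * x₀ i + τ * (2 * n i : ℤ) := by
      simp only [latticePoint]; push_cast; ring
    rw [e]
    exact mul_le_mul hn (hprod n) (by positivity) (norm_nonneg _)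
  rcases le_max_iff.1 (h₃ i (n i)) with h | h
  · exact Or.inl (fin n h)
  · refine Or.inr (fin _ ?_)
    simpa using h

/-- The flow grows at most like a power of `b`, relative to sums of simple fractions. -/
theorem PairedResidues.flow_le (hb : IsXXX b ∨ IsXXZ b) (hE : IsExpanding b τ μ ω d)
    (hP : PairedResidues b τ x₀ Xp Xm Z Z' κ) :
    ∃ S : (Fin M → ℤ) → ℝ, Summable S ∧ (∀ n, 0 ≤ S n) ∧ ∀ i n,
      ‖flow b τ x₀ Xm Z Z' κ i n‖ ≤ Real.exp ((4 * M - 1) * logGrowth d n) *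
        (S n + S (n - Pi.single i 1)) := by
  rcases Nat.eq_zero_or_pos M with rfl | hM
  · exact ⟨0, summable_zero, fun _ => le_rfl, fun i => i.elim0⟩
  obtain ⟨δ, hδ, hdis⟩ := hP.exists_discr_lower hb hE
  obtain ⟨K, hK, hflow⟩ := hP.flow_bound hb
  obtain ⟨D, hD⟩ := hE.bounded
  obtain ⟨C₁, hC₁, h₁⟩ : ∃ C, 0 ≤ C ∧ ∀ (p : Fin (2 * M) × Fin M) (m : ℤ),
      ‖b (Z + (p.1 : ℕ) * τ + x₀ p.2 + τ * m)‖ ≤ C * growth d m :=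
    exists_uniform_bound (fun _ _ => (Real.exp_pos _).le) fun p => hE.upper _
  obtain ⟨C₂, hC₂, h₂⟩ : ∃ C, 0 ≤ C ∧ ∀ (p : Fin (2 * M) × Fin M) (m : ℤ),
      ‖b (Z + (p.1 : ℕ) * τ - x₀ p.2 + τ * m)‖ ≤ C * growth d m :=
    exists_uniform_bound (fun _ _ => (Real.exp_pos _).le) fun p => hE.upper _
  set C := max C₁ C₂
  have hC : 0 ≤ C := le_max_of_le_left hC₁
  have hB : ∀ n : Fin M → ℤ, ∀ j < 2 * M, ∀ k,
      ‖b (Z + j * τ + latticePoint τ x₀ n k)‖ ≤ C * Real.exp (logGrowth d n) ∧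
      ‖b (Z + j * τ - latticePoint τ x₀ n k)‖ ≤ C * Real.exp (logGrowth d n) := by
    refine fun n j hj k => ⟨?_, ?_⟩
    · have e : Z + j * τ + latticePoint τ x₀ n k = Z + j * τ + x₀ k + τ * (n k) := by
        simp only [latticePoint]; ring
      rw [e]
      exact (h₁ (⟨j, hj⟩, k) _).trans (mul_le_mul (le_max_left _ _) (hE.growth_le n k)
        (Real.exp_pos _).le hC)
    · have e : Z + j * τ - latticePoint τ x₀ n k = Z + j * τ - x₀ k + τ * (-n k : ℤ) := by
        simp only [latticePoint]; push_cast; ring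
      rw [e]
      refine (h₂ (⟨j, hj⟩, k) _).trans (mul_le_mul (le_max_right _ _) ?_ (Real.exp_pos _).le hC)
      rw [growth_neg]
      exact hE.growth_le n k
  set S₀ : (Fin M → ℤ) → ℝ := fun n =>
    ∑ j ∈ Finset.range (2 * M), ‖cauchySum b τ x₀ Xp Xm (Z + j * τ) n‖ with hS₀
  have hS₀n : ∀ n, 0 ≤ S₀ n := fun n => Finset.sum_nonneg fun _ _ => norm_nonneg _
  have hS₀s : Summable S₀ := summable_sum fun j _ => by
    have := hP.summable j
    simpa only [Int.cast_natCast] using this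
  set K' := K * C ^ (4 * M - 1) * Real.exp ((4 * M - 1) * D) / δ
  have hD0 : 0 ≤ D := (hE.nonneg 0).trans (hD 0)
  have hcast : ((4 * M - 1 : ℕ) : ℝ) = 4 * M - 1 := by
    rw [Nat.cast_sub (by omega)]; push_cast; ring
  have hM1 : (0 : ℝ) ≤ 4 * M - 1 := by rw [← hcast]; exact Nat.cast_nonneg _
  have hpow : ∀ n : Fin M → ℤ, (C * Real.exp (logGrowth d n)) ^ (4 * M - 1) =
      C ^ (4 * M - 1) * Real.exp ((4 * M - 1) * logGrowth d n) := fun n => by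
    rw [mul_pow, ← Real.exp_nat_mul, hcast]
  have hK' : 0 ≤ K' := by positivity
  refine ⟨fun n => K' * S₀ n, hS₀s.mul_left _, fun n => mul_nonneg hK' (hS₀n n), fun i n => ?_⟩
  have hfl := norm_nonneg (flow b τ x₀ Xm Z Z' κ i n)
  have hexp1 : 1 ≤ Real.exp ((4 * M - 1) * D) := Real.one_le_exp (by positivity)
  have hKC : 0 ≤ K * C ^ (4 * M - 1) := by positivity
  rcases hdis i n with h | h
  · have h3 := (hflow n i _ (by positivity) (hB n)).1
    rw [hpow] at h3
    have h4 := (mul_le_mul_of_nonneg_left h hfl).trans h3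
    rw [← le_div_iff₀ hδ] at h4
    refine h4.trans ?_
    have : K * (C ^ (4 * M - 1) * Real.exp ((4 * M - 1) * logGrowth d n)) * S₀ n / δ =
        Real.exp ((4 * M - 1) * logGrowth d n) * (K * C ^ (4 * M - 1) / δ * S₀ n) := by ring
    change K * (C ^ (4 * M - 1) * Real.exp ((4 * M - 1) * logGrowth d n)) * S₀ n / δ ≤ _
    rw [this]
    refine mul_le_mul_of_nonneg_left ?_ (Real.exp_pos _).le
    have h5 : K * C ^ (4 * M - 1) / δ ≤ K' := by
      exact div_le_div_of_nonneg_right (le_mul_of_one_le_right hKC hexp1) hδ.le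
    have := mul_le_mul_of_nonneg_right h5 (hS₀n n)
    have := mul_nonneg hK' (hS₀n (n - Pi.single i 1))
    linarith
  · have h3 := (hflow (n - Pi.single i 1) i _ (by positivity) (hB _)).2
    rw [hpow, sub_add_cancel] at h3
    have h4 := (mul_le_mul_of_nonneg_left h hfl).trans h3
    rw [← le_div_iff₀ hδ] at h4
    refine h4.trans ?_
    change K * (C ^ (4 * M - 1) * Real.exp ((4 * M - 1) * logGrowth d (n - Pi.single i 1))) *
      S₀ (n - Pi.single i 1) / δ ≤ _
    have h6 : Real.exp ((4 * M - 1) * logGrowth d (n - Pi.single i 1)) ≤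
        Real.exp ((4 * M - 1) * logGrowth d n) * Real.exp ((4 * M - 1) * D) := by
      rw [← Real.exp_add, ← mul_add]
      exact Real.exp_le_exp.2 (mul_le_mul_of_nonneg_left (hE.logGrowth_sub_single_le hD n i) hM1)
    calc _ ≤ K * (C ^ (4 * M - 1) * (Real.exp ((4 * M - 1) * logGrowth d n) *
          Real.exp ((4 * M - 1) * D))) * S₀ (n - Pi.single i 1) / δ := by
          have := hS₀n (n - Pi.single i 1)
          gcongr
      _ = Real.exp ((4 * M - 1) * logGrowth d n) * (K' * S₀ (n - Pi.single i 1)) := by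
          simp only [K']; ring
      _ ≤ _ := by
          refine mul_le_mul_of_nonneg_left ?_ (Real.exp_pos _).le
          have := mul_nonneg hK' (hS₀n n)
          linarith

end Expanding

section Expanding

variable {b : ℂ → ℂ} {τ μ ω : ℂ} {d : ℕ → ℝ}
  {V : Type*} [NormedAddCommGroup V] [NormedSpace ℂ V] {M : ℕ}
  {x₀ : Fin M → ℂ} {Xp Xm : Fin M → (Fin M → ℤ) → V} {Z Z' κ : ℂ}

/-- The difference of two sums of simple fractions, deformed by `deformer` and damped by
`damping`. The deformation costs a further sum of simple fractions, with poles at `-Zh`. -/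
def dampedSum (b : ℂ → ℂ) (τ ω : ℂ) (x₀ : Fin M → ℂ) (Xp Xm : Fin M → (Fin M → ℤ) → V)
    (Z Z' κ Zh s : ℂ) (n : Fin M → ℤ) : V :=
  (∏ i, damping b τ ω Zh (x₀ i) s (n i)) •
    ((b (Zh - (Z + τ) - s * ω) / b (Zh - (Z + τ))) • cauchySum b τ x₀ Xp Xm (Z + τ) n +
      (b (s * ω) / b (Zh - (Z + τ)) - κ * (b (s * ω) / b (Zh - Z'))) •
        cauchySum b τ x₀ Xp Xm Zh n -
      (b (Zh - Z' - s * ω) / b (Zh - Z')) • (κ • cauchySum b τ x₀ Xp Xm Z' n))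

theorem deformed_cauchySum (hb : IsXXX b ∨ IsXXZ b) {A Zh s : ℂ} {n : Fin M → ℤ}
    (h1 : ∀ i, b (A + latticePoint τ x₀ n i) ≠ 0) (h1' : ∀ i, b (A - latticePoint τ x₀ n i) ≠ 0)
    (h2 : ∀ i, b (Zh + latticePoint τ x₀ n i) ≠ 0) (h2' : ∀ i, b (Zh - latticePoint τ x₀ n i) ≠ 0)
    (h3 : b (Zh - A) ≠ 0) :
    (b (Zh - A - s * ω) / b (Zh - A)) • cauchySum b τ x₀ Xp Xm A n +
      (b (s * ω) / b (Zh - A)) • cauchySum b τ x₀ Xp Xm Zh n =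
    ∑ i, ((deformer b ω Zh s (latticePoint τ x₀ n i) * (b (A + latticePoint τ x₀ n i))⁻¹) • Xp i n +
      (deformer b ω Zh s (-latticePoint τ x₀ n i) * (b (A + -latticePoint τ x₀ n i))⁻¹) •
        Xm i n) := by
  rw [cauchySum, cauchySum, Finset.smul_sum, Finset.smul_sum, ← Finset.sum_add_distrib]
  refine Finset.sum_congr rfl fun i _ => ?_
  have h1i := h1' i
  have h2i := h2' i
  rw [sub_eq_add_neg] at h1i h2i
  rw [deformer_mul_inv hb (h1 i) (h2 i) h3, deformer_mul_inv hb h1i h2i h3, sub_eq_add_neg A,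
    sub_eq_add_neg Zh (latticePoint τ x₀ n i)]
  module

/-- The deformed sums telescope as the original ones do. -/
theorem PairedResidues.dampedSum_eq (hb : IsXXX b ∨ IsXXZ b)
    (hP : PairedResidues b τ x₀ Xp Xm Z Z' κ) {k : ℤ} (hk : k ≠ 1) {s : ℂ}
    (h2 : ∀ i, ∀ l : ℕ, b (x₀ i + τ * l + τ - (Z + k * τ) + s * ω) ≠ 0)
    (h2' : ∀ i, ∀ l : ℕ, b (-x₀ i + τ * l + τ - (Z + k * τ) + s * ω) ≠ 0) (n : Fin M → ℤ) :
    dampedSum b τ ω x₀ Xp Xm Z Z' κ (Z + k * τ) s n =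
      ∑ i, (((∏ j, damping b τ ω (Z + k * τ) (x₀ j) s (n j)) *
          deformer b ω (Z + k * τ) s (-latticePoint τ x₀ n i)) • flow b τ x₀ Xm Z Z' κ i n -
        ((∏ j, damping b τ ω (Z + k * τ) (x₀ j) s ((n + Pi.single i 1 : Fin M → ℤ) j)) *
          deformer b ω (Z + k * τ) s (-latticePoint τ x₀ (n + Pi.single i 1) i)) •
            flow b τ x₀ Xm Z Z' κ i (n + Pi.single i 1)) := by
  have lo : ∀ (k : ℤ) i, ∀ m : ℤ, b (Z + k * τ + (x₀ i + τ * m)) ≠ 0 ∧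
      b (Z + k * τ - (x₀ i + τ * m)) ≠ 0 := fun k i m => by
    obtain ⟨c, hc, h⟩ := hP.lower k
    exact ⟨norm_pos_iff.1 (hc.trans_le (h i m).1), norm_pos_iff.1 (hc.trans_le (h i m).2)⟩
  have lo' : ∀ i, ∀ m : ℤ, b (Z' + (x₀ i + τ * m)) ≠ 0 ∧ b (Z' - (x₀ i + τ * m)) ≠ 0 := fun i m => by
    obtain ⟨c, hc, h⟩ := hP.lower'
    exact ⟨norm_pos_iff.1 (hc.trans_le (h i m).1), norm_pos_iff.1 (hc.trans_le (h i m).2)⟩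
  have lo1 := lo 1
  simp only [Int.cast_one, one_mul] at lo1
  set Zh := Z + k * τ with hZh
  have hroot : b (Zh - (Z + τ)) ≠ 0 := by
    have := hP.root (k - 1) (sub_ne_zero.2 hk)
    push_cast at this
    have e : Zh - (Z + τ) = (k - 1) * τ := by rw [hZh]; ring
    rwa [e]
  have e1 := deformed_cauchySum (Xp := Xp) (Xm := Xm) (ω := ω) (s := s) hb (fun i => (lo1 i (n i)).1)
    (fun i => (lo1 i (n i)).2) (fun i => (lo k i (n i)).1) (fun i => (lo k i (n i)).2) hroot
  have e2 := deformed_cauchySum (Xp := Xp) (Xm := Xm) (ω := ω) (s := s) hb (fun i => (lo' i (n i)).1)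
    (fun i => (lo' i (n i)).2) (fun i => (lo k i (n i)).1) (fun i => (lo k i (n i)).2) (hP.ne k)
  have e3 : dampedSum b τ ω x₀ Xp Xm Z Z' κ Zh s n = (∏ i, damping b τ ω Zh (x₀ i) s (n i)) •
      (((b (Zh - (Z + τ) - s * ω) / b (Zh - (Z + τ))) • cauchySum b τ x₀ Xp Xm (Z + τ) n +
      (b (s * ω) / b (Zh - (Z + τ))) • cauchySum b τ x₀ Xp Xm Zh n) -
      κ • ((b (Zh - Z' - s * ω) / b (Zh - Z')) • cauchySum b τ x₀ Xp Xm Z' n +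
        (b (s * ω) / b (Zh - Z')) • cauchySum b τ x₀ Xp Xm Zh n)) := by
    rw [dampedSum]; module
  rw [e3, e1, e2, Finset.smul_sum, ← Finset.sum_sub_distrib, Finset.smul_sum]
  refine Finset.sum_congr rfl fun i _ => ?_
  have hφ : (∏ j, damping b τ ω Zh (x₀ j) s ((n + Pi.single i 1 : Fin M → ℤ) j)) *
      deformer b ω Zh s (-latticePoint τ x₀ (n + Pi.single i 1) i) =
      (∏ j, damping b τ ω Zh (x₀ j) s (n j)) * deformer b ω Zh s (latticePoint τ x₀ n i) := by
    rw [← Finset.prod_erase_mul _ _ (Finset.mem_univ i),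
      ← Finset.prod_erase_mul (a := i) Finset.univ (fun j => damping b τ ω Zh (x₀ j) s (n j))
        (Finset.mem_univ i), mul_assoc, mul_assoc]
    congr 1
    · exact Finset.prod_congr rfl fun j hj => by simp [Finset.ne_of_mem_erase hj]
    · have := damping_succ hb (s := s) (fun m => (lo k i m).2) (fun m => by
        have := (lo k i (-m)).1
        push_cast at this
        convert this using 2; ring) (h2 i) (h2' i) (n i)
      rw [latticePoint_add_single, neg_add, ← sub_eq_add_neg]
      simpa [latticePoint] using this
  rw [hφ, hP.flow_add_single, flow]
  rw [← hZh]
  module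

theorem tsum_add_right_eq {G W : Type*} [AddGroup G] [AddCommMonoid W] [TopologicalSpace W] (f : G → W)
    (a : G) :
    ∑' n, f (n + a) = ∑' n, f n :=
  (Equiv.addRight a).tsum_eq f

/-- If the real part of `s` is large, then the damped flows are summable and the damped sums
telescope. -/
theorem PairedResidues.tsum_dampedSum_eq_zero [CompleteSpace V] (hb : IsXXX b ∨ IsXXZ b)
    (hE : IsExpanding b τ μ ω d) (hP : PairedResidues b τ x₀ Xp Xm Z Z' κ) {k : ℤ} (hk : k ≠ 1)
    {s : ℂ} (hs : 2 * M ≤ s.re) {C : ℝ} (hC : 0 ≤ C)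
    (hφ : ∀ n : Fin M → ℤ, ‖∏ i, damping b τ ω (Z + k * τ) (x₀ i) s (n i)‖ ≤
      C * Real.exp (-(2 * s.re * logGrowth d n)))
    (h2 : ∀ i, ∀ l : ℕ, b (x₀ i + τ * l + τ - (Z + k * τ) + s * ω) ≠ 0)
    (h2' : ∀ i, ∀ l : ℕ, b (-x₀ i + τ * l + τ - (Z + k * τ) + s * ω) ≠ 0) :
    ∑' n, dampedSum b τ ω x₀ Xp Xm Z Z' κ (Z + k * τ) s n = 0 := by
  obtain ⟨S, hS, hS0, hfl⟩ := hP.flow_le hb hE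
  have hDU := hP.dampedSum_eq (ω := ω) (s := s) hb hk h2 h2'
  set Zh := Z + k * τ with hZh
  set U : Fin M → (Fin M → ℤ) → V := fun i n =>
    ((∏ j, damping b τ ω Zh (x₀ j) s (n j)) * deformer b ω Zh s (-latticePoint τ x₀ n i)) •
      flow b τ x₀ Xm Z Z' κ i n with hUdef
  have hU : ∀ i, Summable (U i) := fun i => by
    obtain ⟨c, hc, hlow⟩ := hP.lower k
    obtain ⟨C', hC', hup⟩ := hE.upper (-x₀ i + Zh - s * ω)
    have hd : ∀ n : Fin M → ℤ, ‖deformer b ω Zh s (-latticePoint τ x₀ n i)‖ ≤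
        C' * Real.exp (logGrowth d n) / c := fun n => by
      rw [deformer, norm_div]
      have e1 : -latticePoint τ x₀ n i + Zh - s * ω = -x₀ i + Zh - s * ω + τ * (-n i : ℤ) := by
        simp only [latticePoint]; push_cast; ring
      have e2 : -latticePoint τ x₀ n i + Zh = Zh - (x₀ i + τ * n i) := by
        simp only [latticePoint]; ring
      rw [e1, e2]
      refine div_le_div₀ (by positivity) ?_ hc (hlow i (n i)).2
      refine (hup _).trans ?_
      rw [growth_neg]
      exact mul_le_mul_of_nonneg_left (hE.growth_le n i) hC'
    have hsum : Summable fun n => C * C' / c * (S n + S (n - Pi.single i 1)) :=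
      (hS.add (hS.comp_injective (i := fun n : Fin M → ℤ => n - Pi.single i 1)
        fun _ _ h => sub_left_injective h)).mul_left _
    refine Summable.of_norm_bounded hsum fun n => ?_
    have hS1 : 0 ≤ S n + S (n - Pi.single i 1) := add_nonneg (hS0 _) (hS0 _)
    have hL := hE.logGrowth_nonneg n
    have hexp : Real.exp (-(2 * s.re * logGrowth d n)) * Real.exp (logGrowth d n) *
        Real.exp ((4 * M - 1) * logGrowth d n) ≤ 1 := by
      rw [← Real.exp_add, ← Real.exp_add]
      refine Real.exp_le_one_iff.2 ?_
      nlinarith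
    have h1 : ‖U i n‖ ≤ (C * Real.exp (-(2 * s.re * logGrowth d n))) *
        (C' * Real.exp (logGrowth d n) / c) * (Real.exp ((4 * M - 1) * logGrowth d n) *
        (S n + S (n - Pi.single i 1))) := by
      rw [hUdef, norm_smul, norm_mul]
      exact mul_le_mul (mul_le_mul (hφ n) (hd n) (norm_nonneg _) (by positivity))
        (hfl i n) (norm_nonneg _) (by positivity)
    refine h1.trans ?_
    have h3 := mul_le_mul_of_nonneg_left hexp
      (by positivity : 0 ≤ C * C' / c * (S n + S (n - Pi.single i 1)))
    rw [mul_one] at h3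
    refine le_trans (le_of_eq ?_) h3
    generalize Real.exp (-(2 * s.re * logGrowth d n)) = q₁, Real.exp (logGrowth d n) = q₂,
      Real.exp ((4 * M - 1) * logGrowth d n) = q₃
    ring
  have hU' : ∀ i, Summable fun n => U i (n + Pi.single i 1) := fun i =>
    (hU i).comp_injective (i := fun n : Fin M → ℤ => n + Pi.single i 1)
      fun _ _ h => add_left_injective _ h
  have hDU' : ∀ n, dampedSum b τ ω x₀ Xp Xm Z Z' κ Zh s n =
      ∑ i, (U i n - U i (n + Pi.single i 1)) := hDU
  have hshift : ∀ i, ∑' n : Fin M → ℤ, U i (n + Pi.single i 1) = ∑' n, U i n := fun i =>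
    tsum_add_right_eq (U i) _
  clear_value U
  rw [tsum_congr hDU', Summable.tsum_finsetSum fun i _ => (hU i).sub (hU' i)]
  refine Finset.sum_eq_zero fun i _ => ?_
  rw [(hU i).tsum_sub (hU' i), hshift, sub_self]

/-- For an expanding function `b` the sum over the lattice of the difference of the two sums of
simple fractions vanishes: by telescoping for `s` with large real part, and by analytic
continuation for `s = 0`. -/
theorem PairedResidues.tsum_eq_zero_of_isExpanding [CompleteSpace V] (hb : IsXXX b ∨ IsXXZ b)
    (hE : IsExpanding b τ μ ω d) (hP : PairedResidues b τ x₀ Xp Xm Z Z' κ) :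
    ∑' n, (cauchySum b τ x₀ Xp Xm (Z + τ) n - κ • cauchySum b τ x₀ Xp Xm Z' n) = 0 := by
  have lo : ∀ (k : ℤ) i, ∀ m : ℤ, b (Z + k * τ + (x₀ i + τ * m)) ≠ 0 ∧
      b (Z + k * τ - (x₀ i + τ * m)) ≠ 0 := fun k i m => by
    obtain ⟨c, hc, h⟩ := hP.lower k
    exact ⟨norm_pos_iff.1 (hc.trans_le (h i m).1), norm_pos_iff.1 (hc.trans_le (h i m).2)⟩
  have lo0 : ∀ (k : ℤ) i, ∀ m : ℤ, b (Z + k * τ + (-x₀ i + τ * m)) ≠ 0 := fun k i m => by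
    have := (lo k i (-m)).2
    push_cast at this
    convert this using 2; ring
  have lo0' : ∀ (k : ℤ) i, ∀ m : ℤ, b (Z + k * τ - (-x₀ i + τ * m)) ≠ 0 := fun k i m => by
    have := (lo k i (-m)).1
    push_cast at this
    convert this using 2; ring
  -- far to the left of `Z` no pole of the damping factors lies in the half plane `0 ≤ re s`
  have hre : ∀ y, ∀ᶠ k : ℤ in atBot, ∀ s : ℂ, 0 ≤ s.re → ∀ l : ℕ,
      b (y + τ * l + τ - (Z + k * τ) + s * ω) ≠ 0 := fun y => by
    have hk : ∀ᶠ k : ℤ in atBot, (k : ℝ) * (μ * τ).re < (μ * (y + τ - Z)).re :=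
      ((tendsto_intCast_atBot_iff.2 tendsto_id).atBot_mul_const hE.re_mul_pos).eventually
        (eventually_lt_atBot _)
    filter_upwards [hk] with k hk s hs l
    obtain ⟨c, hc, h⟩ := hE.lower
    refine norm_pos_iff.1 (lt_of_lt_of_le (mul_pos hc (abs_pos.2 (ne_of_gt ?_))) (h _))
    have e : μ * (y + τ * l + τ - (Z + k * τ) + s * ω) = μ * (y + τ - Z) - ((k : ℝ) : ℂ) * (μ * τ) +
        ((l : ℝ) : ℂ) * (μ * τ) + μ * (s * ω) := by push_cast; ring
    rw [e, Complex.add_re, Complex.add_re, Complex.sub_re, Complex.re_ofReal_mul,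
      Complex.re_ofReal_mul]
    have := hE.re_mul_nonneg s hs
    have := mul_nonneg (Nat.cast_nonneg (α := ℝ) l) hE.re_mul_pos.le
    linarith
  obtain ⟨k, hk1, hkr, hkr', hkn, hkn'⟩ := (((eventually_lt_atBot (1 : ℤ)).and
    ((eventually_all.2 fun i => hE.ratio (x₀ i) Z).and
    ((eventually_all.2 fun i => hE.ratio (-x₀ i) Z).and
    ((eventually_all.2 fun i => hre (x₀ i)).and
    (eventually_all.2 fun i => hre (-x₀ i)))))).exists)
  set Zh := Z + k * τ with hZh
  -- The damped sums telescope for `2 M ≤ re s`; the radius `R` leaves room for such `s`. The bound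
  -- on the damping factors is uniform on the closed half disc that joins them to `0`.
  set R : ℝ := 2 * M + 3
  obtain ⟨C, hC, hφ⟩ : ∃ C, 0 ≤ C ∧ ∀ (i : Fin M) (p : {s : ℂ // 0 ≤ s.re ∧ ‖s‖ ≤ R} × ℤ),
      ‖damping b τ ω Zh (x₀ i) p.1 p.2‖ ≤ C *
        Real.exp (-(2 * (p.1 : ℂ).re * ∑ l ∈ Finset.range p.2.natAbs, d l)) := by
    refine exists_uniform_bound (fun _ _ => (Real.exp_pos _).le) fun i => ?_
    obtain ⟨ε, hε, h⟩ := hkr i (fun m => (lo k i m).1) R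
    obtain ⟨ε', hε', h'⟩ := hkr' i (lo0 k i) R
    obtain ⟨C, hC, hφ⟩ := hE.norm_damping_le hε hε' h h'
    exact ⟨C, hC, fun p => hφ p.1 p.1.2.1 p.1.2.2 p.2⟩
  let φ : ℂ → (Fin M → ℤ) → ℂ := fun s n => ∏ i, damping b τ ω Zh (x₀ i) s (n i)
  have hφ' : ∀ s : ℂ, 0 ≤ s.re → ‖s‖ ≤ R → ∀ n : Fin M → ℤ,
      ‖φ s n‖ ≤ C ^ M * Real.exp (-(2 * s.re * logGrowth d n)) := fun s hs hR n => by
    simp only [φ, norm_prod]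
    refine (Finset.prod_le_prod (fun _ _ => norm_nonneg _)
      fun i _ => hφ i (⟨s, hs, hR⟩, n i)).trans ?_
    rw [Finset.prod_mul_distrib, Finset.prod_const, Finset.card_univ, Fintype.card_fin,
      ← Real.exp_sum, Finset.sum_neg_distrib, logGrowth, Finset.mul_sum]
  set D : ℂ → (Fin M → ℤ) → V := fun s n => dampedSum b τ ω x₀ Xp Xm Z Z' κ Zh s n with hD
  have hbd := b_differentiable hb
  have hdiff : ∀ s : ℂ, 0 ≤ s.re → ∀ n, DifferentiableAt ℂ (fun s => D s n) s := fun s hs n => by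
    have h1 : DifferentiableAt ℂ (fun s => ∏ i, damping b τ ω Zh (x₀ i) s (n i)) s :=
      DifferentiableAt.fun_finsetProd fun i _ => differentiableAt_damping hb (fun m => (lo k i m).1)
        (lo0 k i) (hkn i s hs) (hkn' i s hs) _
    have h2 : ∀ y, DifferentiableAt ℂ (fun s => b (y - s * ω)) s := fun y =>
      hbd.differentiableAt.comp (f := fun s => y - s * ω) s (by fun_prop)
    have h3 : DifferentiableAt ℂ (fun s => b (s * ω)) s :=
      hbd.differentiableAt.comp (f := fun s => s * ω) s (by fun_prop)
    simp only [hD, dampedSum]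
    refine h1.smul (DifferentiableAt.sub (DifferentiableAt.add ?_ ?_) ?_)
    · exact ((h2 _).div_const _).smul_const _
    · exact ((h3.div_const _).sub ((h3.div_const _).const_mul _)).smul_const _
    · exact ((h2 _).div_const _).smul_const _
  -- Each term of the damped sum is dominated, uniformly in `s`, by the undamped sums of simple
  -- fractions at `Z + τ`, `Z'` and `Zh`, which are summable.
  obtain ⟨A, hA⟩ : ∃ A : ℝ, ∀ s ∈ Metric.closedBall (0 : ℂ) R,
      ‖((b (Zh - (Z + τ) - s * ω) / b (Zh - (Z + τ)),
        b (s * ω) / b (Zh - (Z + τ)) - κ * (b (s * ω) / b (Zh - Z'))),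
        b (Zh - Z' - s * ω) / b (Zh - Z'))‖ ≤ A := by
    refine (isCompact_closedBall _ _).exists_bound_of_continuousOn (Continuous.continuousOn ?_)
    have h2 : ∀ y, Continuous fun s => b (y - s * ω) := fun y =>
      (b_continuous hb).comp (by fun_prop)
    have h3 : Continuous fun s => b (s * ω) := (b_continuous hb).comp (by fun_prop)
    exact (((h2 _).div_const _).prodMk ((h3.div_const _).sub ((h3.div_const _).const_mul _))).prodMk
      ((h2 _).div_const _)
  have hA0 : 0 ≤ A := (norm_nonneg _).trans (hA 0 (by simp [R]; positivity))
  set G : (Fin M → ℤ) → ℝ := fun n => C ^ M * (A * ‖cauchySum b τ x₀ Xp Xm (Z + τ) n‖ +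
    A * ‖cauchySum b τ x₀ Xp Xm Zh n‖ + A * ‖κ • cauchySum b τ x₀ Xp Xm Z' n‖)
  have hG : Summable G := by
    have h1 := hP.summable 1
    simp only [Int.cast_one, one_mul] at h1
    exact (((h1.mul_left A).add ((hP.summable k).mul_left A)).add
      (hP.summable'.mul_left A)).mul_left _
  have hDG : ∀ s : ℂ, 0 ≤ s.re → ‖s‖ ≤ R → ∀ n, ‖D s n‖ ≤ G n := fun s hs hR n => by
    have h1 := hA s (mem_closedBall_zero_iff.2 hR)
    rw [norm_prod_le_iff, norm_prod_le_iff] at h1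
    simp only [hD, dampedSum, norm_smul _ (_ + _ - _)]
    refine mul_le_mul ((hφ' s hs hR n).trans (mul_le_of_le_one_right (by positivity) ?_)) ?_
      (norm_nonneg _) (by positivity)
    · refine Real.exp_le_one_iff.2 ?_
      have := mul_nonneg hs (hE.logGrowth_nonneg n)
      linarith
    · refine (norm_sub_le _ _).trans (add_le_add ((norm_add_le _ _).trans (add_le_add ?_ ?_)) ?_)
      all_goals
        rw [norm_smul]
        refine mul_le_mul_of_nonneg_right ?_ (norm_nonneg _)
      · exact h1.1.1
      · exact h1.1.2
      · exact h1.2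
  have hzero : ∀ s : ℂ, 2 * M ≤ s.re → ‖s‖ ≤ R → ∑' n, D s n = 0 := fun s hs hR =>
    have hs0 : 0 ≤ s.re := le_trans (by positivity) hs
    hP.tsum_dampedSum_eq_zero hb hE hk1.ne hs (by positivity) (hφ' s hs0 hR)
      (fun i => hkn i s hs0) (fun i => hkn' i s hs0)
  -- The sum is holomorphic on the open half disc `W` and vanishes near `2 M + 1 ∈ W`.
  set f : ℂ → V := fun s => ∑' n, D s n with hf
  set W : Set ℂ := {s : ℂ | 0 < s.re} ∩ Metric.ball 0 R
  have hWo : IsOpen W := (isOpen_lt continuous_const Complex.continuous_re).inter Metric.isOpen_ball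
  have hWc : IsPreconnected W :=
    ((convex_halfSpace_re_gt 0).inter (convex_ball 0 R)).isPreconnected
  have hfd : DifferentiableOn ℂ f W := by
    refine Complex.differentiableOn_tsum_of_summable_norm hG
      (fun n s hs => (hdiff s hs.1.le n).differentiableWithinAt) hWo
      fun n s hs => hDG s hs.1.le (mem_ball_zero_iff.1 hs.2).le n
  have hM0 : (0 : ℝ) ≤ M := Nat.cast_nonneg M
  have hmem : ((2 * M + 1 : ℝ) : ℂ) ∈ W := by
    refine ⟨?_, ?_⟩
    · simp only [Set.mem_ofPred_eq, Complex.ofReal_re]; positivity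
    · rw [mem_ball_zero_iff, Complex.norm_real, Real.norm_of_nonneg (by positivity)]
      simp only [R]; linarith
  have hev : f =ᶠ[𝓝 ((2 * M + 1 : ℝ) : ℂ)] 0 := by
    have h1 : ∀ᶠ s : ℂ in 𝓝 ((2 * M + 1 : ℝ) : ℂ), 2 * M < s.re :=
      Complex.continuous_re.continuousAt.eventually (lt_mem_nhds (by simp))
    filter_upwards [h1, hWo.mem_nhds hmem] with s hs hs'
    exact hzero s hs.le (mem_ball_zero_iff.1 hs'.2).le
  have hfz : Set.EqOn f 0 W :=
    (hfd.analyticOnNhd hWo).eqOn_zero_of_preconnected_of_eventuallyEq_zero hWc hmem hev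
  -- `s = 0` is only a boundary point of `W`; there the sum vanishes by continuity.
  have hcont : ContinuousOn f ({s : ℂ | 0 ≤ s.re} ∩ Metric.closedBall 0 R) :=
    continuousOn_tsum (fun n s hs => (hdiff s hs.1 n).continuousAt.continuousWithinAt) hG
      fun n s hs => hDG s hs.1 (mem_closedBall_zero_iff.1 hs.2) n
  have hf0 : f 0 = 0 := by
    have hcl : (0 : ℂ) ∈ closure W := by
      have : (0 : ℂ) ∈ closure ({s : ℂ | 0 < s.re}) := by
        rw [Complex.closure_setOfPred_lt_re]
        simp
      rw [mem_closure_iff_nhds] at this ⊢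
      intro t ht
      obtain ⟨s, hs1, hs2⟩ := this (t ∩ Metric.ball 0 R) (inter_mem ht (Metric.ball_mem_nhds _ (by positivity)))
      exact ⟨s, hs1.1, hs2, hs1.2⟩
    have h0 : (0 : ℂ) ∈ {s : ℂ | 0 ≤ s.re} ∩ Metric.closedBall 0 R :=
      ⟨by simp, by simp [R]; positivity⟩
    have hsub : W ⊆ {s : ℂ | 0 ≤ s.re} ∩ Metric.closedBall 0 R :=
      fun s hs => ⟨le_of_lt (Set.mem_ofPred.1 hs.1), Metric.ball_subset_closedBall hs.2⟩
    have : (𝓝[W] (0 : ℂ)).NeBot := mem_closure_iff_nhdsWithin_neBot.1 hcl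
    have t1 : Tendsto f (𝓝[W] 0) (𝓝 (f 0)) := (hcont 0 h0).mono hsub
    have t2 : Tendsto f (𝓝[W] 0) (𝓝 0) := by
      refine tendsto_const_nhds.congr' ?_
      filter_upwards [self_mem_nhdsWithin] with s hs
      exact (hfz hs).symm
    exact tendsto_nhds_unique t1 t2
  rw [← hf0]
  simp only [hf, hD]
  refine tsum_congr fun n => ?_
  have hroot : b (Zh - (Z + τ)) ≠ 0 := by
    have := hP.root (k - 1) (sub_ne_zero.2 hk1.ne)
    push_cast at this
    have e : Zh - (Z + τ) = (k - 1) * τ := by rw [hZh]; ring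
    rwa [e]
  rw [dampedSum, Finset.prod_eq_one fun i _ => damping_zero hb (fun m => (lo k i m).1) (lo0 k i)
    (fun m => (lo k i m).2) (lo0' k i) _]
  rw [zero_mul, sub_zero, sub_zero, div_self hroot, div_self (hP.ne k), b_zero hb, zero_div, zero_div]
  module

end Expanding

/-! ### Telescoping when `b` is quasi-periodic along the lattice -/

section Rotation

theorem norm_cosh_le (w : ℂ) : ‖Complex.cosh w‖ ≤ 1 + ‖Complex.sinh w‖ := by
  have h : Complex.cosh w ^ 2 = 1 + Complex.sinh w ^ 2 := by
    linear_combination Complex.cosh_sq w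
  have h1 : ‖Complex.cosh w‖ ^ 2 ≤ 1 + ‖Complex.sinh w‖ ^ 2 := by
    rw [← norm_pow, h, ← norm_pow]
    exact (norm_add_le _ _).trans (by rw [norm_one])
  nlinarith [norm_nonneg (Complex.cosh w), norm_nonneg (Complex.sinh w)]

theorem norm_sinh_add_le {w w' : ℂ} (h : ‖Complex.sinh w‖ ≤ 1) (h' : ‖Complex.sinh w'‖ ≤ 1) :
    ‖Complex.sinh (w + w')‖ ≤ 2 * (‖Complex.sinh w‖ + ‖Complex.sinh w'‖) := by
  rw [Complex.sinh_add]
  refine (norm_add_le _ _).trans ?_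
  rw [norm_mul, norm_mul]
  have h1 := norm_cosh_le w
  have h2 := norm_cosh_le w'
  nlinarith [norm_nonneg (Complex.sinh w), norm_nonneg (Complex.sinh w'),
    norm_nonneg (Complex.cosh w), norm_nonneg (Complex.cosh w')]

theorem norm_sinh_sub_pi_div_two (w : ℂ) :
    ‖Complex.sinh (w - Real.pi / 2 * Complex.I)‖ = ‖Complex.cosh w‖ := by
  rw [Complex.sinh_sub, Complex.cosh_mul_I, Complex.sinh_mul_I, Complex.cos_pi_div_two,
    Complex.sin_pi_div_two]
  simp

/-- A small value of `sinh (2 w)` forces `w` to be close to `0` or to `π i / 2`, modulo `π i`. -/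
theorem norm_sinh_lt_or {w : ℂ} {δ : ℝ} (hδ : 0 ≤ δ) (h : ‖Complex.sinh (2 * w)‖ < δ ^ 2) :
    ‖Complex.sinh w‖ < δ ∨ ‖Complex.sinh (w - Real.pi / 2 * Complex.I)‖ < δ := by
  rw [norm_sinh_sub_pi_div_two]
  by_contra! hcon
  rw [Complex.sinh_two_mul, norm_mul, norm_mul, Complex.norm_ofNat] at h
  nlinarith [mul_le_mul hcon.1 hcon.2 hδ (norm_nonneg _)]

theorem exists_eq_succ_of_card_le {α β : Type*} [Fintype β] {f : ℕ → Set α} (hf : Monotone f)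
    (h0 : (f 0).Nonempty) (hfin : ∀ t, (f t).Finite)
    (hinj : ∃ g : α → β, Set.InjOn g (f (Fintype.card β))) :
    ∃ t, f (t + 1) = f t := by
  obtain ⟨g, hg⟩ := hinj
  by_contra! hcon
  have h1 : ∀ t, t + 1 ≤ (f t).ncard := by
    intro t
    induction t with
    | zero => exact (Set.ncard_pos (hfin 0)).2 h0
    | succ t ih =>
      have : (f t).ncard < (f (t + 1)).ncard :=
        Set.ncard_lt_ncard (LE.le.ssubset_of_ne (hf t.le_succ) (hcon t).symm)
          (hfin _)
      omega
  have h2 := h1 (Fintype.card β)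
  have h3 : (f (Fintype.card β)).ncard ≤ (Set.univ : Set β).ncard :=
    Set.ncard_le_ncard_of_injOn g (fun _ _ => Set.mem_univ _) hg
  rw [Set.ncard_univ, Nat.card_eq_fintype_card] at h3
  omega

variable {ν τ : ℂ} {M : ℕ} {x₀ : Fin M → ℂ}

/-- The lattice points `n` and `n'` are neighbours in a direction `i` for which the discriminant
factor is small at both. -/
def BadEdge (b : ℂ → ℂ) (τ : ℂ) (x₀ : Fin M → ℂ) (ε : ℝ) (n n' : Fin M → ℤ) : Prop :=
  ∃ i, (n' = n + Pi.single i 1 ∨ n = n' + Pi.single i 1) ∧ discr b τ x₀ i n < ε ∧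
    discr b τ x₀ i n' < ε

/-- The lattice points that are reached from `n₀` in at most `t` steps along bad edges. -/
def reach (b : ℂ → ℂ) (τ : ℂ) (x₀ : Fin M → ℂ) (ε : ℝ) (n₀ : Fin M → ℤ) : ℕ → Set (Fin M → ℤ)
  | 0 => {n₀}
  | t + 1 => reach b τ x₀ ε n₀ t ∪ {n' | ∃ n ∈ reach b τ x₀ ε n₀ t, BadEdge b τ x₀ ε n n'}

/-- The points `±x j` and the two fixed points of `x ↦ -x` modulo `π i / ν`. -/
def anchor (ν : ℂ) (x : Fin M → ℂ) : Fin M ⊕ Fin M ⊕ Fin 2 → ℂ :=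
  Sum.elim x (Sum.elim (fun j => -x j) ![0, Real.pi / 2 * Complex.I / ν])

theorem exists_anchor_neg (hν : ν ≠ 0) (x : Fin M → ℂ) (a : Fin M ⊕ Fin M ⊕ Fin 2) :
    ∃ a', ∀ z, ‖Complex.sinh (ν * (-z - anchor ν x a'))‖ =
      ‖Complex.sinh (ν * (z - anchor ν x a))‖ := by
  have neg : ∀ w w' : ℂ, w' = -w → ‖Complex.sinh w'‖ = ‖Complex.sinh w‖ := fun w w' h => by
    rw [h, Complex.sinh_neg, norm_neg]
  rcases a with j | j | j
  · exact ⟨Sum.inr (Sum.inl j), fun z => neg _ _ (by simp [anchor]; ring)⟩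
  · exact ⟨Sum.inl j, fun z => neg _ _ (by simp [anchor]; ring)⟩
  · refine ⟨Sum.inr (Sum.inr j), fun z => ?_⟩
    fin_cases j
    · exact neg _ _ (by simp [anchor])
    · have e : ν * (-z - anchor ν x (Sum.inr (Sum.inr 1))) =
          -(ν * (z - anchor ν x (Sum.inr (Sum.inr 1)))) - Real.pi * Complex.I := by
        simp only [anchor, Sum.elim_inr, Matrix.cons_val_one, Matrix.cons_val_fin_one]
        field_simp; ring
      change ‖Complex.sinh (ν * (-z - anchor ν x (Sum.inr (Sum.inr 1))))‖ =
        ‖Complex.sinh (ν * (z - anchor ν x (Sum.inr (Sum.inr 1))))‖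
      rw [e, Complex.sinh_sub, Complex.cosh_mul_I, Complex.sinh_mul_I, Complex.cos_pi,
        Complex.sin_pi, Complex.sinh_neg]
      simp

/-- If the discriminant factor of the coordinate `i` is small, then `x i` is close to some `±x k`
or to a fixed point of `x ↦ -x`. -/
theorem near_of_discr_lt {b : ℂ → ℂ} {c : ℂ} (hc : c ≠ 0) (hb : ∀ x, b x = c * Complex.sinh (ν * x))
    (hν : ν ≠ 0) {δ : ℝ} (hδ : 0 < δ) (hδ1 : δ ≤ 1) {i : Fin M} {n : Fin M → ℤ}
    (h : discr b τ x₀ i n < ‖c‖ * δ ^ 2 * ∏ _k ∈ Finset.univ.erase i, (‖c‖ * δ ^ 2 * (‖c‖ * δ ^ 2))) :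
    ‖Complex.sinh (ν * latticePoint τ x₀ n i)‖ < δ ∨
    ‖Complex.sinh (ν * (latticePoint τ x₀ n i - Real.pi / 2 * Complex.I / ν))‖ < δ ∨
    ∃ k, k ≠ i ∧ (‖Complex.sinh (ν * (latticePoint τ x₀ n i + latticePoint τ x₀ n k))‖ < δ ∨
      ‖Complex.sinh (ν * (latticePoint τ x₀ n i - latticePoint τ x₀ n k))‖ < δ) := by
  have hc' : 0 < ‖c‖ := norm_pos_iff.2 hc
  have hδ2 : δ ^ 2 ≤ δ := by nlinarith
  by_contra! hcon
  obtain ⟨h1, h2, h3⟩ := hcon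
  refine absurd h (not_lt.2 ?_)
  rw [discr]
  refine mul_le_mul ?_ (Finset.prod_le_prod (fun _ _ => by positivity) fun k hk => ?_)
    (by positivity) (norm_nonneg _)
  · rw [hb, norm_mul]
    refine mul_le_mul_of_nonneg_left ?_ hc'.le
    by_contra! hlt
    rw [mul_left_comm] at hlt
    rcases norm_sinh_lt_or hδ.le hlt with h4 | h4
    · exact absurd h4 (not_lt.2 h1)
    · refine absurd h4 (not_lt.2 ?_)
      convert h2 using 3
      field_simp
  · obtain ⟨h4, h5⟩ := h3 k (Finset.ne_of_mem_erase hk)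
    rw [hb, hb, norm_mul, norm_mul]
    refine mul_le_mul ?_ ?_ (by positivity) (by positivity)
    · exact mul_le_mul_of_nonneg_left (hδ2.trans h4) hc'.le
    · exact mul_le_mul_of_nonneg_left (hδ2.trans h5) hc'.le

theorem reach_finite (b : ℂ → ℂ) (ε : ℝ) (n₀ : Fin M → ℤ) (t : ℕ) :
    (reach b τ x₀ ε n₀ t).Finite := by
  induction t with
  | zero => exact Set.finite_singleton _
  | succ t ih =>
    refine ih.union ?_
    refine ((ih.biUnion (t := fun n => (Set.range fun i : Fin M => n + Pi.single i 1) ∪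
      Set.range fun i : Fin M => n - Pi.single i 1)
      fun n _ => (Set.finite_range _).union (Set.finite_range _)).subset ?_)
    rintro n' ⟨n, hn, i, h | h, -⟩
    · exact Set.mem_biUnion hn (Or.inl ⟨i, h.symm⟩)
    · exact Set.mem_biUnion hn (Or.inr ⟨i, by simp [h]⟩)

theorem reach_monotone (b : ℂ → ℂ) (ε : ℝ) (n₀ : Fin M → ℤ) : Monotone (reach b τ x₀ ε n₀) :=
  monotone_nat_of_le_succ fun _ => Set.subset_union_left

/-- Along bad edges the coordinates stay close to finitely many points. -/
theorem near_anchor_of_mem_reach {b : ℂ → ℂ} {c : ℂ} (hc : c ≠ 0)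
    (hb : ∀ x, b x = c * Complex.sinh (ν * x)) (hν : ν ≠ 0) {δ ε : ℝ} (hδ : 0 < δ)
    (hε : ∀ i : Fin M, ε ≤ ‖c‖ * δ ^ 2 * ∏ _k ∈ Finset.univ.erase i, (‖c‖ * δ ^ 2 * (‖c‖ * δ ^ 2)))
    (n₀ : Fin M → ℤ) (t : ℕ) (ht : 4 ^ t * δ ≤ 1) {n : Fin M → ℤ} (hn : n ∈ reach b τ x₀ ε n₀ t) :
    ∀ j, |n j - n₀ j| ≤ t ∧ ∃ a, ‖Complex.sinh (ν * (latticePoint τ x₀ n j -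
      anchor ν (latticePoint τ x₀ n₀) a))‖ < 4 ^ t * δ := by
  induction t generalizing n with
  | zero =>
    rw [reach, Set.mem_singleton_iff] at hn
    subst hn
    refine fun j => ⟨by simp, Sum.inl j, ?_⟩
    simpa [anchor] using hδ
  | succ t ih =>
    have h4 : (1 : ℝ) ≤ 4 ^ t := one_le_pow₀ (by norm_num)
    have hle : 4 ^ t * δ ≤ 4 ^ (t + 1) * δ := by rw [pow_succ]; nlinarith
    have hδt : δ ≤ 4 ^ t * δ := by nlinarith
    have ht' := hle.trans ht
    have hδ1 : δ ≤ 1 := hδt.trans ht'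
    have step : 2 * (δ + 4 ^ t * δ) ≤ 4 ^ (t + 1) * δ := by rw [pow_succ]; nlinarith
    have ih := @ih ht'
    rcases hn with hn | ⟨m, hm, i, hmi, -, hdis⟩
    · intro j
      obtain ⟨h1, a, h2⟩ := ih hn j
      exact ⟨h1.trans (by push_cast; omega), a, h2.trans_le hle⟩
    · have hne : ∀ j, j ≠ i → n j = m j := fun j hj => by
        rcases hmi with h | h <;> simp [h, hj]
      have hi : |n i - n₀ i| ≤ (t + 1 : ℕ) := by
        have := (ih hm i).1
        rw [abs_le] at this ⊢
        push_cast
        rcases hmi with h | h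
        · have : n i = m i + 1 := by simp [h]
          omega
        · have : m i = n i + 1 := by simp [h]
          omega
      intro j
      by_cases hj : j = i
      · subst hj
        refine ⟨hi, ?_⟩
        rcases near_of_discr_lt hc hb hν hδ hδ1 (hdis.trans_le (hε j)) with h | h | ⟨k, hk, h⟩
        · refine ⟨Sum.inr (Sum.inr 0), ?_⟩
          simp only [anchor, Sum.elim_inr, Matrix.cons_val_zero, sub_zero]
          exact h.trans_le (hδt.trans hle)
        · exact ⟨Sum.inr (Sum.inr 1), h.trans_le (hδt.trans hle)⟩
        · obtain ⟨-, a, ha⟩ := ih hm k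
          have hnk : latticePoint τ x₀ n k = latticePoint τ x₀ m k := by
            simp only [latticePoint, hne k hk]
          rw [hnk] at h
          rcases h with h | h
          · obtain ⟨a', ha'⟩ := exists_anchor_neg hν (latticePoint τ x₀ n₀) a
            rw [← ha'] at ha
            refine ⟨a', ?_⟩
            have e : ν * (latticePoint τ x₀ n j - anchor ν (latticePoint τ x₀ n₀) a') =
                ν * (latticePoint τ x₀ n j + latticePoint τ x₀ m k) +
                ν * (-latticePoint τ x₀ m k - anchor ν (latticePoint τ x₀ n₀) a') := by ring
            rw [e]
            refine (norm_sinh_add_le (h.le.trans hδ1) (ha.le.trans ht')).trans_lt ?_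
            linarith
          · refine ⟨a, ?_⟩
            have e : ν * (latticePoint τ x₀ n j - anchor ν (latticePoint τ x₀ n₀) a) =
                ν * (latticePoint τ x₀ n j - latticePoint τ x₀ m k) +
                ν * (latticePoint τ x₀ m k - anchor ν (latticePoint τ x₀ n₀) a) := by ring
            rw [e]
            refine (norm_sinh_add_le (h.le.trans hδ1) (ha.le.trans ht')).trans_lt ?_
            linarith
      · obtain ⟨h1, a, h2⟩ := ih hm j
        have hnj : latticePoint τ x₀ n j = latticePoint τ x₀ m j := by
          simp only [latticePoint, hne j hj]
        rw [hne j hj, hnj]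
        exact ⟨h1.trans (by push_cast; omega), a, h2.trans_le hle⟩

/-- If no nonzero multiple of `τ` is a zero of `b`, then for small `ε` every lattice point lies in
a finite set which no bad edge leaves. -/
theorem exists_finite_closed {b : ℂ → ℂ} {c : ℂ} (hc : c ≠ 0)
    (hb : ∀ x, b x = c * Complex.sinh (ν * x)) (hν : ν ≠ 0)
    (hroot : ∀ k : ℤ, k ≠ 0 → b (k * τ) ≠ 0) :
    ∃ ε > 0, ∀ n₀ : Fin M → ℤ, ∃ A : Finset (Fin M → ℤ), n₀ ∈ A ∧
      ∀ n n', BadEdge b τ x₀ ε n n' → n ∈ A → n' ∈ A := by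
  set T := Fintype.card (Fin M → Fin M ⊕ Fin M ⊕ Fin 2) with hT
  -- Two lattice points of one cluster differ by at most `2 T` in each coordinate, so that only
  -- finitely many of the nonzero values `sinh (ν τ k)` matter.
  obtain ⟨q, hq, hq'⟩ : ∃ q > 0, ∀ k : ℤ, k ≠ 0 → |k| ≤ 2 * T →
      q ≤ ‖Complex.sinh (ν * (k * τ))‖ := by
    obtain ⟨q, hq, h⟩ := exists_uniform_lower (ι := Fin (2 * T)) (α := Unit)
      (f := fun m _ => ‖Complex.sinh (ν * ((m + 1 : ℕ) * τ))‖) fun m =>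
        ⟨_, norm_pos_iff.2 fun h => hroot (m + 1 : ℕ) (by positivity) (by
          rw [hb, Int.cast_natCast, h, mul_zero]), fun _ => le_rfl⟩
    refine ⟨q, hq, fun k hk hkT => ?_⟩
    rw [Int.abs_eq_natAbs] at hkT
    have h1 := h ⟨k.natAbs - 1, by omega⟩ ()
    have h2 : k.natAbs - 1 + 1 = k.natAbs := by omega
    simp only [h2] at h1
    refine h1.trans (le_of_eq ?_)
    rcases Int.natAbs_eq k with hk' | hk'
    · conv_rhs => rw [hk', Int.cast_natCast]
    · conv_rhs => rw [hk', Int.cast_neg, Int.cast_natCast, neg_mul, mul_neg, Complex.sinh_neg,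
        norm_neg]
  obtain ⟨δ, hδ, hδ1, hδq⟩ : ∃ δ > 0, 4 ^ T * δ ≤ 1 ∧ 4 * (4 ^ T * δ) ≤ q := by
    refine ⟨min 1 (q / 4) / 4 ^ T, by positivity, ?_, ?_⟩
    · rw [mul_div_cancel₀ _ (by positivity)]
      exact min_le_left _ _
    · rw [mul_div_cancel₀ _ (by positivity)]
      linarith [min_le_right 1 (q / 4)]
  have hc' : 0 < ‖c‖ := norm_pos_iff.2 hc
  obtain ⟨ε, hε, hε'⟩ : ∃ ε > 0, ∀ i : Fin M, ε ≤
      ‖c‖ * δ ^ 2 * ∏ _k ∈ Finset.univ.erase i, (‖c‖ * δ ^ 2 * (‖c‖ * δ ^ 2)) := by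
    obtain ⟨ε, hε, h⟩ := exists_uniform_lower (α := Unit) (f := fun (i : Fin M) _ =>
      ‖c‖ * δ ^ 2 * ∏ _k ∈ Finset.univ.erase i, (‖c‖ * δ ^ 2 * (‖c‖ * δ ^ 2)))
      fun i => ⟨_, by positivity, fun _ => le_rfl⟩
    exact ⟨ε, hε, fun i => h i ()⟩
  refine ⟨ε, hε, fun n₀ => ?_⟩
  have hnear : ∀ n : Fin M → ℤ, ∃ a : Fin M → Fin M ⊕ Fin M ⊕ Fin 2, n ∈ reach b τ x₀ ε n₀ T →
      ∀ j, |n j - n₀ j| ≤ T ∧ ‖Complex.sinh (ν * (latticePoint τ x₀ n j -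
      anchor ν (latticePoint τ x₀ n₀) (a j)))‖ < 4 ^ T * δ := fun n => by
    by_cases hn : n ∈ reach b τ x₀ ε n₀ T
    · have h := near_anchor_of_mem_reach hc hb hν hδ hε' n₀ T hδ1 hn
      choose h1 a h2 using h
      exact ⟨a, fun _ j => ⟨h1 j, h2 j⟩⟩
    · exact ⟨fun j => Sum.inl j, fun h => absurd h hn⟩
  choose g hg using hnear
  -- two points of the cluster with the same anchors coincide
  have hinj : Set.InjOn g (reach b τ x₀ ε n₀ T) := by
    intro n hn n' hn' h
    funext j
    by_contra hne
    obtain ⟨h1, h2⟩ := hg n hn j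
    obtain ⟨h1', h2'⟩ := hg n' hn' j
    rw [← h] at h2'
    have hk : |n j - n' j| ≤ 2 * T := by
      rw [abs_le] at h1 h1' ⊢
      omega
    have h3 := hq' (n j - n' j) (sub_ne_zero.2 hne) hk
    set y := anchor ν (latticePoint τ x₀ n₀) (g n j)
    have e : ν * ((n j - n' j : ℤ) * τ) = ν * (latticePoint τ x₀ n j - y) +
        -(ν * (latticePoint τ x₀ n' j - y)) := by
      simp only [latticePoint]; push_cast; ring
    have h4 : ‖Complex.sinh (-(ν * (latticePoint τ x₀ n' j - y)))‖ < 4 ^ T * δ := by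
      rwa [Complex.sinh_neg, norm_neg]
    rw [e] at h3
    have h5 := norm_sinh_add_le (h2.le.trans hδ1) (h4.le.trans hδ1)
    linarith
  obtain ⟨t, ht⟩ := exists_eq_succ_of_card_le (reach_monotone (τ := τ) (x₀ := x₀) b ε n₀)
    ⟨n₀, rfl⟩ (reach_finite b ε n₀) ⟨g, hinj⟩
  refine ⟨(reach_finite (τ := τ) (x₀ := x₀) b ε n₀ t).toFinset, ?_, fun n n' hnn' hn => ?_⟩
  · rw [Set.Finite.mem_toFinset]
    exact reach_monotone b ε n₀ (Nat.zero_le t) rfl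
  · rw [Set.Finite.mem_toFinset] at hn ⊢
    rw [← ht]
    exact Or.inr ⟨n, hn, hnn'⟩

variable {b : ℂ → ℂ} {V : Type*} [NormedAddCommGroup V] [NormedSpace ℂ V]
  {Xp Xm : Fin M → (Fin M → ℤ) → V} {Z Z' κ : ℂ}

/-- If `b` is quasi-periodic along the lattice, then the sum over the lattice of the difference of
the two sums of simple fractions vanishes: no bad edge leaves a large finite union of clusters, and
the flow through the other edges is summable. -/
theorem PairedResidues.tsum_eq_zero_of_re_eq_zero [CompleteSpace V] {c : ℂ} (hc : c ≠ 0) (hν : ν ≠ 0)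
    (hb : ∀ x, b x = c * Complex.sinh (ν * x)) (hre : (ν * τ).re = 0)
    (hP : PairedResidues b τ x₀ Xp Xm Z Z' κ) :
    ∑' n, (cauchySum b τ x₀ Xp Xm (Z + τ) n - κ • cauchySum b τ x₀ Xp Xm Z' n) = 0 := by
  have hb' : IsXXX b ∨ IsXXZ b := Or.inr ⟨c, ν, hc, hν, hb⟩
  obtain ⟨ε, hε, hcl⟩ := exists_finite_closed (x₀ := x₀) hc hb hν hP.root
  choose A hA hA' using hcl
  obtain ⟨K, hK, hflow⟩ := hP.flow_bound hb'
  -- `b` is bounded on the lattice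
  have hupper : ∀ (y : ℂ) (m : ℤ), ‖b (y + τ * m)‖ ≤ ‖c‖ * Real.exp |(ν * y).re| := fun y m => by
    rw [hb, norm_mul]
    refine mul_le_mul_of_nonneg_left ((norm_sinh_le _).trans (le_of_eq ?_)) (norm_nonneg _)
    congr 2
    rw [mul_add, Complex.add_re, ← mul_assoc, mul_comm (ν * τ), ← Complex.ofReal_intCast,
      Complex.re_ofReal_mul, hre, mul_zero, add_zero]
  obtain ⟨C₁, hC₁, h₁⟩ : ∃ C, 0 ≤ C ∧ ∀ (p : Fin (2 * M) × Fin M) (m : ℤ),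
      ‖b (Z + (p.1 : ℕ) * τ + x₀ p.2 + τ * m)‖ ≤ C * 1 :=
    exists_uniform_bound (g := fun _ _ => (1 : ℝ)) (fun _ _ => zero_le_one)
      fun p => ⟨_, by positivity, fun m => (hupper _ m).trans (mul_one _).ge⟩
  obtain ⟨C₂, hC₂, h₂⟩ : ∃ C, 0 ≤ C ∧ ∀ (p : Fin (2 * M) × Fin M) (m : ℤ),
      ‖b (Z + (p.1 : ℕ) * τ - x₀ p.2 + τ * m)‖ ≤ C * 1 :=
    exists_uniform_bound (g := fun _ _ => (1 : ℝ)) (fun _ _ => zero_le_one)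
      fun p => ⟨_, by positivity, fun m => (hupper _ m).trans (mul_one _).ge⟩
  set B := max C₁ C₂
  have hB : ∀ n : Fin M → ℤ, ∀ j < 2 * M, ∀ k,
      ‖b (Z + j * τ + latticePoint τ x₀ n k)‖ ≤ B ∧
      ‖b (Z + j * τ - latticePoint τ x₀ n k)‖ ≤ B := by
    refine fun n j hj k => ⟨?_, ?_⟩
    · have e : Z + j * τ + latticePoint τ x₀ n k = Z + j * τ + x₀ k + τ * (n k) := by
        simp only [latticePoint]; ring
      rw [e]
      exact (h₁ (⟨j, hj⟩, k) _).trans ((mul_one _).le.trans (le_max_left _ _))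
    · have e : Z + j * τ - latticePoint τ x₀ n k = Z + j * τ - x₀ k + τ * (-n k : ℤ) := by
        simp only [latticePoint]; push_cast; ring
      rw [e]
      exact (h₂ (⟨j, hj⟩, k) _).trans ((mul_one _).le.trans (le_max_right _ _))
  have hB0 : 0 ≤ B := le_max_of_le_left hC₁
  set S : (Fin M → ℤ) → ℝ := fun n =>
    K * B ^ (4 * M - 1) * ∑ j ∈ Finset.range (2 * M), ‖cauchySum b τ x₀ Xp Xm (Z + j * τ) n‖ with hS
  have hS0 : ∀ n, 0 ≤ S n := fun n =>
    mul_nonneg (by positivity) (Finset.sum_nonneg fun _ _ => norm_nonneg _)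
  have hSs : Summable S := Summable.mul_left _ (summable_sum fun j _ => by
    have := hP.summable j
    simpa only [Int.cast_natCast] using this)
  set u := flow b τ x₀ Xm Z Z' κ with hu
  -- The indicator functions `χ L` of unions of clusters exhaust the lattice and take equal values
  -- at the ends of a bad edge, so that after summation by parts only good edges contribute.
  let box : ℕ → Finset (Fin M → ℤ) := fun L => Finset.Icc (fun _ => -(L : ℤ)) fun _ => (L : ℤ)
  let χ : ℕ → (Fin M → ℤ) → ℂ := fun L n => if n ∈ (box L).biUnion A then 1 else 0
  have hχ1 : ∀ L n, ‖χ L n‖ ≤ 1 := fun L n => by simp only [χ]; split_ifs <;> simp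
  have hχ : ∀ n, ∀ᶠ L in atTop, χ L n = 1 := fun n => by
    filter_upwards [eventually_ge_atTop (∑ i, (n i).natAbs)] with L hL
    have h1 : ∀ i, (n i).natAbs ≤ L := fun i =>
      (Finset.single_le_sum (f := fun i => (n i).natAbs) (fun _ _ => Nat.zero_le _)
        (Finset.mem_univ i)).trans hL
    refine if_pos (Finset.mem_biUnion.2 ⟨n, ?_, hA n⟩)
    simp only [box, Finset.mem_Icc, Pi.le_def]
    exact ⟨fun i => by have := h1 i; omega, fun i => by have := h1 i; omega⟩
  have hχc : ∀ L n n', BadEdge b τ x₀ ε n n' → χ L n = χ L n' := fun L n n' h => by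
    have hsymm : BadEdge b τ x₀ ε n' n := by
      obtain ⟨i, h1, h2, h3⟩ := h
      exact ⟨i, h1.symm, h3, h2⟩
    have : n ∈ (box L).biUnion A ↔ n' ∈ (box L).biUnion A := by
      simp only [Finset.mem_biUnion]
      exact ⟨fun ⟨m, hm, hn⟩ => ⟨m, hm, hA' m n n' h hn⟩,
        fun ⟨m, hm, hn⟩ => ⟨m, hm, hA' m n' n hsymm hn⟩⟩
    simp only [χ, this]
  have hχs : ∀ L (w : (Fin M → ℤ) → V), Summable fun n => χ L n • w n := fun L w =>
    summable_of_ne_finset_zero (s := (box L).biUnion A) fun n hn => by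
      simp only [χ, if_neg hn, zero_smul]
  set D : (Fin M → ℤ) → V := fun n =>
    cauchySum b τ x₀ Xp Xm (Z + τ) n - κ • cauchySum b τ x₀ Xp Xm Z' n with hD
  have hDs : Summable fun n => ‖D n‖ := by
    have h1 := hP.summable 1
    simp only [Int.cast_one, one_mul] at h1
    exact Summable.of_nonneg_of_le (fun _ => norm_nonneg _) (fun n => norm_sub_le _ _)
      (h1.add hP.summable')
  have hlim1 : Tendsto (fun L => ∑' n, χ L n • D n) atTop (𝓝 (∑' n, D n)) := by
    refine tendsto_tsum_of_dominated_convergence hDs (fun n => ?_)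
      (Eventually.of_forall fun L n => ?_)
    · refine tendsto_const_nhds.congr' ?_
      filter_upwards [hχ n] with L hL
      rw [hL, one_smul]
    · rw [norm_smul]
      exact mul_le_of_le_one_left (norm_nonneg _) (hχ1 L n)
  have hparts : ∀ L, ∑' n, χ L n • D n =
      ∑ i, ∑' n : Fin M → ℤ, (χ L n - χ L (n - Pi.single i 1)) • u i n := fun L => by
    have h1 : ∀ i, Summable fun n : Fin M → ℤ => χ L (n - Pi.single i 1) • u i n := fun i => by
      have := (hχs L fun n : Fin M → ℤ => u i (n + Pi.single i 1)).comp_injective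
        (i := fun n : Fin M → ℤ => n - Pi.single i 1) fun _ _ h => sub_left_injective h
      refine this.congr fun n => ?_
      simp only [Function.comp_apply, sub_add_cancel]
    have h2 : ∀ i, ∑' n : Fin M → ℤ, χ L (n - Pi.single i 1) • u i n =
        ∑' n : Fin M → ℤ, χ L n • u i (n + Pi.single i 1) := fun i => by
      refine (tsum_add_right_eq (fun n : Fin M → ℤ => χ L (n - Pi.single i 1) • u i n)
        (Pi.single i 1)).symm.trans ?_
      simp only [add_sub_cancel_right]
    have h3 : ∀ n : Fin M → ℤ, χ L n • D n =
        ∑ i, (χ L n • u i n - χ L n • u i (n + Pi.single i 1)) := fun n => by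
      simp only [hD]
      rw [hP.sum_flow, Finset.smul_sum]
      exact Finset.sum_congr rfl fun i _ => smul_sub _ _ _
    rw [tsum_congr h3]
    refine (Summable.tsum_finsetSum fun i _ =>
      (hχs L (u i)).sub (hχs L fun n : Fin M → ℤ => u i (n + Pi.single i 1))).trans
      (Finset.sum_congr rfl fun i _ => ?_)
    refine ((hχs L (u i)).tsum_sub (hχs L fun n : Fin M → ℤ => u i (n + Pi.single i 1))).trans ?_
    rw [← h2]
    refine ((hχs L (u i)).tsum_sub (h1 i)).symm.trans ?_
    exact tsum_congr fun n => (sub_smul _ _ _).symm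
  have hlim2 : Tendsto (fun L => ∑' n, χ L n • D n) atTop (𝓝 0) := by
    simp only [hparts]
    rw [← Finset.sum_const_zero (s := (Finset.univ : Finset (Fin M)))]
    refine tendsto_finsetSum _ fun i _ => ?_
    rw [← tsum_zero (α := V) (β := Fin M → ℤ)]
    refine tendsto_tsum_of_dominated_convergence
      (bound := fun n : Fin M → ℤ => 2 * ε⁻¹ * (S n + S (n - Pi.single i 1))) ?_ (fun n => ?_)
      (Eventually.of_forall fun L n => ?_)
    · exact (hSs.add (hSs.comp_injective (i := fun n : Fin M → ℤ => n - Pi.single i 1)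
        fun _ _ h => sub_left_injective h)).mul_left _
    · refine tendsto_const_nhds.congr' ?_
      filter_upwards [hχ n, hχ (n - Pi.single i 1)] with L h1 h2
      rw [h1, h2, sub_self, zero_smul]
    · have hb2 : 0 ≤ 2 * ε⁻¹ * (S n + S (n - Pi.single i 1)) :=
        mul_nonneg (by positivity) (add_nonneg (hS0 _) (hS0 _))
      by_cases hbad : BadEdge b τ x₀ ε (n - Pi.single i 1) n
      · rw [hχc L _ _ hbad, sub_self, zero_smul, norm_zero]
        exact hb2
      · have hle : ‖u i n‖ ≤ ε⁻¹ * (S n + S (n - Pi.single i 1)) := by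
          have hor : ε ≤ discr b τ x₀ i (n - Pi.single i 1) ∨ ε ≤ discr b τ x₀ i n := by
            by_contra! hcon
            exact hbad ⟨i, Or.inl (by simp), hcon.1, hcon.2⟩
          rw [← div_eq_inv_mul, le_div_iff₀ hε]
          rcases hor with h | h
          · have h1 := (hflow (n - Pi.single i 1) i B hB0 (hB _)).2
            rw [sub_add_cancel] at h1
            have h2 := (mul_le_mul_of_nonneg_left h (norm_nonneg (u i n))).trans h1
            have h3 := hS0 n
            change _ ≤ S (n - Pi.single i 1) at h2
            linarith
          · have h1 := (hflow n i B hB0 (hB n)).1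
            have h2 := (mul_le_mul_of_nonneg_left h (norm_nonneg (u i n))).trans h1
            have h3 := hS0 (n - Pi.single i 1)
            change _ ≤ S n at h2
            linarith
        rw [norm_smul, mul_assoc]
        refine mul_le_mul ?_ hle (norm_nonneg _) (by norm_num)
        refine (norm_sub_le _ _).trans ?_
        linarith [hχ1 L n, hχ1 L (n - Pi.single i 1)]
  exact tendsto_nhds_unique hlim1 hlim2

end Rotation

/-! ### Lattices with periodic `b` -/

section Periodic

theorem eventually_codiscrete_iff {P : ℂ → Prop} :
    (∀ᶠ x in codiscrete ℂ, P x) ↔ ∀ x, ∀ᶠ y in 𝓝[≠] x, P y := by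
  rw [Filter.Eventually, mem_codiscrete]
  refine forall_congr' fun x => ?_
  rw [disjoint_principal_right, compl_compl]
  rfl

theorem eventually_codiscrete_comp {P : ℂ → Prop} (h : ∀ᶠ x in codiscrete ℂ, P x) (e : ℂ ≃ₜ ℂ) :
    ∀ᶠ x in codiscrete ℂ, P (e x) := by
  rw [eventually_codiscrete_iff] at h ⊢
  intro x
  have ht : Tendsto e (𝓝[≠] x) (𝓝[≠] (e x)) :=
    e.continuous.continuousAt.continuousWithinAt.tendsto_nhdsWithin
      fun y hy => e.injective.ne hy
  exact ht.eventually (h (e x))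

theorem eventually_codiscrete_add {P : ℂ → Prop} (h : ∀ᶠ x in codiscrete ℂ, P x) (a : ℂ) :
    ∀ᶠ x in codiscrete ℂ, P (x + a) :=
  eventually_codiscrete_comp h (Homeomorph.addRight a)

theorem eventually_codiscrete_sub {P : ℂ → Prop} (h : ∀ᶠ x in codiscrete ℂ, P x) (a : ℂ) :
    ∀ᶠ x in codiscrete ℂ, P (a - x) :=
  eventually_codiscrete_comp h (Homeomorph.subLeft a)

theorem codiscrete_b_ne_zero {b : ℂ → ℂ} (hb : IsXXX b ∨ IsXXZ b) {α : ℂ} (hα : α ≠ 0) (c : ℂ) :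
    ∀ᶠ x in codiscrete ℂ, b (α * x + c) ≠ 0 :=
  eventually_codiscrete_iff.2 fun x => eventually_b_ne_zero hb α c x hα

/-- `φ (y + ω) = Q y φ y` for a meromorphic function `Q ≠ 0` with period `ω`. -/
def IsQuasiPeriodic (ω : ℂ) (φ : ℂ → ℂ) : Prop :=
  ∃ Q : ℂ → ℂ, Meromorphic Q ∧ (∀ y, Q (y + ω) = Q y) ∧ (∀ᶠ y in codiscrete ℂ, Q y ≠ 0) ∧
    ∀ᶠ y in codiscrete ℂ, φ (y + ω) = Q y * φ y

variable {ω : ℂ}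

theorem isQuasiPeriodic_const (c : ℂ) : IsQuasiPeriodic ω fun _ => c :=
  ⟨fun _ => 1, fun _ => MeromorphicAt.const _ _, fun _ => rfl, Eventually.of_forall fun _ => one_ne_zero,
    Eventually.of_forall fun _ => (one_mul _).symm⟩

theorem IsQuasiPeriodic.mul {φ ψ : ℂ → ℂ} (hφ : IsQuasiPeriodic ω φ) (hψ : IsQuasiPeriodic ω ψ) :
    IsQuasiPeriodic ω fun y => φ y * ψ y := by
  obtain ⟨Q, h1, h2, h3, h4⟩ := hφ
  obtain ⟨Q', h1', h2', h3', h4'⟩ := hψ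
  refine ⟨fun y => Q y * Q' y, fun x => (h1 x).mul (h1' x), fun y => by simp only [h2, h2'], ?_, ?_⟩
  · filter_upwards [h3, h3'] with y a b using mul_ne_zero a b
  · filter_upwards [h4, h4'] with y a b
    rw [a, b]; ring

theorem IsQuasiPeriodic.prod {ι : Type*} (s : Finset ι) {φ : ι → ℂ → ℂ}
    (h : ∀ i ∈ s, IsQuasiPeriodic ω (φ i)) : IsQuasiPeriodic ω fun y => ∏ i ∈ s, φ i y := by
  classical
  induction s using Finset.induction_on with
  | empty => simpa using isQuasiPeriodic_const 1
  | insert i s hi ih =>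
    simp only [Finset.prod_insert hi]
    exact (h i (by simp)).mul (ih fun j hj => h j (by simp [hj]))

theorem IsQuasiPeriodic.comp_add {φ : ℂ → ℂ} (h : IsQuasiPeriodic ω φ) (a : ℂ) :
    IsQuasiPeriodic ω fun y => φ (y + a) := by
  obtain ⟨Q, h1, h2, h3, h4⟩ := h
  refine ⟨fun y => Q (y + a), fun x => (h1 (x + a)).comp_analyticAt (f := Q) (g := fun y => y + a)
    (by fun_prop), fun y => by
    change Q (y + ω + a) = Q (y + a)
    rw [add_right_comm, h2], eventually_codiscrete_add h3 a, ?_⟩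
  filter_upwards [eventually_codiscrete_add h4 a] with y hy
  rw [add_right_comm, hy]

theorem IsQuasiPeriodic.comp_sub {φ : ℂ → ℂ} (h : IsQuasiPeriodic ω φ) (a : ℂ) :
    IsQuasiPeriodic ω fun y => φ (a - y) := by
  obtain ⟨Q, h1, h2, h3, h4⟩ := h
  have h2' : ∀ y, Q (a - (y + ω)) = Q (a - y) := fun y => by
    rw [← h2]; congr 1; ring
  refine ⟨fun y => (Q (a - y))⁻¹, fun x => ((h1 (a - x)).comp_analyticAt (f := Q)
    (g := fun y => a - y) (by fun_prop)).inv, fun y => by simp only [h2'], ?_, ?_⟩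
  · filter_upwards [eventually_codiscrete_sub h3 a] with y hy using inv_ne_zero hy
  · filter_upwards [eventually_codiscrete_sub h4 (a - ω), eventually_codiscrete_sub h3 a] with y hy hy'
    have e : a - ω - y + ω = a - y := by ring
    have e' : a - ω - y = a - (y + ω) := by ring
    rw [e, e', h2'] at hy
    rw [hy, inv_mul_cancel_left₀ hy']

/-- Iteration of a difference equation whose coefficient has period `m τ`. -/
theorem isQuasiPeriodic_of_step {τ : ℂ} {m : ℕ} {φ q : ℂ → ℂ} (hq : Meromorphic q)
    (hqω : ∀ y, q (y + m * τ) = q y) (hq0 : ∀ᶠ y in codiscrete ℂ, q y ≠ 0)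
    (h : ∀ᶠ y in codiscrete ℂ, φ (y + τ) = q y * φ y) : IsQuasiPeriodic (m * τ) φ := by
  refine ⟨fun y => ∏ l ∈ Finset.range m, q (y + l * τ), fun x => ?_, fun y => ?_, ?_, ?_⟩
  · exact MeromorphicAt.fun_prod fun l _ => (hq (x + l * τ)).comp_analyticAt (f := q)
      (g := fun y => y + l * τ) (by fun_prop)
  · exact Finset.prod_congr rfl fun l _ => by rw [add_right_comm, hqω]
  · have : ∀ᶠ y in codiscrete ℂ, ∀ l ∈ Finset.range m, q (y + l * τ) ≠ 0 :=
      (eventually_all_finset _).2 fun l _ => eventually_codiscrete_add hq0 _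
    filter_upwards [this] with y hy using Finset.prod_ne_zero_iff.2 hy
  · have : ∀ᶠ y in codiscrete ℂ, ∀ l ∈ Finset.range m,
        φ (y + l * τ + τ) = q (y + l * τ) * φ (y + l * τ) :=
      (eventually_all_finset _).2 fun l _ => eventually_codiscrete_add h _
    filter_upwards [this] with y hy
    clear hqω this
    induction m with
    | zero => simp
    | succ m ih =>
      have e : y + (m + 1 : ℕ) * τ = y + m * τ + τ := by push_cast; ring
      rw [e, hy m (by simp), ih fun l hl => hy l (by simp at hl ⊢; omega), Finset.prod_range_succ]
      ring

/-- Along an orbit on which it is analytic, a quasi-periodic function vanishes or is a geometric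
sequence. -/
theorem IsQuasiPeriodic.orbit {φ : ℂ → ℂ} (h : IsQuasiPeriodic ω φ) {p : ℂ}
    (ha : ∀ k : ℤ, AnalyticAt ℂ φ (p + k * ω)) :
    (∀ k : ℤ, φ (p + k * ω) = 0) ∨
      ∃ ρ : ℂ, ∀ k : ℤ, φ (p + (k + 1 : ℤ) * ω) = ρ * φ (p + k * ω) := by
  obtain ⟨Q, hQ, hQω, hQ0, hφ⟩ := h
  have hper : ∀ (k : ℤ) y, Q (y + k * ω) = Q y := fun k => by
    induction k using Int.induction_on with
    | zero => simp
    | succ k ih =>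
      intro y
      have e : y + ((k + 1 : ℤ) : ℂ) * ω = y + (k : ℤ) * ω + ω := by push_cast; ring
      rw [e, hQω, ih]
    | pred k ih =>
      intro y
      have e : y + ((-k : ℤ) : ℂ) * ω = y + ((-k - 1 : ℤ) : ℂ) * ω + ω := by push_cast; ring
      have := ih y
      rwa [e, hQω] at this
  -- the equation near the points of the orbit, transported to `p`
  have hev : ∀ k : ℤ, ∀ᶠ y in 𝓝[≠] p, φ (y + (k + 1 : ℤ) * ω) = Q y * φ (y + k * ω) := fun k => by
    have := eventually_codiscrete_iff.1 (eventually_codiscrete_add hφ (k * ω)) p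
    filter_upwards [this] with y hy
    rw [hper] at hy
    rw [← hy]; congr 1; push_cast; ring
  have hlim : ∀ k : ℤ, Tendsto (fun y => φ (y + k * ω)) (𝓝[≠] p) (𝓝 (φ (p + k * ω))) := fun k =>
    ((ha k).continuousAt.comp_of_eq (f := fun y => y + k * ω) (by fun_prop) rfl).tendsto.mono_left
      nhdsWithin_le_nhds
  -- As `φ` is analytic along the orbit, a pole of the periodic multiplier `Q` at `p` forces
  -- `φ (p + k ω) = lim Q⁻¹ φ (y + (k + 1) ω) = 0`, and a zero of `Q` forces the same from the left.
  rcases lt_trichotomy (meromorphicOrderAt Q p) 0 with ho | ho | ho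
  · left
    intro k
    have h1 : Tendsto (fun y => (Q y)⁻¹) (𝓝[≠] p) (𝓝 0) :=
      tendsto_inv₀_cobounded.comp ((tendsto_cobounded_iff_meromorphicOrderAt_neg (hQ p)).2 ho)
    have h2 := (h1.mul (hlim (k + 1)))
    rw [zero_mul] at h2
    refine tendsto_nhds_unique (hlim k) (h2.congr' ?_)
    filter_upwards [hev k, eventually_codiscrete_iff.1 hQ0 p] with y hy hy'
    rw [hy, inv_mul_cancel_left₀ hy']
  · obtain ⟨ρ, -, h1⟩ := (tendsto_ne_zero_iff_meromorphicOrderAt_eq_zero (hQ p)).2 ho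
    refine Or.inr ⟨ρ, fun k => tendsto_nhds_unique (hlim (k + 1)) ?_⟩
    exact (h1.mul (hlim k)).congr' ((hev k).mono fun y hy => hy.symm)
  · left
    intro k
    have h1 := (tendsto_zero_iff_meromorphicOrderAt_pos (hQ p)).2 ho
    have h2 := h1.mul (hlim (k - 1))
    rw [zero_mul] at h2
    refine tendsto_nhds_unique (hlim k) (h2.congr' ?_)
    filter_upwards [hev (k - 1)] with y hy
    rw [← hy]; congr 2; push_cast; ring

variable {b : ℂ → ℂ}

theorem boundaryBbar_add_period (hω : ∀ y, b (y + ω) = b y) (η ξ : ℂ) {N : ℕ} (x : ℂ)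
    (t : Fin N → ℂ) : boundaryBbar b η ξ (x + ω) t = boundaryBbar b η ξ x t := by
  have hω' : ∀ y, b (y - ω) = b y := fun y => by rw [← hω, sub_add_cancel]
  have hR : ∀ y, Rmat b η (y + ω) = Rmat b η y := fun y => by
    simp only [Rmat, add_right_comm y ω η, hω]
  have hR' : ∀ y, Rmat b η (y - ω) = Rmat b η y := fun y => by rw [← hR, sub_add_cancel]
  have hm : ∀ y, monodromy b η (y + ω) t = monodromy b η y t := fun y => by
    simp only [monodromy, add_sub_right_comm, hR]
  have hm' : ∀ y, monodromy b η (y - ω) t = monodromy b η y t := fun y => by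
    rw [← hm, sub_add_cancel]
  have hK : ∀ y, Kmat b ξ (y + ω) = Kmat b ξ y := fun y => by
    simp only [Kmat, ← sub_sub, ← add_assoc, hω, hω']
  have hU : ∀ y, boundaryMonodromy b η ξ (y + ω) t = boundaryMonodromy b η ξ y t := fun y => by
    have e : -(y + ω) = -y - ω := by ring
    rw [boundaryMonodromy, boundaryMonodromy, hm, hK, e, hm']
  have hf : ∀ y, boundaryBbarFormula b η ξ (y + ω) t = boundaryBbarFormula b η ξ y t := fun y => by
    have hB : boundaryB b η ξ (y + ω + η / 2) t = boundaryB b η ξ (y + η / 2) t := by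
      rw [add_right_comm]; simp only [boundaryB, hU]
    have e1 : ∀ r, b (y + ω - t r - η / 2) = b (y - t r - η / 2) := fun r => by
      rw [← hω (y - t r - η / 2)]; congr 1; ring
    have e2 : ∀ r, b (y + ω - t r + η / 2) = b (y - t r + η / 2) := fun r => by
      rw [← hω (y - t r + η / 2)]; congr 1; ring
    have e3 : b (ξ - (y + ω) - η / 2) = b (ξ - y - η / 2) := by
      rw [← hω' (ξ - y - η / 2)]; congr 1; ring
    have e4 : b (2 * (y + ω)) = b (2 * y) := by
      rw [← hω (2 * y), ← hω (2 * y + ω)]; congr 1; ring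
    have e5 : b (2 * (y + ω) + η) = b (2 * y + η) := by
      rw [← hω (2 * y + η), ← hω (2 * y + η + ω)]; congr 1; ring
    simp only [boundaryBbarFormula, hB, e1, e2, e3, e4, e5]
  have hmap : map (fun y => y + ω) (𝓝[≠] x) = 𝓝[≠] (x + ω) := by
    have := (Homeomorph.addRight ω).isOpenEmbedding.map_nhdsWithin_eq {x}ᶜ x
    rw [Set.image_compl_eq (Homeomorph.addRight ω).bijective, Set.image_singleton] at this
    exact this
  rw [boundaryBbar, boundaryBbar, limUnder, limUnder, ← hmap, Filter.map_map]
  congr 2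
  exact funext hf

theorem boundaryBethe_update (hω : ∀ y, b (y + ω) = b y) (η ξ : ℂ) {N M : ℕ} (x : Fin M → ℂ)
    (t : Fin N → ℂ) (i : Fin M) (k : ℤ) :
    boundaryBethe b η ξ (Function.update x i (x i + k * ω)) t = boundaryBethe b η ξ x t := by
  have hk : ∀ y, b (y + k * ω) = b y := fun y => by
    induction k using Int.induction_on with
    | zero => simp
    | succ k ih =>
      have e : y + ((k + 1 : ℤ) : ℂ) * ω = y + (k : ℤ) * ω + ω := by push_cast; ring
      rw [e, hω, ih]
    | pred k ih =>
      have e : y + ((-k : ℤ) : ℂ) * ω = y + ((-k - 1 : ℤ) : ℂ) * ω + ω := by push_cast; ring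
      rwa [e, hω] at ih
  have : ∀ j, boundaryBbar b η ξ (Function.update x i (x i + k * ω) j) t =
      boundaryBbar b η ξ (x j) t := fun j => by
    by_cases hj : j = i
    · subst hj; rw [Function.update_self, boundaryBbar_add_period hk]
    · rw [Function.update_of_ne hj]
  simp only [boundaryBethe, this]

/-- The periods of a function `b` with a zero at a positive multiple of `τ`. -/
theorem exists_period (hb : IsXXX b ∨ IsXXZ b) {τ : ℂ} (hτ : τ ≠ 0) {k : ℤ} (hk : k ≠ 0)
    (h : b (k * τ) = 0) : ∃ m : ℕ, 0 < m ∧ ∀ y, b (y + m * τ) = b y := by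
  have hk' : b (k.natAbs * τ) = 0 := by
    rcases Int.natAbs_eq k with h' | h'
    · rw [h', Int.cast_natCast] at h; exact h
    · rw [h', Int.cast_neg, Int.cast_natCast, neg_mul, b_neg hb, neg_eq_zero] at h; exact h
  have hm : 0 < k.natAbs := Int.natAbs_pos.2 hk
  refine ⟨2 * k.natAbs, by omega, fun y => ?_⟩
  rcases hb with ⟨c, hc, h⟩ | ⟨c, ν, hc, hν, h⟩
  · rw [h] at hk'
    have : (k.natAbs : ℂ) ≠ 0 := Nat.cast_ne_zero.2 hm.ne'
    exact absurd hk' (mul_ne_zero hc (mul_ne_zero this hτ))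
  · rw [h] at hk'
    have hs : Complex.sinh (ν * (k.natAbs * τ)) = 0 := (mul_eq_zero.1 hk').resolve_left hc
    have hc2 := Complex.cosh_sq (ν * (k.natAbs * τ))
    rw [hs] at hc2
    have e : ν * (y + (2 * k.natAbs : ℕ) * τ) = ν * y + 2 * (ν * (k.natAbs * τ)) := by
      push_cast; ring
    rw [h, h, e, Complex.sinh_add, Complex.cosh_two_mul, Complex.sinh_two_mul, hs, hc2]
    ring

end Periodic

section Periodic

variable {b : ℂ → ℂ} {τ : ℂ}

theorem meromorphic_b_affine (hb : IsXXX b ∨ IsXXZ b) {f : ℂ → ℂ}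
    (hf : ∃ α : ℂ, α ≠ 0 ∧ ∃ c, ∀ x, f x = α * x + c) :
    (Meromorphic fun x => b (f x)) ∧ ∀ᶠ x in codiscrete ℂ, b (f x) ≠ 0 := by
  obtain ⟨α, hα, c, hf⟩ := hf
  simp only [hf]
  refine ⟨fun x => ?_, codiscrete_b_ne_zero hb hα c⟩
  have : Differentiable ℂ fun x => b (α * x + c) := (b_differentiable hb).comp (by fun_prop)
  exact (this.analyticAt x).meromorphicAt

theorem isQuasiPeriodic_g (hb : IsXXX b ∨ IsXXZ b) {η ξp ξm : ℂ} {g : ℂ → ℂ} {m : ℕ}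
    (hω : ∀ y, b (y + m * τ) = b y)
    (hg_eq : (fun x => g (x + τ)) =ᶠ[codiscrete ℂ] fun x =>
      b (ξm - x - η / 2) * b (ξp - x - τ / 2 - η / 2) /
        (b (ξm + x + τ - η / 2) * b (ξp + x + τ / 2 - η / 2)) * g x) :
    IsQuasiPeriodic (m * τ) g := by
  have hω' : ∀ y, b (y - m * τ) = b y := fun y => by rw [← hω, sub_add_cancel]
  obtain ⟨m1, n1⟩ := meromorphic_b_affine hb (f := fun x => ξm - x - η / 2)
    ⟨-1, by norm_num, ξm - η / 2, fun x => by ring⟩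
  obtain ⟨m2, n2⟩ := meromorphic_b_affine hb (f := fun x => ξp - x - τ / 2 - η / 2)
    ⟨-1, by norm_num, ξp - τ / 2 - η / 2, fun x => by ring⟩
  obtain ⟨m3, n3⟩ := meromorphic_b_affine hb (f := fun x => ξm + x + τ - η / 2)
    ⟨1, by norm_num, ξm + τ - η / 2, fun x => by ring⟩
  obtain ⟨m4, n4⟩ := meromorphic_b_affine hb (f := fun x => ξp + x + τ / 2 - η / 2)
    ⟨1, by norm_num, ξp + τ / 2 - η / 2, fun x => by ring⟩
  refine isQuasiPeriodic_of_step (fun x => ((m1 x).mul (m2 x)).div ((m3 x).mul (m4 x)))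
    (fun y => ?_) ?_ hg_eq
  · have e1 : b (ξm - (y + m * τ) - η / 2) = b (ξm - y - η / 2) := by
      rw [← hω' (ξm - y - η / 2)]; congr 1; ring
    have e2 : b (ξp - (y + m * τ) - τ / 2 - η / 2) = b (ξp - y - τ / 2 - η / 2) := by
      rw [← hω' (ξp - y - τ / 2 - η / 2)]; congr 1; ring
    have e3 : b (ξm + (y + m * τ) + τ - η / 2) = b (ξm + y + τ - η / 2) := by
      rw [← hω (ξm + y + τ - η / 2)]; congr 1; ring
    have e4 : b (ξp + (y + m * τ) + τ / 2 - η / 2) = b (ξp + y + τ / 2 - η / 2) := by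
      rw [← hω (ξp + y + τ / 2 - η / 2)]; congr 1; ring
    simp only [Pi.div_apply, Pi.mul_apply, e1, e2, e3, e4]
  · filter_upwards [n1, n2, n3, n4] with x h1 h2 h3 h4
    exact div_ne_zero (mul_ne_zero h1 h2) (mul_ne_zero h3 h4)

theorem isQuasiPeriodic_h (hb : IsXXX b ∨ IsXXZ b) {η : ℂ} {h : ℂ → ℂ} {m : ℕ}
    (hω : ∀ y, b (y + m * τ) = b y)
    (hh_eq : (fun x => h (x + τ)) =ᶠ[codiscrete ℂ] fun x =>
      b (x + τ) * b (x + η) / (b x * b (x + τ - η)) * h x) :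
    IsQuasiPeriodic (m * τ) h := by
  obtain ⟨m1, n1⟩ := meromorphic_b_affine hb (f := fun x => x + τ)
    ⟨1, by norm_num, τ, fun x => by ring⟩
  obtain ⟨m2, n2⟩ := meromorphic_b_affine hb (f := fun x => x + η)
    ⟨1, by norm_num, η, fun x => by ring⟩
  obtain ⟨m3, n3⟩ := meromorphic_b_affine hb (f := fun x => x)
    ⟨1, by norm_num, 0, fun x => by ring⟩
  obtain ⟨m4, n4⟩ := meromorphic_b_affine hb (f := fun x => x + τ - η)
    ⟨1, by norm_num, τ - η, fun x => by ring⟩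
  refine isQuasiPeriodic_of_step (fun x => ((m1 x).mul (m2 x)).div ((m3 x).mul (m4 x)))
    (fun y => ?_) ?_ hh_eq
  · have e1 : b (y + m * τ + τ) = b (y + τ) := by rw [← hω (y + τ)]; congr 1; ring
    have e2 : b (y + m * τ + η) = b (y + η) := by rw [← hω (y + η)]; congr 1; ring
    have e4 : b (y + m * τ + τ - η) = b (y + τ - η) := by
      rw [← hω (y + τ - η)]; congr 1; ring
    simp only [Pi.div_apply, Pi.mul_apply, e1, e2, hω, e4]
  · filter_upwards [n1, n2, n3, n4] with x h1 h2 h3 h4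
    exact div_ne_zero (mul_ne_zero h1 h2) (mul_ne_zero h3 h4)

theorem isQuasiPeriodic_F (hb : IsXXX b ∨ IsXXZ b) {η : ℂ} {F : ℂ → ℂ} {m : ℕ}
    (hω : ∀ y, b (y + m * τ) = b y)
    (hF_eq : (fun x => F (x + τ)) =ᶠ[codiscrete ℂ] fun x =>
      b (x + τ - η / 2) / b (x + τ + η / 2) * F x) :
    IsQuasiPeriodic (m * τ) F := by
  obtain ⟨m1, n1⟩ := meromorphic_b_affine hb (f := fun x => x + τ - η / 2)
    ⟨1, by norm_num, τ - η / 2, fun x => by ring⟩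
  obtain ⟨m2, n2⟩ := meromorphic_b_affine hb (f := fun x => x + τ + η / 2)
    ⟨1, by norm_num, τ + η / 2, fun x => by ring⟩
  refine isQuasiPeriodic_of_step (fun x => (m1 x).div (m2 x)) (fun y => ?_) ?_ hF_eq
  · have e1 : b (y + m * τ + τ - η / 2) = b (y + τ - η / 2) := by
      rw [← hω (y + τ - η / 2)]; congr 1; ring
    have e2 : b (y + m * τ + τ + η / 2) = b (y + τ + η / 2) := by
      rw [← hω (y + τ + η / 2)]; congr 1; ring
    simp only [Pi.div_apply, e1, e2]
  · filter_upwards [n1, n2] with x h1 h2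
    exact div_ne_zero h1 h2

theorem eq_zero_of_summable_geometric {f : ℤ → ℝ} {ρ : ℝ} (hf : Summable f) (h0 : ∀ k, 0 ≤ f k)
    (h : ∀ k, f (k + 1) = ρ * f k) : f 0 = 0 := by
  have hlim := hf.tendsto_cofinite_zero
  refine le_antisymm ?_ (h0 0)
  rcases le_total 1 ρ with h1 | h1
  · have hk : ∀ k : ℕ, f 0 ≤ f k := fun k => by
      induction k with
      | zero => simp
      | succ k ih =>
        rw [Nat.cast_succ, h]
        exact ih.trans (le_mul_of_one_le_left (h0 _) h1)
    have hl : Tendsto (fun k : ℕ => f k) atTop (𝓝 0) := by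
      rw [← Nat.cofinite_eq_atTop]
      exact hlim.comp (Nat.cast_injective (R := ℤ)).tendsto_cofinite
    exact ge_of_tendsto' hl hk
  · have hk : ∀ k : ℕ, f 0 ≤ f (-(k : ℤ)) := fun k => by
      induction k with
      | zero => simp
      | succ k ih =>
        have := h (-((k + 1 : ℕ) : ℤ))
        rw [Nat.cast_succ, neg_add, neg_add_cancel_right] at this
        rw [this] at ih
        rw [Nat.cast_succ, neg_add]
        exact ih.trans (mul_le_of_le_one_left (h0 _) h1)
    have hl : Tendsto (fun k : ℕ => f (-(k : ℤ))) atTop (𝓝 0) := by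
      rw [← Nat.cofinite_eq_atTop]
      exact hlim.comp (Function.Injective.tendsto_cofinite (f := fun k : ℕ => -(k : ℤ))
        fun a b hab => by simpa using hab)
    exact ge_of_tendsto' hl hk

/-- If `b` has a period in `τ ℕ`, then an absolutely convergent sum has vanishing summands. -/
theorem summand_eq_zero_of_period (hb : IsXXX b ∨ IsXXZ b) {η ξp ξm : ℂ} {g h F : ℂ → ℂ} {m : ℕ}
    (hm : 0 < m) (hω : ∀ y, b (y + m * τ) = b y)
    (hg_eq : (fun x => g (x + τ)) =ᶠ[codiscrete ℂ] fun x =>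
      b (ξm - x - η / 2) * b (ξp - x - τ / 2 - η / 2) /
        (b (ξm + x + τ - η / 2) * b (ξp + x + τ / 2 - η / 2)) * g x)
    (hh_eq : (fun x => h (x + τ)) =ᶠ[codiscrete ℂ] fun x =>
      b (x + τ) * b (x + η) / (b x * b (x + τ - η)) * h x)
    (hF_eq : (fun x => F (x + τ)) =ᶠ[codiscrete ℂ] fun x =>
      b (x + τ - η / 2) / b (x + τ + η / 2) * F x)
    {N M : ℕ} {x₀ : Fin M → ℂ} (hx₀ : IsGeneric b τ g h x₀) (i : Fin M) {t : Fin N → ℂ}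
    (hF : ∀ s, ∀ k : ℤ, AnalyticAt ℂ F (t s + (x₀ i + τ * k)) ∧
      AnalyticAt ℂ F (t s - (x₀ i + τ * k)))
    (hsum : Summable fun n => ‖summand b η ξm τ g h F x₀ n t‖) (n : Fin M → ℤ) :
    summand b η ξm τ g h F x₀ n t = 0 := by
  set ω : ℂ := m * τ with hωdef
  set x := latticePoint τ x₀ n with hx
  have hgQ := isQuasiPeriodic_g hb hω hg_eq
  have hhQ := isQuasiPeriodic_h hb hω hh_eq
  have hFQ := isQuasiPeriodic_F hb hω hF_eq
  have hpt : ∀ k : ℤ, x i + k * ω = x₀ i + τ * (n i + k * m : ℤ) := fun k => by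
    simp only [hx, latticePoint, hωdef]; push_cast; ring
  let P : (ℂ → ℂ) → Prop := fun φ => IsQuasiPeriodic ω φ ∧ ∀ k : ℤ, AnalyticAt ℂ φ (x i + k * ω)
  have Pconst : ∀ c, P fun _ => c := fun c => ⟨isQuasiPeriodic_const c, fun _ => analyticAt_const⟩
  have Pmul : ∀ {φ ψ : ℂ → ℂ}, P φ → P ψ → P fun y => φ y * ψ y := fun h1 h2 =>
    ⟨h1.1.mul h2.1, fun k => (h1.2 k).mul (h2.2 k)⟩
  have Pprod : ∀ {ι : Type} (s : Finset ι) {φ : ι → ℂ → ℂ}, (∀ j ∈ s, P (φ j)) →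
      P fun y => ∏ j ∈ s, φ j y := fun s φ hφ =>
    ⟨IsQuasiPeriodic.prod s fun j hj => (hφ j hj).1, fun k =>
      Finset.analyticAt_fun_prod s fun j hj => (hφ j hj).2 k⟩
  have Padd : ∀ {φ : ℂ → ℂ} (a : ℂ), IsQuasiPeriodic ω φ →
      (∀ k : ℤ, AnalyticAt ℂ φ (x i + k * ω + a)) → P fun y => φ (y + a) := fun a h1 h2 =>
    ⟨h1.comp_add a, fun k => (h2 k).fun_comp (f := fun y => y + a) (by fun_prop)⟩
  have Psub : ∀ {φ : ℂ → ℂ} (a : ℂ), IsQuasiPeriodic ω φ →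
      (∀ k : ℤ, AnalyticAt ℂ φ (a - (x i + k * ω))) → P fun y => φ (a - y) := fun a h1 h2 =>
    ⟨h1.comp_sub a, fun k => (h2 k).fun_comp (f := fun y => a - y) (by fun_prop)⟩
  have hW : P fun y => weight g h F (Function.update x i y) t := by
    unfold weight
    refine Pmul (Pmul (Pprod _ fun j _ => ?_) (Pprod _ fun a _ => Pprod _ fun c hc => ?_))
      (Pprod _ fun r _ => Pprod _ fun j _ => ?_)
    · by_cases hj : j = i
      · subst hj
        simp only [Function.update_self]
        exact ⟨hgQ, fun k => by rw [hpt]; exact hx₀.analyticAt_g j _⟩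
      · simp only [Function.update_of_ne hj]
        exact Pconst _
    · have hac : a < c := Finset.mem_Ioi.1 hc
      by_cases ha : a = i
      · subst ha
        simp only [Function.update_self, Function.update_of_ne hac.ne']
        refine Pmul (Padd _ hhQ fun k => ?_) ?_
        · have e : x a + k * ω + x c = x₀ a + x₀ c + τ * (n a + k * m + n c : ℤ) := by
            rw [hpt]; simp only [hx, latticePoint]; push_cast; ring
          rw [e]; exact hx₀.analyticAt_h_add a c hac _
        · simp only [sub_eq_add_neg]
          refine Padd _ hhQ fun k => ?_
          have e : x a + k * ω + -x c = x₀ a - x₀ c + τ * (n a + k * m - n c : ℤ) := by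
            rw [hpt]; simp only [hx, latticePoint]; push_cast; ring
          rw [e]; exact hx₀.analyticAt_h_sub a c hac _
      · by_cases hci : c = i
        · subst hci
          simp only [Function.update_self, Function.update_of_ne ha]
          refine Pmul ?_ (Psub _ hhQ fun k => ?_)
          · simp only [add_comm (x a)]
            refine Padd _ hhQ fun k => ?_
            have e : x c + k * ω + x a = x₀ a + x₀ c + τ * (n c + k * m + n a : ℤ) := by
              rw [hpt]; simp only [hx, latticePoint]; push_cast; ring
            rw [e]; exact hx₀.analyticAt_h_add a c hac _
          · have e : x a - (x c + k * ω) = x₀ a - x₀ c + τ * (n a - (n c + k * m) : ℤ) := by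
              rw [hpt]; simp only [hx, latticePoint]; push_cast; ring
            rw [e]; exact hx₀.analyticAt_h_sub a c hac _
        · simp only [Function.update_of_ne ha, Function.update_of_ne hci]
          exact Pconst _
    · by_cases hj : j = i
      · subst hj
        simp only [Function.update_self]
        refine Pmul ?_ (Psub _ hFQ fun k => ?_)
        · simp only [add_comm (t r)]
          refine Padd _ hFQ fun k => ?_
          rw [hpt, add_comm]
          exact (hF r _).1
        · rw [hpt]
          exact (hF r _).2
      · simp only [Function.update_of_ne hj]
        exact Pconst _
  have hlat : ∀ k : ℤ, latticePoint τ x₀ (n + Pi.single i (k * m)) =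
      Function.update x i (x i + k * ω) := fun k => by
    ext j
    by_cases hj : j = i
    · subst hj
      rw [Function.update_self, hpt]
      simp [latticePoint]
    · simp [latticePoint, hx, hj]
  have hterm : ∀ k : ℤ, summand b η ξm τ g h F x₀ (n + Pi.single i (k * m)) t =
      weight g h F (Function.update x i (x i + k * ω)) t • boundaryBethe b η ξm x t := fun k => by
    rw [summand, hlat, boundaryBethe_update hω]
  have h0 := hterm 0
  rw [Int.zero_mul, Pi.single_zero, add_zero] at h0
  rcases hW.1.orbit hW.2 with h1 | ⟨ρ, h1⟩
  · rw [h0, h1, zero_smul]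
  · have hinj : Function.Injective fun k : ℤ => n + Pi.single i (k * m) := fun k l hkl => by
      have := congrFun (add_left_cancel hkl) i
      simpa [hm.ne'] using this
    have h2 := eq_zero_of_summable_geometric (hsum.comp_injective hinj) (ρ := ‖ρ‖)
      (fun _ => norm_nonneg _) fun k => by
        simp only [Function.comp_apply]
        rw [hterm, hterm, h1, mul_smul, norm_smul]
    simp only [Function.comp_apply, Int.zero_mul, Pi.single_zero, add_zero] at h2
    exact norm_eq_zero.1 h2

end Periodic

/-! ### The boundary qKZ equations at a generic point -/

section Pointwise

variable {b : ℂ → ℂ} {N M : ℕ} {τ : ℂ}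

theorem PairedResidues.tsum_eq_zero {V : Type*} [NormedAddCommGroup V] [NormedSpace ℂ V]
    [CompleteSpace V] (hb : IsXXX b ∨ IsXXZ b) (hτ : τ ≠ 0) {x₀ : Fin M → ℂ}
    {Xp Xm : Fin M → (Fin M → ℤ) → V} {Z Z' κ : ℂ}
    (hP : PairedResidues b τ x₀ Xp Xm Z Z' κ) :
    ∑' n : Fin M → ℤ,
      (cauchySum b τ x₀ Xp Xm (Z + τ) n - κ • cauchySum b τ x₀ Xp Xm Z' n) = 0 := by
  rcases hb with ⟨c, hc, h⟩ | ⟨c, ν, hc, hν, h⟩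
  · exact hP.tsum_eq_zero_of_isExpanding (Or.inl ⟨c, hc, h⟩) (isExpanding_rational hτ hc h)
  · have hb : IsXXX b ∨ IsXXZ b := Or.inr ⟨c, ν, hc, hν, h⟩
    rcases lt_trichotomy (ν * τ).re 0 with h0 | h0 | h0
    · refine hP.tsum_eq_zero_of_isExpanding hb
        (isExpanding_hyperbolic (neg_ne_zero.2 hc) (neg_ne_zero.2 hν) (fun x => ?_) (by simpa using h0))
      rw [h, neg_mul, neg_mul, Complex.sinh_neg]; ring
    · exact hP.tsum_eq_zero_of_re_eq_zero hc hν h h0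
    · exact hP.tsum_eq_zero_of_isExpanding hb (isExpanding_hyperbolic hc hν h h0)

/-- Away from the zeros of `b` a shift of the argument changes `b` by a bounded factor. -/
theorem exists_ratio_bound (hb : IsXXX b ∨ IsXXZ b) (a : ℂ) {c : ℝ} (hc : 0 < c) :
    ∃ K, 0 ≤ K ∧ ∀ y, c ≤ ‖b y‖ → ‖b (y + a) / b y‖ ≤ K := by
  obtain ⟨A, B, hA, hB, h⟩ : ∃ A B : ℝ, 0 ≤ A ∧ 0 ≤ B ∧ ∀ y, ‖b (y + a)‖ ≤ A * ‖b y‖ + B := by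
    rcases hb with ⟨l, -, h⟩ | ⟨l, ν, -, -, h⟩
    · refine ⟨1, ‖l * a‖, zero_le_one, norm_nonneg _, fun y => ?_⟩
      rw [h, h, mul_add, one_mul]
      exact norm_add_le _ _
    · refine ⟨‖Complex.cosh (ν * a)‖ + ‖Complex.sinh (ν * a)‖, ‖l‖ * ‖Complex.sinh (ν * a)‖,
        by positivity, by positivity, fun y => ?_⟩
      rw [h, h, mul_add, Complex.sinh_add, norm_mul, norm_mul]
      have h1 := norm_add_le (Complex.sinh (ν * y) * Complex.cosh (ν * a))
        (Complex.cosh (ν * y) * Complex.sinh (ν * a))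
      rw [norm_mul, norm_mul] at h1
      have h2 := mul_le_mul_of_nonneg_right (norm_cosh_le (ν * y))
        (norm_nonneg (Complex.sinh (ν * a)))
      nlinarith [mul_le_mul_of_nonneg_left (h1.trans (add_le_add_right h2 _)) (norm_nonneg l)]
  refine ⟨A + B / c, by positivity, fun y hy => ?_⟩
  have hy0 : 0 < ‖b y‖ := hc.trans_le hy
  rw [norm_div, div_le_iff₀ hy0]
  refine (h y).trans ?_
  rw [add_mul]
  refine add_le_add_right ?_ _
  rw [div_mul_eq_mul_div, le_div_iff₀ hc]
  exact mul_le_mul_of_nonneg_left hy hB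

/-- The conditions on the inhomogeneities `t` under which the `r`-th boundary qKZ equation is proved
directly: the functional equation of `F` holds and `b` does not vanish where it has to be
inverted, for all lattice points at once. -/
structure IsRegularPoint (b : ℂ → ℂ) (η ξp ξm τ : ℂ) (F : ℂ → ℂ) (x₀ : Fin M → ℂ) (r : Fin N)
    (t : Fin N → ℂ) : Prop where
  F_add : ∀ s i, ∀ k : ℤ, F (t s + x₀ i + τ * k + τ) * b (t s + x₀ i + τ * k + τ + η / 2) =
    b (t s + x₀ i + τ * k + τ - η / 2) * F (t s + x₀ i + τ * k)
  F_sub : ∀ s i, ∀ k : ℤ, F (t s - x₀ i + τ * k + τ) * b (t s - x₀ i + τ * k + τ + η / 2) =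
    b (t s - x₀ i + τ * k + τ - η / 2) * F (t s - x₀ i + τ * k)
  ne_add : ∀ s i, ∀ k : ℤ, b (t s + x₀ i + η / 2 + τ * k) ≠ 0 ∧ b (t s + x₀ i - η / 2 + τ * k) ≠ 0
  ne_sub : ∀ s i, ∀ k : ℤ, b (t s - x₀ i + η / 2 + τ * k) ≠ 0 ∧ b (t s - x₀ i - η / 2 + τ * k) ≠ 0
  ne_diff : ∀ s, s ≠ r → ∀ k : ℤ, b (t r - t s + η + τ * k) ≠ 0 ∧ b (t r - t s - η + τ * k) ≠ 0
  ne_sum : ∀ s, s ≠ r → b (t s + t r + η) ≠ 0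
  ne_ξm : b (ξm + t r) ≠ 0
  ne_ξp : b (ξp + t r + τ / 2) ≠ 0
  ne_double : ∀ k : ℤ, b (2 * t r + τ * k) ≠ 0
  lower : ∃ c > 0, ∀ i, ∀ k : ℤ, (c ≤ ‖b (t r + x₀ i + η / 2 + τ * k)‖ ∧
    c ≤ ‖b (t r + x₀ i - η / 2 + τ * k)‖) ∧ c ≤ ‖b (t r - x₀ i + η / 2 + τ * k)‖ ∧
    c ≤ ‖b (t r - x₀ i - η / 2 + τ * k)‖

variable {η ξp ξm : ℂ} {g h F : ℂ → ℂ} {x₀ : Fin M → ℂ} {r : Fin N} {t : Fin N → ℂ}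

theorem otherSites_update (z : ℂ) : otherSites (Function.update t r z) r = otherSites t r := by
  rw [otherSites, otherSites]
  congr 1 <;> refine List.map_congr_left fun s hs => ?_ <;>
    · rw [List.mem_reverse, List.mem_filter] at hs
      have := of_decide_eq_true hs.2
      rw [Function.update_of_ne (by rintro rfl; exact lt_irrefl _ this)]

theorem moveOut_update (z w : ℂ) : moveOut b η r (Function.update t r w) z = moveOut b η r t z := by
  rw [moveOut, moveOut]
  congr 1
  refine List.map_congr_left fun s hs => ?_
  have := of_decide_eq_true (List.mem_filter.1 hs).2
  rw [Function.update_of_ne this.ne']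

theorem siteVec_update (x : Fin M → ℂ) (z Z : ℂ) :
    siteVec b η ξm r x (Function.update t r z) Z = siteVec b η ξm r x t Z := by
  rw [siteVec, siteVec, otherSites_update]

theorem exists_moveOut_inv (hb : IsXXX b ∨ IsXXZ b) {z : ℂ}
    (h : ∀ s, s ≠ r → b (z - t s + η) ≠ 0 ∧ b (z - t s - η) ≠ 0) :
    ∃ D, D * moveOut b η r t z = 1 := by
  rw [moveOut]
  have hl : ∀ s ∈ (List.finRange N).filter fun s => r < s, s ≠ r := fun s hs =>
    (of_decide_eq_true (List.mem_filter.1 hs).2).ne'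
  generalize (List.finRange N).filter (fun s => r < s) = l at hl ⊢
  induction l with
  | nil => exact ⟨1, by simp⟩
  | cons s l ih =>
    obtain ⟨D, hD⟩ := ih fun q hq => hl q (by simp [hq])
    have hs := hl s (by simp)
    refine ⟨D * leg2 r s (Rmat b η (-(z - t s))), ?_⟩
    have h1 : Rmat b η (-(z - t s)) * Rmat b η (z - t s) = 1 := by
      have h2 := Rhat_mul_Rhat_neg hb η (-(z - t s))
      rw [neg_neg] at h2
      have e : b (-(z - t s) + η) ≠ 0 := by
        rw [show -(z - t s) + η = -(z - t s - η) by ring, b_neg hb]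
        exact neg_ne_zero.2 (h s hs).2
      rw [Rmat_eq, Rmat_eq, smul_mul_smul_comm, h2, smul_smul, ← mul_inv,
        inv_mul_cancel₀ (mul_ne_zero e (h s hs).1), one_smul]
    rw [List.map_cons, List.prod_cons, mul_assoc, ← mul_assoc (leg2 _ _ _), ← leg2_mul hs.symm, h1,
      leg2_one, one_mul, hD]

/-- The functional equation of `F` compensates the prefactor of the Bethe vector. -/
theorem weight_update_mul_shiftFactor {x : Fin M → ℂ} {z : ℂ}
    (hF : ∀ i, F (z + x i + τ) * b (z + x i + τ + η / 2) =
      b (z + x i + τ - η / 2) * F (z + x i) ∧ F (z - x i + τ) * b (z - x i + τ + η / 2) =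
      b (z - x i + τ - η / 2) * F (z - x i))
    (h0 : ∀ i, b (z + x i + τ - η / 2) ≠ 0 ∧ b (z - x i + τ - η / 2) ≠ 0) :
    weight g h F x (Function.update t r (z + τ)) * ∏ i, shiftFactor b η (z + τ) (x i) =
      weight g h F x (Function.update t r z) := by
  rw [weight, weight, ← Finset.mul_prod_erase _ _ (Finset.mem_univ r),
    ← Finset.mul_prod_erase _ (fun s => ∏ i, F (Function.update t r z s + x i) *
      F (Function.update t r z s - x i)) (Finset.mem_univ r), Function.update_self,
    Function.update_self]
  have h1 : ∀ w, (∏ s ∈ Finset.univ.erase r, ∏ i, F (Function.update t r w s + x i) *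
      F (Function.update t r w s - x i)) =
      ∏ s ∈ Finset.univ.erase r, ∏ i, F (t s + x i) * F (t s - x i) := fun w =>
    Finset.prod_congr rfl fun s hs => by rw [Function.update_of_ne (Finset.ne_of_mem_erase hs)]
  have h2 : (∏ i, F (z + τ + x i) * F (z + τ - x i)) * ∏ i, shiftFactor b η (z + τ) (x i) =
      ∏ i, F (z + x i) * F (z - x i) := by
    rw [← Finset.prod_mul_distrib]
    refine Finset.prod_congr rfl fun i _ => ?_
    obtain ⟨f1, f2⟩ := hF i
    obtain ⟨d1, d2⟩ := h0 i
    rw [shiftFactor, show z + τ + x i = z + x i + τ by ring, show z + τ - x i = z - x i + τ by ring,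
      show z + τ + η / 2 + x i = z + x i + τ + η / 2 by ring,
      show z + τ + η / 2 - x i = z - x i + τ + η / 2 by ring,
      show z + τ - η / 2 + x i = z + x i + τ - η / 2 by ring,
      show z + τ - η / 2 - x i = z - x i + τ - η / 2 by ring]
    generalize F (z + x i + τ) = F1, F (z - x i + τ) = F2, F (z + x i) = F3, F (z - x i) = F4,
      b (z + x i + τ + η / 2) = b1, b (z - x i + τ + η / 2) = b2, b (z + x i + τ - η / 2) = b3,
      b (z - x i + τ - η / 2) = b4 at *
    field_simp
    linear_combination F2 * b2 * f1 + b3 * F3 * f2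
  rw [h1, h1]
  linear_combination (∏ i, g (x i)) * (∏ i, ∏ j ∈ Finset.Ioi i, h (x i + x j) * h (x i - x j)) *
    (∏ s ∈ Finset.univ.erase r, ∏ i, F (t s + x i) * F (t s - x i)) * h2

theorem summable_mulVec {ι : Type*} {m : Type*} [Fintype m] [DecidableEq m] (A : Matrix m m ℂ)
    {f : ι → m → ℂ} (hf : Summable f) : Summable fun n => A *ᵥ f n :=
  hf.map (Matrix.mulVecLin A).toAddMonoidHom
    (LinearMap.continuous_of_finiteDimensional (Matrix.mulVecLin A))

theorem tsum_mulVec {ι : Type*} {m : Type*} [Fintype m] [DecidableEq m] (A : Matrix m m ℂ)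
    {f : ι → m → ℂ} (hf : Summable f) : ∑' n, A *ᵥ f n = A *ᵥ ∑' n, f n :=
  (hf.map_tsum (Matrix.mulVecLin A).toAddMonoidHom
    (LinearMap.continuous_of_finiteDimensional (Matrix.mulVecLin A))).symm

theorem legUnit_mulVec_bethe (η ξ : ℂ) {L : List (Fin N × ℂ)} (hr : ∀ s ∈ L, s.1 ≠ r)
    (xs : List ℂ) : legUnit r 1 1 *ᵥ bethe (creation b η ξ L) (pseudoVacuum N) xs = 0 := by
  induction xs with
  | nil => simpa [bethe] using (legUnit_mulVec_pseudoVacuum r).2.1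
  | cons x xs ih =>
    rw [bethe_cons, Matrix.mulVec_mulVec, (legUnit_commute_creation η ξ x hr 1 1).eq,
      ← Matrix.mulVec_mulVec, ih, Matrix.mulVec_zero]

theorem legUnit_mulVec_residueTerm (x : Fin M → ℂ) (i : Fin M) (u : ℂ) :
    legUnit r 1 1 *ᵥ residueTerm b η ξm r t x i u = residueTerm b η ξm r t x i u := by
  rw [residueTerm, Matrix.mulVec_smul, Matrix.mulVec_mulVec, legUnit_mul, if_pos rfl]

theorem leg1_Kmat_eq (ξ u : ℂ) : leg1 r (Kmat b ξ u) =
    legUnit r 0 0 + (b (ξ - u) / b (ξ + u)) • legUnit r 1 1 := by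
  rw [legUnit, legUnit, ← leg1_smul, ← leg1_add]
  congr 1
  ext i j
  fin_cases i <;> fin_cases j <;> simp [Kmat]

end Pointwise

section Pointwise

variable {b : ℂ → ℂ} {N M : ℕ} {τ η ξp ξm : ℂ} {g h F : ℂ → ℂ} {x₀ : Fin M → ℂ} {r : Fin N}
  {t : Fin N → ℂ}

theorem poleFactor_ne_zero {L : List (Fin N × ℂ)} {x : ℂ}
    (h : ∀ s ∈ L, b (s.2 - x - η / 2) ≠ 0 ∧ b (-x - s.2 + η / 2) ≠ 0) : poleFactor b η L x ≠ 0 := by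
  rw [poleFactor]
  refine List.prod_ne_zero fun h0 => ?_
  obtain ⟨s, hs, h1⟩ := List.mem_map.1 h0
  exact mul_ne_zero (h s hs).1 (h s hs).2 h1

theorem separated_latticePoint (hb : IsXXX b ∨ IsXXZ b) (hx₀ : IsGeneric b τ g h x₀)
    (n : Fin M → ℤ) {i j : Fin M} (hij : i ≠ j) :
    Separated b (latticePoint τ x₀ n i) (latticePoint τ x₀ n j) := by
  have key : ∀ i j, i < j → ∀ n : Fin M → ℤ,
      Separated b (latticePoint τ x₀ n i) (latticePoint τ x₀ n j) := fun i j hij n => by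
    constructor
    · have := hx₀.ne_zero_add i j hij (n i + n j)
      convert this using 2
      simp only [latticePoint]; push_cast; ring
    · have := hx₀.ne_zero_sub i j hij (n i - n j)
      convert this using 2
      simp only [latticePoint]; push_cast; ring
  rcases lt_or_gt_of_ne hij with h | h
  · exact key i j h n
  · obtain ⟨h1, h2⟩ := key j i h n
    refine ⟨by rwa [add_comm], ?_⟩
    rw [← neg_sub, b_neg hb]
    exact neg_ne_zero.2 h2

/-- The functional equations of `g` and `h` on the lattice, with denominators cleared. -/
structure LatticeEquations (b : ℂ → ℂ) (η ξp ξm τ : ℂ) (g h : ℂ → ℂ) (x₀ : Fin M → ℂ) : Prop where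
  g_eq : ∀ i, ∀ k : ℤ, g (x₀ i + τ * k + τ) * (b (ξm + (x₀ i + τ * k) + τ - η / 2) *
      b (ξp + (x₀ i + τ * k) + τ / 2 - η / 2)) =
    b (ξm - (x₀ i + τ * k) - η / 2) * b (ξp - (x₀ i + τ * k) - τ / 2 - η / 2) * g (x₀ i + τ * k)
  h_add : ∀ i j, i < j → ∀ k : ℤ, h (x₀ i + x₀ j + τ * k + τ) *
      (b (x₀ i + x₀ j + τ * k) * b (x₀ i + x₀ j + τ * k + τ - η)) =
    b (x₀ i + x₀ j + τ * k + τ) * b (x₀ i + x₀ j + τ * k + η) * h (x₀ i + x₀ j + τ * k)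
  h_sub : ∀ i j, i < j → ∀ k : ℤ, h (x₀ i - x₀ j + τ * k + τ) *
      (b (x₀ i - x₀ j + τ * k) * b (x₀ i - x₀ j + τ * k + τ - η)) =
    b (x₀ i - x₀ j + τ * k + τ) * b (x₀ i - x₀ j + τ * k + η) * h (x₀ i - x₀ j + τ * k)

/-- The residues of the summand at the lattice points. -/
def latticeResidue (b : ℂ → ℂ) (η ξm τ : ℂ) (g h F : ℂ → ℂ) (x₀ : Fin M → ℂ) (r : Fin N)
    (t : Fin N → ℂ) (ε : ℂ) (i : Fin M) (n : Fin M → ℤ) : (Fin N → Fin 2) → ℂ :=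
  (ε * weight g h F (latticePoint τ x₀ n) t) •
    residueTerm b η ξm r t (latticePoint τ x₀ n) i (ε * latticePoint τ x₀ n i)

theorem weight_smul_siteVec (n : Fin M → ℤ) (Z : ℂ) :
    weight g h F (latticePoint τ x₀ n) t • siteVec b η ξm r (latticePoint τ x₀ n) t Z =
      (weight g h F (latticePoint τ x₀ n) t *
        (∏ i, poleFactor b η (otherSites t r) (latticePoint τ x₀ n i))⁻¹) •
        bethe (creation b η ξm (otherSites t r)) (pseudoVacuum N) (List.ofFn (latticePoint τ x₀ n)) -
      cauchySum b τ x₀ (latticeResidue b η ξm τ g h F x₀ r t 1)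
        (latticeResidue b η ξm τ g h F x₀ r t (-1)) Z n := by
  rw [siteVec_eq, smul_sub, smul_smul, Finset.smul_sum, cauchySum]
  congr 1
  refine Finset.sum_congr rfl fun i _ => ?_
  rw [latticeResidue, latticeResidue, one_mul, one_mul, neg_one_mul, neg_one_mul]
  module

theorem legUnit_mulVec_cauchySum (n : Fin M → ℤ) (Z : ℂ) :
    legUnit r 1 1 *ᵥ cauchySum b τ x₀ (latticeResidue b η ξm τ g h F x₀ r t 1)
        (latticeResidue b η ξm τ g h F x₀ r t (-1)) Z n =
      cauchySum b τ x₀ (latticeResidue b η ξm τ g h F x₀ r t 1)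
        (latticeResidue b η ξm τ g h F x₀ r t (-1)) Z n := by
  rw [cauchySum, Matrix.mulVec_sum]
  refine Finset.sum_congr rfl fun i _ => ?_
  rw [Matrix.mulVec_add, Matrix.mulVec_smul, Matrix.mulVec_smul, latticeResidue, latticeResidue,
    Matrix.mulVec_smul, Matrix.mulVec_smul, legUnit_mulVec_residueTerm, legUnit_mulVec_residueTerm]

theorem legUnit_mulVec_siteVec (n : Fin M → ℤ) (Z : ℂ) :
    legUnit r 1 1 *ᵥ (weight g h F (latticePoint τ x₀ n) t •
        siteVec b η ξm r (latticePoint τ x₀ n) t Z) =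
      -cauchySum b τ x₀ (latticeResidue b η ξm τ g h F x₀ r t 1)
        (latticeResidue b η ξm τ g h F x₀ r t (-1)) Z n := by
  rw [weight_smul_siteVec, Matrix.mulVec_sub, Matrix.mulVec_smul,
    legUnit_mulVec_bethe η ξm (nodup_otherSites t r).2, smul_zero, zero_sub,
    legUnit_mulVec_cauchySum]

theorem IsRegularPoint.poleFactor_ne_zero (hb : IsXXX b ∨ IsXXZ b)
    (ht : IsRegularPoint b η ξp ξm τ F x₀ r t) (k : ℤ) (n : Fin M → ℤ) (i : Fin M) :
    poleFactor b η (sites (Function.update t r (t r + τ * k))) (latticePoint τ x₀ n i) ≠ 0 := by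
  refine BQKZ.poleFactor_ne_zero fun s hs => ?_
  obtain ⟨q, -, rfl⟩ := List.mem_map.1 hs
  obtain ⟨l, hl⟩ : ∃ l : ℤ, Function.update t r (t r + τ * k) q = t q + τ * l := by
    by_cases hq : q = r
    · subst hq; exact ⟨k, by simp⟩
    · exact ⟨0, by simp [hq]⟩
  simp only [hl]
  constructor
  · have := (ht.ne_sub q i (l - n i)).2
    convert this using 2
    simp only [latticePoint]; push_cast; ring
  · have := (ht.ne_add q i (l + n i)).2
    rw [← neg_ne_zero, ← b_neg hb]
    convert this using 2
    simp only [latticePoint]; push_cast; ring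

theorem IsRegularPoint.weight_update_succ (ht : IsRegularPoint b η ξp ξm τ F x₀ r t) (k : ℤ)
    (n : Fin M → ℤ) :
    weight g h F (latticePoint τ x₀ n) (Function.update t r (t r + τ * k + τ)) *
        ∏ i, shiftFactor b η (t r + τ * k + τ) (latticePoint τ x₀ n i) =
      weight g h F (latticePoint τ x₀ n) (Function.update t r (t r + τ * k)) := by
  refine weight_update_mul_shiftFactor (fun i => ⟨?_, ?_⟩) fun i => ⟨?_, ?_⟩
  · have := ht.F_add r i (k + n i)
    convert this using 3 <;> simp only [latticePoint] <;> push_cast <;> ring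
  · have := ht.F_sub r i (k - n i)
    convert this using 3 <;> simp only [latticePoint] <;> push_cast <;> ring
  · have := (ht.ne_add r i (k + 1 + n i)).2
    convert this using 2
    simp only [latticePoint]; push_cast; ring
  · have := (ht.ne_sub r i (k + 1 - n i)).2
    convert this using 2
    simp only [latticePoint]; push_cast; ring

/-- The summand at a shifted inhomogeneity: the prefactor of the Bethe vector is absorbed in the
weight at the preceding inhomogeneity. -/
theorem IsRegularPoint.summand_update (hb : IsXXX b ∨ IsXXZ b) (hx₀ : IsGeneric b τ g h x₀)
    (ht : IsRegularPoint b η ξp ξm τ F x₀ r t) (k : ℤ) (n : Fin M → ℤ) :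
    summand b η ξm τ g h F x₀ n (Function.update t r (t r + τ * k)) =
      weight g h F (latticePoint τ x₀ n) (Function.update t r (t r + τ * (k - 1))) •
        moveOut b η r t (t r + τ * k) *ᵥ
          siteVec b η ξm r (latticePoint τ x₀ n) t (t r + τ * k + η / 2) := by
  set t' := Function.update t r (t r + τ * k) with ht'
  have hr : t' r = t r + τ * k := by simp [ht']
  have hs : ∀ s, s ≠ r → t' s = t s := fun s hs => by simp [ht', hs]
  have hB := boundaryBethe_eq_siteVec hb η ξm (r := r) (t := t') (x := latticePoint τ x₀ n)
    (fun i j hij => separated_latticePoint hb hx₀ n hij.ne)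
    (fun i => ht.poleFactor_ne_zero hb k n i)
    (fun s hsr => by
      rw [hr, hs s hsr]
      have := (ht.ne_diff s hsr k).1
      convert this using 2; ring)
    (fun i => by
      rw [hr]
      constructor
      · have := (ht.ne_add r i (k + n i)).1
        convert this using 2
        simp only [latticePoint]; push_cast; ring
      · have := (ht.ne_sub r i (k - n i)).1
        convert this using 2
        simp only [latticePoint]; push_cast; ring)
  rw [hr, ht', moveOut_update, siteVec_update, ← ht'] at hB
  have hw := ht.weight_update_succ (g := g) (h := h) (k - 1) n
  rw [Int.cast_sub, Int.cast_one] at hw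
  rw [show t r + τ * ((k : ℂ) - 1) + τ = t r + τ * k by ring, ← ht'] at hw
  rw [summand, hB, smul_smul, hw]

/-- The weights at two inhomogeneities that differ by a multiple of `τ e_r` are comparable. -/
theorem IsRegularPoint.exists_weight_le (hb : IsXXX b ∨ IsXXZ b)
    (ht : IsRegularPoint b η ξp ξm τ F x₀ r t) (k : ℤ) :
    ∃ K : ℝ, 0 ≤ K ∧ ∀ n : Fin M → ℤ, ‖weight g h F (latticePoint τ x₀ n) t‖ ≤
      K * ‖weight g h F (latticePoint τ x₀ n) (Function.update t r (t r + τ * k))‖ := by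
  obtain ⟨c, hc, hlow⟩ := ht.lower
  obtain ⟨K₁, hK₁, h₁⟩ := exists_ratio_bound hb η hc
  obtain ⟨K₂, hK₂, h₂⟩ := exists_ratio_bound hb (-η) hc
  have hw := ht.weight_update_succ (g := g) (h := h)
  have hl : ∀ (k : ℤ) (n : Fin M → ℤ) i,
      (c ≤ ‖b (t r + τ * k + τ + η / 2 + latticePoint τ x₀ n i)‖ ∧
        c ≤ ‖b (t r + τ * k + τ - η / 2 + latticePoint τ x₀ n i)‖) ∧
      c ≤ ‖b (t r + τ * k + τ + η / 2 - latticePoint τ x₀ n i)‖ ∧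
        c ≤ ‖b (t r + τ * k + τ - η / 2 - latticePoint τ x₀ n i)‖ := fun k n i => by
    have e1 := (hlow i (k + 1 + n i)).1
    have e2 := (hlow i (k + 1 - n i)).2
    refine ⟨⟨?_, ?_⟩, ?_, ?_⟩
    · convert e1.1 using 3; simp only [latticePoint]; push_cast; ring
    · convert e1.2 using 3; simp only [latticePoint]; push_cast; ring
    · convert e2.1 using 3; simp only [latticePoint]; push_cast; ring
    · convert e2.2 using 3; simp only [latticePoint]; push_cast; ring
  have hsf : ∀ (k : ℤ) (n : Fin M → ℤ) i,
      ‖shiftFactor b η (t r + τ * k + τ) (latticePoint τ x₀ n i)‖ ≤ K₁ * K₁ ∧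
      ‖(shiftFactor b η (t r + τ * k + τ) (latticePoint τ x₀ n i))⁻¹‖ ≤ K₂ * K₂ := fun k n i => by
    obtain ⟨⟨l1, l2⟩, l3, l4⟩ := hl k n i
    have a2 := h₁ _ l2
    have a4 := h₁ _ l4
    have a1 := h₂ _ l1
    have a3 := h₂ _ l3
    rw [show t r + τ * k + τ - η / 2 + latticePoint τ x₀ n i + η =
      t r + τ * k + τ + η / 2 + latticePoint τ x₀ n i by ring] at a2
    rw [show t r + τ * k + τ - η / 2 - latticePoint τ x₀ n i + η =
      t r + τ * k + τ + η / 2 - latticePoint τ x₀ n i by ring] at a4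
    rw [show t r + τ * k + τ + η / 2 + latticePoint τ x₀ n i + -η =
      t r + τ * k + τ - η / 2 + latticePoint τ x₀ n i by ring] at a1
    rw [show t r + τ * k + τ + η / 2 - latticePoint τ x₀ n i + -η =
      t r + τ * k + τ - η / 2 - latticePoint τ x₀ n i by ring] at a3
    rw [shiftFactor, inv_div, mul_div_mul_comm, mul_div_mul_comm, norm_mul, norm_mul]
    exact ⟨mul_le_mul a2 a4 (norm_nonneg _) hK₁, mul_le_mul a1 a3 (norm_nonneg _) hK₂⟩
  have hne : ∀ (k : ℤ) (n : Fin M → ℤ),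
      ∏ i, shiftFactor b η (t r + τ * k + τ) (latticePoint τ x₀ n i) ≠ 0 := fun k n => by
    refine Finset.prod_ne_zero_iff.2 fun i _ => ?_
    obtain ⟨⟨l1, l2⟩, l3, l4⟩ := hl k n i
    have p := fun y (hy : c ≤ ‖b y‖) => norm_pos_iff.1 (hc.trans_le hy)
    exact div_ne_zero (mul_ne_zero (p _ l1) (p _ l3)) (mul_ne_zero (p _ l2) (p _ l4))
  have hstep : ∀ (k : ℤ) (n : Fin M → ℤ),
      ‖weight g h F (latticePoint τ x₀ n) (Function.update t r (t r + τ * k))‖ ≤ (K₁ * K₁) ^ M *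
        ‖weight g h F (latticePoint τ x₀ n) (Function.update t r (t r + τ * (k + 1 : ℤ)))‖ ∧
      ‖weight g h F (latticePoint τ x₀ n) (Function.update t r (t r + τ * (k + 1 : ℤ)))‖ ≤
        (K₂ * K₂) ^ M *
        ‖weight g h F (latticePoint τ x₀ n) (Function.update t r (t r + τ * k))‖ := fun k n => by
    have e : t r + τ * ((k + 1 : ℤ) : ℂ) = t r + τ * k + τ := by push_cast; ring
    have bound : ∀ (f : Fin M → ℂ) (K : ℝ), (∀ i, ‖f i‖ ≤ K) → ‖∏ i, f i‖ ≤ K ^ M := fun f K hf => by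
      rw [norm_prod]
      exact (Finset.prod_le_prod (fun _ _ => norm_nonneg _) fun i _ => hf i).trans (by simp)
    rw [e]
    constructor
    · rw [← hw k n, norm_mul, mul_comm]
      exact mul_le_mul_of_nonneg_right (bound _ _ fun i => (hsf k n i).1) (norm_nonneg _)
    · rw [← mul_inv_cancel_right₀ (hne k n) (weight g h F _ (Function.update t r (t r + τ * k + τ))),
        hw k n, norm_mul, mul_comm, ← Finset.prod_inv_distrib]
      exact mul_le_mul_of_nonneg_right (bound _ _ fun i => (hsf k n i).2) (norm_nonneg _)
  induction k using Int.induction_on with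
  | zero => exact ⟨1, zero_le_one, fun n => by simp⟩
  | succ k ih =>
    obtain ⟨K, hK, hle⟩ := ih
    exact ⟨K * (K₁ * K₁) ^ M, by positivity, fun n => (hle n).trans (by
      rw [mul_assoc]; exact mul_le_mul_of_nonneg_left (hstep k n).1 hK)⟩
  | pred k ih =>
    obtain ⟨K, hK, hle⟩ := ih
    refine ⟨K * (K₂ * K₂) ^ M, by positivity, fun n => (hle n).trans ?_⟩
    have := (hstep (-k - 1) n).2
    rw [sub_add_cancel] at this
    rw [mul_assoc]
    exact mul_le_mul_of_nonneg_left this hK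

end Pointwise

section Pointwise

variable {b : ℂ → ℂ} {N M : ℕ} {τ η ξp ξm : ℂ} {g h F : ℂ → ℂ} {x₀ : Fin M → ℂ} {r : Fin N}
  {t : Fin N → ℂ}

theorem IsRegularPoint.summable_cauchySum (hb : IsXXX b ∨ IsXXZ b) (hx₀ : IsGeneric b τ g h x₀)
    (ht : IsRegularPoint b η ξp ξm τ F x₀ r t) {k : ℤ}
    (hS : Summable fun n : Fin M → ℤ =>
      summand b η ξm τ g h F x₀ n (Function.update t r (t r + τ * k))) :
    Summable fun n : Fin M → ℤ => ‖cauchySum b τ x₀ (latticeResidue b η ξm τ g h F x₀ r t 1)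
        (latticeResidue b η ξm τ g h F x₀ r t (-1)) (t r + η / 2 + k * τ) n‖ := by
  obtain ⟨D, hD⟩ := exists_moveOut_inv hb (η := η) (r := r) (t := t) (z := t r + τ * k)
    fun s hs => by
      have := ht.ne_diff s hs k
      rwa [show t r - t s + η + τ * k = t r + τ * k - t s + η by ring,
        show t r - t s - η + τ * k = t r + τ * k - t s - η by ring] at this
  obtain ⟨K, hK, hle⟩ := ht.exists_weight_le (g := g) (h := h) hb (k - 1)
  have h1 := (summable_mulVec (legUnit r 1 1) (summable_mulVec D hS)).norm
  refine (h1.mul_left K).of_nonneg_of_le (fun n => norm_nonneg _) fun n => ?_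
  rw [ht.summand_update hb hx₀, Matrix.mulVec_smul, Matrix.mulVec_mulVec, hD, Matrix.one_mulVec,
    Matrix.mulVec_smul]
  have e := legUnit_mulVec_siteVec (b := b) (η := η) (ξm := ξm) (τ := τ) (g := g) (h := h) (F := F)
    (x₀ := x₀) (r := r) (t := t) n (t r + τ * k + η / 2)
  rw [show t r + η / 2 + k * τ = t r + τ * k + η / 2 by ring, ← norm_neg, ← e, Matrix.mulVec_smul,
    norm_smul, norm_smul, ← mul_assoc]
  have := hle n
  push_cast at this
  exact mul_le_mul_of_nonneg_right this (norm_nonneg _)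

/-- The summand transported by `A_r` and the summand at the shifted inhomogeneity differ by a
difference of two sums of simple fractions. -/
theorem IsRegularPoint.transport_sub (hb : IsXXX b ∨ IsXXZ b) (hx₀ : IsGeneric b τ g h x₀)
    (ht : IsRegularPoint b η ξp ξm τ F x₀ r t) (n : Fin M → ℤ) :
    transport b η ξp ξm τ r t *ᵥ summand b η ξm τ g h F x₀ n t -
        summand b η ξm τ g h F x₀ n (Function.update t r (t r + τ)) =
      moveOut b η r t (t r + τ) *ᵥ
        (cauchySum b τ x₀ (latticeResidue b η ξm τ g h F x₀ r t 1)
          (latticeResidue b η ξm τ g h F x₀ r t (-1)) (t r + η / 2 + τ) n -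
        (b (ξp - t r - τ / 2) / b (ξp + t r + τ / 2)) •
          cauchySum b τ x₀ (latticeResidue b η ξm τ g h F x₀ r t 1)
          (latticeResidue b η ξm τ g h F x₀ r t (-1)) (-t r + η / 2) n) := by
  have h1 := ht.summand_update hb hx₀ 1 n
  simp only [Int.cast_one, mul_one, sub_self, mul_zero, add_zero, Function.update_eq_self] at h1
  have h2 := transport_mulVec_boundaryBethe hb η ξp ξm τ (r := r) (t := t)
    (x := latticePoint τ x₀ n) (fun i j hij => separated_latticePoint hb hx₀ n hij.ne)
    (fun i => by simpa using ht.poleFactor_ne_zero hb 0 n i)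
    (fun s hs => by simpa using (ht.ne_diff s hs 0).1) ht.ne_sum ht.ne_ξm (fun i => by
      constructor
      · rw [← neg_ne_zero, ← b_neg hb]
        have := (ht.ne_sub r i (-n i)).2
        convert this using 2
        simp only [latticePoint]; push_cast; ring
      · rw [← neg_ne_zero, ← b_neg hb]
        have := (ht.ne_add r i (n i)).2
        convert this using 2
        simp only [latticePoint]; ring)
  rw [h1, summand, Matrix.mulVec_smul, h2, ← Matrix.mulVec_smul, ← Matrix.mulVec_smul,
    ← Matrix.mulVec_smul, ← Matrix.mulVec_sub]
  congr 1
  rw [leg1_Kmat_eq, ← sub_eq_of_eq_add (legUnit_add r).symm, Matrix.add_mulVec, Matrix.sub_mulVec,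
    Matrix.one_mulVec, Matrix.smul_mulVec, legUnit_mulVec_siteVec, weight_smul_siteVec,
    weight_smul_siteVec, show t r + τ + η / 2 = t r + η / 2 + τ by ring,
    show ξp - (t r + τ / 2) = ξp - t r - τ / 2 by ring,
    show ξp + (t r + τ / 2) = ξp + t r + τ / 2 by ring]
  module

theorem IsRegularPoint.pairedResidues (hb : IsXXX b ∨ IsXXZ b) (hx₀ : IsGeneric b τ g h x₀)
    (hlat : LatticeEquations b η ξp ξm τ g h x₀) (ht : IsRegularPoint b η ξp ξm τ F x₀ r t)
    (hroot : ∀ k : ℤ, k ≠ 0 → b (k * τ) ≠ 0)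
    (hS : ∀ k : ℤ, Summable fun n : Fin M → ℤ =>
      summand b η ξm τ g h F x₀ n (Function.update t r (t r + τ * k)))
    (hS' : Summable fun n : Fin M → ℤ => ‖(b (ξp - t r - τ / 2) / b (ξp + t r + τ / 2)) •
      cauchySum b τ x₀ (latticeResidue b η ξm τ g h F x₀ r t 1)
        (latticeResidue b η ξm τ g h F x₀ r t (-1)) (-t r + η / 2) n‖) :
    PairedResidues b τ x₀ (latticeResidue b η ξm τ g h F x₀ r t 1)
      (latticeResidue b η ξm τ g h F x₀ r t (-1)) (t r + η / 2) (-t r + η / 2)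
      (b (ξp - t r - τ / 2) / b (ξp + t r + τ / 2)) := by
  have hneg : ∀ i j, i < j → ∀ k : ℤ, b (x₀ j - x₀ i + τ * k) ≠ 0 := fun i j hij k => by
    rw [← neg_ne_zero, ← b_neg hb]
    have := hx₀.ne_zero_sub i j hij (-k)
    convert this using 2
    push_cast; ring
  refine ⟨hroot, fun i j hij k => ?_, fun i j hij k => ?_, fun k => ?_, ?_,
    fun k => ht.summable_cauchySum hb hx₀ (hS k), hS', fun k => ?_, fun i n => ?_⟩
  · rcases lt_or_gt_of_ne hij with h | h
    · exact hx₀.ne_zero_add i j h k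
    · rw [add_comm (x₀ i)]; exact hx₀.ne_zero_add j i h k
  · rcases lt_or_gt_of_ne hij with h | h
    · exact hx₀.ne_zero_sub i j h k
    · exact hneg j i h k
  · obtain ⟨c, hc, hlow⟩ := ht.lower
    refine ⟨c, hc, fun i m => ⟨?_, ?_⟩⟩
    · convert (hlow i (k + m)).1.1 using 3; push_cast; ring
    · convert (hlow i (k - m)).2.1 using 3; push_cast; ring
  · obtain ⟨c, hc, hlow⟩ := ht.lower
    refine ⟨c, hc, fun i m => ⟨?_, ?_⟩⟩
    · rw [← norm_b_neg hb]
      convert (hlow i (-m)).2.2 using 3; push_cast; ring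
    · rw [← norm_b_neg hb]
      convert (hlow i m).1.2 using 3; ring
  · have := ht.ne_double k
    convert this using 2; ring
  · have key := weight_residueTerm_shift hb (η := η) (ξp := ξp) (ξm := ξm) (τ := τ) (g := g) (h := h)
      (F := F) (r := r) (t := t) (x := latticePoint τ x₀ n) (i := i)
      (by
        have := hlat.g_eq i (n i)
        simpa only [latticePoint] using this)
      (fun k hk => by
        have hne : i ≠ k := hk.elim ne_of_lt ne_of_gt
        refine ⟨separated_latticePoint hb hx₀ n hne, ?_, ?_⟩
        · have := separated_latticePoint hb hx₀ (n + Pi.single i 1) hne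
          rwa [latticePoint_add_single_eq_update, Function.update_self,
            Function.update_of_ne hne.symm] at this
        · rcases hk with hk | hk
          · have := hlat.h_add i k hk (n i + n k)
            rwa [show x₀ i + x₀ k + τ * ((n i + n k : ℤ) : ℂ) =
              latticePoint τ x₀ n i + latticePoint τ x₀ n k by
                simp only [latticePoint]; push_cast; ring] at this
          · have := hlat.h_add k i hk (n i + n k)
            rwa [show x₀ k + x₀ i + τ * ((n i + n k : ℤ) : ℂ) =
              latticePoint τ x₀ n i + latticePoint τ x₀ n k by
                simp only [latticePoint]; push_cast; ring] at this)
      (fun k hk => by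
        have := hlat.h_sub i k hk (n i - n k)
        rwa [show x₀ i - x₀ k + τ * ((n i - n k : ℤ) : ℂ) =
          latticePoint τ x₀ n i - latticePoint τ x₀ n k by
            simp only [latticePoint]; push_cast; ring] at this)
      (fun k hk => by
        have := hlat.h_sub k i hk (n k - n i - 1)
        rwa [show x₀ k - x₀ i + τ * ((n k - n i - 1 : ℤ) : ℂ) =
          latticePoint τ x₀ n k - latticePoint τ x₀ n i - τ by
            simp only [latticePoint]; push_cast; ring, sub_add_cancel] at this)
      (fun s => by
        refine ⟨?_, ?_, ?_, ?_⟩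
        · have := (ht.ne_add s i (n i + 1)).1
          convert this using 2; simp only [latticePoint]; push_cast; ring
        · have := (ht.ne_sub s i (-n i)).2
          convert this using 2; simp only [latticePoint]; push_cast; ring
        · have := ht.F_add s i (n i)
          rwa [show t s + x₀ i + τ * (n i : ℂ) = t s + latticePoint τ x₀ n i by
            simp only [latticePoint]; ring] at this
        · have := ht.F_sub s i (-n i - 1)
          rwa [show t s - x₀ i + τ * ((-n i - 1 : ℤ) : ℂ) = t s - latticePoint τ x₀ n i - τ by
            simp only [latticePoint]; push_cast; ring, sub_add_cancel] at this)
      (by simpa using ht.poleFactor_ne_zero hb 0 n i)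
      (by
        have := ht.poleFactor_ne_zero hb 0 (n + Pi.single i 1) i
        rwa [latticePoint_add_single, Int.cast_zero, mul_zero, add_zero,
          Function.update_eq_self] at this)
      ht.ne_ξp
      (by
        have := (ht.ne_sub r i (-n i)).1
        convert this using 2; simp only [latticePoint]; push_cast; ring)
    rw [← latticePoint_add_single_eq_update, kernelW, kernelW] at key
    rw [latticeResidue, latticeResidue, latticePoint_add_single, one_mul, one_mul, neg_one_mul,
      neg_one_mul, show t r + η / 2 + τ = t r + τ + η / 2 by ring]
    linear_combination (norm := module) -key

/-- The boundary qKZ equation at a regular point. -/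
theorem IsRegularPoint.tsum_summand (hb : IsXXX b ∨ IsXXZ b) (hτ : τ ≠ 0)
    (hx₀ : IsGeneric b τ g h x₀) (hlat : LatticeEquations b η ξp ξm τ g h x₀)
    (ht : IsRegularPoint b η ξp ξm τ F x₀ r t)
    (hroot : M = 0 ∨ ∀ k : ℤ, k ≠ 0 → b (k * τ) ≠ 0)
    (hS : ∀ k : ℤ, Summable fun n : Fin M → ℤ =>
      summand b η ξm τ g h F x₀ n (Function.update t r (t r + τ * k))) :
    ∑' n : Fin M → ℤ, summand b η ξm τ g h F x₀ n (Function.update t r (t r + τ)) =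
      transport b η ξp ξm τ r t *ᵥ ∑' n : Fin M → ℤ, summand b η ξm τ g h F x₀ n t := by
  have hS0 : Summable fun n : Fin M → ℤ => summand b η ξm τ g h F x₀ n t := by
    simpa using hS 0
  have hS1 : Summable fun n : Fin M → ℤ =>
      summand b η ξm τ g h F x₀ n (Function.update t r (t r + τ)) := by
    simpa using hS 1
  set Y := cauchySum b τ x₀ (latticeResidue b η ξm τ g h F x₀ r t 1)
    (latticeResidue b η ξm τ g h F x₀ r t (-1)) with hY
  set κ := b (ξp - t r - τ / 2) / b (ξp + t r + τ / 2) with hκ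
  set E : (Fin M → ℤ) → (Fin N → Fin 2) → ℂ := fun n =>
    Y (t r + η / 2 + τ) n - κ • Y (-t r + η / 2) n with hE
  have hdiff : ∀ n : Fin M → ℤ, transport b η ξp ξm τ r t *ᵥ summand b η ξm τ g h F x₀ n t -
      summand b η ξm τ g h F x₀ n (Function.update t r (t r + τ)) =
      moveOut b η r t (t r + τ) *ᵥ E n := fun n => ht.transport_sub hb hx₀ n
  have hT := (summable_mulVec (transport b η ξp ξm τ r t) hS0).sub hS1
  simp only [hdiff] at hT
  obtain ⟨D, hD⟩ := exists_moveOut_inv hb (η := η) (r := r) (t := t) (z := t r + τ)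
    fun s hs => by
      have := ht.ne_diff s hs 1
      rwa [Int.cast_one, mul_one, show t r - t s + η + τ = t r + τ - t s + η by ring,
        show t r - t s - η + τ = t r + τ - t s - η by ring] at this
  have hSE : Summable E := by
    have := summable_mulVec D hT
    simpa only [Matrix.mulVec_mulVec, hD, Matrix.one_mulVec] using this
  have hSY : Summable fun n : Fin M → ℤ => Y (t r + η / 2 + τ) n := by
    have := (ht.summable_cauchySum hb hx₀ (hS 1)).of_norm
    simpa using this
  have hSY' : Summable fun n : Fin M → ℤ => ‖κ • Y (-t r + η / 2) n‖ := by
    have := (hSY.sub hSE).norm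
    simpa [hE] using this
  have hzero : ∑' n : Fin M → ℤ, E n = 0 := by
    rcases hroot with rfl | hroot
    · simp [hE, hY, cauchySum]
    · exact (ht.pairedResidues hb hx₀ hlat hroot hS hSY').tsum_eq_zero hb hτ
  have h1 : ∑' n : Fin M → ℤ, (transport b η ξp ξm τ r t *ᵥ summand b η ξm τ g h F x₀ n t -
      summand b η ξm τ g h F x₀ n (Function.update t r (t r + τ))) = 0 := by
    simp only [hdiff]
    rw [tsum_mulVec _ hSE, hzero, Matrix.mulVec_zero]
  rw [(summable_mulVec _ hS0).tsum_sub hS1, tsum_mulVec _ hS0, sub_eq_zero] at h1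
  exact h1.symm

end Pointwise

/-! ### Holomorphic functions of several variables, thin sets and residual sets -/

section SeveralVariables

theorem frequently_nhds_of_residual {X : Type*} [TopologicalSpace X] [BaireSpace X] {P : X → Prop}
    (h : ∀ᶠ s in residual X, P s) (t : X) : ∃ᶠ s in 𝓝 t, P s :=
  mem_closure_iff_frequently.1 (dense_of_mem_residual h t)

variable {E V ι : Type*} [NormedAddCommGroup E] [NormedSpace ℂ E]
  [NormedAddCommGroup V] [NormedSpace ℂ V]

/-- The identity theorem on a ball, applied along complex lines. -/
theorem eq_zero_of_eventually_eq_zero {u : E → ℂ} {t : E} {ρ : ℝ}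
    (hu : DifferentiableOn ℂ u (Metric.ball t ρ)) {p q : E} (hp : p ∈ Metric.ball t ρ)
    (hq : q ∈ Metric.ball t ρ) (h : ∀ᶠ s in 𝓝 p, u s = 0) : u q = 0 := by
  set L : ℂ → E := fun z => p + z • (q - p) with hL
  have hLd : Differentiable ℂ L := (differentiable_id.smul_const _).const_add _
  have hconv : Convex ℝ (L ⁻¹' Metric.ball t ρ) := by
    intro z hz w hw a c ha hc hac
    have e : L (a • z + c • w) = a • L z + c • L w := by
      obtain rfl : c = 1 - a := by linarith
      simp only [hL, ← Complex.coe_smul, smul_eq_mul, Complex.ofReal_sub, Complex.ofReal_one]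
      module
    rw [Set.mem_preimage, e]
    exact convex_ball t ρ hz hw ha hc hac
  have hopen : IsOpen (L ⁻¹' Metric.ball t ρ) := Metric.isOpen_ball.preimage hLd.continuous
  have hd : DifferentiableOn ℂ (u ∘ L) (L ⁻¹' Metric.ball t ρ) :=
    hu.comp hLd.differentiableOn fun z hz => hz
  have h0 : (0 : ℂ) ∈ L ⁻¹' Metric.ball t ρ := by simpa [hL] using hp
  have h1 : (1 : ℂ) ∈ L ⁻¹' Metric.ball t ρ := by simpa [hL] using hq
  have hz : ∀ᶠ z in 𝓝 (0 : ℂ), (u ∘ L) z = 0 := by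
    have : Tendsto L (𝓝 0) (𝓝 p) := by simpa [hL] using hLd.continuous.tendsto 0
    exact this.eventually h
  have := (hd.analyticOnNhd hopen).eqOn_zero_of_preconnected_of_eventuallyEq_zero
    hconv.isPreconnected h0 hz h1
  simpa [hL] using this

/-- Near `t` the zero set of a nonzero germ is closed and nowhere dense. -/
theorem IsNonzeroGerm.exists_isOpen {u : E → ℂ} {t : E} (hu : IsNonzeroGerm u t) :
    ∃ W, IsOpen W ∧ t ∈ W ∧ ContinuousOn u W ∧ (∀ᶠ s in residual E, s ∈ W → u s ≠ 0) := by
  obtain ⟨ρ, hρ, hd⟩ := Metric.eventually_nhds_iff_ball.1 hu.1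
  have hd' : DifferentiableOn ℂ u (Metric.ball t ρ) := fun s hs => (hd s hs).differentiableWithinAt
  refine ⟨Metric.ball t ρ, Metric.isOpen_ball, Metric.mem_ball_self hρ, hd'.continuousOn, ?_⟩
  obtain ⟨q, hq0, hq⟩ := (hu.2.and_eventually (Metric.ball_mem_nhds t hρ)).exists
  have ho : IsOpen (Metric.ball t ρ ∩ u ⁻¹' {0}ᶜ) :=
    hd'.continuousOn.isOpen_inter_preimage Metric.isOpen_ball isOpen_compl_singleton
  refine mem_of_superset (residual_of_dense_open
    (s := (Metric.ball t ρ ∩ u ⁻¹' {0}ᶜ) ∪ (closure (Metric.ball t ρ))ᶜ)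
    (ho.union isClosed_closure.isOpen_compl) fun x => ?_) fun s hs hsW => ?_
  · by_cases hx : x ∈ closure (Metric.ball t ρ)
    · refine closure_mono Set.subset_union_left ?_
      rw [mem_closure_iff]
      intro O hO hxO
      obtain ⟨p, hpO, hp⟩ := mem_closure_iff.1 hx O hO hxO
      by_contra hne
      refine hq0 (eq_zero_of_eventually_eq_zero hd' hp hq ?_)
      filter_upwards [hO.mem_nhds hpO, Metric.isOpen_ball.mem_nhds hp] with s hs1 hs2
      by_contra h0
      exact hne ⟨s, hs1, hs2, h0⟩
    · exact subset_closure (Or.inr hx)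
  · rcases hs with hs | hs
    · exact hs.2
    · exact absurd (subset_closure hsW) hs

theorem IsNonzeroGerm.mul [CompleteSpace E] {u v : E → ℂ} {t : E} (hu : IsNonzeroGerm u t)
    (hv : IsNonzeroGerm v t) : IsNonzeroGerm (fun s => u s * v s) t := by
  refine ⟨hu.1.mp (hv.1.mono fun s h1 h2 => h2.mul h1), ?_⟩
  obtain ⟨W, hW, htW, -, hr⟩ := hu.exists_isOpen
  obtain ⟨W', hW', htW', -, hr'⟩ := hv.exists_isOpen
  refine ((frequently_nhds_of_residual (hr.and hr') t).and_eventually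
    (inter_mem (hW.mem_nhds htW) (hW'.mem_nhds htW'))).mono fun s hs => ?_
  exact mul_ne_zero (hs.1.1 hs.2.1) (hs.1.2 hs.2.2)

theorem IsNonzeroGerm.comp_add {u : E → ℂ} {t a : E} (hu : IsNonzeroGerm u (t + a)) :
    IsNonzeroGerm (fun s => u (s + a)) t := by
  have hm : map (fun s => s + a) (𝓝 t) = 𝓝 (t + a) := (Homeomorph.addRight a).map_nhds_eq t
  obtain ⟨h1, h2⟩ := hu
  rw [← hm] at h1 h2
  refine ⟨(eventually_map.1 h1).mono fun s hs => ?_, frequently_map.1 h2⟩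
  exact hs.comp s (differentiableAt_id.add_const a)

/-- Functions that agree outside a thin set agree on a residual set. -/
theorem EqOffThin.eventually_residual [SecondCountableTopology E] {V : Type*} {U : Set E}
    {f g : E → V}
    (h : EqOffThin U f g) : ∀ᶠ s in residual E, s ∈ U → f s = g s := by
  have key : ∀ t ∈ U, ∃ W ∈ 𝓝 t, ∀ᶠ s in residual E, s ∈ W → f s = g s := fun t ht => by
    obtain ⟨u, hu, hfg⟩ := h t ht
    obtain ⟨W, hW, htW, -, hr⟩ := hu.exists_isOpen
    refine ⟨W ∩ {s | u s ≠ 0 → f s = g s}, inter_mem (hW.mem_nhds htW) hfg, ?_⟩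
    filter_upwards [hr] with s hs hsW using hsW.2 (hs hsW.1)
  choose! W hW hr using key
  obtain ⟨T, hTU, hT, hcov⟩ := TopologicalSpace.countable_cover_nhdsWithin (s := U) (f := W)
    fun x hx => mem_nhdsWithin_of_mem_nhds (hW x hx)
  have := (eventually_countable_ball hT).2 fun x hx => hr x (hTU hx)
  filter_upwards [this] with s hs hsU
  obtain ⟨x, hx, hsx⟩ := Set.mem_iUnion₂.1 (hcov hsU)
  exact hs x hx hsx

/-- Meromorphic functions that agree on a residual set agree outside a thin set. -/
theorem IsMeromorphic.eqOffThin [CompleteSpace E] {f g : E → V} (hf : IsMeromorphic f)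
    (hg : IsMeromorphic g) (h : ∀ᶠ s in residual E, f s = g s) : EqOffThin Set.univ f g := by
  intro t _
  obtain ⟨v, φ, hv, hφ, hvf⟩ := hf t
  obtain ⟨w, ψ, hw, hψ, hwg⟩ := hg t
  obtain ⟨A, hA, htA, hcv, hrv⟩ := hv.exists_isOpen
  obtain ⟨B, hB, htB, hcw, hrw⟩ := hw.exists_isOpen
  obtain ⟨O, hO, hOo, htO⟩ := eventually_nhds_iff.1 (hφ.and (hψ.and (hvf.and hwg)))
  set W := A ∩ B ∩ O
  have hW : IsOpen W := (hA.inter hB).inter hOo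
  have hc : ContinuousOn (fun s => w s • φ s - v s • ψ s) W :=
    ((hcw.mono fun s hs => hs.1.2).smul fun s hs =>
      (hO s hs.2).1.continuousAt.continuousWithinAt).sub
    ((hcv.mono fun s hs => hs.1.1).smul fun s hs =>
      (hO s hs.2).2.1.continuousAt.continuousWithinAt)
  have hzero : ∀ s ∈ W, w s • φ s - v s • ψ s = 0 := by
    intro s hs
    by_contra hne
    have hopen := hc.isOpen_inter_preimage hW (isOpen_compl_singleton (x := (0 : V)))
    obtain ⟨q, ⟨h1, h2, h3⟩, hqW, hq⟩ := ((frequently_nhds_of_residual (h.and (hrv.and hrw))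
      s).and_eventually (hopen.mem_nhds ⟨hs, hne⟩)).exists
    refine hq ?_
    change w q • φ q - v q • ψ q = 0
    rw [← (hO q hqW.2).2.2.1 (h2 hqW.1.1),
      ← (hO q hqW.2).2.2.2 (h3 hqW.1.2), h1, smul_comm, sub_self]
  refine ⟨_, hv.mul hw, ?_⟩
  filter_upwards [hW.mem_nhds ⟨⟨htA, htB⟩, htO⟩] with s hs hne
  obtain ⟨hv0, hw0⟩ := mul_ne_zero_iff.1 hne
  have e := hzero s hs
  rw [← (hO s hs.2).2.2.1 hv0, ← (hO s hs.2).2.2.2 hw0, smul_comm, ← smul_sub, ← smul_sub,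
    smul_eq_zero, smul_eq_zero] at e
  exact sub_eq_zero.1 ((e.resolve_left hv0).resolve_left hw0)

theorem IsMeromorphic.comp_add {f : E → V} (hf : IsMeromorphic f) (a : E) :
    IsMeromorphic fun s => f (s + a) := by
  intro t
  obtain ⟨v, φ, hv, hφ, hvf⟩ := hf (t + a)
  have hm : map (fun s => s + a) (𝓝 t) = 𝓝 (t + a) := (Homeomorph.addRight a).map_nhds_eq t
  rw [← hm] at hφ hvf
  refine ⟨fun s => v (s + a), fun s => φ (s + a), hv.comp_add, ?_, eventually_map.1 hvf⟩
  exact (eventually_map.1 hφ).mono fun s hs => hs.comp s (differentiableAt_id.add_const a)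

/-- A uniform limit of holomorphic functions of several variables is holomorphic, since by the
Schwarz lemma the derivatives converge uniformly on smaller balls. -/
theorem differentiableOn_of_tendstoUniformlyOn [CompleteSpace V] {l : Filter ι} [NeBot l]
    {G : ι → E → V} {G₀ : E → V} {U : Set E} (hU : IsOpen U)
    (hG : ∀ i, DifferentiableOn ℂ (G i) U) (h : TendstoUniformlyOn G G₀ l U) :
    DifferentiableOn ℂ G₀ U := by
  intro t ht
  obtain ⟨ρ, hρ, hρU⟩ := Metric.isOpen_iff.1 hU t ht
  have hsub : ∀ s ∈ Metric.ball t (ρ / 2), Metric.ball s (ρ / 2) ⊆ U := fun s hs =>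
    (Metric.ball_subset_ball' (by have := Metric.mem_ball.1 hs; linarith)).trans hρU
  have hat : ∀ i, ∀ s ∈ U, DifferentiableAt ℂ (G i) s := fun i s hs =>
    (hG i s hs).differentiableAt (hU.mem_nhds hs)
  have hmem : ∀ s ∈ Metric.ball t (ρ / 2), s ∈ U := fun s hs =>
    hsub s hs (Metric.mem_ball_self (half_pos hρ))
  have hC : UniformCauchySeqOn (fun i s => fderiv ℂ (G i) s) l (Metric.ball t (ρ / 2)) := by
    have h1 := h.uniformCauchySeqOn
    rw [SeminormedAddGroup.uniformCauchySeqOn_iff_tendstoUniformlyOn_zero,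
      Metric.tendstoUniformlyOn_iff] at h1 ⊢
    intro ε hε
    filter_upwards [h1 (ε * ρ / 8) (by positivity)] with ij hij s hs
    have hd : DifferentiableOn ℂ (fun q => G ij.2 q - G ij.1 q) (Metric.ball s (ρ / 2)) :=
      ((hG _).sub (hG _)).mono (hsub s hs)
    have hb := Complex.norm_fderiv_le_div_of_mapsTo_ball hd (R₂ := ε * ρ / 4) (fun q hq => by
      have e1 := hij q (hsub s hs hq)
      have e2 := hij s (hmem s hs)
      rw [Pi.zero_apply, dist_zero_left, neg_add_eq_sub] at e1 e2
      rw [Metric.mem_closedBall, dist_eq_norm]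
      exact (norm_sub_le _ _).trans (by linarith)) (half_pos hρ)
    rw [Pi.zero_apply, dist_zero_left, neg_add_eq_sub,
      ← fderiv_fun_sub (hat _ s (hmem s hs)) (hat _ s (hmem s hs))]
    refine hb.trans_lt ?_
    rw [div_lt_iff₀ (half_pos hρ)]
    nlinarith [mul_pos hε hρ]
  choose! G' hG' using fun s (hs : s ∈ Metric.ball t (ρ / 2)) =>
    cauchy_iff_exists_le_nhds.1 (hC.cauchy_map hs)
  have hlim := hC.tendstoUniformlyOn_of_tendsto (f := G') fun s hs => hG' s hs
  exact (hasFDerivAt_of_tendstoUniformlyOn Metric.isOpen_ball hlim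
    (fun i s hs => (hat i s (hmem s hs)).hasFDerivAt)
    (fun s hs => h.tendsto_at (hmem s hs))
    (Metric.mem_ball_self (half_pos hρ))).differentiableAt.differentiableWithinAt

end SeveralVariables

/-! ### Mero-uniformly convergent sums -/

section MeroSum

variable {E V ι : Type*} [NormedAddCommGroup E] [NormedSpace ℂ E]
  [NormedAddCommGroup V] [NormedSpace ℂ V]
  {w : ι → E → V} {U : Set E} {v : E → ℂ} {φ : ι → E → V}

theorem IsMeroUniformChart.isNonzeroGerm (h : IsMeroUniformChart w U v φ) {t : E} (ht : t ∈ U) : IsNonzeroGerm v t :=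
  ⟨by filter_upwards [h.isOpen.mem_nhds ht] with s hs
      using (h.holomorphic_mul s hs).differentiableAt (h.isOpen.mem_nhds hs), h.nonzero t ht⟩

theorem IsMeroUniformChart.eventually_ne_zero [SecondCountableTopology E]
    (h : IsMeroUniformChart w U v φ) :
    ∀ᶠ s in residual E, s ∈ U → v s ≠ 0 := by
  choose! W hW htW _ hr using fun t (ht : t ∈ U) => (h.isNonzeroGerm ht).exists_isOpen
  obtain ⟨T, hTU, hT, hcov⟩ := TopologicalSpace.countable_cover_nhdsWithin (s := U) (f := W)
    fun x hx => mem_nhdsWithin_of_mem_nhds ((hW x hx).mem_nhds (htW x hx))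
  have := (eventually_countable_ball hT).2 fun x hx => hr x (hTU hx)
  filter_upwards [this] with s hs hsU
  obtain ⟨x, hx, hsx⟩ := Set.mem_iUnion₂.1 (hcov hsU)
  exact hs x hx hsx

theorem IsMeroUniformChart.eventually_eq [SecondCountableTopology E] [Countable ι]
    (h : IsMeroUniformChart w U v φ) :
    ∀ᶠ s in residual E, s ∈ U → ∀ x, v s • w x s = φ x s := by
  filter_upwards [eventually_countable_forall.2 fun x => (h.eq x).eventually_residual] with s hs hsU x
    using hs x hsU

theorem IsMeroUniformChart.differentiableOn_tsum [CompleteSpace V]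
    (h : IsMeroUniformChart w U v φ) : DifferentiableOn ℂ (fun s => ∑' x, φ x s) U :=
  differentiableOn_of_tendstoUniformlyOn h.isOpen
    (fun _ => DifferentiableOn.fun_sum fun x _ => h.holomorphic x)
    h.uniformly.hasSumUniformlyOn.tendstoUniformlyOn

/-- A mero-uniformly convergent sum converges absolutely on a residual set, to its sum. -/
theorem HasMeroSum.eventually_residual [SecondCountableTopology E] [CompleteSpace V]
    [Countable ι] {f : E → V}
    (h : HasMeroSum w f) :
    ∀ᶠ s in residual E, (Summable fun x => ‖w x s‖) ∧ f s = ∑' x, w x s := by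
  choose U v φ hU hc hf using h
  obtain ⟨T, hT, hcov⟩ := TopologicalSpace.countable_cover_nhds (f := U)
    fun x => (hc x).isOpen.mem_nhds (hU x)
  have := (eventually_countable_ball hT).2 fun x _ =>
    (hc x).eventually_ne_zero.and ((hc x).eventually_eq.and (hf x).eventually_residual)
  filter_upwards [this] with s hs
  obtain ⟨x, hx, hsx⟩ := Set.mem_iUnion₂.1 (hcov.symm ▸ Set.mem_univ s : s ∈ ⋃ x ∈ T, U x)
  obtain ⟨h1, h2, h3⟩ := hs x hx
  have hv := h1 hsx
  have hw : ∀ n, w n s = (v x s)⁻¹ • φ x n s := fun n => by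
    rw [← h2 hsx n, smul_smul, inv_mul_cancel₀ hv, one_smul]
  have hS := (hc x).absolutely s hsx
  constructor
  · simp only [hw, norm_smul]
    exact hS.mul_left _
  · simp only [hw]
    rw [hS.of_norm.tsum_const_smul, ← h3 hsx, smul_smul, inv_mul_cancel₀ hv, one_smul]

theorem HasMeroSum.isMeromorphic [CompleteSpace E] [CompleteSpace V] {f : E → V} (h : HasMeroSum w f) :
    IsMeromorphic f := by
  intro t
  obtain ⟨U, v, φ, ht, hc, hf⟩ := h t
  obtain ⟨u, hu, huf⟩ := hf t ht
  refine ⟨_, fun s => u s • ∑' x, φ x s, hu.mul (hc.isNonzeroGerm ht), ?_, ?_⟩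
  · filter_upwards [hu.1, hc.isOpen.mem_nhds ht] with s h1 h2
    exact h1.smul ((hc.differentiableOn_tsum s h2).differentiableAt (hc.isOpen.mem_nhds h2))
  · filter_upwards [huf] with s hs h0
    rw [mul_smul, hs (left_ne_zero_of_mul h0)]

/-- A mero-uniformly convergent sum has a sum: off the zeros of the local denominators it is the
pointwise sum of the series. -/
theorem MeroUniformlySummable.exists_hasMeroSum [CompleteSpace E] [SecondCountableTopology E]
    [CompleteSpace V] [Countable ι] (h : MeroUniformlySummable w) :
    ∃ f, HasMeroSum w f := by
  choose U v φ hU hc using h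
  classical
  refine ⟨fun s => if hs : ∃ x, s ∈ U x ∧ v x s ≠ 0 then
    (v hs.choose s)⁻¹ • ∑' n, φ hs.choose n s else 0, fun t₀ => ⟨U t₀, v t₀, φ t₀, hU t₀, hc t₀,
      fun t ht => ⟨v t₀, (hc t₀).isNonzeroGerm ht, ?_⟩⟩⟩
  filter_upwards [(hc t₀).isOpen.mem_nhds ht] with s hs hv
  have hex : ∃ x, s ∈ U x ∧ v x s ≠ 0 := ⟨t₀, hs, hv⟩
  rw [dif_pos hex]
  obtain ⟨hy, hvy⟩ := hex.choose_spec
  set y := hex.choose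
  -- the two charts agree on the overlap, by continuity
  have key : ∀ n, v y s • φ t₀ n s = v t₀ s • φ y n s := fun n => by
    have hO : IsOpen (U t₀ ∩ U y) := (hc t₀).isOpen.inter (hc y).isOpen
    have hcont : ContinuousOn (fun s => v y s • φ t₀ n s - v t₀ s • φ y n s) (U t₀ ∩ U y) :=
      (((hc y).holomorphic_mul.continuousOn.mono fun _ h => h.2).smul
        (((hc t₀).holomorphic n).continuousOn.mono fun _ h => h.1)).sub
      (((hc t₀).holomorphic_mul.continuousOn.mono fun _ h => h.1).smul
        (((hc y).holomorphic n).continuousOn.mono fun _ h => h.2))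
    by_contra hne
    have hopen := hcont.isOpen_inter_preimage hO (isOpen_compl_singleton (x := (0 : V)))
    obtain ⟨q, ⟨h1, h2⟩, hq, hq0⟩ := ((frequently_nhds_of_residual
      ((hc t₀).eventually_eq.and (hc y).eventually_eq) s).and_eventually
      (hopen.mem_nhds ⟨⟨hs, hy⟩, sub_ne_zero.2 hne⟩)).exists
    refine hq0 ?_
    change v y q • φ t₀ n q - v t₀ q • φ y n q = 0
    rw [← h1 hq.1, ← h2 hq.2, smul_comm, sub_self]
  have e : ∀ n, φ t₀ n s = (v t₀ s * (v y s)⁻¹) • φ y n s := fun n => by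
    rw [mul_comm, mul_smul, ← key, smul_smul, inv_mul_cancel₀ hvy, one_smul]
  simp only [e]
  rw [((hc y).absolutely s hy).of_norm.tsum_const_smul, mul_smul]

end MeroSum

/-! ### Generic inhomogeneities -/

section Generic

variable {b : ℂ → ℂ} {N M : ℕ} {τ η ξp ξm : ℂ} {g h F : ℂ → ℂ} {x₀ : Fin M → ℂ} {r : Fin N}

theorem eventually_residual_of_codiscrete {P : ℂ → Prop} (h : ∀ᶠ x in codiscrete ℂ, P x) :
    ∀ᶠ x in residual ℂ, P x := by
  have h' := eventually_codiscrete_iff.1 h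
  refine mem_of_superset (residual_of_dense_open (mem_codiscrete'.1 h).1 fun x => ?_)
    (Set.Subset.refl {x | P x})
  rw [mem_closure_iff_frequently]
  exact ((h' x).frequently).filter_mono nhdsWithin_le_nhds

/-- A generic condition on one complex variable is generic for a nonzero linear form. -/
theorem eventually_residual_linear {P : ℂ → Prop} (h : ∀ᶠ x in residual ℂ, P x)
    (L : (Fin N → ℂ) →L[ℂ] ℂ) (hL : L (Pi.single r 1) ≠ 0) (c : ℂ) :
    ∀ᶠ t in residual (Fin N → ℂ), P (L t + c) := by
  have hs : Function.Surjective L := fun z =>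
    ⟨(z / L (Pi.single r 1)) • Pi.single r 1, by rw [map_smul, smul_eq_mul, div_mul_cancel₀ _ hL]⟩
  have ho : IsOpenMap fun t => L t + c := (Homeomorph.addRight c).isOpenMap.comp (L.isOpenMap hs)
  exact (tendsto_residual_of_isOpenMap (L.continuous.add continuous_const) ho).eventually h

theorem eventually_residual_add {P : (Fin N → ℂ) → Prop} (h : ∀ᶠ t in residual (Fin N → ℂ), P t)
    (a : Fin N → ℂ) : ∀ᶠ t in residual (Fin N → ℂ), P (t + a) :=
  (tendsto_residual_of_isOpenMap (Homeomorph.addRight a).continuous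
    (Homeomorph.addRight a).isOpenMap).eventually h

theorem eventually_residual_b_ne_zero (hb : IsXXX b ∨ IsXXZ b) :
    ∀ᶠ y in residual ℂ, b y ≠ 0 := by
  simpa using eventually_residual_of_codiscrete (codiscrete_b_ne_zero hb one_ne_zero 0)

theorem eventually_residual_lower (hb : IsXXX b ∨ IsXXZ b) (hτ : τ ≠ 0) :
    ∀ᶠ y in residual ℂ, ∃ c > 0, ∀ m : ℤ, c ≤ ‖b (y + τ * m)‖ := by
  have hne : ∀ᶠ y in residual ℂ, ∀ m : ℤ, b (y + τ * m) ≠ 0 :=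
    eventually_countable_forall.2 fun m => by
      simpa using eventually_residual_of_codiscrete (codiscrete_b_ne_zero hb one_ne_zero (τ * m))
  rcases hb with ⟨c, hc, h⟩ | ⟨c, ν, hc, hν, h⟩
  · exact hne.mono fun y hy => (isExpanding_rational hτ hc h).exists_lower hy
  · rcases lt_trichotomy (ν * τ).re 0 with h0 | h0 | h0
    · refine hne.mono fun y hy => (isExpanding_hyperbolic (neg_ne_zero.2 hc) (neg_ne_zero.2 hν)
        (fun x => ?_) (by simpa using h0)).exists_lower hy
      rw [h, neg_mul, neg_mul, Complex.sinh_neg]; ring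
    · have hre : ∀ᶠ y in residual ℂ, (ν * y).re ≠ 0 :=
        (tendsto_residual_of_isOpenMap (Complex.continuous_re.comp (continuous_const_mul ν))
          (Complex.isOpenMap_re.comp (Homeomorph.mulLeft₀ ν hν).isOpenMap)).eventually
          (residual_of_dense_open isOpen_compl_singleton (dense_compl_singleton (0 : ℝ)))
      refine hre.mono fun y hy => ⟨‖c‖ * |(ν * y).re|, by positivity, fun m => ?_⟩
      rw [h, norm_mul]
      refine mul_le_mul_of_nonneg_left ?_ (norm_nonneg c)
      have e : (ν * (y + τ * m)).re = (ν * y).re := by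
        rw [mul_add, ← mul_assoc, Complex.add_re, mul_comm (ν * τ), ← Complex.ofReal_intCast,
          Complex.re_ofReal_mul, h0, mul_zero, add_zero]
      rw [← e]
      exact abs_re_le_norm_sinh _
    · exact hne.mono fun y hy => (isExpanding_hyperbolic hc hν h h0).exists_lower hy

/-- The exceptional points lie on countably many complex hyperplanes, on which some `b` vanishes or
the functional equation of `F` fails, and on finitely many real hyperplanes, on which `b` may come
arbitrarily close to `0` along the lattice. -/
theorem eventually_isRegularPoint (hb : IsXXX b ∨ IsXXZ b) (hτ : τ ≠ 0)
    (hF_eq : (fun x => F (x + τ)) =ᶠ[codiscrete ℂ] fun x =>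
      b (x + τ - η / 2) / b (x + τ + η / 2) * F x) (x₀ : Fin M → ℂ) (r : Fin N) :
    ∀ᶠ t in residual (Fin N → ℂ), IsRegularPoint b η ξp ξm τ F x₀ r t := by
  have hF : ∀ᶠ y in residual ℂ, F (y + τ) * b (y + τ + η / 2) = b (y + τ - η / 2) * F y := by
    refine eventually_residual_of_codiscrete ?_
    filter_upwards [hF_eq, codiscrete_b_ne_zero hb one_ne_zero (τ + η / 2)] with y h1 h2
    rw [one_mul, ← add_assoc] at h2
    rw [h1, div_mul_eq_mul_div, div_mul_cancel₀ _ h2]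
  have hb0 := eventually_residual_b_ne_zero hb
  have hlo := eventually_residual_lower hb hτ
  have P {Q : ℂ → Prop} (hQ : ∀ᶠ y in residual ℂ, Q y) (s : Fin N) (c : ℂ) :=
    eventually_residual_linear (N := N) (r := s) hQ (ContinuousLinearMap.proj s) (by simp) c
  have Pd {Q : ℂ → Prop} (hQ : ∀ᶠ y in residual ℂ, Q y) (s : Fin N) (hs : s ≠ r) (c : ℂ) :=
    eventually_residual_linear (N := N) (r := r) hQ
      (ContinuousLinearMap.proj (R := ℂ) (φ := fun _ : Fin N => ℂ) r -
        ContinuousLinearMap.proj (R := ℂ) (φ := fun _ : Fin N => ℂ) s) (by simp [hs]) c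
  have Ps {Q : ℂ → Prop} (hQ : ∀ᶠ y in residual ℂ, Q y) (s : Fin N) (hs : s ≠ r) (c : ℂ) :=
    eventually_residual_linear (N := N) (r := r) hQ
      (ContinuousLinearMap.proj (R := ℂ) (φ := fun _ : Fin N => ℂ) s +
        ContinuousLinearMap.proj (R := ℂ) (φ := fun _ : Fin N => ℂ) r) (by simp [hs]) c
  have P2 {Q : ℂ → Prop} (hQ : ∀ᶠ y in residual ℂ, Q y) (c : ℂ) :=
    eventually_residual_linear (N := N) (r := r) hQ
      ((2 : ℂ) • ContinuousLinearMap.proj (R := ℂ) (φ := fun _ : Fin N => ℂ) r) (by simp) c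
  have c1 : ∀ᶠ t in residual (Fin N → ℂ), ∀ s i, ∀ k : ℤ, _ := eventually_countable_forall.2 fun s =>
    eventually_countable_forall.2 fun i : Fin M => eventually_countable_forall.2 fun k : ℤ =>
      (P hF s (x₀ i + τ * k)).and ((P hF s (-x₀ i + τ * k)).and
      (((P hb0 s (x₀ i + η / 2 + τ * k)).and (P hb0 s (x₀ i - η / 2 + τ * k))).and
        ((P hb0 s (-x₀ i + η / 2 + τ * k)).and (P hb0 s (-x₀ i - η / 2 + τ * k)))))
  have c2 : ∀ᶠ t in residual (Fin N → ℂ), ∀ s, ∀ hs : s ≠ r, ∀ k : ℤ, _ :=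
    eventually_countable_forall.2 fun s => eventually_countable_forall.2 fun hs =>
      eventually_countable_forall.2 fun k : ℤ =>
      (Pd hb0 s hs (η + τ * k)).and ((Pd hb0 s hs (-η + τ * k)).and (Ps hb0 s hs η))
  have c3 := eventually_countable_forall.2 fun k : ℤ => P2 hb0 (τ * k)
  have c4 := eventually_countable_forall.2 fun i : Fin M =>
    ((P hlo r (x₀ i + η / 2)).and (P hlo r (x₀ i - η / 2))).and
      ((P hlo r (-x₀ i + η / 2)).and (P hlo r (-x₀ i - η / 2)))
  filter_upwards [c1, c2, c3, c4, P hb0 r ξm, P hb0 r (ξp + τ / 2)] with t h1 h2 h3 h4 h5 h6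
  simp only [ContinuousLinearMap.proj_apply, _root_.sub_apply,
    _root_.add_apply, _root_.smul_apply, smul_eq_mul, ← add_assoc,
    ← add_sub_assoc, ← sub_eq_add_neg] at h1 h2 h3 h4 h5 h6
  refine ⟨fun s i k => (h1 s i k).1, fun s i k => (h1 s i k).2.1, fun s i k => (h1 s i k).2.2.1,
    fun s i k => (h1 s i k).2.2.2, fun s hs k => ⟨(h2 s hs k).1, (h2 s hs k).2.1⟩,
    fun s hs => (h2 s hs 0).2.2, by rwa [add_comm], by rwa [add_comm ξp], h3, ?_⟩
  have low : ∀ y : Fin M → ℂ, (∀ i, ∃ c > 0, ∀ m : ℤ, c ≤ ‖b (y i + τ * m)‖) →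
      ∃ c > 0, ∀ i, ∀ m : ℤ, c ≤ ‖b (y i + τ * m)‖ := fun y hy => exists_uniform_lower hy
  obtain ⟨d1, hd1, l1⟩ := low _ fun i => (h4 i).1.1
  obtain ⟨d2, hd2, l2⟩ := low _ fun i => (h4 i).1.2
  obtain ⟨d3, hd3, l3⟩ := low _ fun i => (h4 i).2.1
  obtain ⟨d4, hd4, l4⟩ := low _ fun i => (h4 i).2.2
  refine ⟨min (min d1 d2) (min d3 d4), by positivity, fun i k => ⟨⟨?_, ?_⟩, ?_, ?_⟩⟩
  · exact ((min_le_left _ _).trans (min_le_left _ _)).trans (l1 i k)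
  · exact ((min_le_left _ _).trans (min_le_right _ _)).trans (l2 i k)
  · exact ((min_le_right _ _).trans (min_le_left _ _)).trans (l3 i k)
  · exact ((min_le_right _ _).trans (min_le_right _ _)).trans (l4 i k)

end Generic

/-! ### Meromorphy of the transport operators -/

section Transport

variable {b : ℂ → ℂ} {N : ℕ} {η ξp ξm τ : ℂ} {E : Type*} [NormedAddCommGroup E] [NormedSpace ℂ E]

/-- Multiplication with the matrix-valued function `A` preserves meromorphic functions. -/
def PreservesMeromorphic {m : Type*} [Fintype m] (A : E → Matrix m m ℂ) : Prop :=
  ∀ f : E → m → ℂ, IsMeromorphic f → IsMeromorphic fun t => A t *ᵥ f t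

theorem PreservesMeromorphic.mul {m : Type*} [Fintype m] {A B : E → Matrix m m ℂ}
    (hA : PreservesMeromorphic A) (hB : PreservesMeromorphic B) :
    PreservesMeromorphic fun t => A t * B t := fun f hf => by
  simpa only [Matrix.mulVec_mulVec] using hA _ (hB f hf)

theorem PreservesMeromorphic.list_prod {m ι : Type*} [Fintype m] [DecidableEq m] {l : List ι}
    {A : ι → E → Matrix m m ℂ} (hA : ∀ s ∈ l, PreservesMeromorphic (A s)) :
    PreservesMeromorphic fun t => (l.map fun s => A s t).prod := by
  induction l with
  | nil => intro f hf; simpa using hf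
  | cons s l ih =>
    simpa only [List.map_cons, List.prod_cons] using
      (hA s (by simp)).mul (ih fun q hq => hA q (by simp [hq]))

/-- The matrix function `A` may be multiplied with meromorphic vectors if `A = d⁻¹ • B` off the zeros
of `d`, with entire `d` and `B`. -/
theorem preservesMeromorphic_of_eq [CompleteSpace E] {m : Type*} [Fintype m] {A B : E → Matrix m m ℂ}
    {d : E → ℂ} (hd : Differentiable ℂ d) (hd0 : ∀ᶠ t in residual E, d t ≠ 0)
    (hB : ∀ i j, Differentiable ℂ fun t => B t i j) (hA : ∀ t, d t ≠ 0 → A t = (d t)⁻¹ • B t) :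
    PreservesMeromorphic A := by
  intro f hf t
  obtain ⟨v, φ, hv, hφ, hvf⟩ := hf t
  have hd' : IsNonzeroGerm d t :=
    ⟨Eventually.of_forall fun s => hd s, frequently_nhds_of_residual hd0 t⟩
  refine ⟨fun s => d s * v s, fun s => B s *ᵥ φ s, hd'.mul hv, ?_, ?_⟩
  · filter_upwards [hφ] with s hs
    rw [differentiableAt_pi] at hs ⊢
    intro i
    simp only [Matrix.mulVec, dotProduct]
    exact DifferentiableAt.fun_sum fun j _ => (hB i j s).mul (hs j)
  · filter_upwards [hvf] with s hs h0
    obtain ⟨h1, h2⟩ := mul_ne_zero_iff.1 h0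
    rw [hA s h1, ← hs h2, Matrix.mulVec_smul, Matrix.smul_mulVec, smul_smul, mul_comm (d s), mul_assoc,
      mul_inv_cancel₀ h1, mul_one]

theorem preservesMeromorphic_leg2 (hb : IsXXX b ∨ IsXXZ b) (q s r : Fin N)
    {L : (Fin N → ℂ) →L[ℂ] ℂ} (hL : L (Pi.single r 1) ≠ 0) (c : ℂ) :
    PreservesMeromorphic fun t : Fin N → ℂ => leg2 q s (Rmat b η (L t + c)) := by
  have hbd := b_differentiable hb
  refine preservesMeromorphic_of_eq (d := fun t => b (L t + c + η))
    (B := fun t => leg2 q s (Rhat b η (L t + c))) (hbd.comp (by fun_prop)) ?_ (fun i j => ?_)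
    fun t _ => by rw [Rmat_eq, leg2_smul]
  · simpa only [← add_assoc] using eventually_residual_linear (eventually_residual_b_ne_zero hb) L hL (c + η)
  · simp only [leg2, Rhat, sixVertex, Matrix.of_apply]
    have h1 : Differentiable ℂ fun t => b (L t + c) := hbd.comp (by fun_prop)
    have h2 : Differentiable ℂ fun t => b (L t + c + η) := hbd.comp (by fun_prop)
    split_ifs <;> first | exact h1 | exact h2 | exact differentiable_const _

theorem preservesMeromorphic_leg1 (hb : IsXXX b ∨ IsXXZ b) (ξ c : ℂ) (r : Fin N) :
    PreservesMeromorphic fun t : Fin N → ℂ => leg1 r (Kmat b ξ (t r + c)) := by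
  have hbd := b_differentiable hb
  refine preservesMeromorphic_of_eq (d := fun t => b (ξ + (t r + c)))
    (B := fun t => leg1 r (Khat b ξ (-(t r + c)))) (hbd.comp (by fun_prop)) ?_ (fun i j => ?_)
    fun t ht => by rw [Kmat_eq ξ _ ht, leg1_smul]
  · have := eventually_residual_linear (N := N) (r := r) (eventually_residual_b_ne_zero hb)
      (ContinuousLinearMap.proj r) (by simp) (ξ + c)
    simpa only [ContinuousLinearMap.proj_apply, add_left_comm] using this
  · simp only [leg1, Khat, Matrix.of_apply, Matrix.diagonal_apply]
    have h1 : Differentiable ℂ fun t : Fin N → ℂ => b (ξ - -(t r + c)) := hbd.comp (by fun_prop)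
    have h2 : Differentiable ℂ fun t : Fin N → ℂ => b (ξ + -(t r + c)) := hbd.comp (by fun_prop)
    split_ifs
    · rcases Fin.exists_fin_two.1 ⟨i r, rfl⟩ with h | h <;> rw [h]
      · exact h1
      · exact h2
    · exact differentiable_const _
    · exact differentiable_const _

theorem preservesMeromorphic_transport (hb : IsXXX b ∨ IsXXZ b) (r : Fin N) :
    PreservesMeromorphic fun t : Fin N → ℂ => transport b η ξp ξm τ r t := by
  have hd : ∀ s, s ≠ r → ∀ c, PreservesMeromorphic fun t : Fin N → ℂ =>
      leg2 r s (Rmat b η (t r - t s + c)) := fun s hs c => by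
    simpa using preservesMeromorphic_leg2 hb (η := η) r s r
      (L := ContinuousLinearMap.proj (R := ℂ) (φ := fun _ : Fin N => ℂ) r -
        ContinuousLinearMap.proj (R := ℂ) (φ := fun _ : Fin N => ℂ) s) (by simp [hs]) c
  have hs : ∀ s, s ≠ r → PreservesMeromorphic fun t : Fin N → ℂ =>
      leg2 s r (Rmat b η (t s + t r)) := fun s hs => by
    simpa using preservesMeromorphic_leg2 hb (η := η) s r r
      (L := ContinuousLinearMap.proj (R := ℂ) (φ := fun _ : Fin N => ℂ) s +
        ContinuousLinearMap.proj (R := ℂ) (φ := fun _ : Fin N => ℂ) r) (by simp [hs]) 0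
  have hm : ∀ s, s ∈ (List.finRange N).filter (fun s => r < s) → s ≠ r := fun s h =>
    (of_decide_eq_true (List.mem_filter.1 h).2).ne'
  have hm' : ∀ s, s ∈ (List.finRange N).filter (fun s => s < r) → s ≠ r := fun s h =>
    (of_decide_eq_true (List.mem_filter.1 h).2).ne
  refine (((((PreservesMeromorphic.list_prod fun s h => hd s (hm s h) τ).mul
    (preservesMeromorphic_leg1 hb ξp (τ / 2) r)).mul
    (PreservesMeromorphic.list_prod fun s h => hs s (hm s (List.mem_reverse.1 h)))).mul
    (PreservesMeromorphic.list_prod fun s h => hs s (hm' s (List.mem_reverse.1 h)))).mul ?_).mul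
    (PreservesMeromorphic.list_prod fun s h => ?_)
  · simpa using preservesMeromorphic_leg1 hb ξm 0 r
  · simpa using hd s (hm' s h) 0

end Transport

/-! ### The boundary qKZ equations for the sum -/

section Main

variable {b : ℂ → ℂ} {N M : ℕ} {η ξp ξm τ : ℂ} {g h F : ℂ → ℂ} {x₀ : Fin M → ℂ}

theorem eq_of_codiscrete {u v : ℂ → ℂ} (h : ∀ᶠ x in codiscrete ℂ, u x = v x) {y : ℂ}
    (hu : ContinuousAt u y) (hv : ContinuousAt v y) : u y = v y :=
  ((hu.eventuallyEq_nhds_iff_eventuallyEq_nhdsNE hv).1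
    (eventually_codiscrete_iff.1 h y)).eq_of_nhds

theorem latticeEquations (hb : IsXXX b ∨ IsXXZ b)
    (hg_eq : (fun x => g (x + τ)) =ᶠ[codiscrete ℂ] fun x =>
      b (ξm - x - η / 2) * b (ξp - x - τ / 2 - η / 2) /
        (b (ξm + x + τ - η / 2) * b (ξp + x + τ / 2 - η / 2)) * g x)
    (hh_eq : (fun x => h (x + τ)) =ᶠ[codiscrete ℂ] fun x =>
      b (x + τ) * b (x + η) / (b x * b (x + τ - η)) * h x)
    (hx₀ : IsGeneric b τ g h x₀) : LatticeEquations b η ξp ξm τ g h x₀ := by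
  have hbc := b_continuous hb
  have hb0 : ∀ c, ∀ᶠ x in codiscrete ℂ, b (x + c) ≠ 0 := fun c => by
    simpa using codiscrete_b_ne_zero hb one_ne_zero c
  have hg : ∀ᶠ x in codiscrete ℂ, g (x + τ) *
      (b (ξm + x + τ - η / 2) * b (ξp + x + τ / 2 - η / 2)) =
      b (ξm - x - η / 2) * b (ξp - x - τ / 2 - η / 2) * g x := by
    filter_upwards [hg_eq, hb0 (ξm + τ - η / 2), hb0 (ξp + τ / 2 - η / 2)] with x h1 h2 h3
    rw [show x + (ξm + τ - η / 2) = ξm + x + τ - η / 2 by ring] at h2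
    rw [show x + (ξp + τ / 2 - η / 2) = ξp + x + τ / 2 - η / 2 by ring] at h3
    rw [h1, div_mul_eq_mul_div, div_mul_cancel₀ _ (mul_ne_zero h2 h3)]
  have hh : ∀ᶠ x in codiscrete ℂ, h (x + τ) * (b x * b (x + τ - η)) =
      b (x + τ) * b (x + η) * h x := by
    filter_upwards [hh_eq, hb0 0, hb0 (τ - η)] with x h1 h2 h3
    rw [add_zero] at h2
    rw [← add_sub_assoc] at h3
    rw [h1, div_mul_eq_mul_div, div_mul_cancel₀ _ (mul_ne_zero h2 h3)]
  have shift : ∀ {u : ℂ → ℂ} {y : ℂ}, (∀ k : ℤ, AnalyticAt ℂ u (y + τ * k)) → ∀ k : ℤ,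
      ContinuousAt u (y + τ * k) ∧ ContinuousAt (fun x => u (x + τ)) (y + τ * k) := fun hu k => by
    refine ⟨(hu k).continuousAt, ?_⟩
    have := (hu (k + 1)).continuousAt
    rw [show ((k + 1 : ℤ) : ℂ) = k + 1 by push_cast; ring, mul_add, mul_one, ← add_assoc] at this
    exact ContinuousAt.comp' this (by fun_prop)
  have hA : ∀ {y : ℂ}, (∀ k : ℤ, AnalyticAt ℂ h (y + τ * k)) → ∀ k : ℤ,
      h (y + τ * k + τ) * (b (y + τ * k) * b (y + τ * k + τ - η)) =
        b (y + τ * k + τ) * b (y + τ * k + η) * h (y + τ * k) := fun hu k => by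
    obtain ⟨c1, c2⟩ := shift hu k
    exact eq_of_codiscrete hh (c2.mul (by fun_prop)) (ContinuousAt.mul (by fun_prop) c1)
  refine ⟨fun i k => ?_, fun i j hij => hA (hx₀.analyticAt_h_add i j hij),
    fun i j hij => hA (hx₀.analyticAt_h_sub i j hij)⟩
  obtain ⟨c1, c2⟩ := shift (hx₀.analyticAt_g i) k
  exact eq_of_codiscrete hg (c2.mul (by fun_prop)) (ContinuousAt.mul (by fun_prop) c1)

/-- The equations hold at generic points. If `b` vanishes at a nonzero multiple of `τ`, both sides
are `0`, as then all summands vanish. -/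
theorem eventually_boundaryQKZ (hb : IsXXX b ∨ IsXXZ b) (hτ : τ ≠ 0) (hF : Meromorphic F)
    (hg_eq : (fun x => g (x + τ)) =ᶠ[codiscrete ℂ] fun x =>
      b (ξm - x - η / 2) * b (ξp - x - τ / 2 - η / 2) /
        (b (ξm + x + τ - η / 2) * b (ξp + x + τ / 2 - η / 2)) * g x)
    (hh_eq : (fun x => h (x + τ)) =ᶠ[codiscrete ℂ] fun x =>
      b (x + τ) * b (x + η) / (b x * b (x + τ - η)) * h x)
    (hF_eq : (fun x => F (x + τ)) =ᶠ[codiscrete ℂ] fun x =>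
      b (x + τ - η / 2) / b (x + τ + η / 2) * F x)
    (hx₀ : IsGeneric b τ g h x₀) {f : (Fin N → ℂ) → (Fin N → Fin 2) → ℂ}
    (hf : HasMeroSum (summand b η ξm τ g h F x₀) f) (r : Fin N) :
    ∀ᶠ t in residual (Fin N → ℂ),
      f (t + Pi.single r τ) = transport b η ξp ξm τ r t *ᵥ f t := by
  have hlat := latticeEquations hb hg_eq hh_eq hx₀
  have hupd : ∀ (t : Fin N → ℂ) a, t + Pi.single r a = Function.update t r (t r + a) := fun t a => by
    ext s
    by_cases hs : s = r
    · subst hs; simp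
    · simp [hs]
  have hS := eventually_countable_forall.2 fun k : ℤ =>
    eventually_residual_add hf.eventually_residual (Pi.single r (τ * k))
  by_cases hroot : M = 0 ∨ ∀ k : ℤ, k ≠ 0 → b (k * τ) ≠ 0
  · filter_upwards [eventually_isRegularPoint (ξp := ξp) (ξm := ξm) hb hτ hF_eq x₀ r, hS] with t ht hSt
    have h0 := (hSt 0).2
    have h1 := (hSt 1).2
    simp only [Int.cast_zero, mul_zero, Pi.single_zero, add_zero, Int.cast_one, mul_one] at h0 h1
    rw [h0, h1, hupd]
    exact ht.tsum_summand hb hτ hx₀ hlat hroot fun k => by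
      rw [← hupd]
      exact (hSt k).1.of_norm
  · push Not at hroot
    obtain ⟨hM, k, hk, hbk⟩ := hroot
    obtain ⟨m, hm, hω⟩ := exists_period hb hτ hk hbk
    have hFa : ∀ᶠ y in codiscrete ℂ, AnalyticAt ℂ F y :=
      eventually_codiscrete_iff.2 fun y => (hF y).eventually_analyticAt
    have hA := eventually_countable_forall.2 fun s : Fin N => eventually_countable_forall.2
      fun i : Fin M => eventually_countable_forall.2 fun k : ℤ =>
      (eventually_residual_linear (N := N) (r := s) (eventually_residual_of_codiscrete hFa)
        (ContinuousLinearMap.proj s) (by simp) (x₀ i + τ * k)).and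
      (eventually_residual_linear (N := N) (r := s) (eventually_residual_of_codiscrete hFa)
        (ContinuousLinearMap.proj s) (by simp) (-(x₀ i + τ * k)))
    have hz : ∀ᶠ t in residual (Fin N → ℂ), f t = 0 := by
      filter_upwards [hA, hf.eventually_residual] with t ht hSt
      rw [hSt.2]
      refine (tsum_congr fun n => ?_).trans tsum_zero
      exact summand_eq_zero_of_period hb hm hω hg_eq hh_eq hF_eq hx₀ ⟨0, Nat.pos_of_ne_zero hM⟩
        (fun s k => ⟨(ht s _ k).1, by simpa only [← sub_eq_add_neg] using (ht s _ k).2⟩) hSt.1 n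
    filter_upwards [hz, eventually_residual_add hz (Pi.single r τ)] with t h0 h1
    rw [h0, h1, Matrix.mulVec_zero]

end Main

end BQKZ

end

theorem theorem3p2 {N M : ℕ} (b : ℂ → ℂ) (hb : BQKZ.IsXXX b ∨ BQKZ.IsXXZ b)
    (η τ ξp ξm : ℂ) (hτ : τ ≠ 0)
    (g h F : ℂ → ℂ) (hg : Meromorphic g) (hh : Meromorphic h) (hF : Meromorphic F)
    (hg_eq : (fun x => g (x + τ)) =ᶠ[codiscrete ℂ] fun x =>
      b (ξm - x - η / 2) * b (ξp - x - τ / 2 - η / 2) /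
        (b (ξm + x + τ - η / 2) * b (ξp + x + τ / 2 - η / 2)) * g x)
    (hh_eq : (fun x => h (x + τ)) =ᶠ[codiscrete ℂ] fun x =>
      b (x + τ) * b (x + η) / (b x * b (x + τ - η)) * h x)
    (hF_eq : (fun x => F (x + τ)) =ᶠ[codiscrete ℂ] fun x =>
      b (x + τ - η / 2) / b (x + τ + η / 2) * F x)
    (x₀ : Fin M → ℂ) (hx₀ : BQKZ.IsGeneric b τ g h x₀)
    (hsum : BQKZ.MeroUniformlySummable
      (BQKZ.summand (N := N) b η ξm τ g h F x₀)) :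
    (∃ f : (Fin N → ℂ) → (Fin N → Fin 2) → ℂ,
      BQKZ.HasMeroSum (BQKZ.summand b η ξm τ g h F x₀) f) ∧
    ∀ f : (Fin N → ℂ) → (Fin N → Fin 2) → ℂ,
      BQKZ.HasMeroSum (BQKZ.summand b η ξm τ g h F x₀) f →
        BQKZ.IsMeromorphic f ∧ BQKZ.SolvesBoundaryQKZ b η ξp ξm τ f := by
  refine ⟨hsum.exists_hasMeroSum, fun f hf => ⟨hf.isMeromorphic, fun r => ?_⟩⟩
  exact (hf.isMeromorphic.comp_add _).eqOffThin
    (BQKZ.preservesMeromorphic_transport hb r f hf.isMeromorphic)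
    (BQKZ.eventually_boundaryQKZ hb hτ hF hg_eq hh_eq hF_eq hx₀ hf r)
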